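/- **Setting.** For $c=(c_1,c_2,c_3)$ let $P_c(x)=c_1(1-x)+c_2(1+x)+c_3(1-x^2)$, and for $c_1,c_2\ge -1$ let $\bar c_3(c_1,c_2)=-\tfrac12\left(\sqrt{1+c_1}+\sqrt{1+c_2}\right)\left(\sqrt{1+c_1}+\sqrt{1+c_2}+2\right)$. Let $J=\{c\in\mathbb R^3: c_1\ge-1,\ c_2\ge-1,\ c_3\ge\bar c_3(c_1,c_2)\}$. For $c\in J$ let $\gamma^-(c)$ and $\gamma^+(c)$ be the smallest and the largest number $\gamma$ for which the equation $$(1-x^2)u'+2xu+\tfrac12u^2=P_c(x)\quad\text{on }(-1,1),\qquad u(0)=\gamma,$$ has a $C^1$ solution. Let $I=\{(c,\gamma): c\in J,\ \gamma^-(c)\le\gamma\le\gamma^+(c)\}$, and for $(c,\gamma)\in I$ let $\bar U_\theta=U_\theta^{c,\gamma}$ be this solution, $\bar U_\theta(\pm1)$ its boundary values, and $U^{c,\gamma}=(U^{c,\gamma}_\theta,0)$. Let $I_{2,3},I_{4,3},I_{3,2},I_{4,2}$ be the sets of $(c,\gamma)\in I$ with $c_3>\bar c_3(c_1,c_2)$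 and, respectively, * $I_{2,3}$: $c_1=-1$, $-1<c_2<-\tfrac34$, $\gamma=\gamma^-(c)$; * $I_{4,3}$: $c_1=c_2=-1$, $\gamma=\gamma^-(c)$; * $I_{3,2}$: $-1<c_1<-\tfrac34$, $c_2=-1$, $\gamma=\gamma^+(c)$; * $I_{4,2}$: $c_1=c_2=-1$, $\gamma=\gamma^+(c)$. Let $\psi[f](x)=\int_0^x\int_0^l\int_0^t\frac{2f(s)f'(s)}{1-s^2}\,ds\,dt\,dl$. For $\hat c\in\mathbb R^3$, a pair $U=(U_\theta,U_\phi)\in C^1(-1,1)\times C^2(-1,1)$ is said to satisfy $(\mathrm{NSE}_{\hat c})$ if on $(-1,1)$ $$(1-x^2)U_\theta'+2xU_\theta+\tfrac12U_\theta^2+\psi[U_\phi]=P_{\hat c},\qquad (1-x^2)U_\phi''+U_\theta U_\phi'=0 .$$ Let $\varphi_{c,\gamma}[f]=(1-x^2)f'+(2x+\bar U_\theta)f+\tfrac12f^2$, $a(x)=a_{c,\gamma}(x)=\int_0^x\frac{2s+\bar U_\theta(s)}{1-s^2}ds$, $b(x)=b_{c,\gamma}(x)=\int_0^x\frac{\bar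 U_\theta(s)}{1-s^2}ds$, and $$V^{2a}=\Big(e^{-a(x)}\int_{-1}^xe^{a(s)}ds,\,0\Big),\quad V^{2b}=\Big(e^{-a(x)}\int_{1}^xe^{a(s)}ds,\,0\Big),\quad V^3=\Big(0,\int_0^xe^{-b(t)}dt\Big),\quad V^4=(0,1).$$ For $0<\epsilon<\tfrac12$ let $\mathbf M_1(\epsilon)$ be the space of $f\in C^3(-\tfrac12,\tfrac12)\cap C^1(-1,1)\cap C[-1,1]$ with $f(\pm1)=0$ and finite norm $$\big\|\ln\tfrac{1+x}3(1-x)^{-1+2\epsilon}f\big\|_{L^\infty(-1,1)}+\big\|(1+x)\big(\ln\tfrac{1+x}3\big)^2(1-x)^{2\epsilon}f'\big\|_{L^\infty(-1,1)}+\|f''\|_{L^\infty(-\frac12,\frac12)}+\|f'''\|_{L^\infty(-\frac12,\frac12)},$$ let $\mathbf M_2(\epsilon)$ be the space of $g\in C^2(-1,1)$ with finite norm $\sum_{k=0}^2\|(1-x^2)^{k+\epsilon}g^{(k)}\|_{L^\infty(-1,1)}$, and let $\mathbf X=\mathbf M_1(\epsilon)\times\mathbf M_2(\epsilon)$ with the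 sum of the two norms. Let $\mathbf X_{2b}$ be the closed subspace of all $V=(V_\theta,V_\phi)\in\mathbf X$ with $V_\theta(0)=0$, $V_\phi'(0)=0$ and $V_\phi(0)=0$. Let $\mathbf X^*$ be the space obtained from $\mathbf X$ by interchanging $1+x$ and $1-x$ in the weights of $\mathbf M_1(\epsilon)$, and let $\mathbf X_{2a}$ be the closed subspace of $\mathbf X^*$ given by the same three conditions. **Theorem.** (A) Let $K$ be a compact subset of $I_{2,3}$ or of $I_{4,3}$, and fix $0<\epsilon<\tfrac12$ with $\epsilon>-\tfrac12\bar U_\theta(1)-1$ for every $(c,\gamma)\in K$. Then there exist $\delta>0$ and $V\in C^\infty(K\times B_\delta(0),\mathbf X_{2b})$, $B_\delta(0)\subset\mathbb R^3$ (that is, $V$ is defined and $C^\infty$ on $O\times B_\delta(0)$ for some open $O\subset\mathbb R^4$ containing $K$), such that for every $(c,\gamma)\in K$: $V(c,\gamma,0)=0$; $\partial V/\partial\beta_i|_{\beta=0}=0$ for $i=2,3,4$; and for every $\beta=(\beta_2,\beta_3,\beta_4)\in B_\delta(0)$ the pair $$U=U^{c,\gamma}+\tilde U,\qquad \tilde U=\beta_2V^{2b}_{c,\gamma}+\beta_3V^3_{c,\gamma}+\beta_4V^4_{c,\gamma}+V(c,\gamma,\beta)\tag{1}$$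 satisfies $(\mathrm{NSE}_{\hat c})$ with $$\hat c_1=c_1+\tfrac12\psi[\tilde U_\phi](-1),\qquad \hat c_2=c_2+\tfrac12\psi[\tilde U_\phi](1),\qquad \hat c_3=c_3-\tfrac12\big(\varphi_{c,\gamma}[\tilde U_\theta]\big)''(0).$$ Moreover, there is $\delta'>0$ such that if $(c,\gamma)\in K$, $U-U^{c,\gamma}\in\mathbf X$, $\|U-U^{c,\gamma}\|_{\mathbf X}<\delta'$ and $U$ satisfies $(\mathrm{NSE}_{\hat c})$ for some constants $\hat c_1,\hat c_2,\hat c_3$, then (1) holds for some $\beta$ with $|\beta|<\delta$. (B) Let $K$ be a compact subset of $I_{3,2}$ or of $I_{4,2}$, and fix $0<\epsilon<\tfrac12$ with $\epsilon>\tfrac12\bar U_\theta(-1)-1$ for every $(c,\gamma)\in K$. Then all assertions of (A) hold with $V^{2b}$, $\mathbf X$, $\mathbf X_{2b}$ replaced by $V^{2a}$, $\mathbf X^*$, $\mathbf X_{2a}$. -/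

import Mathlib

open Set Filter Topology
open scoped ContDiff

namespace HomNS

/-! ## Sup norms over an interval -/

/-- `g` is bounded on `s`. -/
def BddOn (s : Set ℝ) (g : ℝ → ℝ) : Prop := ∃ C : ℝ, ∀ x ∈ s, |g x| ≤ C

/-- `sup_{x ∈ s} |g x|`. It is only used for functions that are continuous and bounded on an open
interval `s`, where it is the `L^∞(s)` norm. -/
noncomputable def supOn (s : Set ℝ) (g : ℝ → ℝ) : ℝ := ⨆ x : s, |g x|

theorem BddOn.bddAbove {s : Set ℝ} {g : ℝ → ℝ} (h : BddOn s g) :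
    BddAbove (range fun x : s => |g x|) := by
  obtain ⟨C, hC⟩ := h
  refine ⟨C, ?_⟩
  rintro _ ⟨x, rfl⟩
  exact hC x x.2

theorem le_supOn {s : Set ℝ} {g : ℝ → ℝ} (h : BddOn s g) {x : ℝ} (hx : x ∈ s) :
    |g x| ≤ supOn s g := le_ciSup h.bddAbove (⟨x, hx⟩ : s)

theorem supOn_nonneg (s : Set ℝ) (g : ℝ → ℝ) : 0 ≤ supOn s g :=
  Real.iSup_nonneg fun _ => abs_nonneg _

theorem supOn_le {s : Set ℝ} {g : ℝ → ℝ} {C : ℝ} (hC : 0 ≤ C) (h : ∀ x ∈ s, |g x| ≤ C) :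
    supOn s g ≤ C := Real.iSup_le (fun x => h x x.2) hC

theorem BddOn.add {s : Set ℝ} {f g h : ℝ → ℝ} (e : ∀ x ∈ s, h x = f x + g x)
    (hf : BddOn s f) (hg : BddOn s g) : BddOn s h := by
  obtain ⟨C, hC⟩ := hf
  obtain ⟨D, hD⟩ := hg
  refine ⟨C + D, fun x hx => ?_⟩
  rw [e x hx]
  exact (abs_add_le _ _).trans (add_le_add (hC x hx) (hD x hx))

theorem BddOn.smul {s : Set ℝ} {f h : ℝ → ℝ} {a : ℝ} (e : ∀ x ∈ s, h x = a * f x)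
    (hf : BddOn s f) : BddOn s h := by
  obtain ⟨C, hC⟩ := hf
  refine ⟨|a| * C, fun x hx => ?_⟩
  rw [e x hx, abs_mul]
  exact mul_le_mul_of_nonneg_left (hC x hx) (abs_nonneg _)

theorem supOn_add_le {s : Set ℝ} {f g h : ℝ → ℝ} (e : ∀ x ∈ s, h x = f x + g x)
    (hf : BddOn s f) (hg : BddOn s g) : supOn s h ≤ supOn s f + supOn s g := by
  refine supOn_le (add_nonneg (supOn_nonneg _ _) (supOn_nonneg _ _)) fun x hx => ?_
  rw [e x hx]
  exact (abs_add_le _ _).trans (add_le_add (le_supOn hf hx) (le_supOn hg hx))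

theorem supOn_smul {s : Set ℝ} {f h : ℝ → ℝ} {a : ℝ} (e : ∀ x ∈ s, h x = a * f x) :
    supOn s h = |a| * supOn s f := by
  unfold supOn
  rw [Real.mul_iSup_of_nonneg (abs_nonneg a)]
  congr 1
  funext x
  rw [e x x.2, abs_mul]

/-! ## The function spaces `M₁`, `M₂`, `X` -/

/-- The pole of the sphere (`south` is `x = -1`, `north` is `x = 1`, with `x = cos θ`) at which the
background flow has a logarithmic profile. -/
inductive Pole
  | south
  | north

/-- The coordinate that equals `-1` at the pole `p`. -/
def Pole.coord : Pole → ℝ → ℝ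
  | .south, x => x
  | .north, x => -x

theorem Pole.coord_mem (p : Pole) {x : ℝ} (hx : x ∈ Ioo (-1 : ℝ) 1) :
    p.coord x ∈ Ioo (-1 : ℝ) 1 := by
  cases p
  · exact hx
  · exact ⟨neg_lt_neg hx.2, neg_lt.1 hx.1⟩

/-- Weight of `U_θ`: for `p = south` it is `ln((1+x)/3) (1-x)^(-1+2ε)`;
for `p = north` its reflection `ln((1-x)/3) (1+x)^(-1+2ε)`. -/
noncomputable def wVal (ε : ℝ) (p : Pole) (x : ℝ) : ℝ :=
  Real.log ((1 + p.coord x) / 3) * (1 - p.coord x) ^ (-1 + 2 * ε)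

/-- Weight of `U_θ'`: for `p = south` it is `(1+x) (ln((1+x)/3))² (1-x)^(2ε)`;
for `p = north` its reflection `(1-x) (ln((1-x)/3))² (1+x)^(2ε)`. -/
noncomputable def wDer (ε : ℝ) (p : Pole) (x : ℝ) : ℝ :=
  (1 + p.coord x) * Real.log ((1 + p.coord x) / 3) ^ 2 * (1 - p.coord x) ^ (2 * ε)

theorem wVal_ne_zero (ε : ℝ) (p : Pole) {x : ℝ} (hx : x ∈ Ioo (-1 : ℝ) 1) : wVal ε p x ≠ 0 := by
  obtain ⟨h1, h2⟩ := p.coord_mem hx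
  refine mul_ne_zero (ne_of_lt (Real.log_neg ?_ ?_)) (Real.rpow_pos_of_pos ?_ _).ne' <;> linarith

/-- Membership in `M₁(ε)`. A function on `[-1,1]` that vanishes at `±1` is represented by its
extension by zero to the real line. -/
structure MemM₁ (ε : ℝ) (p : Pole) (f : ℝ → ℝ) : Prop where
  zero_off : ∀ x, x ∉ Ioo (-1 : ℝ) 1 → f x = 0
  cont : ContinuousOn f (Icc (-1) 1)
  c1 : ContDiffOn ℝ 1 f (Ioo (-1) 1)
  c3 : ContDiffOn ℝ 3 f (Ioo (-1 / 2) (1 / 2))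
  bdd0 : BddOn (Ioo (-1) 1) fun x => wVal ε p x * f x
  bdd1 : BddOn (Ioo (-1) 1) fun x => wDer ε p x * deriv f x
  bdd2 : BddOn (Ioo (-1 / 2) (1 / 2)) (iteratedDeriv 2 f)
  bdd3 : BddOn (Ioo (-1 / 2) (1 / 2)) (iteratedDeriv 3 f)

/-- Membership in `M₂(ε)`. A function on `(-1,1)` is represented by its extension by zero. -/
structure MemM₂ (ε : ℝ) (f : ℝ → ℝ) : Prop where
  zero_off : ∀ x, x ∉ Ioo (-1 : ℝ) 1 → f x = 0
  c2 : ContDiffOn ℝ 2 f (Ioo (-1) 1)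
  bdd0 : BddOn (Ioo (-1) 1) fun x => (1 - x ^ 2) ^ ε * f x
  bdd1 : BddOn (Ioo (-1) 1) fun x => (1 - x ^ 2) ^ (1 + ε) * deriv f x
  bdd2 : BddOn (Ioo (-1) 1) fun x => (1 - x ^ 2) ^ (2 + ε) * iteratedDeriv 2 f x

theorem contDiffAt_of_Ioo {n : WithTop ℕ∞} {f : ℝ → ℝ} {a b x : ℝ} (h : ContDiffOn ℝ n f (Ioo a b))
    (hx : x ∈ Ioo a b) : ContDiffAt ℝ n f x := h.contDiffAt (isOpen_Ioo.mem_nhds hx)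

theorem deriv_add_Ioo {n : WithTop ℕ∞} (hn : n ≠ 0) {f g : ℝ → ℝ} {a b x : ℝ}
    (hf : ContDiffOn ℝ n f (Ioo a b)) (hg : ContDiffOn ℝ n g (Ioo a b)) (hx : x ∈ Ioo a b) :
    deriv (f + g) x = deriv f x + deriv g x :=
  deriv_add ((contDiffAt_of_Ioo hf hx).differentiableAt hn)
    ((contDiffAt_of_Ioo hg hx).differentiableAt hn)

theorem deriv_smul_fun (c : ℝ) (f : ℝ → ℝ) (x : ℝ) : deriv (c • f) x = c * deriv f x := by
  rw [deriv_const_smul_field]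
  rfl

theorem iteratedDeriv_add_Ioo {n : ℕ} {m : WithTop ℕ∞} (hm : (n : WithTop ℕ∞) ≤ m) {f g : ℝ → ℝ}
    {a b x : ℝ} (hf : ContDiffOn ℝ m f (Ioo a b)) (hg : ContDiffOn ℝ m g (Ioo a b))
    (hx : x ∈ Ioo a b) :
    iteratedDeriv n (f + g) x = iteratedDeriv n f x + iteratedDeriv n g x :=
  iteratedDeriv_add ((contDiffAt_of_Ioo hf hx).of_le hm) ((contDiffAt_of_Ioo hg hx).of_le hm)

theorem iteratedDeriv_smul_fun (n : ℕ) (c : ℝ) (f : ℝ → ℝ) (x : ℝ) :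
    iteratedDeriv n (c • f) x = c * iteratedDeriv n f x := by
  rw [iteratedDeriv_const_smul_field]
  rfl

theorem iteratedDeriv_zero_fun (n : ℕ) (x : ℝ) : iteratedDeriv n (0 : ℝ → ℝ) x = 0 := by
  simp

theorem MemM₁.zero (ε : ℝ) (p : Pole) : MemM₁ ε p 0 where
  zero_off := fun _ _ => rfl
  cont := continuousOn_const
  c1 := contDiffOn_const
  c3 := contDiffOn_const
  bdd0 := ⟨0, fun x _ => by simp⟩
  bdd1 := ⟨0, fun x _ => by simp⟩
  bdd2 := ⟨0, fun x _ => by rw [iteratedDeriv_zero_fun]; simp⟩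
  bdd3 := ⟨0, fun x _ => by rw [iteratedDeriv_zero_fun]; simp⟩

theorem MemM₁.add {ε : ℝ} {p : Pole} {f g : ℝ → ℝ} (hf : MemM₁ ε p f) (hg : MemM₁ ε p g) :
    MemM₁ ε p (f + g) where
  zero_off := fun x hx => by simp [hf.zero_off x hx, hg.zero_off x hx]
  cont := hf.cont.add hg.cont
  c1 := hf.c1.add hg.c1
  c3 := hf.c3.add hg.c3
  bdd0 := BddOn.add (fun x _ => by simp only [Pi.add_apply]; ring) hf.bdd0 hg.bdd0
  bdd1 := BddOn.add (fun x hx => by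
    rw [deriv_add_Ioo one_ne_zero hf.c1 hg.c1 hx]; ring) hf.bdd1 hg.bdd1
  bdd2 := BddOn.add (fun x hx =>
    iteratedDeriv_add_Ioo (by norm_num) hf.c3 hg.c3 hx) hf.bdd2 hg.bdd2
  bdd3 := BddOn.add (fun x hx =>
    iteratedDeriv_add_Ioo (by norm_num) hf.c3 hg.c3 hx) hf.bdd3 hg.bdd3

theorem MemM₁.smul {ε : ℝ} {p : Pole} {f : ℝ → ℝ} (c : ℝ) (hf : MemM₁ ε p f) :
    MemM₁ ε p (c • f) where
  zero_off := fun x hx => by simp [hf.zero_off x hx]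
  cont := hf.cont.const_smul c
  c1 := hf.c1.const_smul c
  c3 := hf.c3.const_smul c
  bdd0 := BddOn.smul (fun x _ => by simp only [Pi.smul_apply, smul_eq_mul]; ring) hf.bdd0
  bdd1 := BddOn.smul (fun x _ => by rw [deriv_smul_fun]; ring) hf.bdd1
  bdd2 := BddOn.smul (fun x _ => iteratedDeriv_smul_fun 2 c f x) hf.bdd2
  bdd3 := BddOn.smul (fun x _ => iteratedDeriv_smul_fun 3 c f x) hf.bdd3

theorem MemM₂.zero (ε : ℝ) : MemM₂ ε 0 where
  zero_off := fun _ _ => rfl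
  c2 := contDiffOn_const
  bdd0 := ⟨0, fun x _ => by simp⟩
  bdd1 := ⟨0, fun x _ => by simp⟩
  bdd2 := ⟨0, fun x _ => by simp⟩

theorem MemM₂.add {ε : ℝ} {f g : ℝ → ℝ} (hf : MemM₂ ε f) (hg : MemM₂ ε g) :
    MemM₂ ε (f + g) where
  zero_off := fun x hx => by simp [hf.zero_off x hx, hg.zero_off x hx]
  c2 := hf.c2.add hg.c2
  bdd0 := BddOn.add (fun x _ => by simp only [Pi.add_apply]; ring) hf.bdd0 hg.bdd0
  bdd1 := BddOn.add (fun x hx => by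
    rw [deriv_add_Ioo two_ne_zero hf.c2 hg.c2 hx]; ring) hf.bdd1 hg.bdd1
  bdd2 := BddOn.add (fun x hx => by
    rw [iteratedDeriv_add_Ioo (by norm_num) hf.c2 hg.c2 hx]; ring) hf.bdd2 hg.bdd2

theorem MemM₂.smul {ε : ℝ} {f : ℝ → ℝ} (c : ℝ) (hf : MemM₂ ε f) : MemM₂ ε (c • f) where
  zero_off := fun x hx => by simp [hf.zero_off x hx]
  c2 := hf.c2.const_smul c
  bdd0 := BddOn.smul (fun x _ => by simp only [Pi.smul_apply, smul_eq_mul]; ring) hf.bdd0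
  bdd1 := BddOn.smul (fun x _ => by rw [deriv_smul_fun]; ring) hf.bdd1
  bdd2 := BddOn.smul (fun x _ => by rw [iteratedDeriv_smul_fun]; ring) hf.bdd2

/-- `M₁(ε)` as a subspace of all functions. -/
def M₁sub (ε : ℝ) (p : Pole) : Submodule ℝ (ℝ → ℝ) where
  carrier := {f | MemM₁ ε p f}
  zero_mem' := MemM₁.zero ε p
  add_mem' := fun hf hg => hf.add hg
  smul_mem' := fun c _ hf => hf.smul c

/-- `M₂(ε)` as a subspace of all functions. -/
def M₂sub (ε : ℝ) : Submodule ℝ (ℝ → ℝ) where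
  carrier := {f | MemM₂ ε f}
  zero_mem' := MemM₂.zero ε
  add_mem' := fun hf hg => hf.add hg
  smul_mem' := fun c _ hf => hf.smul c

/-- The space `M₁(ε)`; a type of its own, so that it carries no topology but that of its norm. -/
def M₁ (ε : ℝ) (p : Pole) : Type := M₁sub ε p

/-- The space `M₂(ε)`. -/
def M₂ (ε : ℝ) : Type := M₂sub ε

instance (ε : ℝ) (p : Pole) : AddCommGroup (M₁ ε p) := inferInstanceAs (AddCommGroup (M₁sub ε p))
instance (ε : ℝ) (p : Pole) : Module ℝ (M₁ ε p) := inferInstanceAs (Module ℝ (M₁sub ε p))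
instance (ε : ℝ) : AddCommGroup (M₂ ε) := inferInstanceAs (AddCommGroup (M₂sub ε))
instance (ε : ℝ) : Module ℝ (M₂ ε) := inferInstanceAs (Module ℝ (M₂sub ε))

/-- The function underlying an element of `M₁`. -/
def M₁.fn {ε : ℝ} {p : Pole} (f : M₁ ε p) : ℝ → ℝ := (show M₁sub ε p from f).1

/-- The function underlying an element of `M₂`. -/
def M₂.fn {ε : ℝ} (f : M₂ ε) : ℝ → ℝ := (show M₂sub ε from f).1

theorem M₁.mem {ε : ℝ} {p : Pole} (f : M₁ ε p) : MemM₁ ε p f.fn := (show M₁sub ε p from f).2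
theorem M₂.mem {ε : ℝ} (f : M₂ ε) : MemM₂ ε f.fn := (show M₂sub ε from f).2
theorem M₁.ext_fn {ε : ℝ} {p : Pole} {f g : M₁ ε p} (h : f.fn = g.fn) : f = g := Subtype.ext h
theorem M₂.ext_fn {ε : ℝ} {f g : M₂ ε} (h : f.fn = g.fn) : f = g := Subtype.ext h
theorem M₁.fn_add {ε : ℝ} {p : Pole} (f g : M₁ ε p) : (f + g).fn = f.fn + g.fn := rfl
theorem M₂.fn_add {ε : ℝ} (f g : M₂ ε) : (f + g).fn = f.fn + g.fn := rfl
theorem M₁.fn_smul {ε : ℝ} {p : Pole} (c : ℝ) (f : M₁ ε p) : (c • f).fn = c • f.fn := rfl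
theorem M₂.fn_smul {ε : ℝ} (c : ℝ) (f : M₂ ε) : (c • f).fn = c • f.fn := rfl

noncomputable instance (ε : ℝ) (p : Pole) : Norm (M₁ ε p) where
  norm f := supOn (Ioo (-1) 1) (fun x => wVal ε p x * f.fn x)
    + supOn (Ioo (-1) 1) (fun x => wDer ε p x * deriv f.fn x)
    + supOn (Ioo (-1 / 2) (1 / 2)) (iteratedDeriv 2 f.fn)
    + supOn (Ioo (-1 / 2) (1 / 2)) (iteratedDeriv 3 f.fn)

noncomputable instance (ε : ℝ) : Norm (M₂ ε) where
  norm f := supOn (Ioo (-1) 1) (fun x => (1 - x ^ 2) ^ ε * f.fn x)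
    + supOn (Ioo (-1) 1) (fun x => (1 - x ^ 2) ^ (1 + ε) * deriv f.fn x)
    + supOn (Ioo (-1) 1) (fun x => (1 - x ^ 2) ^ (2 + ε) * iteratedDeriv 2 f.fn x)

theorem M₁.norm_def {ε : ℝ} {p : Pole} (f : M₁ ε p) :
    ‖f‖ = supOn (Ioo (-1) 1) (fun x => wVal ε p x * f.fn x)
    + supOn (Ioo (-1) 1) (fun x => wDer ε p x * deriv f.fn x)
    + supOn (Ioo (-1 / 2) (1 / 2)) (iteratedDeriv 2 f.fn)
    + supOn (Ioo (-1 / 2) (1 / 2)) (iteratedDeriv 3 f.fn) := rfl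

theorem M₂.norm_def {ε : ℝ} (f : M₂ ε) :
    ‖f‖ = supOn (Ioo (-1) 1) (fun x => (1 - x ^ 2) ^ ε * f.fn x)
    + supOn (Ioo (-1) 1) (fun x => (1 - x ^ 2) ^ (1 + ε) * deriv f.fn x)
    + supOn (Ioo (-1) 1) (fun x => (1 - x ^ 2) ^ (2 + ε) * iteratedDeriv 2 f.fn x) := rfl

theorem M₁.core (ε : ℝ) (p : Pole) : NormedSpace.Core ℝ (M₁ ε p) where
  norm_nonneg f := by
    rw [M₁.norm_def]
    have := fun s g => supOn_nonneg s g
    exact add_nonneg (add_nonneg (add_nonneg (this _ _) (this _ _)) (this _ _)) (this _ _)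
  norm_smul c f := by
    rw [M₁.norm_def, M₁.norm_def, M₁.fn_smul, Real.norm_eq_abs,
      supOn_smul (f := fun x => wVal ε p x * f.fn x) (a := c)
        (h := fun x => wVal ε p x * (c • f.fn) x)
        (fun x _ => by simp only [Pi.smul_apply, smul_eq_mul]; ring),
      supOn_smul (f := fun x => wDer ε p x * deriv f.fn x) (a := c)
        (h := fun x => wDer ε p x * deriv (c • f.fn) x)
        (fun x _ => by rw [deriv_smul_fun]; ring),
      supOn_smul (fun x _ => iteratedDeriv_smul_fun 2 c f.fn x),
      supOn_smul (fun x _ => iteratedDeriv_smul_fun 3 c f.fn x)]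
    ring
  norm_triangle f g := by
    have hf := f.mem
    have hg := g.mem
    rw [M₁.norm_def, M₁.norm_def, M₁.norm_def, M₁.fn_add]
    have h0 := supOn_add_le (h := fun x => wVal ε p x * (f.fn + g.fn) x)
      (fun x _ => by simp only [Pi.add_apply]; ring) hf.bdd0 hg.bdd0
    have h1 := supOn_add_le (h := fun x => wDer ε p x * deriv (f.fn + g.fn) x)
      (fun x hx => by rw [deriv_add_Ioo one_ne_zero hf.c1 hg.c1 hx]; ring) hf.bdd1 hg.bdd1
    have h2 := supOn_add_le (h := iteratedDeriv 2 (f.fn + g.fn))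
      (fun x hx => iteratedDeriv_add_Ioo (by norm_num) hf.c3 hg.c3 hx) hf.bdd2 hg.bdd2
    have h3 := supOn_add_le (h := iteratedDeriv 3 (f.fn + g.fn))
      (fun x hx => iteratedDeriv_add_Ioo (by norm_num) hf.c3 hg.c3 hx) hf.bdd3 hg.bdd3
    linarith
  norm_eq_zero_iff f := by
    have hf := f.mem
    constructor
    · intro h
      rw [M₁.norm_def] at h
      have h0 : supOn (Ioo (-1) 1) (fun x => wVal ε p x * f.fn x) ≤ 0 := by
        have := supOn_nonneg (Ioo (-1) 1) (fun x => wDer ε p x * deriv f.fn x)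
        have := supOn_nonneg (Ioo (-1 / 2) (1 / 2)) (iteratedDeriv 2 f.fn)
        have := supOn_nonneg (Ioo (-1 / 2) (1 / 2)) (iteratedDeriv 3 f.fn)
        linarith
      refine M₁.ext_fn (funext fun x => ?_)
      change f.fn x = 0
      by_cases hx : x ∈ Ioo (-1 : ℝ) 1
      · have h1 := abs_eq_zero.1 (le_antisymm ((le_supOn hf.bdd0 hx).trans h0) (abs_nonneg _))
        exact (mul_eq_zero.1 h1).resolve_left (wVal_ne_zero ε p hx)
      · exact hf.zero_off x hx
    · rintro rfl
      have h := M₁.fn_smul (0 : ℝ) (0 : M₁ ε p)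
      rw [zero_smul, zero_smul] at h
      have hz : ∀ (s : Set ℝ) (g : ℝ → ℝ), (∀ x ∈ s, g x = 0) → supOn s g = 0 := fun s g hg =>
        le_antisymm (supOn_le le_rfl fun x hx => by simp [hg x hx]) (supOn_nonneg _ _)
      rw [M₁.norm_def, h, hz _ _ (fun x _ => by simp), hz _ _ (fun x _ => by simp),
        hz _ _ (fun x _ => iteratedDeriv_zero_fun 2 x),
        hz _ _ (fun x _ => iteratedDeriv_zero_fun 3 x)]
      norm_num

theorem M₂.core (ε : ℝ) : NormedSpace.Core ℝ (M₂ ε) where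
  norm_nonneg f := by
    rw [M₂.norm_def]
    have := fun s g => supOn_nonneg s g
    exact add_nonneg (add_nonneg (this _ _) (this _ _)) (this _ _)
  norm_smul c f := by
    rw [M₂.norm_def, M₂.norm_def, M₂.fn_smul, Real.norm_eq_abs,
      supOn_smul (f := fun x => (1 - x ^ 2) ^ ε * f.fn x) (a := c)
        (h := fun x => (1 - x ^ 2) ^ ε * (c • f.fn) x)
        (fun x _ => by simp only [Pi.smul_apply, smul_eq_mul]; ring),
      supOn_smul (f := fun x => (1 - x ^ 2) ^ (1 + ε) * deriv f.fn x) (a := c)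
        (h := fun x => (1 - x ^ 2) ^ (1 + ε) * deriv (c • f.fn) x)
        (fun x _ => by rw [deriv_smul_fun]; ring),
      supOn_smul (f := fun x => (1 - x ^ 2) ^ (2 + ε) * iteratedDeriv 2 f.fn x) (a := c)
        (h := fun x => (1 - x ^ 2) ^ (2 + ε) * iteratedDeriv 2 (c • f.fn) x)
        (fun x _ => by rw [iteratedDeriv_smul_fun]; ring)]
    ring
  norm_triangle f g := by
    have hf := f.mem
    have hg := g.mem
    rw [M₂.norm_def, M₂.norm_def, M₂.norm_def, M₂.fn_add]
    have h0 := supOn_add_le (h := fun x => (1 - x ^ 2) ^ ε * (f.fn + g.fn) x)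
      (fun x _ => by simp only [Pi.add_apply]; ring) hf.bdd0 hg.bdd0
    have h1 := supOn_add_le (h := fun x => (1 - x ^ 2) ^ (1 + ε) * deriv (f.fn + g.fn) x)
      (fun x hx => by rw [deriv_add_Ioo two_ne_zero hf.c2 hg.c2 hx]; ring) hf.bdd1 hg.bdd1
    have h2 := supOn_add_le
      (h := fun x => (1 - x ^ 2) ^ (2 + ε) * iteratedDeriv 2 (f.fn + g.fn) x)
      (fun x hx => by rw [iteratedDeriv_add_Ioo (by norm_num) hf.c2 hg.c2 hx]; ring)
      hf.bdd2 hg.bdd2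
    linarith
  norm_eq_zero_iff f := by
    have hf := f.mem
    constructor
    · intro h
      rw [M₂.norm_def] at h
      have h0 : supOn (Ioo (-1) 1) (fun x => (1 - x ^ 2) ^ ε * f.fn x) ≤ 0 := by
        have := supOn_nonneg (Ioo (-1) 1) (fun x => (1 - x ^ 2) ^ (1 + ε) * deriv f.fn x)
        have := supOn_nonneg (Ioo (-1) 1)
          (fun x => (1 - x ^ 2) ^ (2 + ε) * iteratedDeriv 2 f.fn x)
        linarith
      refine M₂.ext_fn (funext fun x => ?_)
      change f.fn x = 0
      by_cases hx : x ∈ Ioo (-1 : ℝ) 1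
      · have h1 := abs_eq_zero.1 (le_antisymm ((le_supOn hf.bdd0 hx).trans h0) (abs_nonneg _))
        refine (mul_eq_zero.1 h1).resolve_left (Real.rpow_pos_of_pos ?_ _).ne'
        nlinarith [hx.1, hx.2]
      · exact hf.zero_off x hx
    · rintro rfl
      have h := M₂.fn_smul (0 : ℝ) (0 : M₂ ε)
      rw [zero_smul, zero_smul] at h
      have hz : ∀ (s : Set ℝ) (g : ℝ → ℝ), (∀ x ∈ s, g x = 0) → supOn s g = 0 := fun s g hg =>
        le_antisymm (supOn_le le_rfl fun x hx => by simp [hg x hx]) (supOn_nonneg _ _)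
      rw [M₂.norm_def, h, hz _ _ (fun x _ => by simp), hz _ _ (fun x _ => by simp),
        hz _ _ (fun x _ => by rw [iteratedDeriv_zero_fun, mul_zero])]
      norm_num

noncomputable instance (ε : ℝ) (p : Pole) : NormedAddCommGroup (M₁ ε p) :=
  NormedAddCommGroup.ofCore (M₁.core ε p)
noncomputable instance (ε : ℝ) (p : Pole) : NormedSpace ℝ (M₁ ε p) :=
  NormedSpace.ofCore (M₁.core ε p)
noncomputable instance (ε : ℝ) : NormedAddCommGroup (M₂ ε) :=
  NormedAddCommGroup.ofCore (M₂.core ε)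
noncomputable instance (ε : ℝ) : NormedSpace ℝ (M₂ ε) :=
  NormedSpace.ofCore (M₂.core ε)

/-- The space `X` of pairs `(U_θ, U_φ)` in `M₁(ε) × M₂(ε)`, with the norm
`‖U_θ‖ + ‖U_φ‖`. -/
abbrev X (ε : ℝ) (p : Pole) : Type := WithLp 1 (M₁ ε p × M₂ ε)

/-- The component `U_θ` of an element of `X`. -/
def thetaPart {ε : ℝ} {p : Pole} (U : X ε p) : ℝ → ℝ := M₁.fn U.fst

/-- The component `U_φ` of an element of `X`. -/
def phiPart {ε : ℝ} {p : Pole} (U : X ε p) : ℝ → ℝ := M₂.fn U.snd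

/-- `l₁(V) = V_θ(0)`. -/
def l₁ (ε : ℝ) (p : Pole) : X ε p →ₗ[ℝ] ℝ where
  toFun V := thetaPart V 0
  map_add' _ _ := rfl
  map_smul' _ _ := rfl

/-- `l₃(V) = V_φ'(0)`. -/
noncomputable def l₃ (ε : ℝ) (p : Pole) : X ε p →ₗ[ℝ] ℝ where
  toFun V := deriv (phiPart V) 0
  map_add' V W := deriv_add_Ioo two_ne_zero (M₂.mem V.snd).c2 (M₂.mem W.snd).c2
    ⟨by norm_num, by norm_num⟩
  map_smul' c V := deriv_smul_fun c (phiPart V) 0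

/-- `l₄(V) = V_φ(0)`. -/
def l₄ (ε : ℝ) (p : Pole) : X ε p →ₗ[ℝ] ℝ where
  toFun V := phiPart V 0
  map_add' _ _ := rfl
  map_smul' _ _ := rfl

/-- The complement of the kernel of the linearised operator:
`ker l₁ ∩ ker l₃ ∩ ker l₄`. -/
noncomputable def X₂ (ε : ℝ) (p : Pole) : Submodule ℝ (X ε p) :=
  LinearMap.ker (l₁ ε p) ⊓ LinearMap.ker (l₃ ε p) ⊓ LinearMap.ker (l₄ ε p)

/-- The space `X_{2b}`, for a background flow that is logarithmic at `x = -1`. -/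
noncomputable abbrev X₂b (ε : ℝ) : Submodule ℝ (X ε .south) := X₂ ε .south

/-- The space `X_{2a}`, for a background flow that is logarithmic at `x = 1`. -/
noncomputable abbrev X₂a (ε : ℝ) : Submodule ℝ (X ε .north) := X₂ ε .north

/-! ## The equations -/

/-- Triples of reals: `(c₁, c₂, c₃)` is `(c 0, c 1, c 2)`, and `(β₂, β₃, β₄)` is
`(β 0, β 1, β 2)`. -/
abbrev R3 : Type := EuclideanSpace ℝ (Fin 3)

/-- `P_c(x) = c₁ (1 - x) + c₂ (1 + x) + c₃ (1 - x²)`. -/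
noncomputable def P (c : R3) (x : ℝ) : ℝ := c 0 * (1 - x) + c 1 * (1 + x) + c 2 * (1 - x ^ 2)

/-- `ψ[U_φ](x) = ∫₀ˣ ∫₀ˡ ∫₀ᵗ 2 U_φ(s) U_φ'(s) / (1 - s²) ds dt dl`. -/
noncomputable def psi (Uφ : ℝ → ℝ) (x : ℝ) : ℝ :=
  ∫ l in (0 : ℝ)..x, ∫ t in (0 : ℝ)..l, ∫ s in (0 : ℝ)..t, 2 * Uφ s * deriv Uφ s / (1 - s ^ 2)

/-- `(U_θ, U_φ)` is a (classical) solution on `(-1,1)` of the reduced Navier-Stokes system with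
constants `c = (ĉ₁, ĉ₂, ĉ₃)`:
`(1-x²) U_θ' + 2x U_θ + U_θ²/2 + ψ[U_φ] = P_c` and `(1-x²) U_φ'' + U_θ U_φ' = 0`. -/
def SolvesNSE (c : R3) (Uθ Uφ : ℝ → ℝ) : Prop :=
  ContDiffOn ℝ 1 Uθ (Ioo (-1) 1) ∧ ContDiffOn ℝ 2 Uφ (Ioo (-1) 1) ∧
  ∀ x ∈ Ioo (-1 : ℝ) 1,
    (1 - x ^ 2) * deriv Uθ x + 2 * x * Uθ x + 1 / 2 * Uθ x ^ 2 + psi Uφ x = P c x ∧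
    (1 - x ^ 2) * iteratedDeriv 2 Uφ x + Uθ x * deriv Uφ x = 0

/-! ## The no-swirl solutions and their parameters -/

/-- `u` is a solution on `(-1,1)` of `(1-x²) u' + 2x u + u²/2 = P_c` with `u(0) = γ`. -/
def IsNoSwirl (c : R3) (γ : ℝ) (u : ℝ → ℝ) : Prop :=
  ContDiffOn ℝ 1 u (Ioo (-1) 1) ∧
  (∀ x ∈ Ioo (-1 : ℝ) 1,
    (1 - x ^ 2) * deriv u x + 2 * x * u x + 1 / 2 * u x ^ 2 = P c x) ∧
  u 0 = γ

open Classical in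
/-- The no-swirl solution `U_θ^{c,γ}`; only its values on `(-1,1)` matter, and there the initial
value problem determines it. -/
noncomputable def Ubar (c : R3) (γ : ℝ) : ℝ → ℝ :=
  if h : ∃ u, IsNoSwirl c γ u then h.choose else 0

theorem Ubar_spec {c : R3} {γ : ℝ} (h : ∃ u, IsNoSwirl c γ u) : IsNoSwirl c γ (Ubar c γ) := by
  unfold Ubar
  rw [dif_pos h]
  exact h.choose_spec

/-- `c̄₃(c₁,c₂) = -½ (√(1+c₁) + √(1+c₂)) (√(1+c₁) + √(1+c₂) + 2)`. -/
noncomputable def c₃bar (c₁ c₂ : ℝ) : ℝ :=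
  -(1 / 2) * (√(1 + c₁) + √(1 + c₂)) * (√(1 + c₁) + √(1 + c₂) + 2)

def J : Set R3 := {c | -1 ≤ c 0 ∧ -1 ≤ c 1 ∧ c₃bar (c 0) (c 1) ≤ c 2}

/-- `γ⁺(c)`: the largest value at `0` of a no-swirl solution. -/
noncomputable def γplus (c : R3) : ℝ := sSup {γ | ∃ u, IsNoSwirl c γ u}

/-- `γ⁻(c)`: the smallest value at `0` of a no-swirl solution. -/
noncomputable def γminus (c : R3) : ℝ := sInf {γ | ∃ u, IsNoSwirl c γ u}

/-- The parameter set `I` of all pairs `(c,γ)`. -/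
def I : Set (R3 × ℝ) := {q | q.1 ∈ J ∧ γminus q.1 ≤ q.2 ∧ q.2 ≤ γplus q.1}

def J₂ : Set R3 := {c | c ∈ J ∧ c 0 = -1 ∧ -1 < c 1 ∧ c₃bar (c 0) (c 1) < c 2}

def J₃ : Set R3 := {c | c ∈ J ∧ -1 < c 0 ∧ c 1 = -1 ∧ c₃bar (c 0) (c 1) < c 2}

def J₄ : Set R3 := {c | c ∈ J ∧ c 0 = -1 ∧ c 1 = -1 ∧ c₃bar (c 0) (c 1) < c 2}

/-- `I_{2,3}`. -/
def I₂₃ : Set (R3 × ℝ) := {q | q ∈ I ∧ q.1 ∈ J₂ ∧ q.1 1 < -(3 / 4) ∧ q.2 = γminus q.1}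

/-- `I_{4,3}`. -/
def I₄₃ : Set (R3 × ℝ) := {q | q ∈ I ∧ q.1 ∈ J₄ ∧ q.1 1 < -(3 / 4) ∧ q.2 = γminus q.1}

/-- `I_{3,2}`. -/
def I₃₂ : Set (R3 × ℝ) := {q | q ∈ I ∧ q.1 ∈ J₃ ∧ q.1 0 < -(3 / 4) ∧ q.2 = γplus q.1}

/-- `I_{4,2}`. -/
def I₄₂ : Set (R3 × ℝ) := {q | q ∈ I ∧ q.1 ∈ J₄ ∧ q.1 0 < -(3 / 4) ∧ q.2 = γplus q.1}

/-! ## Kernel functions of the linearised operator -/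

/-- `a_{c,γ}(x) = ∫₀ˣ (2s + Ū_θ) / (1 - s²) ds`. -/
noncomputable def aFun (c : R3) (γ x : ℝ) : ℝ :=
  ∫ s in (0 : ℝ)..x, (2 * s + Ubar c γ s) / (1 - s ^ 2)

/-- `b_{c,γ}(x) = ∫₀ˣ Ū_θ / (1 - s²) ds`. -/
noncomputable def bFun (c : R3) (γ x : ℝ) : ℝ :=
  ∫ s in (0 : ℝ)..x, Ubar c γ s / (1 - s ^ 2)

/-- The `θ`-component of `V^{2a}`; its `φ`-component is `0`. -/
noncomputable def V2a (c : R3) (γ x : ℝ) : ℝ :=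
  Real.exp (-aFun c γ x) * ∫ s in (-1 : ℝ)..x, Real.exp (aFun c γ s)

/-- The `θ`-component of `V^{2b}`; its `φ`-component is `0`. -/
noncomputable def V2b (c : R3) (γ x : ℝ) : ℝ :=
  Real.exp (-aFun c γ x) * ∫ s in (1 : ℝ)..x, Real.exp (aFun c γ s)

/-- The `φ`-component of `V³`; its `θ`-component is `0`. -/
noncomputable def V3 (c : R3) (γ x : ℝ) : ℝ := ∫ t in (0 : ℝ)..x, Real.exp (-bFun c γ t)

/-- The `φ`-component of `V⁴`; its `θ`-component is `0`. -/
def V4 (_c : R3) (_γ _x : ℝ) : ℝ := 1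

/-- `φ_{c,γ}[Ũ_θ] = (1-x²) Ũ_θ' + (2x + Ū_θ) Ũ_θ + Ũ_θ²/2`. -/
noncomputable def varphi (c : R3) (γ : ℝ) (Uθ : ℝ → ℝ) (x : ℝ) : ℝ :=
  (1 - x ^ 2) * deriv Uθ x + (2 * x + Ubar c γ x) * Uθ x + 1 / 2 * Uθ x ^ 2

/-- The constants `ĉ` of the perturbed flow `U^{c,γ} + (Ũ_θ, Ũ_φ)`. -/
noncomputable def chat (c : R3) (γ : ℝ) (Uθ Uφ : ℝ → ℝ) : R3 :=
  !₂[c 0 + 1 / 2 * psi Uφ (-1), c 1 + 1 / 2 * psi Uφ 1,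
    c 2 - 1 / 2 * iteratedDeriv 2 (varphi c γ Uθ) 0]

/-- The `θ`-component of `β₂ V^{2b} + β₃ V³ + β₄ V⁴ + V`. -/
noncomputable def pertθb {ε : ℝ} (c : R3) (γ : ℝ) (β : R3) (V : X ε .south) (x : ℝ) : ℝ :=
  β 0 * V2b c γ x + thetaPart V x

/-- The `θ`-component of `β₂ V^{2a} + β₃ V³ + β₄ V⁴ + V`. -/
noncomputable def pertθa {ε : ℝ} (c : R3) (γ : ℝ) (β : R3) (V : X ε .north) (x : ℝ) : ℝ :=
  β 0 * V2a c γ x + thetaPart V x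

/-- The `φ`-component of either of these sums. -/
noncomputable def pertφ {ε : ℝ} {p : Pole} (c : R3) (γ : ℝ) (β : R3) (V : X ε p) (x : ℝ) : ℝ :=
  β 1 * V3 c γ x + β 2 * V4 c γ x + phiPart V x

end HomNS

open HomNS

/-! By reflection the logarithmic pole may be taken to be `x = -1`. There `Ū_θ = (1-x) - (1+s)(1+x)
+ v` with `s = √(1+c₂)` and `v ∈ M₁(ε)` vanishing at both poles. The affine part is itself the
swirl-free solution with `c₃ = c̄₃` and carries the boundary values `2` and `-2-2s`; the correction
`v` solves a Riccati equation whose only inhomogeneity is the constant `k = c₃ - c̄₃ > 0`. Writing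
`v = 2(1-x²) z'/z` turns it into a hypergeometric equation in the logarithmic case. The solution
regular at `x = 1` has Taylor coefficients `z_n` in `(1-x)/2` with `n z_n` (`n ≥ 1`) between two
positive constants, so `z` grows like `-ln(1+x)` (`exists_profile`). This yields `v`, and also the
integrating factor `E = (1-x)^s z²/z(0)²` of the linearised `θ`-equation, comparable from both sides
with `(1-x)^s ln²((1+x)/3)`. Any solution starting below this one blows up before `x = 1`
(`IsProfile.le_of_isWeight`), so it is the one with `γ = γ⁻(c)`.

The equations form one quadratic map `Operators.sys`, sending `(s, k, w, φ)` to `s`, the two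
residuals divided by `1-x²`, and the normalisations `w(0)`, `φ'(0)`, `φ(0)`. The swirl term enters
with its affine interpolant at `±1` removed; that interpolant is exactly the shift of `c₁` and `c₂`.
Treating `k` as an unknown and `w(0)` as a datum is the decisive choice: a background is mapped to
`(s, 0, 0, γ+s, 0, 0)`, so no regularity of `c ↦ γ⁻(c)` is needed, and `V^{2b}` appears as the
response to a change of `k`.

At a background the derivative of the map is bijective (`IsWeight.solvable`,
`Operators.Solvable.bijective`): the `θ`-part is solved by integrating against `E` from `x = 1`, the
`φ`-part by integrating against `(1-x²)E` from `x = 0`. The latter solution lies in `M₂(ε)` thanks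
to `s < ε`, which is the hypothesis on `Ū_θ(1) = -2-2s`. Moreover a background is the only preimage
of its image (`Operators.sys_injective`).

A map that is injective on a compact set, with invertible derivative there, has a smooth inverse `S`
near the image of that set (`exists_smooth_inverse_near_compact`). Applying `S` to `(s, 0, 0, γ + s
+ h(0)β₂, β₃, β₄)`, where `h = V^{2b}`, gives the branch; `V` is what is left after subtracting the
background and the part linear in `β` (`exists_branch`). Conversely, a solution near a background
has zero residuals, since no element of the target space has poles at `±1`, so that `ĉ₁` and `ĉ₂`
are forced. Its constant `k` can be recovered from the `θ`-equation at `x = 0`, hence is close to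
that of the background, and its three normalisations then determine `β`. Part (B) is part (A)
conjugated by `f ↦ -f(-·)`. -/

namespace HomNS

/-! ## Target spaces of the differential operators -/

/-- Membership in the target space of the `θ`-equation. -/
structure MemY₁ (ε : ℝ) (f : ℝ → ℝ) : Prop where
  zero_off : ∀ x, x ∉ Ioo (-1 : ℝ) 1 → f x = 0
  cont : ContinuousOn f (Ioo (-1) 1)
  c2 : ContDiffOn ℝ 2 f (Ioo (-1 / 2) (1 / 2))
  -- This is the weight of `f'` in `M₁`, and the inner bounds below are those imposed there on `f''`
  -- and `f'''`: the `θ`-equation is divided by `1 - x²`, so that its leading term is the bare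
  -- derivative.
  bdd0 : BddOn (Ioo (-1) 1) fun x => wDer ε .south x * f x
  bdd1 : BddOn (Ioo (-1 / 2) (1 / 2)) (deriv f)
  bdd2 : BddOn (Ioo (-1 / 2) (1 / 2)) (iteratedDeriv 2 f)

/-- Membership in the target space of the `φ`-equation. -/
structure MemY₂ (ε : ℝ) (f : ℝ → ℝ) : Prop where
  zero_off : ∀ x, x ∉ Ioo (-1 : ℝ) 1 → f x = 0
  cont : ContinuousOn f (Ioo (-1) 1)
  bdd0 : BddOn (Ioo (-1) 1) fun x => (1 - x ^ 2) ^ (2 + ε) * f x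

/-- The target space of the `θ`-equation as a subspace of all functions. -/
def Y₁sub (ε : ℝ) : Submodule ℝ (ℝ → ℝ) where
  carrier := {f | MemY₁ ε f}
  zero_mem' :=
    ⟨fun _ _ => rfl, continuousOn_const, contDiffOn_const, ⟨0, fun x _ => by simp⟩,
      ⟨0, fun x _ => by simp⟩, ⟨0, fun x _ => by rw [iteratedDeriv_zero_fun]; simp⟩⟩
  add_mem' := fun {f g} hf hg =>
    ⟨fun x hx => by simp [hf.zero_off x hx, hg.zero_off x hx], hf.cont.add hg.cont,
      hf.c2.add hg.c2,
      BddOn.add (fun x _ => by simp only [Pi.add_apply]; ring) hf.bdd0 hg.bdd0,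
      BddOn.add (fun x hx => deriv_add_Ioo two_ne_zero hf.c2 hg.c2 hx) hf.bdd1 hg.bdd1,
      BddOn.add (fun x hx => iteratedDeriv_add_Ioo (by norm_num) hf.c2 hg.c2 hx) hf.bdd2 hg.bdd2⟩
  smul_mem' := fun c f hf =>
    ⟨fun x hx => by simp [hf.zero_off x hx], hf.cont.const_smul c, hf.c2.const_smul c,
      BddOn.smul (fun x _ => by simp only [Pi.smul_apply, smul_eq_mul]; ring) hf.bdd0,
      BddOn.smul (fun x _ => deriv_smul_fun c f x) hf.bdd1,
      BddOn.smul (fun x _ => iteratedDeriv_smul_fun 2 c f x) hf.bdd2⟩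

/-- The target space of the `φ`-equation as a subspace of all functions. -/
def Y₂sub (ε : ℝ) : Submodule ℝ (ℝ → ℝ) where
  carrier := {f | MemY₂ ε f}
  zero_mem' := ⟨fun _ _ => rfl, continuousOn_const, ⟨0, fun x _ => by simp⟩⟩
  add_mem' := fun {f g} hf hg =>
    ⟨fun x hx => by simp [hf.zero_off x hx, hg.zero_off x hx], hf.cont.add hg.cont,
      BddOn.add (fun x _ => by simp only [Pi.add_apply]; ring) hf.bdd0 hg.bdd0⟩
  smul_mem' := fun c f hf =>
    ⟨fun x hx => by simp [hf.zero_off x hx], hf.cont.const_smul c,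
      BddOn.smul (fun x _ => by simp only [Pi.smul_apply, smul_eq_mul]; ring) hf.bdd0⟩

/-- The target space of the `θ`-equation. -/
def Y₁ (ε : ℝ) : Type := Y₁sub ε

/-- The target space of the `φ`-equation. -/
def Y₂ (ε : ℝ) : Type := Y₂sub ε

instance (ε : ℝ) : AddCommGroup (Y₁ ε) := inferInstanceAs (AddCommGroup (Y₁sub ε))
instance (ε : ℝ) : Module ℝ (Y₁ ε) := inferInstanceAs (Module ℝ (Y₁sub ε))
instance (ε : ℝ) : AddCommGroup (Y₂ ε) := inferInstanceAs (AddCommGroup (Y₂sub ε))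
instance (ε : ℝ) : Module ℝ (Y₂ ε) := inferInstanceAs (Module ℝ (Y₂sub ε))

/-- The function underlying an element of `Y₁`. -/
def Y₁.fn {ε : ℝ} (f : Y₁ ε) : ℝ → ℝ := (show Y₁sub ε from f).1

/-- The function underlying an element of `Y₂`. -/
def Y₂.fn {ε : ℝ} (f : Y₂ ε) : ℝ → ℝ := (show Y₂sub ε from f).1

/-- The element of `M₁` with a given underlying function. -/
def M₁.mk {ε : ℝ} {p : Pole} (f : ℝ → ℝ) (hf : MemM₁ ε p f) : M₁ ε p :=
  (⟨f, hf⟩ : M₁sub ε p)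

/-- The element of `M₂` with a given underlying function. -/
def M₂.mk {ε : ℝ} (f : ℝ → ℝ) (hf : MemM₂ ε f) : M₂ ε := (⟨f, hf⟩ : M₂sub ε)

/-- The element of `Y₁` with a given underlying function. -/
def Y₁.mk {ε : ℝ} (f : ℝ → ℝ) (hf : MemY₁ ε f) : Y₁ ε := (⟨f, hf⟩ : Y₁sub ε)

/-- The element of `Y₂` with a given underlying function. -/
def Y₂.mk {ε : ℝ} (f : ℝ → ℝ) (hf : MemY₂ ε f) : Y₂ ε := (⟨f, hf⟩ : Y₂sub ε)

@[simp] theorem M₁.fn_mk {ε : ℝ} {p : Pole} (f : ℝ → ℝ) (hf : MemM₁ ε p f) :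
    (M₁.mk f hf).fn = f := rfl
@[simp] theorem M₂.fn_mk {ε : ℝ} (f : ℝ → ℝ) (hf : MemM₂ ε f) : (M₂.mk f hf).fn = f := rfl
@[simp] theorem Y₁.fn_mk {ε : ℝ} (f : ℝ → ℝ) (hf : MemY₁ ε f) : (Y₁.mk f hf).fn = f := rfl
@[simp] theorem Y₂.fn_mk {ε : ℝ} (f : ℝ → ℝ) (hf : MemY₂ ε f) : (Y₂.mk f hf).fn = f := rfl

theorem Y₁.mem {ε : ℝ} (f : Y₁ ε) : MemY₁ ε f.fn := (show Y₁sub ε from f).2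
theorem Y₂.mem {ε : ℝ} (f : Y₂ ε) : MemY₂ ε f.fn := (show Y₂sub ε from f).2
theorem Y₁.ext_fn {ε : ℝ} {f g : Y₁ ε} (h : f.fn = g.fn) : f = g := Subtype.ext h
theorem Y₂.ext_fn {ε : ℝ} {f g : Y₂ ε} (h : f.fn = g.fn) : f = g := Subtype.ext h
theorem Y₁.fn_add {ε : ℝ} (f g : Y₁ ε) : (f + g).fn = f.fn + g.fn := rfl
theorem Y₂.fn_add {ε : ℝ} (f g : Y₂ ε) : (f + g).fn = f.fn + g.fn := rfl
theorem Y₁.fn_smul {ε : ℝ} (c : ℝ) (f : Y₁ ε) : (c • f).fn = c • f.fn := rfl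
theorem Y₂.fn_smul {ε : ℝ} (c : ℝ) (f : Y₂ ε) : (c • f).fn = c • f.fn := rfl
theorem M₁.fn_zero {ε : ℝ} {p : Pole} : (0 : M₁ ε p).fn = 0 := rfl
theorem M₂.fn_zero {ε : ℝ} : (0 : M₂ ε).fn = 0 := rfl
theorem Y₁.fn_zero {ε : ℝ} : (0 : Y₁ ε).fn = 0 := rfl
theorem Y₂.fn_zero {ε : ℝ} : (0 : Y₂ ε).fn = 0 := rfl
theorem M₁.fn_sub {ε : ℝ} {p : Pole} (f g : M₁ ε p) : (f - g).fn = f.fn - g.fn := rfl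
theorem M₂.fn_sub {ε : ℝ} (f g : M₂ ε) : (f - g).fn = f.fn - g.fn := rfl
theorem Y₁.fn_sub {ε : ℝ} (f g : Y₁ ε) : (f - g).fn = f.fn - g.fn := rfl
theorem Y₂.fn_sub {ε : ℝ} (f g : Y₂ ε) : (f - g).fn = f.fn - g.fn := rfl

noncomputable instance (ε : ℝ) : Norm (Y₁ ε) where
  norm f := supOn (Ioo (-1) 1) (fun x => wDer ε .south x * f.fn x)
    + supOn (Ioo (-1 / 2) (1 / 2)) (deriv f.fn)
    + supOn (Ioo (-1 / 2) (1 / 2)) (iteratedDeriv 2 f.fn)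

noncomputable instance (ε : ℝ) : Norm (Y₂ ε) where
  norm f := supOn (Ioo (-1) 1) (fun x => (1 - x ^ 2) ^ (2 + ε) * f.fn x)

theorem Y₁.norm_def {ε : ℝ} (f : Y₁ ε) :
    ‖f‖ = supOn (Ioo (-1) 1) (fun x => wDer ε .south x * f.fn x)
    + supOn (Ioo (-1 / 2) (1 / 2)) (deriv f.fn)
    + supOn (Ioo (-1 / 2) (1 / 2)) (iteratedDeriv 2 f.fn) := rfl

theorem Y₂.norm_def {ε : ℝ} (f : Y₂ ε) :
    ‖f‖ = supOn (Ioo (-1) 1) (fun x => (1 - x ^ 2) ^ (2 + ε) * f.fn x) := rfl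

theorem supOn_eq_zero {s : Set ℝ} {g : ℝ → ℝ} (hg : ∀ x ∈ s, g x = 0) : supOn s g = 0 :=
  le_antisymm (supOn_le le_rfl fun x hx => by simp [hg x hx]) (supOn_nonneg _ _)

theorem wDer_pos (ε : ℝ) (p : Pole) {x : ℝ} (hx : x ∈ Ioo (-1 : ℝ) 1) : 0 < wDer ε p x := by
  obtain ⟨h1, h2⟩ := p.coord_mem hx
  refine mul_pos (mul_pos (by linarith) (pow_pos_of_ne_zero ?_)) (Real.rpow_pos_of_pos ?_ _)
  · exact ne_of_lt (Real.log_neg (by linarith) (by linarith))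
  · linarith
where
  pow_pos_of_ne_zero {y : ℝ} (h : y ≠ 0) : 0 < y ^ 2 := by positivity

theorem one_sub_sq_pos {x : ℝ} (hx : x ∈ Ioo (-1 : ℝ) 1) : 0 < 1 - x ^ 2 := by
  nlinarith [hx.1, hx.2]

theorem Y₁.core (ε : ℝ) : NormedSpace.Core ℝ (Y₁ ε) where
  norm_nonneg f := by
    rw [Y₁.norm_def]
    have := fun s g => supOn_nonneg s g
    exact add_nonneg (add_nonneg (this _ _) (this _ _)) (this _ _)
  norm_smul c f := by
    rw [Y₁.norm_def, Y₁.norm_def, Y₁.fn_smul, Real.norm_eq_abs,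
      supOn_smul (f := fun x => wDer ε .south x * f.fn x) (a := c)
        (h := fun x => wDer ε .south x * (c • f.fn) x)
        (fun x _ => by simp only [Pi.smul_apply, smul_eq_mul]; ring),
      supOn_smul (fun x _ => deriv_smul_fun c f.fn x),
      supOn_smul (fun x _ => iteratedDeriv_smul_fun 2 c f.fn x)]
    ring
  norm_triangle f g := by
    have hf := f.mem
    have hg := g.mem
    rw [Y₁.norm_def, Y₁.norm_def, Y₁.norm_def, Y₁.fn_add]
    have h0 := supOn_add_le (h := fun x => wDer ε .south x * (f.fn + g.fn) x)
      (fun x _ => by simp only [Pi.add_apply]; ring) hf.bdd0 hg.bdd0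
    have h1 := supOn_add_le (h := deriv (f.fn + g.fn))
      (fun x hx => deriv_add_Ioo two_ne_zero hf.c2 hg.c2 hx) hf.bdd1 hg.bdd1
    have h2 := supOn_add_le (h := iteratedDeriv 2 (f.fn + g.fn))
      (fun x hx => iteratedDeriv_add_Ioo (by norm_num) hf.c2 hg.c2 hx) hf.bdd2 hg.bdd2
    linarith
  norm_eq_zero_iff f := by
    have hf := f.mem
    constructor
    · intro h
      rw [Y₁.norm_def] at h
      have h0 : supOn (Ioo (-1) 1) (fun x => wDer ε .south x * f.fn x) ≤ 0 := by
        have := supOn_nonneg (Ioo (-1 / 2) (1 / 2)) (deriv f.fn)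
        have := supOn_nonneg (Ioo (-1 / 2) (1 / 2)) (iteratedDeriv 2 f.fn)
        linarith
      refine Y₁.ext_fn (funext fun x => ?_)
      change f.fn x = 0
      by_cases hx : x ∈ Ioo (-1 : ℝ) 1
      · have h1 := abs_eq_zero.1 (le_antisymm ((le_supOn hf.bdd0 hx).trans h0) (abs_nonneg _))
        exact (mul_eq_zero.1 h1).resolve_left (wDer_pos ε .south hx).ne'
      · exact hf.zero_off x hx
    · rintro rfl
      rw [Y₁.norm_def, Y₁.fn_zero, supOn_eq_zero (fun x _ => by simp),
        supOn_eq_zero (fun x _ => by simp), supOn_eq_zero (fun x _ => iteratedDeriv_zero_fun 2 x)]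
      norm_num

theorem Y₂.core (ε : ℝ) : NormedSpace.Core ℝ (Y₂ ε) where
  norm_nonneg f := supOn_nonneg _ _
  norm_smul c f := by
    rw [Y₂.norm_def, Y₂.norm_def, Y₂.fn_smul, Real.norm_eq_abs]
    exact supOn_smul (fun x _ => by simp only [Pi.smul_apply, smul_eq_mul]; ring)
  norm_triangle f g := by
    rw [Y₂.norm_def, Y₂.norm_def, Y₂.norm_def, Y₂.fn_add]
    exact supOn_add_le (fun x _ => by simp only [Pi.add_apply]; ring) f.mem.bdd0 g.mem.bdd0
  norm_eq_zero_iff f := by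
    constructor
    · intro h
      rw [Y₂.norm_def] at h
      refine Y₂.ext_fn (funext fun x => ?_)
      change f.fn x = 0
      by_cases hx : x ∈ Ioo (-1 : ℝ) 1
      · have h1 := abs_eq_zero.1
          (le_antisymm ((le_supOn f.mem.bdd0 hx).trans h.le) (abs_nonneg _))
        exact (mul_eq_zero.1 h1).resolve_left (Real.rpow_pos_of_pos (one_sub_sq_pos hx) _).ne'
      · exact f.mem.zero_off x hx
    · rintro rfl
      rw [Y₂.norm_def, Y₂.fn_zero, supOn_eq_zero (fun x _ => by simp)]

noncomputable instance (ε : ℝ) : NormedAddCommGroup (Y₁ ε) :=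
  NormedAddCommGroup.ofCore (Y₁.core ε)
noncomputable instance (ε : ℝ) : NormedSpace ℝ (Y₁ ε) := NormedSpace.ofCore (Y₁.core ε)
noncomputable instance (ε : ℝ) : NormedAddCommGroup (Y₂ ε) :=
  NormedAddCommGroup.ofCore (Y₂.core ε)
noncomputable instance (ε : ℝ) : NormedSpace ℝ (Y₂ ε) := NormedSpace.ofCore (Y₂.core ε)

/-! ## Pointwise control by the norms -/

theorem M₁.val_le {ε : ℝ} {p : Pole} (f : M₁ ε p) {x : ℝ} (hx : x ∈ Ioo (-1 : ℝ) 1) :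
    |wVal ε p x * f.fn x| ≤ ‖f‖ := by
  have := le_supOn f.mem.bdd0 hx
  rw [M₁.norm_def]
  linarith [supOn_nonneg (Ioo (-1) 1) (fun x => wDer ε p x * deriv f.fn x),
    supOn_nonneg (Ioo (-1 / 2) (1 / 2)) (iteratedDeriv 2 f.fn),
    supOn_nonneg (Ioo (-1 / 2) (1 / 2)) (iteratedDeriv 3 f.fn)]

theorem M₁.der_le {ε : ℝ} {p : Pole} (f : M₁ ε p) {x : ℝ} (hx : x ∈ Ioo (-1 : ℝ) 1) :
    |wDer ε p x * deriv f.fn x| ≤ ‖f‖ := by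
  have := le_supOn f.mem.bdd1 hx
  rw [M₁.norm_def]
  linarith [supOn_nonneg (Ioo (-1) 1) (fun x => wVal ε p x * f.fn x),
    supOn_nonneg (Ioo (-1 / 2) (1 / 2)) (iteratedDeriv 2 f.fn),
    supOn_nonneg (Ioo (-1 / 2) (1 / 2)) (iteratedDeriv 3 f.fn)]

theorem M₁.der2_le {ε : ℝ} {p : Pole} (f : M₁ ε p) {x : ℝ} (hx : x ∈ Ioo (-1 / 2 : ℝ) (1 / 2)) :
    |iteratedDeriv 2 f.fn x| ≤ ‖f‖ := by
  have := le_supOn f.mem.bdd2 hx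
  rw [M₁.norm_def]
  linarith [supOn_nonneg (Ioo (-1) 1) (fun x => wVal ε p x * f.fn x),
    supOn_nonneg (Ioo (-1) 1) (fun x => wDer ε p x * deriv f.fn x),
    supOn_nonneg (Ioo (-1 / 2) (1 / 2)) (iteratedDeriv 3 f.fn)]

theorem M₁.der3_le {ε : ℝ} {p : Pole} (f : M₁ ε p) {x : ℝ} (hx : x ∈ Ioo (-1 / 2 : ℝ) (1 / 2)) :
    |iteratedDeriv 3 f.fn x| ≤ ‖f‖ := by
  have := le_supOn f.mem.bdd3 hx
  rw [M₁.norm_def]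
  linarith [supOn_nonneg (Ioo (-1) 1) (fun x => wVal ε p x * f.fn x),
    supOn_nonneg (Ioo (-1) 1) (fun x => wDer ε p x * deriv f.fn x),
    supOn_nonneg (Ioo (-1 / 2) (1 / 2)) (iteratedDeriv 2 f.fn)]

theorem M₂.val_le {ε : ℝ} (f : M₂ ε) {x : ℝ} (hx : x ∈ Ioo (-1 : ℝ) 1) :
    |(1 - x ^ 2) ^ ε * f.fn x| ≤ ‖f‖ := by
  have := le_supOn f.mem.bdd0 hx
  rw [M₂.norm_def]
  linarith [supOn_nonneg (Ioo (-1) 1) (fun x => (1 - x ^ 2) ^ (1 + ε) * deriv f.fn x),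
    supOn_nonneg (Ioo (-1) 1) (fun x => (1 - x ^ 2) ^ (2 + ε) * iteratedDeriv 2 f.fn x)]

theorem M₂.der_le {ε : ℝ} (f : M₂ ε) {x : ℝ} (hx : x ∈ Ioo (-1 : ℝ) 1) :
    |(1 - x ^ 2) ^ (1 + ε) * deriv f.fn x| ≤ ‖f‖ := by
  have := le_supOn f.mem.bdd1 hx
  rw [M₂.norm_def]
  linarith [supOn_nonneg (Ioo (-1) 1) (fun x => (1 - x ^ 2) ^ ε * f.fn x),
    supOn_nonneg (Ioo (-1) 1) (fun x => (1 - x ^ 2) ^ (2 + ε) * iteratedDeriv 2 f.fn x)]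

theorem M₂.der2_le {ε : ℝ} (f : M₂ ε) {x : ℝ} (hx : x ∈ Ioo (-1 : ℝ) 1) :
    |(1 - x ^ 2) ^ (2 + ε) * iteratedDeriv 2 f.fn x| ≤ ‖f‖ := by
  have := le_supOn f.mem.bdd2 hx
  rw [M₂.norm_def]
  linarith [supOn_nonneg (Ioo (-1) 1) (fun x => (1 - x ^ 2) ^ ε * f.fn x),
    supOn_nonneg (Ioo (-1) 1) (fun x => (1 - x ^ 2) ^ (1 + ε) * deriv f.fn x)]

theorem Y₁.val_le {ε : ℝ} (f : Y₁ ε) {x : ℝ} (hx : x ∈ Ioo (-1 : ℝ) 1) :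
    |wDer ε .south x * f.fn x| ≤ ‖f‖ := by
  have := le_supOn f.mem.bdd0 hx
  rw [Y₁.norm_def]
  linarith [supOn_nonneg (Ioo (-1 / 2) (1 / 2)) (iteratedDeriv 2 f.fn),
    supOn_nonneg (Ioo (-1 / 2) (1 / 2)) (deriv f.fn)]

theorem Y₁.der_le {ε : ℝ} (f : Y₁ ε) {x : ℝ} (hx : x ∈ Ioo (-1 / 2 : ℝ) (1 / 2)) :
    |deriv f.fn x| ≤ ‖f‖ := by
  have := le_supOn f.mem.bdd1 hx
  rw [Y₁.norm_def]
  linarith [supOn_nonneg (Ioo (-1 / 2) (1 / 2)) (iteratedDeriv 2 f.fn),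
    supOn_nonneg (Ioo (-1) 1) (fun x => wDer ε .south x * f.fn x)]

theorem Y₁.der2_le {ε : ℝ} (f : Y₁ ε) {x : ℝ} (hx : x ∈ Ioo (-1 / 2 : ℝ) (1 / 2)) :
    |iteratedDeriv 2 f.fn x| ≤ ‖f‖ := by
  have := le_supOn f.mem.bdd2 hx
  rw [Y₁.norm_def]
  linarith [supOn_nonneg (Ioo (-1 / 2) (1 / 2)) (deriv f.fn),
    supOn_nonneg (Ioo (-1) 1) (fun x => wDer ε .south x * f.fn x)]

theorem Y₂.val_le {ε : ℝ} (f : Y₂ ε) {x : ℝ} (hx : x ∈ Ioo (-1 : ℝ) 1) :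
    |(1 - x ^ 2) ^ (2 + ε) * f.fn x| ≤ ‖f‖ := le_supOn f.mem.bdd0 hx

/-! ## Completeness -/

theorem inner_subset_outer : Ioo (-1 / 2 : ℝ) (1 / 2) ⊆ Ioo (-1 : ℝ) 1 :=
  Ioo_subset_Ioo (by norm_num) (by norm_num)

theorem continuousOn_wDer (ε : ℝ) (p : Pole) : ContinuousOn (wDer ε p) (Ioo (-1) 1) := by
  have hc : Continuous p.coord := by cases p; exacts [continuous_id, continuous_neg]
  have h : ∀ x ∈ Ioo (-1 : ℝ) 1, -1 < p.coord x ∧ p.coord x < 1 := fun x hx => p.coord_mem hx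
  unfold wDer
  refine ((by fun_prop : ContinuousOn (fun x => 1 + p.coord x) _).mul
    (ContinuousOn.pow (ContinuousOn.log (by fun_prop) fun x hx => ?_) 2)).mul
    (ContinuousOn.rpow_const (by fun_prop) fun x hx => Or.inl ?_)
  · have := (h x hx).1; exact ne_of_gt (by linarith)
  · have := (h x hx).2; linarith

theorem continuousOn_wVal (ε : ℝ) (p : Pole) : ContinuousOn (wVal ε p) (Ioo (-1) 1) := by
  have hc : Continuous p.coord := by cases p; exacts [continuous_id, continuous_neg]
  have h : ∀ x ∈ Ioo (-1 : ℝ) 1, -1 < p.coord x ∧ p.coord x < 1 := fun x hx => p.coord_mem hx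
  unfold wVal
  refine (ContinuousOn.log (by fun_prop) fun x hx => ?_).mul
    (ContinuousOn.rpow_const (by fun_prop) fun x hx => Or.inl ?_)
  · have := (h x hx).1; exact ne_of_gt (by linarith)
  · have := (h x hx).2; linarith

theorem continuousOn_one_sub_sq_rpow (r : ℝ) :
    ContinuousOn (fun x : ℝ => (1 - x ^ 2) ^ r) (Ioo (-1) 1) :=
  ContinuousOn.rpow_const (by fun_prop) fun _ hx => Or.inl (one_sub_sq_pos hx).ne'

theorem one_sub_sq_rpow_pos (r : ℝ) {x : ℝ} (hx : x ∈ Ioo (-1 : ℝ) 1) :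
    0 < (1 - x ^ 2) ^ r := Real.rpow_pos_of_pos (one_sub_sq_pos hx) _

/-- A sequence that is Cauchy in a weighted sup norm over an open set converges, in that norm and
locally uniformly. -/
theorem exists_weighted_limit {s : Set ℝ} {w : ℝ → ℝ} (hw : ContinuousOn w s)
    (hw0 : ∀ x ∈ s, w x ≠ 0) (u : ℕ → ℝ → ℝ)
    (hu : ∀ e > 0, ∃ N, ∀ m ≥ N, ∀ n ≥ N, ∀ x ∈ s, |w x * (u m x - u n x)| ≤ e) :
    ∃ g : ℝ → ℝ, TendstoLocallyUniformlyOn u g atTop s ∧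
      ∀ e > 0, ∃ N, ∀ n ≥ N, ∀ x ∈ s, |w x * (u n x - g x)| ≤ e := by
  have hc : ∀ x ∈ s, ∃ y, Tendsto (fun n => u n x) atTop (𝓝 y) := by
    intro x hx
    refine cauchySeq_tendsto_of_complete (Metric.cauchySeq_iff.2 fun e he => ?_)
    have hwx : 0 < |w x| := abs_pos.2 (hw0 x hx)
    obtain ⟨N, hN⟩ := hu (|w x| * (e / 2)) (by positivity)
    refine ⟨N, fun m hm n hn => ?_⟩
    have := hN m hm n hn x hx
    rw [abs_mul] at this
    have := le_of_mul_le_mul_left this hwx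
    rw [Real.dist_eq]
    linarith
  choose! g hg using hc
  have hlim : ∀ e > 0, ∃ N, ∀ n ≥ N, ∀ x ∈ s, |w x * (u n x - g x)| ≤ e := by
    intro e he
    obtain ⟨N, hN⟩ := hu e he
    refine ⟨N, fun n hn x hx => ?_⟩
    have ht : Tendsto (fun m => |w x * (u n x - u m x)|) atTop (𝓝 |w x * (u n x - g x)|) :=
      (((tendsto_const_nhds.sub (hg x hx))).const_mul _).abs
    exact le_of_tendsto ht (eventually_atTop.2 ⟨N, fun m hm => hN n hn m hm x hx⟩)
  refine ⟨g, ?_, hlim⟩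
  rw [Metric.tendstoLocallyUniformlyOn_iff]
  intro e he x hx
  have hwx : 0 < |w x| := abs_pos.2 (hw0 x hx)
  -- By continuity the weight exceeds `|w x| / 2` near `x`, so this weighted error leaves an
  -- unweighted error of at most `e / 2` there.
  obtain ⟨N, hN⟩ := hlim (|w x| / 2 * (e / 2)) (by positivity)
  have hev : ∀ᶠ y in 𝓝[s] x, |w x| / 2 < |w y| :=
    (hw x hx).abs.eventually (lt_mem_nhds (by linarith))
  refine ⟨{y | |w x| / 2 < |w y|} ∩ s, inter_mem hev self_mem_nhdsWithin,
    eventually_atTop.2 ⟨N, fun n hn y hy => ?_⟩⟩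
  have h1 := hN n hn y hy.2
  have h2 : |w x| / 2 < |w y| := hy.1
  rw [abs_mul] at h1
  rw [dist_comm, Real.dist_eq]
  by_contra! h3
  nlinarith [abs_nonneg (u n y - g y)]

theorem bddOn_of_near {s : Set ℝ} {w f g : ℝ → ℝ} {e : ℝ} (hf : BddOn s fun x => w x * f x)
    (h : ∀ x ∈ s, |w x * (f x - g x)| ≤ e) : BddOn s fun x => w x * g x := by
  obtain ⟨C, hC⟩ := hf
  refine ⟨C + e, fun x hx => ?_⟩
  have : w x * g x = w x * f x - w x * (f x - g x) := by ring
  change |w x * g x| ≤ _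
  rw [this]
  exact (abs_sub _ _).trans (add_le_add (hC x hx) (h x hx))

theorem bddOn_of_near_one {s : Set ℝ} {f g : ℝ → ℝ} {e : ℝ} (hf : BddOn s f)
    (h : ∀ x ∈ s, |1 * (f x - g x)| ≤ e) : BddOn s g := by
  have := bddOn_of_near (w := fun _ => 1) (f := f) (by simpa only [one_mul] using hf) h
  simpa only [one_mul] using this

/-- Isolates one summand of a weighted norm: `D` is the derivative measured by that summand and `w`
its weight. The output is the input of `exists_weighted_limit`. -/
theorem exists_channel_bound {V : Type*} [NormedAddCommGroup V] {u : ℕ → V}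
    (hu : ∀ e > 0, ∃ N, ∀ m ≥ N, ∀ n ≥ N, dist (u m) (u n) < e) {D : V → ℝ → ℝ} {w : ℝ → ℝ}
    {s : Set ℝ} (h : ∀ m n, ∀ x ∈ s, |w x * (D (u m) x - D (u n) x)| ≤ ‖u m - u n‖) :
    ∀ e > 0, ∃ N, ∀ m ≥ N, ∀ n ≥ N, ∀ x ∈ s, |w x * (D (u m) x - D (u n) x)| ≤ e := by
  intro e he
  obtain ⟨N, hN⟩ := hu e he
  refine ⟨N, fun m hm n hn x hx => (h m n x hx).trans ?_⟩
  rw [← dist_eq_norm]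
  exact (hN m hm n hn).le

theorem hasDerivAt_of_locallyUniform {a b : ℝ} {u : ℕ → ℝ → ℝ} {g g' : ℝ → ℝ}
    (hu : ∀ n, DifferentiableOn ℝ (u n) (Ioo a b))
    (h0 : TendstoLocallyUniformlyOn u g atTop (Ioo a b))
    (h1 : TendstoLocallyUniformlyOn (fun n => deriv (u n)) g' atTop (Ioo a b)) {x : ℝ}
    (hx : x ∈ Ioo a b) : HasDerivAt g (g' x) x :=
  hasDerivAt_of_tendstoLocallyUniformlyOn isOpen_Ioo h1
    (Eventually.of_forall fun n _ hy =>
      ((hu n).differentiableAt (isOpen_Ioo.mem_nhds hy)).hasDerivAt)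
    (fun _ hy => h0.tendsto_at hy) hx

theorem contDiffOn_succ_of_hasDerivAt {a b : ℝ} {f g : ℝ → ℝ} {n : ℕ}
    (h : ∀ x ∈ Ioo a b, HasDerivAt f (g x) x) (hg : ContDiffOn ℝ n g (Ioo a b)) :
    ContDiffOn ℝ (n + 1) f (Ioo a b) := by
  rw [contDiffOn_succ_iff_deriv_of_isOpen isOpen_Ioo]
  refine ⟨fun x hx => (h x hx).differentiableAt.differentiableWithinAt, by simp, ?_⟩
  exact hg.congr fun x hx => (h x hx).deriv

theorem iteratedDeriv_succ_eqOn {a b : ℝ} {f g : ℝ → ℝ} {n : ℕ}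
    (h : ∀ x ∈ Ioo a b, HasDerivAt f (g x) x) {x : ℝ} (hx : x ∈ Ioo a b) :
    iteratedDeriv (n + 1) f x = iteratedDeriv n g x := by
  rw [iteratedDeriv_succ']
  refine Filter.EventuallyEq.iteratedDeriv_eq n ?_
  filter_upwards [isOpen_Ioo.mem_nhds hx] with y hy using (h y hy).deriv

theorem indicator_eventuallyEq {f : ℝ → ℝ} {x : ℝ} (hx : x ∈ Ioo (-1 : ℝ) 1) :
    (Ioo (-1 : ℝ) 1).indicator f =ᶠ[𝓝 x] f := by
  filter_upwards [isOpen_Ioo.mem_nhds hx] with y hy using indicator_of_mem hy f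

theorem _root_.ContDiffOn.deriv_Ioo {a b : ℝ} {f : ℝ → ℝ} {m n : WithTop ℕ∞} (hf : ContDiffOn ℝ n f (Ioo a b))
    (h : m + 1 ≤ n) : ContDiffOn ℝ m (deriv f) (Ioo a b) :=
  ContDiffOn.deriv_of_isOpen hf isOpen_Ioo h

theorem _root_.ContDiffOn.hasDerivAt_Ioo {a b : ℝ} {f : ℝ → ℝ} {n : WithTop ℕ∞}
    (hf : ContDiffOn ℝ n f (Ioo a b)) (hn : n ≠ 0) {x : ℝ} (hx : x ∈ Ioo a b) :
    HasDerivAt f (deriv f x) x :=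
  ((contDiffAt_of_Ioo hf hx).differentiableAt hn).hasDerivAt

/-- The weighted limit is meaningful only on `(-1,1)`. It is cut off by an indicator, because
elements of the spaces are represented by their extension by zero. -/
instance (ε : ℝ) : CompleteSpace (Y₂ ε) := by
  refine Metric.complete_of_cauchySeq_tendsto fun u hu => ?_
  rw [Metric.cauchySeq_iff] at hu
  obtain ⟨g, hg, hg'⟩ := exists_weighted_limit (continuousOn_one_sub_sq_rpow (2 + ε))
    (fun x hx => (one_sub_sq_rpow_pos _ hx).ne') (fun n => (u n).fn) (fun e he => by
      obtain ⟨N, hN⟩ := hu e he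
      refine ⟨N, fun m hm n hn x hx => ((u m - u n).val_le hx).trans ?_⟩
      rw [← dist_eq_norm]
      exact (hN m hm n hn).le)
  set G := (Ioo (-1 : ℝ) 1).indicator g with hG
  have hGg : ∀ x ∈ Ioo (-1 : ℝ) 1, G x = g x := fun x hx => indicator_of_mem hx g
  have hmem : MemY₂ ε G := by
    obtain ⟨N, hN⟩ := hg' 1 one_pos
    refine ⟨fun x hx => indicator_of_notMem hx g, ?_,
      bddOn_of_near (u N).mem.bdd0 (e := 1) fun x hx => ?_⟩
    · exact (hg.continuousOn (Frequently.of_forall fun n => (u n).mem.cont)).congr hGg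
    · rw [hGg x hx]; exact hN N le_rfl x hx
  refine ⟨Y₂.mk G hmem, Metric.tendsto_atTop.2 fun e he => ?_⟩
  obtain ⟨N, hN⟩ := hg' (e / 2) (by positivity)
  refine ⟨N, fun n hn => ?_⟩
  rw [dist_eq_norm, Y₂.norm_def]
  refine (supOn_le (half_pos he).le fun x hx => ?_).trans_lt (half_lt_self he)
  rw [Y₂.fn_sub, Y₂.fn_mk, Pi.sub_apply, hGg x hx]
  exact hN n hn x hx

/-- Every summand of the norm has its own limit, and all these convergences are locally uniform.
Hence the limits of the derivatives are the derivatives of the limit, and closeness to one member of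
the sequence transfers the bounds. -/
instance (ε : ℝ) : CompleteSpace (Y₁ ε) := by
  refine Metric.complete_of_cauchySeq_tendsto fun u hu => ?_
  rw [Metric.cauchySeq_iff] at hu
  have hd1 : ∀ (v w : Y₁ ε), ∀ x ∈ Ioo (-1 / 2 : ℝ) (1 / 2),
      deriv (v - w).fn x = deriv v.fn x - deriv w.fn x := fun v w x hx => by
    rw [Y₁.fn_sub]
    exact deriv_sub ((contDiffAt_of_Ioo v.mem.c2 hx).differentiableAt two_ne_zero)
      ((contDiffAt_of_Ioo w.mem.c2 hx).differentiableAt two_ne_zero)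
  have hd2 : ∀ (v w : Y₁ ε), ∀ x ∈ Ioo (-1 / 2 : ℝ) (1 / 2),
      iteratedDeriv 2 (v - w).fn x = iteratedDeriv 2 v.fn x - iteratedDeriv 2 w.fn x :=
    fun v w x hx => by
      rw [Y₁.fn_sub]
      exact iteratedDeriv_sub (contDiffAt_of_Ioo v.mem.c2 hx) (contDiffAt_of_Ioo w.mem.c2 hx)
  obtain ⟨g, hg, hg'⟩ := exists_weighted_limit (continuousOn_wDer ε .south)
    (fun x hx => (wDer_pos ε .south hx).ne') (fun n => (u n).fn)
    (exists_channel_bound hu (D := fun f => f.fn) fun m n x hx => (u m - u n).val_le hx)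
  obtain ⟨g1, hg1, hg1'⟩ := exists_weighted_limit (s := Ioo (-1 / 2 : ℝ) (1 / 2))
    (w := fun _ => 1) continuousOn_const (fun _ _ => one_ne_zero) (fun n => deriv (u n).fn)
    (exists_channel_bound hu (D := fun f => deriv f.fn) fun m n x hx => by rw [one_mul, ← hd1 _ _ x hx]; exact (u m - u n).der_le hx)
  obtain ⟨g2, hg2, hg2'⟩ := exists_weighted_limit (s := Ioo (-1 / 2 : ℝ) (1 / 2))
    (w := fun _ => 1) continuousOn_const (fun _ _ => one_ne_zero)
    (fun n => iteratedDeriv 2 (u n).fn)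
    (exists_channel_bound hu (D := fun f => iteratedDeriv 2 f.fn) fun m n x hx => by rw [one_mul, ← hd2 _ _ x hx]; exact (u m - u n).der2_le hx)
  set G := (Ioo (-1 : ℝ) 1).indicator g with hG
  have hGg : ∀ x ∈ Ioo (-1 : ℝ) 1, G x = g x := fun x hx => indicator_of_mem hx g
  have hD1 : ∀ x ∈ Ioo (-1 / 2 : ℝ) (1 / 2), HasDerivAt G (g1 x) x := fun x hx =>
    (hasDerivAt_of_locallyUniform (fun n => (u n).mem.c2.differentiableOn two_ne_zero)
      (hg.mono inner_subset_outer) hg1 hx).congr_of_eventuallyEq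
      (indicator_eventuallyEq (inner_subset_outer hx))
  have hD2 : ∀ x ∈ Ioo (-1 / 2 : ℝ) (1 / 2), HasDerivAt g1 (g2 x) x := fun x hx =>
    hasDerivAt_of_locallyUniform
      (fun n => ((u n).mem.c2.deriv_Ioo (m := 1) (by norm_num)).differentiableOn one_ne_zero)
      hg1 (by simpa only [iteratedDeriv_succ, iteratedDeriv_zero] using hg2) hx
  have hcg2 : ContinuousOn g2 (Ioo (-1 / 2 : ℝ) (1 / 2)) :=
    hg2.continuousOn (Frequently.of_forall fun n => by
      simpa only [iteratedDeriv_succ, iteratedDeriv_zero] using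
        (((u n).mem.c2.deriv_Ioo (m := 1) (by norm_num)).deriv_Ioo (m := 0)
          (by norm_num)).continuousOn)
  have hE1 : ∀ x ∈ Ioo (-1 / 2 : ℝ) (1 / 2), deriv G x = g1 x := fun x hx => (hD1 x hx).deriv
  have hE2 : ∀ x ∈ Ioo (-1 / 2 : ℝ) (1 / 2), iteratedDeriv 2 G x = g2 x := fun x hx => by
    rw [iteratedDeriv_succ_eqOn hD1 hx, iteratedDeriv_one, (hD2 x hx).deriv]
  have hmem : MemY₁ ε G := by
    obtain ⟨N0, hN0⟩ := hg' 1 one_pos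
    obtain ⟨N1, hN1⟩ := hg1' 1 one_pos
    obtain ⟨N2, hN2⟩ := hg2' 1 one_pos
    refine ⟨fun x hx => indicator_of_notMem hx g, ?_, ?_,
      bddOn_of_near (u N0).mem.bdd0 (e := 1) fun x hx => ?_, ?_, ?_⟩
    · exact (hg.continuousOn (Frequently.of_forall fun n => (u n).mem.cont)).congr hGg
    · exact contDiffOn_succ_of_hasDerivAt (n := 1) hD1
        (contDiffOn_succ_of_hasDerivAt (n := 0) hD2 (contDiffOn_zero.2 hcg2))
    · rw [hGg x hx]; exact hN0 N0 le_rfl x hx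
    · exact bddOn_of_near_one (u N1).mem.bdd1 (e := 1)
        fun x hx => by rw [hE1 x hx]; exact hN1 N1 le_rfl x hx
    · exact bddOn_of_near_one (u N2).mem.bdd2 (e := 1)
        fun x hx => by rw [hE2 x hx]; exact hN2 N2 le_rfl x hx
  refine ⟨Y₁.mk G hmem, Metric.tendsto_atTop.2 fun e he => ?_⟩
  obtain ⟨N0, hN0⟩ := hg' (e / 4) (by positivity)
  obtain ⟨N1, hN1⟩ := hg1' (e / 4) (by positivity)
  obtain ⟨N2, hN2⟩ := hg2' (e / 4) (by positivity)
  refine ⟨max N0 (max N1 N2), fun n hn => ?_⟩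
  simp only [ge_iff_le, max_le_iff] at hn
  have h0 : supOn (Ioo (-1) 1) (fun x => wDer ε .south x * (u n - Y₁.mk G hmem).fn x) ≤ e / 4 :=
    supOn_le (by positivity) fun x hx => by
      rw [Y₁.fn_sub, Y₁.fn_mk, Pi.sub_apply, hGg x hx]; exact hN0 n hn.1 x hx
  have h1 : supOn (Ioo (-1 / 2) (1 / 2)) (deriv (u n - Y₁.mk G hmem).fn) ≤ e / 4 :=
    supOn_le (by positivity) fun x hx => by
      rw [hd1 _ _ x hx, Y₁.fn_mk, hE1 x hx]; simpa using hN1 n hn.2.1 x hx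
  have h2 : supOn (Ioo (-1 / 2) (1 / 2)) (iteratedDeriv 2 (u n - Y₁.mk G hmem).fn) ≤ e / 4 :=
    supOn_le (by positivity) fun x hx => by
      rw [hd2 _ _ x hx, Y₁.fn_mk, hE2 x hx]; simpa using hN2 n hn.2.2 x hx
  rw [dist_eq_norm, Y₁.norm_def]
  linarith

instance (ε : ℝ) : CompleteSpace (M₂ ε) := by
  refine Metric.complete_of_cauchySeq_tendsto fun u hu => ?_
  rw [Metric.cauchySeq_iff] at hu
  have hd1 : ∀ (v w : M₂ ε), ∀ x ∈ Ioo (-1 : ℝ) 1,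
      deriv (v - w).fn x = deriv v.fn x - deriv w.fn x := fun v w x hx => by
    rw [M₂.fn_sub]
    exact deriv_sub ((contDiffAt_of_Ioo v.mem.c2 hx).differentiableAt two_ne_zero)
      ((contDiffAt_of_Ioo w.mem.c2 hx).differentiableAt two_ne_zero)
  have hd2 : ∀ (v w : M₂ ε), ∀ x ∈ Ioo (-1 : ℝ) 1,
      iteratedDeriv 2 (v - w).fn x = iteratedDeriv 2 v.fn x - iteratedDeriv 2 w.fn x :=
    fun v w x hx => by
      rw [M₂.fn_sub]
      exact iteratedDeriv_sub (contDiffAt_of_Ioo v.mem.c2 hx) (contDiffAt_of_Ioo w.mem.c2 hx)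
  obtain ⟨g, hg, hg'⟩ := exists_weighted_limit (continuousOn_one_sub_sq_rpow ε)
    (fun x hx => (one_sub_sq_rpow_pos _ hx).ne') (fun n => (u n).fn)
    (exists_channel_bound hu (D := fun f => f.fn) fun m n x hx => (u m - u n).val_le hx)
  obtain ⟨g1, hg1, hg1'⟩ := exists_weighted_limit (continuousOn_one_sub_sq_rpow (1 + ε))
    (fun x hx => (one_sub_sq_rpow_pos _ hx).ne') (fun n => deriv (u n).fn)
    (exists_channel_bound hu (D := fun f => deriv f.fn) fun m n x hx => by rw [← hd1 _ _ x hx]; exact (u m - u n).der_le hx)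
  obtain ⟨g2, hg2, hg2'⟩ := exists_weighted_limit (continuousOn_one_sub_sq_rpow (2 + ε))
    (fun x hx => (one_sub_sq_rpow_pos _ hx).ne') (fun n => iteratedDeriv 2 (u n).fn)
    (exists_channel_bound hu (D := fun f => iteratedDeriv 2 f.fn) fun m n x hx => by rw [← hd2 _ _ x hx]; exact (u m - u n).der2_le hx)
  set G := (Ioo (-1 : ℝ) 1).indicator g with hG
  have hGg : ∀ x ∈ Ioo (-1 : ℝ) 1, G x = g x := fun x hx => indicator_of_mem hx g
  have hD1 : ∀ x ∈ Ioo (-1 : ℝ) 1, HasDerivAt G (g1 x) x := fun x hx =>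
    (hasDerivAt_of_locallyUniform (fun n => (u n).mem.c2.differentiableOn two_ne_zero)
      hg hg1 hx).congr_of_eventuallyEq (indicator_eventuallyEq hx)
  have hD2 : ∀ x ∈ Ioo (-1 : ℝ) 1, HasDerivAt g1 (g2 x) x := fun x hx =>
    hasDerivAt_of_locallyUniform
      (fun n => ((u n).mem.c2.deriv_Ioo (m := 1) (by norm_num)).differentiableOn one_ne_zero)
      hg1 (by simpa only [iteratedDeriv_succ, iteratedDeriv_zero] using hg2) hx
  have hcg2 : ContinuousOn g2 (Ioo (-1 : ℝ) 1) :=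
    hg2.continuousOn (Frequently.of_forall fun n => by
      simpa only [iteratedDeriv_succ, iteratedDeriv_zero] using
        (((u n).mem.c2.deriv_Ioo (m := 1) (by norm_num)).deriv_Ioo (m := 0)
          (by norm_num)).continuousOn)
  have hE1 : ∀ x ∈ Ioo (-1 : ℝ) 1, deriv G x = g1 x := fun x hx => (hD1 x hx).deriv
  have hE2 : ∀ x ∈ Ioo (-1 : ℝ) 1, iteratedDeriv 2 G x = g2 x := fun x hx => by
    rw [iteratedDeriv_succ_eqOn hD1 hx, iteratedDeriv_one, (hD2 x hx).deriv]
  have hmem : MemM₂ ε G := by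
    obtain ⟨N0, hN0⟩ := hg' 1 one_pos
    obtain ⟨N1, hN1⟩ := hg1' 1 one_pos
    obtain ⟨N2, hN2⟩ := hg2' 1 one_pos
    refine ⟨fun x hx => indicator_of_notMem hx g, ?_,
      bddOn_of_near (u N0).mem.bdd0 (e := 1) fun x hx => ?_,
      bddOn_of_near (u N1).mem.bdd1 (e := 1) fun x hx => ?_,
      bddOn_of_near (u N2).mem.bdd2 (e := 1) fun x hx => ?_⟩
    · exact contDiffOn_succ_of_hasDerivAt (n := 1) hD1
        (contDiffOn_succ_of_hasDerivAt (n := 0) hD2 (contDiffOn_zero.2 hcg2))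
    · rw [hGg x hx]; exact hN0 N0 le_rfl x hx
    · rw [hE1 x hx]; exact hN1 N1 le_rfl x hx
    · rw [hE2 x hx]; exact hN2 N2 le_rfl x hx
  refine ⟨M₂.mk G hmem, Metric.tendsto_atTop.2 fun e he => ?_⟩
  obtain ⟨N0, hN0⟩ := hg' (e / 4) (by positivity)
  obtain ⟨N1, hN1⟩ := hg1' (e / 4) (by positivity)
  obtain ⟨N2, hN2⟩ := hg2' (e / 4) (by positivity)
  refine ⟨max N0 (max N1 N2), fun n hn => ?_⟩
  simp only [ge_iff_le, max_le_iff] at hn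
  have h0 : supOn (Ioo (-1) 1) (fun x => (1 - x ^ 2) ^ ε * (u n - M₂.mk G hmem).fn x) ≤ e / 4 :=
    supOn_le (by positivity) fun x hx => by
      rw [M₂.fn_sub, M₂.fn_mk, Pi.sub_apply, hGg x hx]; exact hN0 n hn.1 x hx
  have h1 : supOn (Ioo (-1) 1)
      (fun x => (1 - x ^ 2) ^ (1 + ε) * deriv (u n - M₂.mk G hmem).fn x) ≤ e / 4 :=
    supOn_le (by positivity) fun x hx => by
      rw [hd1 _ _ x hx, M₂.fn_mk, hE1 x hx]; exact hN1 n hn.2.1 x hx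
  have h2 : supOn (Ioo (-1) 1)
      (fun x => (1 - x ^ 2) ^ (2 + ε) * iteratedDeriv 2 (u n - M₂.mk G hmem).fn x) ≤ e / 4 :=
    supOn_le (by positivity) fun x hx => by
      rw [hd2 _ _ x hx, M₂.fn_mk, hE2 x hx]; exact hN2 n hn.2.2 x hx
  rw [dist_eq_norm, M₂.norm_def]
  linarith

/-! ### The logarithmic weight and continuity up to the poles -/

/-- `-ln((1+x)/3)`, positive on `(-1,1)`. -/
noncomputable def ell (x : ℝ) : ℝ := -Real.log ((1 + x) / 3)

/-- From `log y ≤ y - 1` at `y = (1+x)/3 < 2/3`. The divisor `3` in the weights is what keeps the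
logarithm away from zero on the whole interval. -/
theorem ell_ge {x : ℝ} (hx : x ∈ Ioo (-1 : ℝ) 1) : 1 / 3 ≤ ell x := by
  have h1 : (0 : ℝ) < (1 + x) / 3 := by linarith [hx.1]
  have := Real.log_le_sub_one_of_pos h1
  unfold ell
  linarith [hx.2]

theorem ell_pos {x : ℝ} (hx : x ∈ Ioo (-1 : ℝ) 1) : 0 < ell x := by linarith [ell_ge hx]

theorem tendsto_ell : Tendsto ell (𝓝[>] (-1)) atTop := by
  unfold ell
  refine tendsto_neg_atBot_atTop.comp (Real.tendsto_log_nhdsGT_zero.comp ?_)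
  refine tendsto_nhdsWithin_iff.2 ⟨?_, ?_⟩
  · have : ContinuousAt (fun x : ℝ => (1 + x) / 3) (-1) := by fun_prop
    have h := this.tendsto
    norm_num at h
    exact h.mono_left nhdsWithin_le_nhds
  · filter_upwards [self_mem_nhdsWithin] with x hx
    have : (-1 : ℝ) < x := hx
    change 0 < (1 + x) / 3
    linarith

theorem abs_wVal_south (ε : ℝ) {x : ℝ} (hx : x ∈ Ioo (-1 : ℝ) 1) :
    |wVal ε .south x| = ell x * (1 - x) ^ (-1 + 2 * ε) := by
  have h2 : 0 < (1 - x) ^ (-1 + 2 * ε) := Real.rpow_pos_of_pos (by linarith [hx.2]) _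
  change |Real.log ((1 + x) / 3) * (1 - x) ^ (-1 + 2 * ε)| = _
  rw [abs_mul, abs_of_pos h2, ← abs_neg]
  change |ell x| * _ = _
  rw [abs_of_pos (ell_pos hx)]

theorem wDer_south (ε x : ℝ) :
    wDer ε .south x = (1 + x) * ell x ^ 2 * (1 - x) ^ (2 * ε) := by
  change (1 + x) * Real.log ((1 + x) / 3) ^ 2 * (1 - x) ^ (2 * ε) = _
  rw [ell, neg_sq]

theorem abs_le_of_wVal {ε C y x : ℝ} (hx : x ∈ Ioo (-1 : ℝ) 1) (h : |wVal ε .south x * y| ≤ C) :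
    |y| ≤ C * ((1 - x) ^ (1 - 2 * ε) / ell x) := by
  have h1 : (0 : ℝ) < 1 - x := by linarith [hx.2]
  rw [abs_mul, abs_wVal_south ε hx] at h
  have h2 : (1 - x) ^ (1 - 2 * ε) = ((1 - x) ^ (-1 + 2 * ε))⁻¹ := by
    rw [← Real.rpow_neg h1.le]; congr 1; ring
  have h3 : 0 < (1 - x) ^ (-1 + 2 * ε) := Real.rpow_pos_of_pos h1 _
  have h4 := ell_pos hx
  rw [h2, ← mul_div_assoc, le_div_iff₀ h4, ← div_eq_mul_inv, le_div_iff₀ h3]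
  linarith

/-- The weight bound reads `|f| ≤ C (1-x)^(1-2ε) / ell`. The right side vanishes at `x = -1` because
`ell` tends to infinity, and at `x = 1` because `1 - 2ε > 0`. -/
theorem continuousOn_Icc_of_weight_south {ε : ℝ} (hε : ε < 1 / 2) {f : ℝ → ℝ}
    (hc : ContinuousOn f (Ioo (-1) 1)) (h0 : ∀ x, x ∉ Ioo (-1 : ℝ) 1 → f x = 0)
    (hb : BddOn (Ioo (-1) 1) fun x => wVal ε .south x * f x) : ContinuousOn f (Icc (-1) 1) := by
  obtain ⟨C, hC⟩ := hb
  have hC0 : 0 ≤ C := (abs_nonneg _).trans (hC 0 ⟨by norm_num, by norm_num⟩)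
  have hle : ∀ x ∈ Ioo (-1 : ℝ) 1, |f x| ≤ C * ((1 - x) ^ (1 - 2 * ε) / ell x) := fun x hx =>
    abs_le_of_wVal hx (hC x hx)
  intro x hx
  rcases eq_or_lt_of_le hx.1 with rfl | h1
  · rw [← continuousWithinAt_sdiff_self, ContinuousWithinAt, h0 _ (by simp)]
    have hs : Icc (-1 : ℝ) 1 \ {-1} ⊆ Ioi (-1) := fun y hy => lt_of_le_of_ne hy.1.1 (Ne.symm hy.2)
    refine Tendsto.mono_left ?_ (nhdsWithin_mono _ hs)
    refine squeeze_zero_norm' (a := fun y => C * 2 ^ (1 - 2 * ε) * (ell y)⁻¹) ?_ ?_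
    · have : Iio (1 : ℝ) ∈ 𝓝[>] (-1 : ℝ) :=
        mem_nhdsWithin_of_mem_nhds (Iio_mem_nhds (by norm_num))
      filter_upwards [self_mem_nhdsWithin, this] with y hy1 hy2
      have hy : y ∈ Ioo (-1 : ℝ) 1 := ⟨hy1, hy2⟩
      refine (hle y hy).trans ?_
      rw [mul_assoc, div_eq_mul_inv]
      have := ell_pos hy
      have h2 : (1 - y) ^ (1 - 2 * ε) ≤ 2 ^ (1 - 2 * ε) :=
        Real.rpow_le_rpow (by linarith [hy.2]) (by linarith [hy.1]) (by linarith)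
      gcongr
    · simpa using (tendsto_inv_atTop_zero.comp tendsto_ell).const_mul (C * 2 ^ (1 - 2 * ε))
  rcases eq_or_lt_of_le hx.2 with rfl | h2
  · rw [← continuousWithinAt_sdiff_self, ContinuousWithinAt, h0 _ (by simp)]
    have hs : Icc (-1 : ℝ) 1 \ {1} ⊆ Iio 1 := fun y hy => lt_of_le_of_ne hy.1.2 hy.2
    refine Tendsto.mono_left ?_ (nhdsWithin_mono _ hs)
    refine squeeze_zero_norm' (a := fun y => C * (3 * (1 - y) ^ (1 - 2 * ε))) ?_ ?_
    · have : Ioi (-1 : ℝ) ∈ 𝓝[<] (1 : ℝ) :=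
        mem_nhdsWithin_of_mem_nhds (Ioi_mem_nhds (by norm_num))
      filter_upwards [self_mem_nhdsWithin, this] with y hy1 hy2
      have hy : y ∈ Ioo (-1 : ℝ) 1 := ⟨hy2, hy1⟩
      refine (hle y hy).trans ?_
      have h3 : 0 ≤ (1 - y) ^ (1 - 2 * ε) := Real.rpow_nonneg (by linarith [hy.2]) _
      have h4 := ell_ge hy
      gcongr
      rw [div_le_iff₀ (ell_pos hy)]
      nlinarith
    · have : ContinuousAt (fun y : ℝ => C * (3 * (1 - y) ^ (1 - 2 * ε))) 1 :=
        continuousAt_const.mul (continuousAt_const.mul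
          (ContinuousAt.rpow_const (by fun_prop) (Or.inr (by linarith))))
      have h := this.tendsto
      simp only [sub_self, Real.zero_rpow (show 1 - 2 * ε ≠ 0 by linarith), mul_zero] at h
      exact h.mono_left nhdsWithin_le_nhds
  · exact (hc.continuousAt (isOpen_Ioo.mem_nhds ⟨h1, h2⟩)).continuousWithinAt

theorem continuousOn_Icc_of_weight {ε : ℝ} (hε : ε < 1 / 2) {p : Pole} {f : ℝ → ℝ}
    (hc : ContinuousOn f (Ioo (-1) 1)) (h0 : ∀ x, x ∉ Ioo (-1 : ℝ) 1 → f x = 0)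
    (hb : BddOn (Ioo (-1) 1) fun x => wVal ε p x * f x) : ContinuousOn f (Icc (-1) 1) := by
  cases p
  · exact continuousOn_Icc_of_weight_south hε hc h0 hb
  · have hm : ∀ x, -x ∈ Ioo (-1 : ℝ) 1 ↔ x ∈ Ioo (-1 : ℝ) 1 := fun x => by
      simp only [mem_Ioo]; constructor <;> rintro ⟨h1, h2⟩ <;> constructor <;> linarith
    have h := continuousOn_Icc_of_weight_south (ε := ε) hε (f := fun x => f (-x))
      (hc.comp continuousOn_neg fun x hx => (hm x).2 hx) (fun x hx => h0 _ fun h => hx ((hm x).1 h))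
      (by
        obtain ⟨C, hC⟩ := hb
        refine ⟨C, fun x hx => ?_⟩
        have := hC (-x) ((hm x).2 hx)
        simpa only [wVal, Pole.coord, neg_neg] using this)
    have h2 := h.comp (t := Icc (-1) 1) (s := Icc (-1) 1) continuousOn_neg fun x hx =>
      ⟨by linarith [hx.2], by linarith [hx.1]⟩
    exact h2.congr fun x _ => by simp

/-- The bound on `ε` is needed for one clause only: continuity of the limit on the closed interval,
which does not follow from local uniform convergence but from the weighted bound. -/
theorem M₁.completeSpace {ε : ℝ} (hε : ε < 1 / 2) (p : Pole) : CompleteSpace (M₁ ε p) := by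
  refine Metric.complete_of_cauchySeq_tendsto fun u hu => ?_
  rw [Metric.cauchySeq_iff] at hu
  have hd1 : ∀ (v w : M₁ ε p), ∀ x ∈ Ioo (-1 : ℝ) 1,
      deriv (v - w).fn x = deriv v.fn x - deriv w.fn x := fun v w x hx => by
    rw [M₁.fn_sub]
    exact deriv_sub ((contDiffAt_of_Ioo v.mem.c1 hx).differentiableAt one_ne_zero)
      ((contDiffAt_of_Ioo w.mem.c1 hx).differentiableAt one_ne_zero)
  have hd2 : ∀ (v w : M₁ ε p), ∀ x ∈ Ioo (-1 / 2 : ℝ) (1 / 2),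
      iteratedDeriv 2 (v - w).fn x = iteratedDeriv 2 v.fn x - iteratedDeriv 2 w.fn x :=
    fun v w x hx => by
      rw [M₁.fn_sub]
      exact iteratedDeriv_sub ((contDiffAt_of_Ioo v.mem.c3 hx).of_le (by norm_num))
        ((contDiffAt_of_Ioo w.mem.c3 hx).of_le (by norm_num))
  have hd3 : ∀ (v w : M₁ ε p), ∀ x ∈ Ioo (-1 / 2 : ℝ) (1 / 2),
      iteratedDeriv 3 (v - w).fn x = iteratedDeriv 3 v.fn x - iteratedDeriv 3 w.fn x :=
    fun v w x hx => by
      rw [M₁.fn_sub]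
      exact iteratedDeriv_sub (contDiffAt_of_Ioo v.mem.c3 hx) (contDiffAt_of_Ioo w.mem.c3 hx)
  obtain ⟨g, hg, hg'⟩ := exists_weighted_limit (continuousOn_wVal ε p)
    (fun x hx => wVal_ne_zero ε p hx) (fun n => (u n).fn)
    (exists_channel_bound hu (D := fun f => f.fn) fun m n x hx => (u m - u n).val_le hx)
  obtain ⟨g1, hg1, hg1'⟩ := exists_weighted_limit (continuousOn_wDer ε p)
    (fun x hx => (wDer_pos ε p hx).ne') (fun n => deriv (u n).fn)
    (exists_channel_bound hu (D := fun f => deriv f.fn) fun m n x hx => by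
      rw [← hd1 _ _ x hx]; exact (u m - u n).der_le hx)
  obtain ⟨g2, hg2, hg2'⟩ := exists_weighted_limit (s := Ioo (-1 / 2 : ℝ) (1 / 2))
    (w := fun _ => 1) continuousOn_const (fun _ _ => one_ne_zero)
    (fun n => iteratedDeriv 2 (u n).fn)
    (exists_channel_bound hu (D := fun f => iteratedDeriv 2 f.fn) fun m n x hx => by
      rw [one_mul, ← hd2 _ _ x hx]; exact (u m - u n).der2_le hx)
  obtain ⟨g3, hg3, hg3'⟩ := exists_weighted_limit (s := Ioo (-1 / 2 : ℝ) (1 / 2))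
    (w := fun _ => 1) continuousOn_const (fun _ _ => one_ne_zero)
    (fun n => iteratedDeriv 3 (u n).fn)
    (exists_channel_bound hu (D := fun f => iteratedDeriv 3 f.fn) fun m n x hx => by
      rw [one_mul, ← hd3 _ _ x hx]; exact (u m - u n).der3_le hx)
  set G := (Ioo (-1 : ℝ) 1).indicator g with hG
  have hGg : ∀ x ∈ Ioo (-1 : ℝ) 1, G x = g x := fun x hx => indicator_of_mem hx g
  have hD1 : ∀ x ∈ Ioo (-1 : ℝ) 1, HasDerivAt G (g1 x) x := fun x hx =>
    (hasDerivAt_of_locallyUniform (fun n => (u n).mem.c1.differentiableOn one_ne_zero)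
      hg hg1 hx).congr_of_eventuallyEq (indicator_eventuallyEq hx)
  have hD2 : ∀ x ∈ Ioo (-1 / 2 : ℝ) (1 / 2), HasDerivAt g1 (g2 x) x := fun x hx =>
    hasDerivAt_of_locallyUniform
      (fun n => ((u n).mem.c3.deriv_Ioo (m := 2) (by norm_num)).differentiableOn two_ne_zero)
      (hg1.mono inner_subset_outer)
      (by simpa only [iteratedDeriv_succ, iteratedDeriv_zero] using hg2) hx
  have hc2 : ∀ n, ContDiffOn ℝ 1 (iteratedDeriv 2 (u n).fn) (Ioo (-1 / 2) (1 / 2)) := fun n => by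
    simpa only [iteratedDeriv_succ, iteratedDeriv_zero] using
      ((u n).mem.c3.deriv_Ioo (m := 2) (by norm_num)).deriv_Ioo (m := 1) (by norm_num)
  have hD3 : ∀ x ∈ Ioo (-1 / 2 : ℝ) (1 / 2), HasDerivAt g2 (g3 x) x := fun x hx =>
    hasDerivAt_of_locallyUniform (fun n => (hc2 n).differentiableOn one_ne_zero) hg2
      (by simpa only [iteratedDeriv_succ, iteratedDeriv_zero] using hg3) hx
  have hcg1 : ContinuousOn g1 (Ioo (-1 : ℝ) 1) :=
    hg1.continuousOn (Frequently.of_forall fun n =>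
      ((u n).mem.c1.deriv_Ioo (m := 0) (by norm_num)).continuousOn)
  have hcg3 : ContinuousOn g3 (Ioo (-1 / 2 : ℝ) (1 / 2)) :=
    hg3.continuousOn (Frequently.of_forall fun n => by
      simpa only [iteratedDeriv_succ, iteratedDeriv_zero] using
        ((hc2 n).deriv_Ioo (m := 0) (by norm_num)).continuousOn)
  have hE1 : ∀ x ∈ Ioo (-1 : ℝ) 1, deriv G x = g1 x := fun x hx => (hD1 x hx).deriv
  have hD1' : ∀ x ∈ Ioo (-1 / 2 : ℝ) (1 / 2), HasDerivAt G (g1 x) x := fun x hx =>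
    hD1 x (inner_subset_outer hx)
  have hE2 : ∀ x ∈ Ioo (-1 / 2 : ℝ) (1 / 2), iteratedDeriv 2 G x = g2 x := fun x hx => by
    rw [iteratedDeriv_succ_eqOn hD1' hx, iteratedDeriv_one, (hD2 x hx).deriv]
  have hE3 : ∀ x ∈ Ioo (-1 / 2 : ℝ) (1 / 2), iteratedDeriv 3 G x = g3 x := fun x hx => by
    rw [iteratedDeriv_succ_eqOn hD1' hx, iteratedDeriv_succ_eqOn hD2 hx, iteratedDeriv_one,
      (hD3 x hx).deriv]
  have hmem : MemM₁ ε p G := by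
    obtain ⟨N0, hN0⟩ := hg' 1 one_pos
    obtain ⟨N1, hN1⟩ := hg1' 1 one_pos
    obtain ⟨N2, hN2⟩ := hg2' 1 one_pos
    obtain ⟨N3, hN3⟩ := hg3' 1 one_pos
    have hb : BddOn (Ioo (-1) 1) fun x => wVal ε p x * G x :=
      bddOn_of_near (u N0).mem.bdd0 (e := 1) fun x hx => by
        rw [hGg x hx]; exact hN0 N0 le_rfl x hx
    have hc1 : ContDiffOn ℝ 1 G (Ioo (-1) 1) :=
      contDiffOn_succ_of_hasDerivAt (n := 0) hD1 (contDiffOn_zero.2 hcg1)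
    refine ⟨fun x hx => indicator_of_notMem hx g, ?_, hc1, ?_, hb,
      bddOn_of_near (u N1).mem.bdd1 (e := 1) fun x hx => ?_, ?_, ?_⟩
    · exact continuousOn_Icc_of_weight hε hc1.continuousOn (fun x hx => indicator_of_notMem hx g) hb
    · exact contDiffOn_succ_of_hasDerivAt (n := 2) hD1' (contDiffOn_succ_of_hasDerivAt (n := 1) hD2
        (contDiffOn_succ_of_hasDerivAt (n := 0) hD3 (contDiffOn_zero.2 hcg3)))
    · rw [hE1 x hx]; exact hN1 N1 le_rfl x hx
    · exact bddOn_of_near_one (u N2).mem.bdd2 (e := 1)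
        fun x hx => by rw [hE2 x hx]; exact hN2 N2 le_rfl x hx
    · exact bddOn_of_near_one (u N3).mem.bdd3 (e := 1)
        fun x hx => by rw [hE3 x hx]; exact hN3 N3 le_rfl x hx
  refine ⟨M₁.mk G hmem, Metric.tendsto_atTop.2 fun e he => ?_⟩
  obtain ⟨N0, hN0⟩ := hg' (e / 5) (by positivity)
  obtain ⟨N1, hN1⟩ := hg1' (e / 5) (by positivity)
  obtain ⟨N2, hN2⟩ := hg2' (e / 5) (by positivity)
  obtain ⟨N3, hN3⟩ := hg3' (e / 5) (by positivity)
  refine ⟨max (max N0 N1) (max N2 N3), fun n hn => ?_⟩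
  simp only [ge_iff_le, max_le_iff] at hn
  have h0 : supOn (Ioo (-1) 1) (fun x => wVal ε p x * (u n - M₁.mk G hmem).fn x) ≤ e / 5 :=
    supOn_le (by positivity) fun x hx => by
      rw [M₁.fn_sub, M₁.fn_mk, Pi.sub_apply, hGg x hx]; exact hN0 n hn.1.1 x hx
  have h1 : supOn (Ioo (-1) 1)
      (fun x => wDer ε p x * deriv (u n - M₁.mk G hmem).fn x) ≤ e / 5 :=
    supOn_le (by positivity) fun x hx => by
      rw [hd1 _ _ x hx, M₁.fn_mk, hE1 x hx]; exact hN1 n hn.1.2 x hx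
  have h2 : supOn (Ioo (-1 / 2) (1 / 2)) (iteratedDeriv 2 (u n - M₁.mk G hmem).fn) ≤ e / 5 :=
    supOn_le (by positivity) fun x hx => by
      rw [hd2 _ _ x hx, M₁.fn_mk, hE2 x hx]; simpa using hN2 n hn.2.1 x hx
  have h3 : supOn (Ioo (-1 / 2) (1 / 2)) (iteratedDeriv 3 (u n - M₁.mk G hmem).fn) ≤ e / 5 :=
    supOn_le (by positivity) fun x hx => by
      rw [hd3 _ _ x hx, M₁.fn_mk, hE3 x hx]; simpa using hN3 n hn.2.2 x hx
  rw [dist_eq_norm, M₁.norm_def]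
  linarith

end HomNS

namespace HomNS

/-! ## Integrals with singular endpoints -/

/-- A nonnegative derivative of a function continuous on the closed interval is automatically
integrable, even if unbounded at the end points. An explicit primitive `G` of a majorant thus
settles integrability and the estimate of singular integrals together. -/
theorem intervalIntegrable_of_majorant {a b : ℝ} (hab : a ≤ b) {g G G' : ℝ → ℝ}
    (hG : ContinuousOn G (Icc a b)) (hG' : ∀ x ∈ Ioo a b, HasDerivAt G (G' x) x)
    (hg : ContinuousOn g (Ioo a b)) (hle : ∀ x ∈ Ioo a b, |g x| ≤ G' x) :
    IntervalIntegrable g MeasureTheory.volume a b ∧ |∫ x in a..b, g x| ≤ G b - G a := by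
  have hI : IntervalIntegrable G' MeasureTheory.volume a b :=
    intervalIntegral.intervalIntegrable_deriv_of_nonneg (by rwa [uIcc_of_le hab])
      (by rwa [min_eq_left hab, max_eq_right hab])
      (by rw [min_eq_left hab, max_eq_right hab]; exact fun x hx => (abs_nonneg _).trans (hle x hx))
  have hgI : IntervalIntegrable g MeasureTheory.volume a b := by
    rw [intervalIntegrable_iff_integrableOn_Ioo_of_le hab] at hI ⊢
    refine hI.mono' (hg.aestronglyMeasurable measurableSet_Ioo) ?_
    exact (MeasureTheory.ae_restrict_mem measurableSet_Ioo).mono fun x hx => hle x hx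
  refine ⟨hgI, ?_⟩
  rw [← intervalIntegral.integral_eq_sub_of_hasDerivAt_of_le hab hG hG' hI]
  refine (intervalIntegral.abs_integral_le_integral_abs hab).trans ?_
  exact intervalIntegral.integral_mono_on_of_le_Ioo hab hgI.abs hI hle

theorem uIcc_zero_subset {x : ℝ} (hx : x ∈ Ioo (-1 : ℝ) 1) : uIcc 0 x ⊆ Ioo (-1 : ℝ) 1 :=
  ordConnected_Ioo.uIcc_subset ⟨by norm_num, by norm_num⟩ hx

theorem zero_mem_outer : (0 : ℝ) ∈ Ioo (-1 : ℝ) 1 := ⟨by norm_num, by norm_num⟩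

theorem intervalIntegrable_Ioo {q : ℝ → ℝ} (hq : ContinuousOn q (Ioo (-1) 1)) {x y : ℝ}
    (hx : x ∈ Ioo (-1 : ℝ) 1) (hy : y ∈ Ioo (-1 : ℝ) 1) :
    IntervalIntegrable q MeasureTheory.volume x y :=
  (hq.mono (ordConnected_Ioo.uIcc_subset hx hy)).intervalIntegrable

theorem hasDerivAt_integral_Ioo {q : ℝ → ℝ} (hq : ContinuousOn q (Ioo (-1) 1)) {a x : ℝ}
    (ha : IntervalIntegrable q MeasureTheory.volume a x) (hx : x ∈ Ioo (-1 : ℝ) 1) :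
    HasDerivAt (fun y => ∫ s in a..y, q s) (q x) x :=
  intervalIntegral.integral_hasDerivAt_right ha
    (hq.stronglyMeasurableAtFilter isOpen_Ioo x hx)
    (hq.continuousAt (isOpen_Ioo.mem_nhds hx))

theorem hasDerivAt_primitive {q : ℝ → ℝ} (hq : ContinuousOn q (Ioo (-1) 1)) {x : ℝ}
    (hx : x ∈ Ioo (-1 : ℝ) 1) : HasDerivAt (fun y => ∫ s in (0 : ℝ)..y, q s) (q x) x :=
  hasDerivAt_integral_Ioo hq (intervalIntegrable_Ioo hq zero_mem_outer hx) hx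

theorem continuousOn_primitive {q : ℝ → ℝ} (hq : ContinuousOn q (Ioo (-1) 1)) :
    ContinuousOn (fun y => ∫ s in (0 : ℝ)..y, q s) (Ioo (-1) 1) := fun _ hx =>
  (hasDerivAt_primitive hq hx).continuousAt.continuousWithinAt

theorem hasDerivAt_one_sub_rpow (p : ℝ) {x : ℝ} (hx : x < 1) :
    HasDerivAt (fun y : ℝ => (1 - y) ^ p) (-(p * (1 - x) ^ (p - 1))) x := by
  have h := ((hasDerivAt_id x).const_sub 1).rpow_const (p := p)
    (Or.inl (show 1 - id x ≠ 0 by simp only [id]; linarith))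
  exact h.congr_deriv (by simp only [id]; ring_nf)

theorem hasDerivAt_one_add_rpow (p : ℝ) {x : ℝ} (hx : -1 < x) :
    HasDerivAt (fun y : ℝ => (1 + y) ^ p) (p * (1 + x) ^ (p - 1)) x := by
  have h := ((hasDerivAt_id x).const_add 1).rpow_const (p := p)
    (Or.inl (show 1 + id x ≠ 0 by simp only [id]; linarith))
  exact h.congr_deriv (by simp only [id]; ring_nf)

theorem one_sub_sq_rpow_eq (r : ℝ) {x : ℝ} (hx : x ∈ Ioo (-1 : ℝ) 1) :
    (1 - x ^ 2) ^ r = (1 - x) ^ r * (1 + x) ^ r := by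
  rw [← Real.mul_rpow (by linarith [hx.2]) (by linarith [hx.1])]
  congr 1; ring

theorem one_sub_sq_rpow_le_left {r x : ℝ} (hr : r ≤ 0) (h0 : 0 ≤ x) (h1 : x < 1) :
    (1 - x ^ 2) ^ r ≤ (1 - x) ^ r :=
  Real.rpow_le_rpow_of_nonpos (by linarith) (by nlinarith) hr

theorem one_sub_sq_rpow_le_right {r x : ℝ} (hr : r ≤ 0) (h0 : x ≤ 0) (h1 : -1 < x) :
    (1 - x ^ 2) ^ r ≤ (1 + x) ^ r :=
  Real.rpow_le_rpow_of_nonpos (by linarith) (by nlinarith) hr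

/-- Integration gains one power of `1 - x²` in the singular regime. -/
theorem abs_primitive_le {q : ℝ → ℝ} (hq : ContinuousOn q (Ioo (-1) 1)) {N α : ℝ} (hα : 0 < α)
    (h : ∀ x ∈ Ioo (-1 : ℝ) 1, |q x| ≤ N * (1 - x ^ 2) ^ (-1 - α)) {x : ℝ}
    (hx : x ∈ Ioo (-1 : ℝ) 1) :
    |∫ s in (0 : ℝ)..x, q s| ≤ N * (2 ^ α / α) * (1 - x ^ 2) ^ (-α) := by
  have hN : 0 ≤ N := by simpa using (abs_nonneg _).trans (h 0 zero_mem_outer)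
  -- Here `y` is the distance to the nearer pole, for which `1 - x² ≤ 2y`. This converts the
  -- one-sided power produced by integration back into the symmetric weight, at the cost of `2^α`.
  have key : ∀ y : ℝ, 0 < y → y ≤ 1 → 1 - x ^ 2 ≤ 2 * y → 
      y ^ (-α) / α ≤ (2 ^ α / α) * (1 - x ^ 2) ^ (-α) := by
    intro y hy _ hxy
    have h1 : (2 * y) ^ (-α) ≤ (1 - x ^ 2) ^ (-α) :=
      Real.rpow_le_rpow_of_nonpos (one_sub_sq_pos hx) hxy (by linarith)
    rw [Real.mul_rpow (by norm_num) hy.le, Real.rpow_neg (by norm_num)] at h1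
    have h2 : (0 : ℝ) < 2 ^ α := by positivity
    rw [div_mul_eq_mul_div]
    gcongr
    rw [inv_mul_le_iff₀ h2] at h1
    exact h1
  rcases le_total 0 x with h0 | h0
  · obtain ⟨-, hb⟩ := intervalIntegrable_of_majorant (g := q) (a := 0) (b := x) h0
      (G := fun s => N * ((1 - s) ^ (-α) / α)) (G' := fun s => N * (1 - s) ^ (-1 - α))
      (fun s hs => ((((hasDerivAt_one_sub_rpow (-α) (hs.2.trans_lt hx.2)).div_const
        α).const_mul N).continuousAt).continuousWithinAt)
      (fun s hs => by
        refine (((hasDerivAt_one_sub_rpow (-α) (hs.2.trans hx.2)).div_const α).const_mul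
          N).congr_deriv ?_
        rw [show -α - 1 = -1 - α by ring]; field_simp)
      (hq.mono fun s hs => ⟨by linarith [hs.1], hs.2.trans hx.2⟩)
      (fun s hs => (h s ⟨by linarith [hs.1], hs.2.trans hx.2⟩).trans
        (mul_le_mul_of_nonneg_left (one_sub_sq_rpow_le_left (by linarith) hs.1.le
          (hs.2.trans hx.2)) hN))
    refine hb.trans ?_
    have h3 := key (1 - x) (by linarith [hx.2]) (by linarith) (by nlinarith [hx.2])
    have h4 := mul_le_mul_of_nonneg_left h3 hN
    have h5 : 0 ≤ N * ((1 - (0 : ℝ)) ^ (-α) / α) := by simp only [sub_zero, Real.one_rpow]; positivity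
    simp only [mul_assoc] at h4 ⊢
    linarith
  · obtain ⟨-, hb⟩ := intervalIntegrable_of_majorant (g := q) (a := x) (b := 0) h0
      (G := fun s => -(N * ((1 + s) ^ (-α) / α))) (G' := fun s => N * (1 + s) ^ (-1 - α))
      (fun s hs => ((((hasDerivAt_one_add_rpow (-α) (hx.1.trans_le hs.1)).div_const
        α).const_mul N).neg.continuousAt).continuousWithinAt)
      (fun s hs => by
        refine (((hasDerivAt_one_add_rpow (-α) (hx.1.trans hs.1)).div_const α).const_mul
          N).neg.congr_deriv ?_
        rw [show -α - 1 = -1 - α by ring]; field_simp)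
      (hq.mono fun s hs => ⟨hx.1.trans hs.1, by linarith [hs.2]⟩)
      (fun s hs => (h s ⟨hx.1.trans hs.1, by linarith [hs.2]⟩).trans
        (mul_le_mul_of_nonneg_left (one_sub_sq_rpow_le_right (by linarith) hs.2.le
          (hx.1.trans hs.1)) hN))
    rw [intervalIntegral.integral_symm, abs_neg]
    refine hb.trans ?_
    have h3 := key (1 + x) (by linarith [hx.1]) (by linarith) (by nlinarith [hx.1])
    have h4 := mul_le_mul_of_nonneg_left h3 hN
    have h5 : 0 ≤ N * ((1 + (0 : ℝ)) ^ (-α) / α) := by simp only [add_zero, Real.one_rpow]; positivity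
    simp only [mul_assoc] at h4 ⊢
    linarith

/-- Integration up to an endpoint in the integrable regime. -/
theorem abs_integral_to_one_le {q : ℝ → ℝ} (hq : ContinuousOn q (Ioo (-1) 1)) {N α : ℝ}
    (hα0 : 0 ≤ α) (hα : α < 1) (h : ∀ x ∈ Ioo (-1 : ℝ) 1, |q x| ≤ N * (1 - x ^ 2) ^ (-α)) {x : ℝ}
    (h0 : 0 ≤ x) (h1 : x ≤ 1) :
    IntervalIntegrable q MeasureTheory.volume x 1 ∧
      |∫ s in x..1, q s| ≤ N * ((1 - x) ^ (1 - α) / (1 - α)) := by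
  have hN : 0 ≤ N := by simpa using (abs_nonneg _).trans (h 0 zero_mem_outer)
  obtain ⟨hi, hb⟩ := intervalIntegrable_of_majorant (g := q) (a := x) (b := 1) h1
      (G := fun s => -(N * ((1 - s) ^ (1 - α) / (1 - α)))) (G' := fun s => N * (1 - s) ^ (-α))
      (ContinuousOn.neg (continuousOn_const.mul (ContinuousOn.div_const
        (ContinuousOn.rpow_const (by fun_prop) fun _ _ => Or.inr (by linarith)) _)))
      (fun s hs => by
        refine (((hasDerivAt_one_sub_rpow (1 - α) hs.2).div_const (1 - α)).const_mul
          N).neg.congr_deriv ?_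
        have : 1 - α ≠ 0 := by linarith
        rw [show 1 - α - 1 = -α by ring]; field_simp)
      (hq.mono fun s hs => ⟨by linarith [hs.1], hs.2⟩)
      (fun s hs => (h s ⟨by linarith [hs.1], hs.2⟩).trans
        (mul_le_mul_of_nonneg_left (one_sub_sq_rpow_le_left (by linarith) (h0.trans hs.1.le)
          hs.2) hN))
  refine ⟨hi, hb.trans (le_of_eq ?_)⟩
  simp only [sub_self, Real.zero_rpow (show 1 - α ≠ 0 by linarith)]
  ring

theorem abs_integral_from_neg_one_le {q : ℝ → ℝ} (hq : ContinuousOn q (Ioo (-1) 1)) {N α : ℝ}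
    (hα0 : 0 ≤ α) (hα : α < 1) (h : ∀ x ∈ Ioo (-1 : ℝ) 1, |q x| ≤ N * (1 - x ^ 2) ^ (-α)) {x : ℝ}
    (h0 : x ≤ 0) (h1 : -1 ≤ x) :
    IntervalIntegrable q MeasureTheory.volume (-1) x ∧
      |∫ s in (-1)..x, q s| ≤ N * ((1 + x) ^ (1 - α) / (1 - α)) := by
  have hm : ∀ x, -x ∈ Ioo (-1 : ℝ) 1 ↔ x ∈ Ioo (-1 : ℝ) 1 := fun x => by
    simp only [mem_Ioo]; constructor <;> rintro ⟨h1, h2⟩ <;> constructor <;> linarith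
  obtain ⟨hi, hb⟩ := abs_integral_to_one_le (q := fun s => q (-s)) (N := N) (x := -x)
    (hq.comp continuousOn_neg fun x hx => (hm x).2 hx) hα0 hα
    (fun x hx => by simpa using h (-x) ((hm x).2 hx)) (by linarith) (by linarith)
  refine ⟨?_, ?_⟩
  · have := (IntervalIntegrable.iff_comp_neg (f := fun s => q (-s))).1 hi
    simp only [neg_neg] at this
    exact this.symm
  · rw [intervalIntegral.integral_comp_neg, neg_neg] at hb
    rwa [sub_neg_eq_add] at hb

/-! ## The trilinear swirl term -/

/-- The polarised form of `psi`. -/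
noncomputable def psi₂ (f g : ℝ → ℝ) (x : ℝ) : ℝ :=
  ∫ l in (0 : ℝ)..x, ∫ t in (0 : ℝ)..l, ∫ s in (0 : ℝ)..t, 2 * f s * deriv g s / (1 - s ^ 2)

/-- The polarised form of `psi`, corrected by an affine function so as to vanish at `±1`. -/
noncomputable def psiHat (f g : ℝ → ℝ) (x : ℝ) : ℝ :=
  psi₂ f g x - 1 / 2 * psi₂ f g (-1) * (1 - x) - 1 / 2 * psi₂ f g 1 * (1 + x)

/-- The second derivative of `psi₂`. -/
noncomputable def psiDer₂ (f g : ℝ → ℝ) (x : ℝ) : ℝ :=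
  ∫ s in (0 : ℝ)..x, 2 * f s * deriv g s / (1 - s ^ 2)

/-- The derivative of `psi₂`. -/
noncomputable def psiDer₁ (f g : ℝ → ℝ) (x : ℝ) : ℝ := ∫ t in (0 : ℝ)..x, psiDer₂ f g t

theorem psi₂_eq (f g : ℝ → ℝ) (x : ℝ) : psi₂ f g x = ∫ l in (0 : ℝ)..x, psiDer₁ f g l := rfl

theorem continuousOn_swirl {f g : ℝ → ℝ} (hf : ContinuousOn f (Ioo (-1) 1))
    (hg : ContinuousOn (deriv g) (Ioo (-1) 1)) :
    ContinuousOn (fun s => 2 * f s * deriv g s / (1 - s ^ 2)) (Ioo (-1) 1) :=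
  ((continuousOn_const.mul hf).mul hg).div (by fun_prop) fun _ hx => (one_sub_sq_pos hx).ne'

theorem psi₂_hasDerivAt {f g : ℝ → ℝ} (hf : ContinuousOn f (Ioo (-1) 1))
    (hg : ContinuousOn (deriv g) (Ioo (-1) 1)) {x : ℝ} (hx : x ∈ Ioo (-1 : ℝ) 1) :
    HasDerivAt (psi₂ f g) (psiDer₁ f g x) x ∧ HasDerivAt (psiDer₁ f g) (psiDer₂ f g x) x :=
  ⟨hasDerivAt_primitive (continuousOn_primitive (continuousOn_primitive
      (continuousOn_swirl hf hg))) hx,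
    hasDerivAt_primitive (continuousOn_primitive (continuousOn_swirl hf hg)) hx⟩

/-- Pointwise data on `f`, `g` controlling the swirl term. -/
structure SwirlBound (ε : ℝ) (f g : ℝ → ℝ) (N : ℝ) : Prop where
  contf : ContinuousOn f (Ioo (-1) 1)
  contg : ContinuousOn (deriv g) (Ioo (-1) 1)
  le : ∀ x ∈ Ioo (-1 : ℝ) 1, |2 * f x * deriv g x / (1 - x ^ 2)| ≤ N * (1 - x ^ 2) ^ (-2 - 2 * ε)

/-- The exponent adds up as `ε` from `f`, `1 + ε` from `g'` and `1` from the denominator. -/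
theorem M₂.swirlBound {ε : ℝ} (f g : M₂ ε) : SwirlBound ε f.fn g.fn (2 * (‖f‖ * ‖g‖)) where
  contf := f.mem.c2.continuousOn
  contg := (g.mem.c2.deriv_Ioo (m := 1) (by norm_num)).continuousOn
  le x hx := by
    have h0 := one_sub_sq_pos hx
    have h1 := f.val_le hx
    have h2 := g.der_le hx
    have h3 := mul_le_mul h1 h2 (abs_nonneg _) (norm_nonneg _)
    have e : (1 - x ^ 2) ^ (-2 - 2 * ε)
        = ((1 - x ^ 2) ^ ε * (1 - x ^ 2) ^ (1 + ε) * (1 - x ^ 2))⁻¹ := by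
      rw [← Real.rpow_add h0, ← Real.rpow_add_one h0.ne', ← Real.rpow_neg h0.le]
      congr 1; ring
    rw [e, ← div_eq_mul_inv, le_div_iff₀ (by positivity)]
    rw [← abs_mul] at h3
    have e2 : |2 * f.fn x * deriv g.fn x / (1 - x ^ 2)| *
        ((1 - x ^ 2) ^ ε * (1 - x ^ 2) ^ (1 + ε) * (1 - x ^ 2))
        = 2 * |(1 - x ^ 2) ^ ε * f.fn x * ((1 - x ^ 2) ^ (1 + ε) * deriv g.fn x)| := by
      have hA : 0 < (1 - x ^ 2) ^ ε := by positivity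
      have hB : 0 < (1 - x ^ 2) ^ (1 + ε) := by positivity
      simp only [abs_div, abs_mul, abs_of_pos hA, abs_of_pos hB, abs_of_pos h0, abs_two]
      field_simp
    rw [e2]
    linarith

section SwirlBound

variable {ε : ℝ} {f g : ℝ → ℝ} {N : ℝ}

/-- Each integration from the equator gains one power of `1 - x²`: the exponent goes from `-2-2ε` to
`-1-2ε` here and to `-2ε` for `psiDer₁`. As `2ε < 1`, the third integral converges up to the poles.
-/
theorem SwirlBound.der₂ (h : SwirlBound ε f g N) (hε : 0 < ε) {x : ℝ} (hx : x ∈ Ioo (-1 : ℝ) 1) :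
    |psiDer₂ f g x| ≤ N * (2 ^ (1 + 2 * ε) / (1 + 2 * ε)) * (1 - x ^ 2) ^ (-1 - 2 * ε) := by
  have := abs_primitive_le (continuousOn_swirl h.contf h.contg) (N := N) (α := 1 + 2 * ε)
    (by linarith) (fun y hy => by
      rw [show -1 - (1 + 2 * ε) = -2 - 2 * ε by ring]; exact h.le y hy) hx
  rwa [show -(1 + 2 * ε) = -1 - 2 * ε by ring] at this

/-- The constant in the estimate of `psiDer₁`. -/
noncomputable def psiConst (ε : ℝ) : ℝ :=
  2 ^ (1 + 2 * ε) / (1 + 2 * ε) * (2 ^ (2 * ε) / (2 * ε))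

theorem SwirlBound.der₁ (h : SwirlBound ε f g N) (hε : 0 < ε) {x : ℝ} (hx : x ∈ Ioo (-1 : ℝ) 1) :
    |psiDer₁ f g x| ≤ N * psiConst ε * (1 - x ^ 2) ^ (-(2 * ε)) := by
  have := abs_primitive_le (continuousOn_primitive (continuousOn_swirl h.contf h.contg))
    (N := N * (2 ^ (1 + 2 * ε) / (1 + 2 * ε))) (α := 2 * ε)
    (by linarith) (fun y hy => h.der₂ hε hy) hx
  rwa [mul_assoc N] at this

theorem SwirlBound.continuousOn_der₁ (h : SwirlBound ε f g N) :
    ContinuousOn (psiDer₁ f g) (Ioo (-1) 1) :=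
  continuousOn_primitive (continuousOn_primitive (continuousOn_swirl h.contf h.contg))

theorem SwirlBound.near_one (h : SwirlBound ε f g N) (hε : 0 < ε) (hε' : ε < 1 / 2) {x : ℝ}
    (h0 : 0 ≤ x) (h1 : x ≤ 1) :
    |psi₂ f g x - psi₂ f g 1| ≤ N * psiConst ε * ((1 - x) ^ (1 - 2 * ε) / (1 - 2 * ε)) := by
  obtain ⟨hi, hb⟩ := abs_integral_to_one_le h.continuousOn_der₁ (by linarith) (by linarith)
    (fun y hy => h.der₁ hε hy) h0 h1
  have hi0 := (abs_integral_to_one_le h.continuousOn_der₁ (by linarith) (by linarith)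
    (fun y hy => h.der₁ hε hy) le_rfl zero_le_one).1
  rw [psi₂_eq, psi₂_eq, ← intervalIntegral.integral_add_adjacent_intervals (hi0.trans hi.symm) hi,
    sub_add_cancel_left, abs_neg]
  exact hb

theorem SwirlBound.near_neg_one (h : SwirlBound ε f g N) (hε : 0 < ε) (hε' : ε < 1 / 2) {x : ℝ}
    (h0 : x ≤ 0) (h1 : -1 ≤ x) :
    |psi₂ f g x - psi₂ f g (-1)| ≤ N * psiConst ε * ((1 + x) ^ (1 - 2 * ε) / (1 - 2 * ε)) := by
  obtain ⟨hi, hb⟩ := abs_integral_from_neg_one_le h.continuousOn_der₁ (by linarith) (by linarith)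
    (fun y hy => h.der₁ hε hy) h0 h1
  have hi0 := (abs_integral_from_neg_one_le h.continuousOn_der₁ (by linarith) (by linarith)
    (fun y hy => h.der₁ hε hy) le_rfl (by norm_num)).1.symm
  rw [psi₂_eq, psi₂_eq, ← intervalIntegral.integral_add_adjacent_intervals hi0 hi,
    add_sub_cancel_left]
  exact hb

theorem psi₂_zero (f g : ℝ → ℝ) : psi₂ f g 0 = 0 := by simp [psi₂]

theorem SwirlBound.at_one (h : SwirlBound ε f g N) (hε : 0 < ε) (hε' : ε < 1 / 2) :
    |psi₂ f g 1| ≤ N * psiConst ε / (1 - 2 * ε) := by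
  have := h.near_one hε hε' le_rfl zero_le_one
  rwa [psi₂_zero, zero_sub, abs_neg, sub_zero, Real.one_rpow, mul_one_div] at this

theorem SwirlBound.at_neg_one (h : SwirlBound ε f g N) (hε : 0 < ε) (hε' : ε < 1 / 2) :
    |psi₂ f g (-1)| ≤ N * psiConst ε / (1 - 2 * ε) := by
  have := h.near_neg_one hε hε' le_rfl (by norm_num)
  rwa [psi₂_zero, zero_sub, abs_neg, add_zero, Real.one_rpow, mul_one_div] at this

/-- Removing the affine interpolant leaves `psi₂ x - psi₂ 1` and multiples of `1 - x`. The former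
has the Hölder rate `1 - 2ε`, and `1 - x ≤ (1-x)^(1-2ε)` on `[0,1]`. -/
theorem SwirlBound.psiHat_near_one (h : SwirlBound ε f g N) (hε : 0 < ε) (hε' : ε < 1 / 2) {x : ℝ}
    (h0 : 0 ≤ x) (h1 : x ≤ 1) :
    |psiHat f g x| ≤ N * (2 * psiConst ε / (1 - 2 * ε)) * (1 - x) ^ (1 - 2 * ε) := by
  have e : psiHat f g x = (psi₂ f g x - psi₂ f g 1) + (1 / 2 * (1 - x)) * psi₂ f g 1
      - (1 / 2 * (1 - x)) * psi₂ f g (-1) := by unfold psiHat; ring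
  have a1 := h.near_one hε hε' h0 h1
  have a2 := h.at_one hε hε'
  have a3 := h.at_neg_one hε hε'
  have h2 : 1 - x ≤ (1 - x) ^ (1 - 2 * ε) := by
    conv_lhs => rw [← Real.rpow_one (1 - x)]
    exact Real.rpow_le_rpow_of_exponent_ge_of_imp (by linarith) (by linarith) (by linarith)
      (fun _ h => absurd h (by linarith))
  have h3 : 0 ≤ N * psiConst ε / (1 - 2 * ε) := (abs_nonneg _).trans a2
  have h4 := mul_le_mul_of_nonneg_left h2 h3
  have hx : 0 ≤ 1 / 2 * (1 - x) := by linarith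
  rw [e]
  refine (abs_sub _ _).trans ((add_le_add_left (abs_add_le _ _) _).trans ?_)
  rw [abs_mul (1 / 2 * _), abs_mul (1 / 2 * _), abs_of_nonneg hx]
  have b2 := mul_le_mul_of_nonneg_left a2 hx
  have b3 := mul_le_mul_of_nonneg_left a3 hx
  have e1 : N * psiConst ε * ((1 - x) ^ (1 - 2 * ε) / (1 - 2 * ε))
    = N * psiConst ε / (1 - 2 * ε) * (1 - x) ^ (1 - 2 * ε) := by ring
  have e2 : N * (2 * psiConst ε / (1 - 2 * ε)) * (1 - x) ^ (1 - 2 * ε)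
    = 2 * (N * psiConst ε / (1 - 2 * ε) * (1 - x) ^ (1 - 2 * ε)) := by ring
  rw [e2]
  rw [e1] at a1
  nlinarith

theorem SwirlBound.psiHat_near_neg_one (h : SwirlBound ε f g N) (hε : 0 < ε) (hε' : ε < 1 / 2)
    {x : ℝ} (h0 : x ≤ 0) (h1 : -1 ≤ x) :
    |psiHat f g x| ≤ N * (2 * psiConst ε / (1 - 2 * ε)) * (1 + x) ^ (1 - 2 * ε) := by
  have e : psiHat f g x = (psi₂ f g x - psi₂ f g (-1)) + (1 / 2 * (1 + x)) * psi₂ f g (-1)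
      - (1 / 2 * (1 + x)) * psi₂ f g 1 := by unfold psiHat; ring
  have a1 := h.near_neg_one hε hε' h0 h1
  have a2 := h.at_one hε hε'
  have a3 := h.at_neg_one hε hε'
  have h2 : 1 + x ≤ (1 + x) ^ (1 - 2 * ε) := by
    conv_lhs => rw [← Real.rpow_one (1 + x)]
    exact Real.rpow_le_rpow_of_exponent_ge_of_imp (by linarith) (by linarith) (by linarith)
      (fun _ h => absurd h (by linarith))
  have h3 : 0 ≤ N * psiConst ε / (1 - 2 * ε) := (abs_nonneg _).trans a2
  have h4 := mul_le_mul_of_nonneg_left h2 h3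
  have hx : 0 ≤ 1 / 2 * (1 + x) := by linarith
  rw [e]
  refine (abs_sub _ _).trans ((add_le_add_left (abs_add_le _ _) _).trans ?_)
  rw [abs_mul (1 / 2 * _), abs_mul (1 / 2 * _), abs_of_nonneg hx]
  have b2 := mul_le_mul_of_nonneg_left a2 hx
  have b3 := mul_le_mul_of_nonneg_left a3 hx
  have e1 : N * psiConst ε * ((1 + x) ^ (1 - 2 * ε) / (1 - 2 * ε))
    = N * psiConst ε / (1 - 2 * ε) * (1 + x) ^ (1 - 2 * ε) := by ring
  have e2 : N * (2 * psiConst ε / (1 - 2 * ε)) * (1 + x) ^ (1 - 2 * ε)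
    = 2 * (N * psiConst ε / (1 - 2 * ε) * (1 + x) ^ (1 - 2 * ε)) := by ring
  rw [e2]
  rw [e1] at a1
  nlinarith

end SwirlBound

/-- The end points `x = ±1` are admissible because the outer integral only sees the open interval.
-/
theorem psi₂_congr {f g f' g' : ℝ → ℝ} (hf : EqOn f f' (Ioo (-1) 1))
    (hg : EqOn (deriv g) (deriv g') (Ioo (-1) 1)) {x : ℝ} (hx : x ∈ Icc (-1 : ℝ) 1) :
    psi₂ f g x = psi₂ f' g' x := by
  have h2 : EqOn (psiDer₂ f g) (psiDer₂ f' g') (Ioo (-1) 1) := fun y hy =>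
    intervalIntegral.integral_congr fun s hs => by
      simp only [hf (uIcc_zero_subset hy hs), hg (uIcc_zero_subset hy hs)]
  have h1 : EqOn (psiDer₁ f g) (psiDer₁ f' g') (Ioo (-1) 1) := fun y hy =>
    intervalIntegral.integral_congr fun s hs => h2 (uIcc_zero_subset hy hs)
  rw [psi₂_eq, psi₂_eq]
  refine intervalIntegral.integral_congr_uIoo fun s hs => h1 ?_
  rcases le_total 0 x with h0 | h0
  · rw [uIoo_of_le h0] at hs
    exact ⟨by linarith [hs.1], by linarith [hs.2, hx.2]⟩
  · rw [uIoo_of_ge h0] at hs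
    exact ⟨by linarith [hs.1, hx.1], by linarith [hs.2]⟩

/-- At `x = ±1` linearity is not formal, as the integral of a non-integrable function is `0` by
default. The bounds `SwirlBound` make the outer integrand integrable up to the poles. -/
theorem psi₂_comb {ε : ℝ} {f₁ g₁ f₂ g₂ f₃ g₃ : ℝ → ℝ} {N₁ N₂ a b : ℝ} (hε : 0 < ε) (hε' : ε < 1 / 2)
    (h₁ : SwirlBound ε f₁ g₁ N₁) (h₂ : SwirlBound ε f₂ g₂ N₂)
    (h : ∀ x ∈ Ioo (-1 : ℝ) 1, f₃ x * deriv g₃ x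
      = a * (f₁ x * deriv g₁ x) + b * (f₂ x * deriv g₂ x)) {x : ℝ} (hx : x ∈ Icc (-1 : ℝ) 1) :
    psi₂ f₃ g₃ x = a * psi₂ f₁ g₁ x + b * psi₂ f₂ g₂ x := by
  have c₁ := continuousOn_swirl h₁.contf h₁.contg
  have c₂ := continuousOn_swirl h₂.contf h₂.contg
  have e2 : ∀ y ∈ Ioo (-1 : ℝ) 1,
      psiDer₂ f₃ g₃ y = a * psiDer₂ f₁ g₁ y + b * psiDer₂ f₂ g₂ y := fun y hy => by
    unfold psiDer₂
    rw [← intervalIntegral.integral_const_mul, ← intervalIntegral.integral_const_mul,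
      ← intervalIntegral.integral_add
        ((intervalIntegrable_Ioo c₁ zero_mem_outer hy).const_mul a)
        ((intervalIntegrable_Ioo c₂ zero_mem_outer hy).const_mul b)]
    refine intervalIntegral.integral_congr fun s hs => ?_
    have := h s (uIcc_zero_subset hy hs)
    have h0 := (one_sub_sq_pos (uIcc_zero_subset hy hs)).ne'
    rw [mul_assoc, this]
    field_simp
  have d₁ : ContinuousOn (psiDer₂ f₁ g₁) (Ioo (-1) 1) := continuousOn_primitive c₁
  have d₂ : ContinuousOn (psiDer₂ f₂ g₂) (Ioo (-1) 1) := continuousOn_primitive c₂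
  have e1 : ∀ y ∈ Ioo (-1 : ℝ) 1,
      psiDer₁ f₃ g₃ y = a * psiDer₁ f₁ g₁ y + b * psiDer₁ f₂ g₂ y := fun y hy => by
    unfold psiDer₁
    rw [← intervalIntegral.integral_const_mul, ← intervalIntegral.integral_const_mul,
      ← intervalIntegral.integral_add
        ((intervalIntegrable_Ioo d₁ zero_mem_outer hy).const_mul a)
        ((intervalIntegrable_Ioo d₂ zero_mem_outer hy).const_mul b)]
    exact intervalIntegral.integral_congr fun s hs => e2 s (uIcc_zero_subset hy hs)
  have hI : ∀ {f g : ℝ → ℝ} {N : ℝ}, SwirlBound ε f g N →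
      IntervalIntegrable (psiDer₁ f g) MeasureTheory.volume 0 x := by
    intro f g N h
    rcases le_total 0 x with h0 | h0
    · exact (abs_integral_to_one_le h.continuousOn_der₁ (by linarith) (by linarith)
        (fun y hy => h.der₁ hε hy) le_rfl zero_le_one).1.trans
        (abs_integral_to_one_le h.continuousOn_der₁ (by linarith) (by linarith)
        (fun y hy => h.der₁ hε hy) h0 hx.2).1.symm
    · exact (abs_integral_from_neg_one_le h.continuousOn_der₁ (by linarith) (by linarith)
        (fun y hy => h.der₁ hε hy) le_rfl (by norm_num)).1.symm.trans
        (abs_integral_from_neg_one_le h.continuousOn_der₁ (by linarith) (by linarith)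
        (fun y hy => h.der₁ hε hy) h0 hx.1).1
  rw [psi₂_eq, psi₂_eq, psi₂_eq, ← intervalIntegral.integral_const_mul,
    ← intervalIntegral.integral_const_mul,
    ← intervalIntegral.integral_add ((hI h₁).const_mul a) ((hI h₂).const_mul b)]
  refine intervalIntegral.integral_congr_uIoo fun s hs => e1 s ?_
  rcases le_total 0 x with h0 | h0
  · rw [uIoo_of_le h0] at hs
    exact ⟨by linarith [hs.1], by linarith [hs.2, hx.2]⟩
  · rw [uIoo_of_ge h0] at hs
    exact ⟨by linarith [hs.1, hx.1], by linarith [hs.2]⟩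

end HomNS

namespace HomNS

/-! ## Functions with two bounded derivatives near the equator -/

/-- `f` is `C²` on `(-1/2,1/2)` and `f`, `f'`, `f''` are bounded there by `A`. -/
structure C2B (f : ℝ → ℝ) (A : ℝ) : Prop where
  c2 : ContDiffOn ℝ 2 f (Ioo (-1 / 2) (1 / 2))
  le0 : ∀ x ∈ Ioo (-1 / 2 : ℝ) (1 / 2), |f x| ≤ A
  le1 : ∀ x ∈ Ioo (-1 / 2 : ℝ) (1 / 2), |deriv f x| ≤ A
  le2 : ∀ x ∈ Ioo (-1 / 2 : ℝ) (1 / 2), |iteratedDeriv 2 f x| ≤ A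

theorem half_mem : (0 : ℝ) ∈ Ioo (-1 / 2 : ℝ) (1 / 2) := ⟨by norm_num, by norm_num⟩

theorem C2B.nonneg {f : ℝ → ℝ} {A : ℝ} (h : C2B f A) : 0 ≤ A :=
  (abs_nonneg _).trans (h.le0 0 half_mem)

theorem C2B.mono {f : ℝ → ℝ} {A B : ℝ} (h : C2B f A) (hAB : A ≤ B) : C2B f B :=
  ⟨h.c2, fun x hx => (h.le0 x hx).trans hAB, fun x hx => (h.le1 x hx).trans hAB,
    fun x hx => (h.le2 x hx).trans hAB⟩

theorem iteratedDeriv_two_eq {f f' : ℝ → ℝ} {a b : ℝ} (h : ∀ x ∈ Ioo a b, HasDerivAt f (f' x) x)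
    {x y : ℝ} (hx : x ∈ Ioo a b) (hy : HasDerivAt f' y x) : iteratedDeriv 2 f x = y := by
  rw [iteratedDeriv_succ_eqOn h hx, iteratedDeriv_one, hy.deriv]

theorem C2B.hasDerivAt {f : ℝ → ℝ} {A : ℝ} (h : C2B f A) {x : ℝ}
    (hx : x ∈ Ioo (-1 / 2 : ℝ) (1 / 2)) : HasDerivAt f (deriv f x) x :=
  h.c2.hasDerivAt_Ioo two_ne_zero hx

theorem C2B.hasDerivAt₂ {f : ℝ → ℝ} {A : ℝ} (h : C2B f A) {x : ℝ}
    (hx : x ∈ Ioo (-1 / 2 : ℝ) (1 / 2)) : HasDerivAt (deriv f) (iteratedDeriv 2 f x) x := by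
  have := (h.c2.deriv_Ioo (m := 1) (by norm_num)).hasDerivAt_Ioo one_ne_zero hx
  simpa only [iteratedDeriv_succ, iteratedDeriv_zero] using this

theorem C2B.of_hasDerivAt {f f₁ f₂ : ℝ → ℝ} {A : ℝ}
    (h₁ : ∀ x ∈ Ioo (-1 / 2 : ℝ) (1 / 2), HasDerivAt f (f₁ x) x)
    (h₂ : ∀ x ∈ Ioo (-1 / 2 : ℝ) (1 / 2), HasDerivAt f₁ (f₂ x) x)
    (hc : ContinuousOn f₂ (Ioo (-1 / 2) (1 / 2)))
    (le0 : ∀ x ∈ Ioo (-1 / 2 : ℝ) (1 / 2), |f x| ≤ A)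
    (le1 : ∀ x ∈ Ioo (-1 / 2 : ℝ) (1 / 2), |f₁ x| ≤ A)
    (le2 : ∀ x ∈ Ioo (-1 / 2 : ℝ) (1 / 2), |f₂ x| ≤ A) : C2B f A where
  c2 := contDiffOn_succ_of_hasDerivAt (n := 1) h₁
    (contDiffOn_succ_of_hasDerivAt (n := 0) h₂ (contDiffOn_zero.2 hc))
  le0 := le0
  le1 := fun x hx => by rw [(h₁ x hx).deriv]; exact le1 x hx
  le2 := fun x hx => by rw [iteratedDeriv_two_eq h₁ hx (h₂ x hx)]; exact le2 x hx

theorem C2B.continuousOn₂ {f : ℝ → ℝ} {A : ℝ} (h : C2B f A) :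
    ContinuousOn (iteratedDeriv 2 f) (Ioo (-1 / 2) (1 / 2)) := by
  have := ((h.c2.deriv_Ioo (m := 1) (by norm_num)).deriv_Ioo (m := 0) (by norm_num)).continuousOn
  simpa only [iteratedDeriv_succ, iteratedDeriv_zero] using this

theorem C2B.congr {f g : ℝ → ℝ} {A : ℝ} (h : C2B f A)
    (e : EqOn g f (Ioo (-1 / 2) (1 / 2))) : C2B g A := by
  have ev : ∀ x ∈ Ioo (-1 / 2 : ℝ) (1 / 2), g =ᶠ[𝓝 x] f := fun x hx => by
    filter_upwards [isOpen_Ioo.mem_nhds hx] with y hy using e hy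
  exact C2B.of_hasDerivAt (fun x hx => (h.hasDerivAt hx).congr_of_eventuallyEq (ev x hx))
    (fun x hx => h.hasDerivAt₂ hx) h.continuousOn₂ (fun x hx => by rw [e hx]; exact h.le0 x hx)
    h.le1 h.le2

/-- The constant `4` counts the terms of the second derivative in the Leibniz rule. -/
theorem C2B.mul {f g : ℝ → ℝ} {A B : ℝ} (hf : C2B f A) (hg : C2B g B) :
    C2B (fun x => f x * g x) (4 * (A * B)) := by
  have hA := hf.nonneg
  have hB := hg.nonneg
  have hAB : 0 ≤ A * B := mul_nonneg hA hB
  have m : ∀ {a b : ℝ}, |a| ≤ A → |b| ≤ B → |a * b| ≤ A * B := fun {a b} ha hb => by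
    rw [abs_mul]; exact mul_le_mul ha hb (abs_nonneg _) hA
  refine C2B.of_hasDerivAt (f₁ := fun x => deriv f x * g x + f x * deriv g x)
    (f₂ := fun x => (iteratedDeriv 2 f x * g x + deriv f x * deriv g x)
      + (deriv f x * deriv g x + f x * iteratedDeriv 2 g x))
    (fun x hx => (hf.hasDerivAt hx).mul (hg.hasDerivAt hx))
    (fun x hx => ((hf.hasDerivAt₂ hx).mul (hg.hasDerivAt hx)).add
      ((hf.hasDerivAt hx).mul (hg.hasDerivAt₂ hx))) ?_ ?_ ?_ ?_
  · have a1 := hf.c2.continuousOn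
    have a2 := hg.c2.continuousOn
    have a3 := (hf.c2.deriv_Ioo (m := 1) (by norm_num)).continuousOn
    have a4 := (hg.c2.deriv_Ioo (m := 1) (by norm_num)).continuousOn
    exact ((hf.continuousOn₂.mul a2).add (a3.mul a4)).add ((a3.mul a4).add
      (a1.mul hg.continuousOn₂))
  · exact fun x hx => (m (hf.le0 x hx) (hg.le0 x hx)).trans (by linarith)
  · intro x hx
    have h1 := m (hf.le1 x hx) (hg.le0 x hx)
    have h2 := m (hf.le0 x hx) (hg.le1 x hx)
    exact (abs_add_le _ _).trans (by linarith)
  · intro x hx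
    have h1 := m (hf.le2 x hx) (hg.le0 x hx)
    have h2 := m (hf.le1 x hx) (hg.le1 x hx)
    have h3 := m (hf.le0 x hx) (hg.le2 x hx)
    refine (abs_add_le _ _).trans ((add_le_add (abs_add_le _ _) (abs_add_le _ _)).trans ?_)
    linarith

/-- A smooth function on `(-1,1)` has bounded derivatives near the equator. -/
theorem exists_bound_inner {f : ℝ → ℝ} {n : WithTop ℕ∞} (hf : ContDiffOn ℝ n f (Ioo (-1) 1)) {k : ℕ}
    (hk : (k : WithTop ℕ∞) ≤ n) : BddOn (Ioo (-1 / 2) (1 / 2)) (iteratedDeriv k f) := by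
  have hc : ContinuousOn (iteratedDeriv k f) (Ioo (-1) 1) := fun x hx => by
    have h := hf.continuousOn_iteratedDerivWithin hk isOpen_Ioo.uniqueDiffOn
    have h2 := (h.congr fun y hy => (iteratedDerivWithin_of_isOpen isOpen_Ioo hy).symm)
    exact h2 x hx
  have hs : Icc (-1 / 2 : ℝ) (1 / 2) ⊆ Ioo (-1) 1 := fun x hx =>
    ⟨by linarith [hx.1], by linarith [hx.2]⟩
  obtain ⟨C, hC⟩ := isCompact_Icc.exists_bound_of_continuousOn (hc.mono hs)
  exact ⟨C, fun x hx => hC x ⟨hx.1.le, hx.2.le⟩⟩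

theorem exists_C2B {f : ℝ → ℝ} {n : WithTop ℕ∞} (hf : ContDiffOn ℝ n f (Ioo (-1) 1))
    (hn : 2 ≤ n) : ∃ A, C2B f A := by
  obtain ⟨A0, h0⟩ := exists_bound_inner hf (k := 0) (by simp)
  obtain ⟨A1, h1⟩ := exists_bound_inner hf (k := 1) (le_trans (by norm_num) hn)
  obtain ⟨A2, h2⟩ := exists_bound_inner hf (k := 2) hn
  refine ⟨max A0 (max A1 A2), (hf.mono inner_subset_outer).of_le hn, fun x hx => ?_, fun x hx => ?_,
    fun x hx => ?_⟩
  · exact (by simpa using h0 x hx : |f x| ≤ A0).trans (le_max_left _ _)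
  · exact (by simpa using h1 x hx : |deriv f x| ≤ A1).trans (le_max_of_le_right (le_max_left _ _))
  · exact (h2 x hx).trans (le_max_of_le_right (le_max_right _ _))

/-! ## Elementary weight estimates -/

theorem one_sub_rpow_le_two {r x : ℝ} (h0 : 0 ≤ r) (h1 : r ≤ 1) (hx : x ∈ Ioo (-1 : ℝ) 1) :
    (1 - x) ^ r ≤ 2 := by
  calc (1 - x) ^ r ≤ 2 ^ r := Real.rpow_le_rpow (by linarith [hx.2]) (by linarith [hx.1]) h0
    _ ≤ 2 ^ (1 : ℝ) := Real.rpow_le_rpow_of_exponent_le (by norm_num) h1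
    _ = 2 := Real.rpow_one 2

theorem one_add_mul_ell_le {x : ℝ} (hx : x ∈ Ioo (-1 : ℝ) 1) : (1 + x) * ell x ≤ 3 := by
  have h1 : (0 : ℝ) < 1 + x := by linarith [hx.1]
  have := Real.one_sub_inv_le_log_of_pos (show (0 : ℝ) < (1 + x) / 3 by linarith)
  have h2 : ell x ≤ 3 / (1 + x) := by
    unfold ell; rw [inv_div] at this; linarith
  rw [le_div_iff₀ h1] at h2
  linarith

/-- Logarithms lose against powers: `log u ≤ u^(p/2) / (p/2)` at `u = 3/(1+x)`, squared. -/
theorem ell_sq_mul_rpow_le {p : ℝ} (hp : 0 < p) {x : ℝ} (hx : x ∈ Ioo (-1 : ℝ) 1) :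
    ell x ^ 2 * (1 + x) ^ p ≤ 3 ^ p * (4 / p ^ 2) := by
  have h1 : (0 : ℝ) < 1 + x := by linarith [hx.1]
  have h0 : (0 : ℝ) < 3 / (1 + x) := by positivity
  have h2 : ell x ≤ (3 / (1 + x)) ^ (p / 2) / (p / 2) := by
    have := Real.log_le_rpow_div h0.le (half_pos hp)
    unfold ell
    rwa [← Real.log_inv, inv_div]
  have h3 : ell x ^ 2 ≤ ((3 / (1 + x)) ^ (p / 2) / (p / 2)) ^ 2 :=
    pow_le_pow_left₀ (ell_pos hx).le h2 2
  have e : ((3 / (1 + x)) ^ (p / 2)) ^ 2 = (3 / (1 + x)) ^ p := by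
    rw [← Real.rpow_natCast, ← Real.rpow_mul h0.le]; congr 1; push_cast; ring
  rw [div_pow, e, Real.div_rpow (by norm_num) h1.le] at h3
  have h4 : 0 < (1 + x) ^ p := by positivity
  calc ell x ^ 2 * (1 + x) ^ p ≤ (3 ^ p / (1 + x) ^ p / (p / 2) ^ 2) * (1 + x) ^ p := by gcongr
    _ = 3 ^ p * (4 / p ^ 2) := by field_simp; norm_num

theorem one_add_mul_ell_sq_le {x : ℝ} (hx : x ∈ Ioo (-1 : ℝ) 1) : (1 + x) * ell x ^ 2 ≤ 12 := by
  have := ell_sq_mul_rpow_le one_pos hx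
  rw [Real.rpow_one, Real.rpow_one] at this
  linarith

theorem wDer_le {ε : ℝ} (h0 : 0 < ε) (h1 : ε < 1 / 2) {x : ℝ} (hx : x ∈ Ioo (-1 : ℝ) 1) :
    wDer ε .south x ≤ 24 := by
  rw [wDer_south]
  have a := one_add_mul_ell_sq_le hx
  have b := one_sub_rpow_le_two (r := 2 * ε) (by linarith) (by linarith) hx
  have c : 0 ≤ (1 - x) ^ (2 * ε) := Real.rpow_nonneg (by linarith [hx.2]) _
  nlinarith

/-- The factors `1 + x` and `(1-x)^(2ε)` are at least `1/2` near the equator and `ell² ≥ 1/9`.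
Consequently the weighted bounds control unweighted values there with constant `36`. -/
theorem wDer_inner_ge {ε : ℝ} (h0 : 0 < ε) (h1 : ε < 1 / 2) {x : ℝ}
    (hx : x ∈ Ioo (-1 / 2 : ℝ) (1 / 2)) : 1 / 36 ≤ wDer ε .south x := by
  rw [wDer_south]
  have hl := ell_ge (inner_subset_outer hx)
  have a : 1 / 9 ≤ ell x ^ 2 := by nlinarith
  have b : 1 / 2 ≤ (1 - x) ^ (2 * ε) := by
    calc (1 / 2 : ℝ) = (1 / 2) ^ (1 : ℝ) := (Real.rpow_one _).symm
      _ ≤ (1 / 2) ^ (2 * ε) :=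
        Real.rpow_le_rpow_of_exponent_ge (by norm_num) (by norm_num) (by linarith)
      _ ≤ (1 - x) ^ (2 * ε) := Real.rpow_le_rpow (by norm_num) (by linarith [hx.2]) (by linarith)
  have c : 1 / 2 ≤ 1 + x := by linarith [hx.1]
  have d : 1 / 18 ≤ (1 + x) * ell x ^ 2 := by nlinarith
  nlinarith

theorem M₁.abs_le {ε : ℝ} (h0 : 0 < ε) (h1 : ε < 1 / 2) (f : M₁ ε .south) {x : ℝ}
    (hx : x ∈ Ioo (-1 : ℝ) 1) : |f.fn x| ≤ 6 * ‖f‖ := by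
  refine (abs_le_of_wVal hx (f.val_le hx)).trans ?_
  have a := one_sub_rpow_le_two (r := 1 - 2 * ε) (by linarith) (by linarith) hx
  have b := ell_ge hx
  have : (1 - x) ^ (1 - 2 * ε) / ell x ≤ 6 := by
    rw [div_le_iff₀ (ell_pos hx)]; linarith
  nlinarith [norm_nonneg f]

theorem abs_le_of_weight {w y A c : ℝ} (hc : 0 < c) (hw : c ≤ w) (h : |w * y| ≤ A) :
    |y| ≤ A / c := by
  rw [abs_mul, abs_of_pos (hc.trans_le hw)] at h
  rw [le_div_iff₀ hc]
  nlinarith [abs_nonneg y]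

theorem M₁.c2b {ε : ℝ} (h0 : 0 < ε) (h1 : ε < 1 / 2) (f : M₁ ε .south) :
    C2B f.fn (36 * ‖f‖) where
  c2 := f.mem.c3.of_le (by norm_num)
  le0 x hx := (f.abs_le h0 h1 (inner_subset_outer hx)).trans (by linarith [norm_nonneg f])
  le1 x hx := by
    have := abs_le_of_weight (by norm_num) (wDer_inner_ge h0 h1 hx)
      (f.der_le (inner_subset_outer hx))
    linarith
  le2 x hx := (f.der2_le hx).trans (by linarith [norm_nonneg f])

theorem M₁.deriv_c2b {ε : ℝ} (h0 : 0 < ε) (h1 : ε < 1 / 2) (f : M₁ ε .south) :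
    C2B (deriv f.fn) (36 * ‖f‖) where
  c2 := f.mem.c3.deriv_Ioo (by norm_num)
  le0 x hx := (f.c2b h0 h1).le1 x hx
  le1 x hx := by
    have := f.der2_le hx
    simp only [iteratedDeriv_succ, iteratedDeriv_zero] at this
    exact this.trans (by linarith [norm_nonneg f])
  le2 x hx := by
    have := f.der3_le hx
    simp only [iteratedDeriv_succ, iteratedDeriv_zero] at this ⊢
    exact this.trans (by linarith [norm_nonneg f])

/-! ## Bounded operators into the target spaces -/

/-- A function with the two relevant bounds, cut off outside `(-1,1)`, belongs to `Y₁`. -/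
theorem memY₁_indicator {ε : ℝ} {g : ℝ → ℝ} {A B : ℝ} (hc : ContinuousOn g (Ioo (-1) 1))
    (h0 : ∀ x ∈ Ioo (-1 : ℝ) 1, |wDer ε .south x * g x| ≤ A) (h2 : C2B g B) :
    MemY₁ ε ((Ioo (-1) 1).indicator g) := by
  have h2' : C2B ((Ioo (-1) 1).indicator g) B :=
    h2.congr fun x hx => indicator_of_mem (inner_subset_outer hx) g
  refine ⟨fun x hx => indicator_of_notMem hx g, hc.congr fun x hx => indicator_of_mem hx g, h2'.c2,
    ⟨A, fun x hx => ?_⟩, ⟨B, h2'.le1⟩, ⟨B, h2'.le2⟩⟩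
  simp only [indicator_of_mem hx]
  exact h0 x hx

theorem Y₁.norm_le {ε : ℝ} {f : Y₁ ε} {g : ℝ → ℝ} {A B : ℝ} (e : EqOn f.fn g (Ioo (-1) 1))
    (h0 : ∀ x ∈ Ioo (-1 : ℝ) 1, |wDer ε .south x * g x| ≤ A) (h2 : C2B g B) :
    ‖f‖ ≤ A + 2 * B := by
  have h2' : C2B f.fn B := h2.congr fun x hx => e (inner_subset_outer hx)
  have hA : 0 ≤ A := (abs_nonneg _).trans (h0 0 zero_mem_outer)
  rw [Y₁.norm_def]
  have a := supOn_le (s := Ioo (-1) 1) (g := fun x => wDer ε .south x * f.fn x) hA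
    fun x hx => by simp only [e hx]; exact h0 x hx
  have b := supOn_le h2.nonneg h2'.le1
  have c := supOn_le h2.nonneg h2'.le2
  linarith

theorem memY₂_indicator {ε : ℝ} {g : ℝ → ℝ} {A : ℝ} (hc : ContinuousOn g (Ioo (-1) 1))
    (h0 : ∀ x ∈ Ioo (-1 : ℝ) 1, |(1 - x ^ 2) ^ (2 + ε) * g x| ≤ A) :
    MemY₂ ε ((Ioo (-1) 1).indicator g) := by
  refine ⟨fun x hx => indicator_of_notMem hx g, hc.congr fun x hx => indicator_of_mem hx g,
    ⟨A, fun x hx => ?_⟩⟩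
  simp only [indicator_of_mem hx]
  exact h0 x hx

theorem Y₂.norm_le {ε : ℝ} {f : Y₂ ε} {g : ℝ → ℝ} {A : ℝ} (e : EqOn f.fn g (Ioo (-1) 1))
    (h0 : ∀ x ∈ Ioo (-1 : ℝ) 1, |(1 - x ^ 2) ^ (2 + ε) * g x| ≤ A) : ‖f‖ ≤ A := by
  have hA : 0 ≤ A := (abs_nonneg _).trans (h0 0 zero_mem_outer)
  rw [Y₂.norm_def]
  exact supOn_le hA fun x hx => by simp only [e hx]; exact h0 x hx

theorem Y₁.ext_on {ε : ℝ} {f g : Y₁ ε} (h : EqOn f.fn g.fn (Ioo (-1) 1)) : f = g :=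
  Y₁.ext_fn <| funext fun x => by
    by_cases hx : x ∈ Ioo (-1 : ℝ) 1
    · exact h hx
    · rw [f.mem.zero_off x hx, g.mem.zero_off x hx]

theorem Y₂.ext_on {ε : ℝ} {f g : Y₂ ε} (h : EqOn f.fn g.fn (Ioo (-1) 1)) : f = g :=
  Y₂.ext_fn <| funext fun x => by
    by_cases hx : x ∈ Ioo (-1 : ℝ) 1
    · exact h hx
    · rw [f.mem.zero_off x hx, g.mem.zero_off x hx]

theorem M₁.ext_on {ε : ℝ} {p : Pole} {f g : M₁ ε p} (h : EqOn f.fn g.fn (Ioo (-1) 1)) : f = g :=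
  M₁.ext_fn <| funext fun x => by
    by_cases hx : x ∈ Ioo (-1 : ℝ) 1
    · exact h hx
    · rw [f.mem.zero_off x hx, g.mem.zero_off x hx]

theorem M₂.ext_on {ε : ℝ} {f g : M₂ ε} (h : EqOn f.fn g.fn (Ioo (-1) 1)) : f = g :=
  M₂.ext_fn <| funext fun x => by
    by_cases hx : x ∈ Ioo (-1 : ℝ) 1
    · exact h hx
    · rw [f.mem.zero_off x hx, g.mem.zero_off x hx]

section Build

variable {V W : Type*} [NormedAddCommGroup V] [NormedSpace ℝ V] [NormedAddCommGroup W]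
  [NormedSpace ℝ W]

/-- The formula `op v w` is cut off outside `(-1,1)`; algebraic identities need checking only
inside, since elements of `Y₁` are determined there. The operator norm `C + 2D` reflects one
weighted and two inner suprema. -/
theorem Y₁.exists_bilin {ε : ℝ} (op : V → W → ℝ → ℝ) (C D : ℝ)
    (hc : ∀ v w, ContinuousOn (op v w) (Ioo (-1) 1))
    (h0 : ∀ v w, ∀ x ∈ Ioo (-1 : ℝ) 1, |wDer ε .south x * op v w x| ≤ C * ‖v‖ * ‖w‖)
    (h2 : ∀ v w, C2B (op v w) (D * ‖v‖ * ‖w‖))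
    (addl : ∀ v v' w, ∀ x ∈ Ioo (-1 : ℝ) 1, op (v + v') w x = op v w x + op v' w x)
    (smull : ∀ (c : ℝ) v w, ∀ x ∈ Ioo (-1 : ℝ) 1, op (c • v) w x = c * op v w x)
    (addr : ∀ v w w', ∀ x ∈ Ioo (-1 : ℝ) 1, op v (w + w') x = op v w x + op v w' x)
    (smulr : ∀ (c : ℝ) v w, ∀ x ∈ Ioo (-1 : ℝ) 1, op v (c • w) x = c * op v w x) :
    ∃ B : V →L[ℝ] W →L[ℝ] Y₁ ε, ∀ v w, ∀ x ∈ Ioo (-1 : ℝ) 1, (B v w).fn x = op v w x := by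
  let T : V → W → Y₁ ε := fun v w =>
    Y₁.mk _ (memY₁_indicator (hc v w) (h0 v w) (h2 v w))
  have hT : ∀ v w, ∀ x ∈ Ioo (-1 : ℝ) 1, (T v w).fn x = op v w x := fun v w x hx =>
    indicator_of_mem hx _
  refine ⟨LinearMap.mkContinuous₂ (LinearMap.mk₂ ℝ T ?_ ?_ ?_ ?_) (C + 2 * D) ?_, hT⟩
  · exact fun v v' w => Y₁.ext_on fun x hx => by
      rw [Y₁.fn_add, Pi.add_apply, hT _ _ x hx, hT _ _ x hx, hT _ _ x hx, addl _ _ _ x hx]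
  · exact fun c v w => Y₁.ext_on fun x hx => by
      rw [Y₁.fn_smul, Pi.smul_apply, hT _ _ x hx, hT _ _ x hx, smull _ _ _ x hx, smul_eq_mul]
  · exact fun v w w' => Y₁.ext_on fun x hx => by
      rw [Y₁.fn_add, Pi.add_apply, hT _ _ x hx, hT _ _ x hx, hT _ _ x hx, addr _ _ _ x hx]
  · exact fun c v w => Y₁.ext_on fun x hx => by
      rw [Y₁.fn_smul, Pi.smul_apply, hT _ _ x hx, hT _ _ x hx, smulr _ _ _ x hx, smul_eq_mul]
  · intro v w
    have := Y₁.norm_le (f := T v w) (hT v w) (h0 v w) (h2 v w)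
    change ‖T v w‖ ≤ _
    linarith

theorem Y₂.exists_bilin {ε : ℝ} (op : V → W → ℝ → ℝ) (C : ℝ)
    (hc : ∀ v w, ContinuousOn (op v w) (Ioo (-1) 1))
    (h0 : ∀ v w, ∀ x ∈ Ioo (-1 : ℝ) 1, |(1 - x ^ 2) ^ (2 + ε) * op v w x| ≤ C * ‖v‖ * ‖w‖)
    (addl : ∀ v v' w, ∀ x ∈ Ioo (-1 : ℝ) 1, op (v + v') w x = op v w x + op v' w x)
    (smull : ∀ (c : ℝ) v w, ∀ x ∈ Ioo (-1 : ℝ) 1, op (c • v) w x = c * op v w x)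
    (addr : ∀ v w w', ∀ x ∈ Ioo (-1 : ℝ) 1, op v (w + w') x = op v w x + op v w' x)
    (smulr : ∀ (c : ℝ) v w, ∀ x ∈ Ioo (-1 : ℝ) 1, op v (c • w) x = c * op v w x) :
    ∃ B : V →L[ℝ] W →L[ℝ] Y₂ ε, ∀ v w, ∀ x ∈ Ioo (-1 : ℝ) 1, (B v w).fn x = op v w x := by
  let T : V → W → Y₂ ε := fun v w => Y₂.mk _ (memY₂_indicator (hc v w) (h0 v w))
  have hT : ∀ v w, ∀ x ∈ Ioo (-1 : ℝ) 1, (T v w).fn x = op v w x := fun v w x hx =>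
    indicator_of_mem hx _
  refine ⟨LinearMap.mkContinuous₂ (LinearMap.mk₂ ℝ T ?_ ?_ ?_ ?_) C ?_, hT⟩
  · exact fun v v' w => Y₂.ext_on fun x hx => by
      rw [Y₂.fn_add, Pi.add_apply, hT _ _ x hx, hT _ _ x hx, hT _ _ x hx, addl _ _ _ x hx]
  · exact fun c v w => Y₂.ext_on fun x hx => by
      rw [Y₂.fn_smul, Pi.smul_apply, hT _ _ x hx, hT _ _ x hx, smull _ _ _ x hx, smul_eq_mul]
  · exact fun v w w' => Y₂.ext_on fun x hx => by
      rw [Y₂.fn_add, Pi.add_apply, hT _ _ x hx, hT _ _ x hx, hT _ _ x hx, addr _ _ _ x hx]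
  · exact fun c v w => Y₂.ext_on fun x hx => by
      rw [Y₂.fn_smul, Pi.smul_apply, hT _ _ x hx, hT _ _ x hx, smulr _ _ _ x hx, smul_eq_mul]
  · exact fun v w => Y₂.norm_le (f := T v w) (hT v w) (h0 v w)

theorem Y₁.exists_lin {ε : ℝ} (op : V → ℝ → ℝ) (C D : ℝ)
    (hc : ∀ v, ContinuousOn (op v) (Ioo (-1) 1))
    (h0 : ∀ v, ∀ x ∈ Ioo (-1 : ℝ) 1, |wDer ε .south x * op v x| ≤ C * ‖v‖)
    (h2 : ∀ v, C2B (op v) (D * ‖v‖))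
    (add : ∀ v v', ∀ x ∈ Ioo (-1 : ℝ) 1, op (v + v') x = op v x + op v' x)
    (smul : ∀ (c : ℝ) v, ∀ x ∈ Ioo (-1 : ℝ) 1, op (c • v) x = c * op v x) :
    ∃ B : V →L[ℝ] Y₁ ε, ∀ v, ∀ x ∈ Ioo (-1 : ℝ) 1, (B v).fn x = op v x := by
  let T : V → Y₁ ε := fun v => Y₁.mk _ (memY₁_indicator (hc v) (h0 v) (h2 v))
  have hT : ∀ v, ∀ x ∈ Ioo (-1 : ℝ) 1, (T v).fn x = op v x := fun v x hx => indicator_of_mem hx _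
  refine ⟨LinearMap.mkContinuous ⟨⟨T, ?_⟩, ?_⟩ (C + 2 * D) ?_, hT⟩
  · exact fun v v' => Y₁.ext_on fun x hx => by
      rw [Y₁.fn_add, Pi.add_apply, hT _ x hx, hT _ x hx, hT _ x hx, add _ _ x hx]
  · exact fun c v => Y₁.ext_on fun x hx => by
      change (T (c • v)).fn x = (c • T v).fn x
      rw [Y₁.fn_smul, Pi.smul_apply, hT _ x hx, hT _ x hx, smul _ _ x hx, smul_eq_mul]
  · intro v
    have := Y₁.norm_le (f := T v) (hT v) (h0 v) (h2 v)
    change ‖T v‖ ≤ _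
    linarith

theorem Y₂.exists_lin {ε : ℝ} (op : V → ℝ → ℝ) (C : ℝ)
    (hc : ∀ v, ContinuousOn (op v) (Ioo (-1) 1))
    (h0 : ∀ v, ∀ x ∈ Ioo (-1 : ℝ) 1, |(1 - x ^ 2) ^ (2 + ε) * op v x| ≤ C * ‖v‖)
    (add : ∀ v v', ∀ x ∈ Ioo (-1 : ℝ) 1, op (v + v') x = op v x + op v' x)
    (smul : ∀ (c : ℝ) v, ∀ x ∈ Ioo (-1 : ℝ) 1, op (c • v) x = c * op v x) :
    ∃ B : V →L[ℝ] Y₂ ε, ∀ v, ∀ x ∈ Ioo (-1 : ℝ) 1, (B v).fn x = op v x := by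
  let T : V → Y₂ ε := fun v => Y₂.mk _ (memY₂_indicator (hc v) (h0 v))
  have hT : ∀ v, ∀ x ∈ Ioo (-1 : ℝ) 1, (T v).fn x = op v x := fun v x hx => indicator_of_mem hx _
  refine ⟨LinearMap.mkContinuous ⟨⟨T, ?_⟩, ?_⟩ C ?_, hT⟩
  · exact fun v v' => Y₂.ext_on fun x hx => by
      rw [Y₂.fn_add, Pi.add_apply, hT _ x hx, hT _ x hx, hT _ x hx, add _ _ x hx]
  · exact fun c v => Y₂.ext_on fun x hx => by
      change (T (c • v)).fn x = (c • T v).fn x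
      rw [Y₂.fn_smul, Pi.smul_apply, hT _ x hx, hT _ x hx, smul _ _ x hx, smul_eq_mul]
  · exact fun v => Y₂.norm_le (f := T v) (hT v) (h0 v)

end Build

end HomNS

namespace HomNS

/-! ### Boundedness of the operators of the system -/

/-- The continuous linear and bilinear pieces of the system, as maps between the weighted spaces. -/
structure Operators (ε : ℝ) where
  d : M₁ ε .south →L[ℝ] Y₁ ε
  d_fn : ∀ f, ∀ x ∈ Ioo (-1 : ℝ) 1, (d f).fn x = deriv f.fn x
  quot : M₁ ε .south →L[ℝ] Y₁ ε
  quot_fn : ∀ f, ∀ x ∈ Ioo (-1 : ℝ) 1, (quot f).fn x = f.fn x / (1 - x)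
  prod : M₁ ε .south →L[ℝ] M₁ ε .south →L[ℝ] Y₁ ε
  prod_fn : ∀ f g, ∀ x ∈ Ioo (-1 : ℝ) 1, (prod f g).fn x = f.fn x * g.fn x / (1 - x ^ 2)
  -- `psiHat` instead of `psi₂`: after division by `1 - x²` the result lies in `Y₁` only if the
  -- numerator vanishes at both poles.
  swirl : M₂ ε →L[ℝ] M₂ ε →L[ℝ] Y₁ ε
  swirl_fn : ∀ f g, ∀ x ∈ Ioo (-1 : ℝ) 1, (swirl f g).fn x = psiHat f.fn g.fn x / (1 - x ^ 2)
  one : Y₁ ε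
  one_fn : ∀ x ∈ Ioo (-1 : ℝ) 1, one.fn x = 1
  d₂ : M₂ ε →L[ℝ] Y₂ ε
  d₂_fn : ∀ f, ∀ x ∈ Ioo (-1 : ℝ) 1, (d₂ f).fn x = iteratedDeriv 2 f.fn x
  drift : M₂ ε →L[ℝ] Y₂ ε
  drift_fn : ∀ f, ∀ x ∈ Ioo (-1 : ℝ) 1, (drift f).fn x = 2 * x * deriv f.fn x / (1 - x ^ 2)
  quot₂ : M₂ ε →L[ℝ] Y₂ ε
  quot₂_fn : ∀ f, ∀ x ∈ Ioo (-1 : ℝ) 1, (quot₂ f).fn x = deriv f.fn x / (1 - x)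
  transport : M₁ ε .south →L[ℝ] M₂ ε →L[ℝ] Y₂ ε
  transport_fn : ∀ f g, ∀ x ∈ Ioo (-1 : ℝ) 1,
    (transport f g).fn x = f.fn x * deriv g.fn x / (1 - x ^ 2)
  ev : M₁ ε .south →L[ℝ] ℝ
  ev_fn : ∀ f, ev f = f.fn 0
  evDer : M₂ ε →L[ℝ] ℝ
  evDer_fn : ∀ f, evDer f = deriv f.fn 0
  ev₂ : M₂ ε →L[ℝ] ℝ
  ev₂_fn : ∀ f, ev₂ f = f.fn 0

theorem M₁.deriv_add {ε : ℝ} {p : Pole} (f g : M₁ ε p) {x : ℝ} (hx : x ∈ Ioo (-1 : ℝ) 1) :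
    deriv (f + g).fn x = deriv f.fn x + deriv g.fn x :=
  deriv_add_Ioo one_ne_zero f.mem.c1 g.mem.c1 hx

theorem M₂.deriv_add {ε : ℝ} (f g : M₂ ε) {x : ℝ} (hx : x ∈ Ioo (-1 : ℝ) 1) :
    deriv (f + g).fn x = deriv f.fn x + deriv g.fn x :=
  deriv_add_Ioo two_ne_zero f.mem.c2 g.mem.c2 hx

theorem M₁.deriv_smul {ε : ℝ} {p : Pole} (c : ℝ) (f : M₁ ε p) (x : ℝ) :
    deriv (c • f).fn x = c * deriv f.fn x := deriv_smul_fun c f.fn x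

theorem M₂.deriv_smul {ε : ℝ} (c : ℝ) (f : M₂ ε) (x : ℝ) :
    deriv (c • f).fn x = c * deriv f.fn x := deriv_smul_fun c f.fn x

theorem M₂.continuousOn_deriv {ε : ℝ} (f : M₂ ε) : ContinuousOn (deriv f.fn) (Ioo (-1) 1) :=
  (f.mem.c2.deriv_Ioo (m := 1) (by norm_num)).continuousOn

theorem M₁.continuousOn_deriv {ε : ℝ} {p : Pole} (f : M₁ ε p) :
    ContinuousOn (deriv f.fn) (Ioo (-1) 1) :=
  (f.mem.c1.deriv_Ioo (m := 0) (by norm_num)).continuousOn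

theorem M₂.continuousOn_deriv₂ {ε : ℝ} (f : M₂ ε) :
    ContinuousOn (iteratedDeriv 2 f.fn) (Ioo (-1) 1) := by
  have := ((f.mem.c2.deriv_Ioo (m := 1) (by norm_num)).deriv_Ioo (m := 0) (by norm_num)).continuousOn
  simpa only [iteratedDeriv_succ, iteratedDeriv_zero] using this

theorem contDiffOn_inv_one_sub_sq (n : WithTop ℕ∞) :
    ContDiffOn ℝ n (fun x : ℝ => (1 - x ^ 2)⁻¹) (Ioo (-1) 1) :=
  ContDiffOn.inv (by fun_prop) fun _ hx => (one_sub_sq_pos hx).ne'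

theorem contDiffOn_inv_one_sub (n : WithTop ℕ∞) :
    ContDiffOn ℝ n (fun x : ℝ => (1 - x)⁻¹) (Ioo (-1) 1) :=
  ContDiffOn.inv (by fun_prop) fun x hx => by have := hx.2; exact ne_of_gt (by linarith)

/-- The weight of the product of two elements of `M₁`. -/
theorem wDer_mul_prod_le {ε : ℝ} (h0 : 0 < ε) (h1 : ε < 1 / 2) {x y z A B : ℝ}
    (hx : x ∈ Ioo (-1 : ℝ) 1) (hy : |wVal ε .south x * y| ≤ A) (hz : |wVal ε .south x * z| ≤ B) :
    |wDer ε .south x * (y * z / (1 - x ^ 2))| ≤ 2 * (A * B) := by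
  have a1 : 0 < 1 - x := by linarith [hx.2]
  have a2 : 0 < 1 + x := by linarith [hx.1]
  have hm := mul_le_mul hy hz (abs_nonneg _) ((abs_nonneg _).trans hy)
  -- The squared logarithm of the derivative weight is shared out between the two factors. This is
  -- why the two weights of `M₁` fit the quadratic term, with the bounded power `(1-x)^(1-2ε)` to
  -- spare.
  have e : wDer ε .south x * (y * z / (1 - x ^ 2))
      = (wVal ε .south x * y) * (wVal ε .south x * z) * (1 - x) ^ (1 - 2 * ε) := by
    have e1 : (1 - x) ^ (2 * ε) = (1 - x) ^ (-1 + 2 * ε) * (1 - x) := by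
      rw [← Real.rpow_add_one a1.ne']; congr 1; ring
    have e2 : (1 - x) ^ (-1 + 2 * ε) * (1 - x) ^ (1 - 2 * ε) = 1 := by
      rw [← Real.rpow_add a1]; simp
    have e3 : wVal ε .south x = -(ell x * (1 - x) ^ (-1 + 2 * ε)) := by
      change Real.log ((1 + x) / 3) * (1 - x) ^ (-1 + 2 * ε) = _
      rw [ell]; ring
    rw [wDer_south, e1, e3, show 1 - x ^ 2 = (1 - x) * (1 + x) by ring]
    field_simp
    linear_combination (-(ell x ^ 2 * y * z)) * e2
  rw [e, abs_mul, abs_mul]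
  have h2 := one_sub_rpow_le_two (r := 1 - 2 * ε) (by linarith) (by linarith) hx
  have h3 : 0 ≤ (1 - x) ^ (1 - 2 * ε) := by positivity
  rw [abs_of_nonneg h3]
  have h4 : 0 ≤ A * B := (mul_nonneg (abs_nonneg _) (abs_nonneg _)).trans hm
  nlinarith [mul_le_mul hm h2 h3 h4]

/-- Relative to the weight of `y`, one logarithm is left over; the factor `1 + x` absorbs it through
`(1+x) ell ≤ 3`. -/
theorem wDer_mul_quot_le {ε : ℝ} {x y A : ℝ}
    (hx : x ∈ Ioo (-1 : ℝ) 1) (hy : |wVal ε .south x * y| ≤ A) :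
    |wDer ε .south x * (y / (1 - x))| ≤ 3 * A := by
  have a1 : 0 < 1 - x := by linarith [hx.2]
  have a2 : 0 < 1 + x := by linarith [hx.1]
  have e : wDer ε .south x * (y / (1 - x)) = -((wVal ε .south x * y) * ((1 + x) * ell x)) := by
    have e1 : (1 - x) ^ (2 * ε) = (1 - x) ^ (-1 + 2 * ε) * (1 - x) := by
      rw [← Real.rpow_add_one a1.ne']; congr 1; ring
    have e3 : wVal ε .south x = -(ell x * (1 - x) ^ (-1 + 2 * ε)) := by
      change Real.log ((1 + x) / 3) * (1 - x) ^ (-1 + 2 * ε) = _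
      rw [ell]; ring
    rw [wDer_south, e1, e3]
    field_simp
  have h5 : 0 ≤ (1 + x) * ell x := mul_nonneg a2.le (ell_pos hx).le
  rw [e, abs_neg, abs_mul, abs_of_nonneg h5]
  have := one_add_mul_ell_le hx
  nlinarith [mul_le_mul hy this h5 ((abs_nonneg _).trans hy)]

theorem ell_le_three {x : ℝ} (h0 : 0 ≤ x) (h1 : x < 1) : ell x ≤ 3 := by
  have := one_add_mul_ell_le (x := x) ⟨by linarith, h1⟩
  nlinarith [ell_pos (x := x) ⟨by linarith, h1⟩]

/-- The `Y₁` weight of a function vanishing to order `1 - 2ε` at both poles. -/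
theorem exists_wDer_div_le {ε : ℝ} (h0 : 0 < ε) (h1 : ε < 1 / 2) : ∃ C, 0 ≤ C ∧ ∀ (g : ℝ → ℝ) (N : ℝ),
    (∀ x, 0 ≤ x → x < 1 → |g x| ≤ N * (1 - x) ^ (1 - 2 * ε)) →
    (∀ x, x ≤ 0 → -1 < x → |g x| ≤ N * (1 + x) ^ (1 - 2 * ε)) →
    ∀ x ∈ Ioo (-1 : ℝ) 1, |wDer ε .south x * (g x / (1 - x ^ 2))| ≤ C * N := by
  refine ⟨9 + 3 ^ (1 - 2 * ε) * (4 / (1 - 2 * ε) ^ 2), by positivity, fun g N hp hm x hx => ?_⟩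
  have a1 : 0 < 1 - x := by linarith [hx.2]
  have a2 : 0 < 1 + x := by linarith [hx.1]
  have hl := ell_pos hx
  have hN : 0 ≤ N := by simpa using (abs_nonneg _).trans (hp 0 le_rfl one_pos)
  have e : wDer ε .south x * (g x / (1 - x ^ 2)) = ell x ^ 2 * (1 - x) ^ (-1 + 2 * ε) * g x := by
    have e1 : (1 - x) ^ (2 * ε) = (1 - x) ^ (-1 + 2 * ε) * (1 - x) := by
      rw [← Real.rpow_add_one a1.ne']; congr 1; ring
    rw [wDer_south, e1, show 1 - x ^ 2 = (1 - x) * (1 + x) by ring]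
    field_simp
  have hw : 0 ≤ (1 - x) ^ (-1 + 2 * ε) := by positivity
  rw [e, abs_mul, abs_of_nonneg (by positivity : 0 ≤ ell x ^ 2 * (1 - x) ^ (-1 + 2 * ε))]
  have hK : 0 ≤ 3 ^ (1 - 2 * ε) * (4 / (1 - 2 * ε) ^ 2) := by positivity
  -- For `x ≥ 0` the powers of `1 - x` cancel and `ell² ≤ 9`. For `x ≤ 0` the power `(1+x)^(1-2ε)`
  -- beats `ell²`. The two constants add up to the witness.
  rcases le_total 0 x with h | h
  · have h2 := hp x h hx.2
    have e2 : (1 - x) ^ (-1 + 2 * ε) * (1 - x) ^ (1 - 2 * ε) = 1 := by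
      rw [← Real.rpow_add a1]; simp
    have h3 : ell x ^ 2 ≤ 9 := by nlinarith [ell_le_three h hx.2]
    calc ell x ^ 2 * (1 - x) ^ (-1 + 2 * ε) * |g x|
        ≤ 9 * (1 - x) ^ (-1 + 2 * ε) * (N * (1 - x) ^ (1 - 2 * ε)) := by gcongr
      _ = 9 * N := by linear_combination 9 * N * e2
      _ ≤ _ := by gcongr; linarith
  · have h2 := hm x h hx.1
    have h3 := ell_sq_mul_rpow_le (p := 1 - 2 * ε) (by linarith) hx
    have h4 : (1 - x) ^ (-1 + 2 * ε) ≤ 1 :=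
      Real.rpow_le_one_of_one_le_of_nonpos (by linarith) (by linarith)
    calc ell x ^ 2 * (1 - x) ^ (-1 + 2 * ε) * |g x|
        ≤ ell x ^ 2 * 1 * (N * (1 + x) ^ (1 - 2 * ε)) := by gcongr
      _ = N * (ell x ^ 2 * (1 + x) ^ (1 - 2 * ε)) := by ring
      _ ≤ N * (3 ^ (1 - 2 * ε) * (4 / (1 - 2 * ε) ^ 2)) := by gcongr
      _ ≤ _ := by nlinarith

theorem one_sub_sq_rpow_neg_inner_le {r x : ℝ} (h0 : 0 ≤ r) (h3 : r ≤ 3)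
    (hx : x ∈ Ioo (-1 / 2 : ℝ) (1 / 2)) : (1 - x ^ 2) ^ (-r) ≤ 8 := by
  calc (1 - x ^ 2) ^ (-r) ≤ (1 / 2) ^ (-r) :=
        Real.rpow_le_rpow_of_nonpos (by norm_num) (by nlinarith [hx.1, hx.2]) (by linarith)
    _ ≤ (1 / 2) ^ (-(3 : ℝ)) :=
        Real.rpow_le_rpow_of_exponent_ge (by norm_num) (by norm_num) (by linarith)
    _ = 8 := by rw [Real.rpow_neg (by norm_num)]; norm_num

theorem psiConst_nonneg {ε : ℝ} (h0 : 0 < ε) : 0 ≤ psiConst ε := by unfold psiConst; positivity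

theorem SwirlBound.nonneg {ε N : ℝ} {f g : ℝ → ℝ} (h : SwirlBound ε f g N) : 0 ≤ N := by
  simpa using (abs_nonneg _).trans (h.le 0 zero_mem_outer)

theorem exists_psiHat_c2b {ε : ℝ} (h0 : 0 < ε) (h1 : ε < 1 / 2) :
    ∃ K, ∀ (f g : ℝ → ℝ) (N : ℝ), SwirlBound ε f g N → C2B (psiHat f g) (K * N) := by
  have hp := psiConst_nonneg h0
  have h12 : 0 < 1 - 2 * ε := by linarith
  set a := 2 * psiConst ε / (1 - 2 * ε) with ha
  set b := psiConst ε / (1 - 2 * ε) with hb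
  set c := 2 ^ (1 + 2 * ε) / (1 + 2 * ε) with hc
  have ha0 : 0 ≤ a := by positivity
  have hb0 : 0 ≤ b := by positivity
  have hc0 : 0 ≤ c := by positivity
  refine ⟨2 * a + (8 * psiConst ε + b) + 8 * c, fun f g N h => ?_⟩
  have hN := h.nonneg
  refine C2B.of_hasDerivAt
    (f₁ := fun x => psiDer₁ f g x + 1 / 2 * psi₂ f g (-1) - 1 / 2 * psi₂ f g 1)
    (f₂ := psiDer₂ f g) (fun x hx => ?_) (fun x hx => ?_) ?_ (fun x hx => ?_) (fun x hx => ?_)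
    (fun x hx => ?_)
  · have := (psi₂_hasDerivAt h.contf h.contg (inner_subset_outer hx)).1
    have h2 := (this.sub (((hasDerivAt_id x).const_sub 1).const_mul (1 / 2 * psi₂ f g (-1)))).sub
      (((hasDerivAt_id x).const_add 1).const_mul (1 / 2 * psi₂ f g 1))
    exact h2.congr_deriv (by ring)
  · have := (psi₂_hasDerivAt h.contf h.contg (inner_subset_outer hx)).2
    exact (this.add_const _).sub_const _
  · exact (continuousOn_primitive (continuousOn_swirl h.contf h.contg)).mono inner_subset_outer
  · have hx' := inner_subset_outer hx
    have key : |psiHat f g x| ≤ N * a * 2 := by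
      rcases le_total 0 x with hs | hs
      · refine (h.psiHat_near_one h0 h1 hs hx'.2.le).trans ?_
        gcongr
        exact one_sub_rpow_le_two (by linarith) (by linarith) hx'
      · refine (h.psiHat_near_neg_one h0 h1 hs hx'.1.le).trans ?_
        gcongr
        have := one_sub_rpow_le_two (r := 1 - 2 * ε) (by linarith) (by linarith)
          (x := -x) ⟨by linarith [hx'.2], by linarith [hx'.1]⟩
        rwa [sub_neg_eq_add] at this
    refine key.trans ?_
    nlinarith [mul_nonneg hN ha0, mul_nonneg hN hb0, mul_nonneg hN hc0, mul_nonneg hN hp]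
  · have k1 := h.der₁ h0 (inner_subset_outer hx)
    have k2 := one_sub_sq_rpow_neg_inner_le (r := 2 * ε) (by linarith) (by linarith) hx
    have k3 := h.at_one h0 h1
    have k4 := h.at_neg_one h0 h1
    have k5 : |psiDer₁ f g x| ≤ N * psiConst ε * 8 := k1.trans (by gcongr)
    rw [mul_div_assoc] at k3 k4
    refine (abs_sub _ _).trans ((add_le_add_left (abs_add_le _ _) _).trans ?_)
    rw [abs_mul, abs_mul, abs_of_pos (by norm_num : (0 : ℝ) < 1 / 2)]
    nlinarith [mul_nonneg hN ha0, mul_nonneg hN hb0, mul_nonneg hN hc0, mul_nonneg hN hp]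
  · have k1 := h.der₂ h0 (inner_subset_outer hx)
    have k2 := one_sub_sq_rpow_neg_inner_le (r := 1 + 2 * ε) (by linarith) (by linarith) hx
    rw [show -(1 + 2 * ε) = -1 - 2 * ε by ring] at k2
    have k5 : |psiDer₂ f g x| ≤ N * c * 8 := k1.trans (by gcongr)
    refine k5.trans ?_
    nlinarith [mul_nonneg hN ha0, mul_nonneg hN hb0, mul_nonneg hN hc0, mul_nonneg hN hp]

theorem rpow_two_add_eq {ε x : ℝ} (hx : x ∈ Ioo (-1 : ℝ) 1) :
    (1 - x ^ 2) ^ (2 + ε) = (1 - x ^ 2) ^ (1 + ε) * (1 - x ^ 2) := by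
  rw [← Real.rpow_add_one (one_sub_sq_pos hx).ne']; congr 1; ring

theorem exists_operators {ε : ℝ} (h0 : 0 < ε) (h1 : ε < 1 / 2) : Nonempty (Operators ε) := by
  obtain ⟨G, hG⟩ := exists_C2B (contDiffOn_inv_one_sub_sq 2) le_rfl
  obtain ⟨H, hH⟩ := exists_C2B (contDiffOn_inv_one_sub 2) le_rfl
  have cinv : ContinuousOn (fun x : ℝ => (1 - x ^ 2)⁻¹) (Ioo (-1) 1) :=
    (contDiffOn_inv_one_sub_sq 0).continuousOn
  have cinv1 : ContinuousOn (fun x : ℝ => (1 - x)⁻¹) (Ioo (-1) 1) :=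
    (contDiffOn_inv_one_sub 0).continuousOn
  obtain ⟨d, hd⟩ := Y₁.exists_lin (ε := ε) (fun f : M₁ ε .south => deriv f.fn) 1 36
    (fun f => f.continuousOn_deriv) (fun f x hx => by rw [one_mul]; exact f.der_le hx)
    (fun f => f.deriv_c2b h0 h1) (fun f g x hx => M₁.deriv_add f g hx)
    (fun c f x _ => M₁.deriv_smul c f x)
  obtain ⟨quot, hquot⟩ := Y₁.exists_lin (ε := ε) (fun (f : M₁ ε .south) x => f.fn x / (1 - x)) 3
    (4 * (36 * H))
    (fun f => by simp only [div_eq_mul_inv]; exact f.mem.c1.continuousOn.mul cinv1)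
    (fun f x hx => wDer_mul_quot_le hx (f.val_le hx))
    (fun f => by simpa only [div_eq_mul_inv] using
      ((f.c2b h0 h1).mul hH).mono (le_of_eq (by ring)))
    (fun f g x _ => by rw [M₁.fn_add, Pi.add_apply]; ring)
    (fun c f x _ => by rw [M₁.fn_smul, Pi.smul_apply, smul_eq_mul]; ring)
  obtain ⟨prod, hprod⟩ := Y₁.exists_bilin (ε := ε)
    (fun (f g : M₁ ε .south) x => f.fn x * g.fn x / (1 - x ^ 2)) 2
    (4 * (4 * (36 * 36) * G))
    (fun f g => by
      simp only [div_eq_mul_inv]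
      exact (f.mem.c1.continuousOn.mul g.mem.c1.continuousOn).mul cinv)
    (fun f g x hx => by
      rw [mul_assoc]; exact wDer_mul_prod_le h0 h1 hx (f.val_le hx) (g.val_le hx))
    (fun f g => by
      simpa only [div_eq_mul_inv] using
        (((f.c2b h0 h1).mul (g.c2b h0 h1)).mul hG).mono (le_of_eq (by ring)))
    (fun f g h x _ => by rw [M₁.fn_add, Pi.add_apply]; ring)
    (fun c f h x _ => by rw [M₁.fn_smul, Pi.smul_apply, smul_eq_mul]; ring)
    (fun f g h x _ => by rw [M₁.fn_add, Pi.add_apply]; ring)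
    (fun c f h x _ => by rw [M₁.fn_smul, Pi.smul_apply, smul_eq_mul]; ring)
  obtain ⟨K, hK⟩ := exists_psiHat_c2b h0 h1
  obtain ⟨L, hL0, hL⟩ := exists_wDer_div_le h0 h1
  -- One linear-combination rule covers all four bilinearity conditions: `a = b = 1` for sums and `b
  -- = 0` for multiples.
  have hcomb : ∀ {f g f₁ g₁ f₂ g₂ : M₂ ε} {a b : ℝ}, (∀ x ∈ Ioo (-1 : ℝ) 1,
      f.fn x * deriv g.fn x
        = a * (f₁.fn x * deriv g₁.fn x) + b * (f₂.fn x * deriv g₂.fn x)) →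
      ∀ x ∈ Ioo (-1 : ℝ) 1, psiHat f.fn g.fn x / (1 - x ^ 2)
        = a * (psiHat f₁.fn g₁.fn x / (1 - x ^ 2)) + b * (psiHat f₂.fn g₂.fn x / (1 - x ^ 2)) := by
    intro f g f₁ g₁ f₂ g₂ a b h x hx
    have hc := fun y hy => psi₂_comb h0 h1 (M₂.swirlBound f₁ g₁) (M₂.swirlBound f₂ g₂) h (x := y) hy
    unfold psiHat
    rw [hc x ⟨hx.1.le, hx.2.le⟩, hc 1 (by norm_num), hc (-1) (by norm_num)]
    ring
  obtain ⟨swirl, hswirl⟩ := Y₁.exists_bilin (ε := ε)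
    (fun (f g : M₂ ε) x => psiHat f.fn g.fn x / (1 - x ^ 2))
    (L * (2 * (2 * psiConst ε / (1 - 2 * ε)))) (4 * (K * 2 * G))
    (fun f g => by
      have hb := M₂.swirlBound f g
      have : ContinuousOn (psi₂ f.fn g.fn) (Ioo (-1) 1) := fun x hx =>
        (psi₂_hasDerivAt hb.contf hb.contg hx).1.continuousAt.continuousWithinAt
      simp only [div_eq_mul_inv, psiHat]
      exact ((this.sub (by fun_prop)).sub (by fun_prop)).mul cinv)
    (fun f g x hx => by
      have hb := M₂.swirlBound f g
      refine (hL _ _ (fun y hy hy' => hb.psiHat_near_one h0 h1 hy hy'.le)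
        (fun y hy hy' => hb.psiHat_near_neg_one h0 h1 hy hy'.le) x hx).trans (le_of_eq ?_)
      ring)
    (fun f g => by
      simpa only [div_eq_mul_inv] using
        ((hK _ _ _ (M₂.swirlBound f g)).mul hG).mono (le_of_eq (by ring)))
    (fun f g h x hx => by
      rw [hcomb (f₁ := f) (f₂ := g) (g₁ := h) (g₂ := h) (a := 1) (b := 1)
        (fun y _ => by rw [M₂.fn_add, Pi.add_apply]; ring) x hx]; ring)
    (fun c f h x hx => by
      rw [hcomb (f₁ := f) (f₂ := f) (g₁ := h) (g₂ := h) (a := c) (b := 0)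
        (fun y _ => by rw [M₂.fn_smul, Pi.smul_apply, smul_eq_mul]; ring) x hx]; ring)
    (fun f g h x hx => by
      rw [hcomb (f₁ := f) (f₂ := f) (g₁ := g) (g₂ := h) (a := 1) (b := 1)
        (fun y hy => by rw [M₂.deriv_add _ _ hy]; ring) x hx]; ring)
    (fun c f h x hx => by
      rw [hcomb (f₁ := f) (f₂ := f) (g₁ := h) (g₂ := h) (a := c) (b := 0)
        (fun y _ => by rw [M₂.deriv_smul]; ring) x hx]; ring)
  have hone := memY₁_indicator (ε := ε) (g := fun _ => 1) (A := 24) (B := 1) continuousOn_const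
    (fun x hx => by
      rw [mul_one, abs_of_pos (wDer_pos ε .south hx)]; exact wDer_le h0 h1 hx)
    (C2B.of_hasDerivAt (f₁ := fun _ => 0) (f₂ := fun _ => 0) (fun x _ => hasDerivAt_const x 1)
      (fun x _ => hasDerivAt_const x 0) continuousOn_const (by simp) (by simp) (by simp))
  obtain ⟨d₂, hd₂⟩ := Y₂.exists_lin (ε := ε) (fun f : M₂ ε => iteratedDeriv 2 f.fn) 1
    (fun f => f.continuousOn_deriv₂) (fun f x hx => by rw [one_mul]; exact f.der2_le hx)
    (fun f g x hx => iteratedDeriv_add_Ioo (by norm_num) f.mem.c2 g.mem.c2 hx)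
    (fun c f x _ => iteratedDeriv_smul_fun 2 c f.fn x)
  obtain ⟨drift, hdrift⟩ := Y₂.exists_lin (ε := ε)
    (fun (f : M₂ ε) x => 2 * x * deriv f.fn x / (1 - x ^ 2)) 2
    (fun f => by
      have := f.continuousOn_deriv
      simp only [div_eq_mul_inv]
      exact ((by fun_prop : ContinuousOn (fun x : ℝ => 2 * x) _).mul this).mul cinv)
    (fun f x hx => by
      have := f.der_le hx
      have hp := one_sub_sq_pos hx
      have e : (1 - x ^ 2) ^ (2 + ε) * (2 * x * deriv f.fn x / (1 - x ^ 2))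
          = 2 * x * ((1 - x ^ 2) ^ (1 + ε) * deriv f.fn x) := by
        rw [rpow_two_add_eq hx]; field_simp
      rw [e, abs_mul]
      refine mul_le_mul ?_ this (abs_nonneg _) (by norm_num)
      rw [abs_le]; constructor <;> linarith [hx.1, hx.2])
    (fun f g x hx => by rw [M₂.deriv_add _ _ hx]; ring)
    (fun c f x _ => by rw [M₂.deriv_smul]; ring)
  obtain ⟨quot₂, hquot₂⟩ := Y₂.exists_lin (ε := ε)
    (fun (f : M₂ ε) x => deriv f.fn x / (1 - x)) 2
    (fun f => by
      simp only [div_eq_mul_inv]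
      exact f.continuousOn_deriv.mul cinv1)
    (fun f x hx => by
      have := f.der_le hx
      have hp : 0 < 1 - x := by linarith [hx.2]
      have e : (1 - x ^ 2) ^ (2 + ε) * (deriv f.fn x / (1 - x))
          = (1 + x) * ((1 - x ^ 2) ^ (1 + ε) * deriv f.fn x) := by
        rw [rpow_two_add_eq hx, show 1 - x ^ 2 = (1 - x) * (1 + x) by ring]; field_simp
      rw [e, abs_mul]
      refine mul_le_mul ?_ this (abs_nonneg _) (by norm_num)
      rw [abs_le]; constructor <;> linarith [hx.1, hx.2])
    (fun f g x hx => by rw [M₂.deriv_add _ _ hx]; ring)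
    (fun c f x _ => by rw [M₂.deriv_smul]; ring)
  obtain ⟨transport, htransport⟩ := Y₂.exists_bilin (ε := ε)
    (fun (f : M₁ ε .south) (g : M₂ ε) x => f.fn x * deriv g.fn x / (1 - x ^ 2)) 6
    (fun f g => by
      simp only [div_eq_mul_inv]
      exact (f.mem.c1.continuousOn.mul g.continuousOn_deriv).mul cinv)
    (fun f g x hx => by
      have := g.der_le hx
      have hp := one_sub_sq_pos hx
      have e : (1 - x ^ 2) ^ (2 + ε) * (f.fn x * deriv g.fn x / (1 - x ^ 2))
          = f.fn x * ((1 - x ^ 2) ^ (1 + ε) * deriv g.fn x) := by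
        rw [rpow_two_add_eq hx]; field_simp
      rw [e, abs_mul]
      exact mul_le_mul (f.abs_le h0 h1 hx) this (abs_nonneg _) (by positivity))
    (fun f g h x _ => by rw [M₁.fn_add, Pi.add_apply]; ring)
    (fun c f h x _ => by rw [M₁.fn_smul, Pi.smul_apply, smul_eq_mul]; ring)
    (fun f g h x hx => by rw [M₂.deriv_add _ _ hx]; ring)
    (fun c f h x _ => by rw [M₂.deriv_smul]; ring)
  let ev : M₁ ε .south →ₗ[ℝ] ℝ := ⟨⟨fun f => f.fn 0, fun _ _ => rfl⟩, fun _ _ => rfl⟩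
  let evDer : M₂ ε →ₗ[ℝ] ℝ := ⟨⟨fun f => deriv f.fn 0, fun f g =>
    M₂.deriv_add f g zero_mem_outer⟩, fun c f => M₂.deriv_smul c f 0⟩
  let ev₂ : M₂ ε →ₗ[ℝ] ℝ := ⟨⟨fun f => f.fn 0, fun _ _ => rfl⟩, fun _ _ => rfl⟩
  exact ⟨{
    d := d
    d_fn := hd
    quot := quot
    quot_fn := hquot
    prod := prod
    prod_fn := hprod
    swirl := swirl
    swirl_fn := hswirl
    one := Y₁.mk _ hone
    one_fn := fun x hx => indicator_of_mem hx fun _ => 1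
    d₂ := d₂
    d₂_fn := hd₂
    drift := drift
    drift_fn := hdrift
    quot₂ := quot₂
    quot₂_fn := hquot₂
    transport := transport
    transport_fn := htransport
    ev := ev.mkContinuous 6 fun f => f.abs_le h0 h1 zero_mem_outer
    ev_fn := fun _ => rfl
    evDer := evDer.mkContinuous 1 fun f => by
      have := f.der_le zero_mem_outer
      rw [one_mul]; change |deriv f.fn 0| ≤ _; simpa using this
    evDer_fn := fun _ => rfl
    ev₂ := ev₂.mkContinuous 1 fun f => by
      have := f.val_le zero_mem_outer
      rw [one_mul]; change |f.fn 0| ≤ _; simpa using this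
    ev₂_fn := fun _ => rfl }⟩

end HomNS

namespace HomNS

/-! ## The inverse function theorem along a compact set -/

/-- The inverse function theorem gives injectivity near each point of `Γ`. With injectivity on the
compact set `Γ` itself, this spreads to a neighbourhood of `Γ`, where the local inverses therefore
glue to a single one. -/
theorem exists_smooth_inverse_near_compact {E F : Type*} [NormedAddCommGroup E] [NormedSpace ℝ E]
    [CompleteSpace E] [NormedAddCommGroup F] [NormedSpace ℝ F] {Ψ : E → F} (hΨ : ContDiff ℝ ∞ Ψ)
    {Γ : Set E} (hΓ : IsCompact Γ) (hinj : InjOn Ψ Γ)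
    (hinv : ∀ e ∈ Γ, ∃ A : E ≃L[ℝ] F, (A : E →L[ℝ] F) = fderiv ℝ Ψ e) :
    ∃ (U : Set E) (S : F → E), IsOpen U ∧ Γ ⊆ U ∧ IsOpen (Ψ '' U) ∧ ContDiffOn ℝ ∞ S (Ψ '' U) ∧
      ∀ e ∈ U, S (Ψ e) = e := by
  have htop : (∞ : WithTop ℕ∞) ≠ 0 := by simp
  have hstrict : ∀ {e : E} {A : E ≃L[ℝ] F}, (A : E →L[ℝ] F) = fderiv ℝ Ψ e →
      HasStrictFDerivAt Ψ (A : E →L[ℝ] F) e := fun {e A} h => by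
    rw [h]; exact hΨ.contDiffAt.hasStrictFDerivAt htop
  obtain ⟨t, ht, htinj⟩ := hinj.exists_mem_nhdsSet hΓ (fun e _ => hΨ.continuous.continuousAt)
    (fun e he => by
      obtain ⟨A, hA⟩ := hinv e he
      exact ⟨_, ((hstrict hA).toOpenPartialHomeomorph Ψ).open_source.mem_nhds
        (hstrict hA).mem_toOpenPartialHomeomorph_source,
        ((hstrict hA).toOpenPartialHomeomorph Ψ).injOn⟩)
  -- Invertibility is an open condition on operators, so this open set contains `Γ`, and at each of
  -- its points `Ψ` is a local diffeomorphism.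
  set V : Set E := fderiv ℝ Ψ ⁻¹' range ((↑) : (E ≃L[ℝ] F) → E →L[ℝ] F) with hV
  have hVo : IsOpen V := (ContinuousLinearEquiv.isOpen).preimage (hΨ.continuous_fderiv htop)
  set U := interior t ∩ V with hU
  have hUo : IsOpen U := isOpen_interior.inter hVo
  have hUinj : InjOn Ψ U := htinj.mono (inter_subset_left.trans interior_subset)
  have hS : ∀ e ∈ U, Function.invFunOn Ψ U (Ψ e) = e := fun e he =>
    hUinj (Function.invFunOn_mem ⟨e, he, rfl⟩) he (Function.invFunOn_eq ⟨e, he, rfl⟩)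
  refine ⟨U, Function.invFunOn Ψ U, hUo, ?_, ?_, ?_, hS⟩
  · exact fun e he => ⟨subset_interior_iff_mem_nhdsSet.2 ht he, hinv e he⟩
  · rw [isOpen_iff_mem_nhds]
    rintro _ ⟨e, he, rfl⟩
    obtain ⟨A, hA⟩ := he.2
    rw [← (hstrict hA).map_nhds_eq_of_equiv]
    exact image_mem_map (hUo.mem_nhds he)
  · rintro _ ⟨e, he, rfl⟩
    obtain ⟨A, hA⟩ := he.2
    have hd : HasFDerivAt Ψ (A : E →L[ℝ] F) e := (hstrict hA).hasFDerivAt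
    have hl := (hΨ.contDiffAt (x := e)).to_localInverse hd htop
    -- The global inverse agrees near `Ψ e` with the smooth local one: the latter takes values in
    -- `U`, where `Ψ` is injective.
    refine (hl.congr_of_eventuallyEq ?_).contDiffWithinAt
    have h1 := ((hΨ.contDiffAt (x := e)).hasStrictFDerivAt' hd htop).eventually_right_inverse
    have h2 : (hΨ.contDiffAt (x := e)).localInverse hd htop (Ψ e) = e :=
      (hΨ.contDiffAt (x := e)).localInverse_apply_image hd htop
    have h3 : ∀ᶠ y in 𝓝 (Ψ e), (hΨ.contDiffAt (x := e)).localInverse hd htop y ∈ U :=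
      hl.continuousAt (by rw [h2]; exact hUo.mem_nhds he)
    filter_upwards [h1, h3] with y hy1 hy3
    have := hS _ hy3
    rw [← this]
    congr 1
    exact hy1.symm

/-! ## The system as a smooth map -/

/-- The space of unknowns `(s, k, w, φ)`. -/
abbrev Unknowns (ε : ℝ) : Type := ℝ × ℝ × M₁ ε .south × M₂ ε

/-- The space of data. -/
abbrev Data (ε : ℝ) : Type := ℝ × Y₁ ε × Y₂ ε × ℝ × ℝ × ℝ

variable {ε : ℝ}

/-- The `θ`-equation, divided by `1 - x²`, for `U_θ = (1-x) - (1+s)(1+x) + w`. -/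
noncomputable def Operators.eqθ (o : Operators ε) (s k : ℝ) (w : M₁ ε .south) (φ : M₂ ε) : Y₁ ε :=
  o.d w - s • o.quot w + (1 / 2 : ℝ) • o.prod w w + o.swirl φ φ - k • o.one

/-- The `φ`-equation, divided by `1 - x²`. -/
noncomputable def Operators.eqφ (o : Operators ε) (s : ℝ) (w : M₁ ε .south) (φ : M₂ ε) : Y₂ ε :=
  o.d₂ φ - o.drift φ - s • o.quot₂ φ + o.transport w φ

/-- The full system together with the three normalisations. -/
noncomputable def Operators.sys (o : Operators ε) (e : Unknowns ε) : Data ε :=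
  (e.1, o.eqθ e.1 e.2.1 e.2.2.1 e.2.2.2, o.eqφ e.1 e.2.2.1 e.2.2.2, o.ev e.2.2.1,
    o.evDer e.2.2.2, o.ev₂ e.2.2.2)

theorem Operators.contDiff_sys (o : Operators ε) : ContDiff ℝ ∞ o.sys := by
  unfold Operators.sys Operators.eqθ Operators.eqφ
  have hw : ContDiff ℝ ∞ fun e : Unknowns ε => e.2.2.1 := by fun_prop
  have hφ : ContDiff ℝ ∞ fun e : Unknowns ε => e.2.2.2 := by fun_prop
  have hs : ContDiff ℝ ∞ fun e : Unknowns ε => e.1 := by fun_prop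
  have hk : ContDiff ℝ ∞ fun e : Unknowns ε => e.2.1 := by fun_prop
  have h1 : ContDiff ℝ ∞ fun e : Unknowns ε => o.prod e.2.2.1 e.2.2.1 :=
    (o.prod.contDiff.comp hw).clm_apply hw
  have h2 : ContDiff ℝ ∞ fun e : Unknowns ε => o.swirl e.2.2.2 e.2.2.2 :=
    (o.swirl.contDiff.comp hφ).clm_apply hφ
  have h3 : ContDiff ℝ ∞ fun e : Unknowns ε => o.transport e.2.2.1 e.2.2.2 :=
    (o.transport.contDiff.comp hw).clm_apply hφ
  refine hs.prodMk (((((((o.d.contDiff.comp hw).sub (hs.smul (o.quot.contDiff.comp hw))).add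
    (h1.const_smul _)).add h2).sub (hk.smul contDiff_const))).prodMk
    (((((o.d₂.contDiff.comp hφ).sub (o.drift.contDiff.comp hφ)).sub
      (hs.smul (o.quot₂.contDiff.comp hφ))).add h3).prodMk
    ((o.ev.contDiff.comp hw).prodMk ((o.evDer.contDiff.comp hφ).prodMk
      (o.ev₂.contDiff.comp hφ)))))

theorem Operators.prod_comm (o : Operators ε) (f g : M₁ ε .south) : o.prod f g = o.prod g f :=
  Y₁.ext_on fun x hx => by rw [o.prod_fn _ _ x hx, o.prod_fn _ _ x hx, mul_comm]

/-- The linearised `θ`-operator. -/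
noncomputable def Operators.linθ (o : Operators ε) (s : ℝ) (v h : M₁ ε .south) : Y₁ ε :=
  o.d h - s • o.quot h + o.prod v h

/-- The derivative of the system at a swirl-free flow. -/
theorem Operators.fderiv_sys (o : Operators ε) (s k : ℝ) (v : M₁ ε .south) (σ κ : ℝ)
    (h : M₁ ε .south) (χ : M₂ ε) :
    fderiv ℝ o.sys (s, k, v, 0) (σ, κ, h, χ)
      = (σ, o.linθ s v h - σ • o.quot v - κ • o.one, o.eqφ s v χ, o.ev h, o.evDer χ, o.ev₂ χ) := by
  have hd : HasFDerivAt o.sys (fderiv ℝ o.sys (s, k, v, 0)) (s, k, v, 0) :=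
    (o.contDiff_sys.differentiable (by simp) _).hasFDerivAt
  have hline : HasDerivAt (fun t : ℝ => ((s, k, v, 0) : Unknowns ε) + t • (σ, κ, h, χ))
      ((σ, κ, h, χ) : Unknowns ε) 0 := by
    have := ((hasDerivAt_id (0 : ℝ)).smul_const ((σ, κ, h, χ) : Unknowns ε)).const_add
      ((s, k, v, 0) : Unknowns ε)
    simpa using this
  have h1 : HasDerivAt (fun t : ℝ => o.sys (((s, k, v, 0) : Unknowns ε) + t • (σ, κ, h, χ)))
      (fderiv ℝ o.sys (s, k, v, 0) (σ, κ, h, χ)) 0 :=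
    HasFDerivAt.comp_hasDerivAt (l := o.sys) (l' := fderiv ℝ o.sys (s, k, v, 0))
      (f := fun t : ℝ => ((s, k, v, 0) : Unknowns ε) + t • (σ, κ, h, χ))
      (0 : ℝ) (by simpa using hd) hline
  -- The system is quadratic, so along a line it is an explicit polynomial in `t`. The coefficient
  -- of `t` is the derivative, which makes termwise differentiation unnecessary.
  have h2 : ∀ t : ℝ, o.sys (((s, k, v, 0) : Unknowns ε) + t • (σ, κ, h, χ))
      = o.sys (s, k, v, 0) + t • ((σ, o.linθ s v h - σ • o.quot v - κ • o.one, o.eqφ s v χ, o.ev h,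
        o.evDer χ, o.ev₂ χ) : Data ε)
      + t ^ 2 • ((0, (1 / 2 : ℝ) • o.prod h h + o.swirl χ χ - σ • o.quot h,
        o.transport h χ - σ • o.quot₂ χ, 0, 0, 0) : Data ε) := by
    intro t
    simp only [Operators.sys, Operators.eqθ, Operators.eqφ, Operators.linθ, Prod.smul_mk,
      Prod.mk_add_mk, map_add, map_smul, add_apply, zero_add, map_zero,
      smul_apply, o.prod_comm h v, smul_zero, add_zero,
      Prod.mk.injEq, smul_eq_mul]
    refine ⟨by ring, by module, by module, by ring, by ring, by ring⟩
  have h3 : HasDerivAt (fun t : ℝ => o.sys (((s, k, v, 0) : Unknowns ε) + t • (σ, κ, h, χ)))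
      ((σ, o.linθ s v h - σ • o.quot v - κ • o.one, o.eqφ s v χ, o.ev h,
        o.evDer χ, o.ev₂ χ) : Data ε) 0 := by
    simp only [h2]
    have a := ((hasDerivAt_id (0 : ℝ)).smul_const
      ((σ, o.linθ s v h - σ • o.quot v - κ • o.one, o.eqφ s v χ, o.ev h,
        o.evDer χ, o.ev₂ χ) : Data ε)).const_add (o.sys (s, k, v, 0))
    have b := ((hasDerivAt_pow 2 (0 : ℝ))).smul_const
      ((0, (1 / 2 : ℝ) • o.prod h h + o.swirl χ χ - σ • o.quot h,
        o.transport h χ - σ • o.quot₂ χ, 0, 0, 0) : Data ε)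
    refine (a.add b).congr_deriv ?_
    simp
  exact h1.unique h3

/-- Solvability of the linearised equations at a swirl-free flow. -/
structure Operators.Solvable (o : Operators ε) (s : ℝ) (v : M₁ ε .south) : Prop where
  surjθ : ∀ ρ, ∃ h, o.linθ s v h = ρ
  injθ : ∀ h, o.linθ s v h = 0 → h = 0
  ne : ∀ h, o.linθ s v h = o.one → o.ev h ≠ 0
  surjφ : ∀ η a b, ∃ χ, o.eqφ s v χ = η ∧ o.evDer χ = a ∧ o.ev₂ χ = b
  injφ : ∀ χ, o.eqφ s v χ = 0 → o.evDer χ = 0 → o.ev₂ χ = 0 → χ = 0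

theorem Operators.linθ_add (o : Operators ε) (s : ℝ) (v h g : M₁ ε .south) :
    o.linθ s v (h + g) = o.linθ s v h + o.linθ s v g := by
  simp only [Operators.linθ, map_add]; module

theorem Operators.linθ_smul (o : Operators ε) (s : ℝ) (v : M₁ ε .south) (c : ℝ) (h : M₁ ε .south) :
    o.linθ s v (c • h) = c • o.linθ s v h := by
  simp only [Operators.linθ, map_smul]; module

/-- All solutions of the linear `θ`-equation with free `κ` are `h₀ + κ h₁`, where `h₁` is the
response to the constant `1`. As `h₁(0) ≠ 0`, prescribing the value at `0` fixes `κ`; the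
`φ`-equation decouples. -/
theorem Operators.Solvable.bijective {o : Operators ε} {s : ℝ} {v : M₁ ε .south}
    (H : o.Solvable s v) (k : ℝ) : Function.Bijective (fderiv ℝ o.sys (s, k, v, 0)) := by
  obtain ⟨h₁, hh₁⟩ := H.surjθ o.one
  have hne := H.ne h₁ hh₁
  constructor
  · rw [injective_iff_map_eq_zero]
    rintro ⟨σ, κ, h, χ⟩ h0
    rw [o.fderiv_sys] at h0
    simp only [Prod.mk_eq_zero] at h0
    obtain ⟨rfl, hθ, hφ, e1, e2, e3⟩ := h0
    obtain rfl := H.injφ χ hφ e2 e3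
    have hz : h + (-κ) • h₁ = 0 := H.injθ _ (by
      rw [o.linθ_add, o.linθ_smul, hh₁, ← hθ]; module)
    have hκ : κ = 0 := by
      have := congrArg o.ev hz
      rw [map_add, map_smul, e1, map_zero, zero_add, smul_eq_mul] at this
      have := (mul_eq_zero.1 this).resolve_right hne
      linarith
    subst hκ
    have : h = 0 := by simpa using hz
    rw [this]; rfl
  · rintro ⟨σ, ρ, η, a, b, c⟩
    obtain ⟨χ, hχ, hb, hc⟩ := H.surjφ η b c
    obtain ⟨h₀, hh₀⟩ := H.surjθ (ρ + σ • o.quot v)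
    refine ⟨(σ, (a - o.ev h₀) / o.ev h₁, h₀ + ((a - o.ev h₀) / o.ev h₁) • h₁, χ), ?_⟩
    rw [o.fderiv_sys, hχ, hb, hc, o.linθ_add, o.linθ_smul, hh₁, hh₀, map_add, map_smul]
    simp only [Prod.mk.injEq, true_and, and_true, smul_eq_mul]
    refine ⟨by module, ?_⟩
    field_simp
    ring

theorem Operators.Solvable.exists_equiv {o : Operators ε} {s : ℝ} {v : M₁ ε .south}
    (H : o.Solvable s v) (hε : ε < 1 / 2) (k : ℝ) :
    ∃ A : Unknowns ε ≃L[ℝ] Data ε,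
      (A : Unknowns ε →L[ℝ] Data ε) = fderiv ℝ o.sys (s, k, v, 0) := by
  have := M₁.completeSpace hε .south
  obtain ⟨hi, hs⟩ := H.bijective k
  exact ⟨ContinuousLinearEquiv.ofBijective _ (LinearMap.ker_eq_bot.2 hi)
    (LinearMap.range_eq_top.2 hs), ContinuousLinearEquiv.coe_ofBijective _ _ _⟩

end HomNS

namespace HomNS

/-! ## The linearised equations -/

theorem eq_of_hasDerivAt_zero {f : ℝ → ℝ} (h : ∀ x ∈ Ioo (-1 : ℝ) 1, HasDerivAt f 0 x) {x y : ℝ}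
    (hx : x ∈ Ioo (-1 : ℝ) 1) (hy : y ∈ Ioo (-1 : ℝ) 1) : f x = f y :=
  isOpen_Ioo.is_const_of_deriv_eq_zero isPreconnected_Ioo
    (fun z hz => (h z hz).differentiableAt.differentiableWithinAt) (fun z hz => (h z hz).deriv) hx hy

theorem hasDerivAt_ell {x : ℝ} (hx : -1 < x) : HasDerivAt ell (-(1 + x)⁻¹) x := by
  have h1 : (1 + x) / 3 ≠ 0 := by have : 0 < 1 + x := by linarith
                                  positivity
  have h2 : 1 + x ≠ 0 := by have : 0 < 1 + x := by linarith
                            exact this.ne'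
  have h := ((((hasDerivAt_id x).const_add 1).div_const 3).log h1).neg
  refine h.congr_deriv ?_
  simp only [id]
  field_simp

/-- The logarithmic derivative of the integrating factor. -/
noncomputable def rate (s : ℝ) (v : ℝ → ℝ) (x : ℝ) : ℝ := -(s / (1 - x)) + v x / (1 - x ^ 2)

/-- `E` is an integrating factor of the linearised `θ`-equation with the expected behaviour at both
poles. -/
structure IsWeight (s : ℝ) (v E : ℝ → ℝ) : Prop where
  pos : ∀ x ∈ Ioo (-1 : ℝ) 1, 0 < E x
  der : ∀ x ∈ Ioo (-1 : ℝ) 1, HasDerivAt E (rate s v x * E x) x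
  lower : ∃ c > 0, ∀ x ∈ Ioo (-1 : ℝ) 1, c * ((1 - x) ^ s * ell x ^ 2) ≤ E x
  upper : ∃ C > 0, ∀ x ∈ Ioo (-1 : ℝ) 1, E x ≤ C * ((1 - x) ^ s * ell x ^ 2)

theorem memM₁_indicator {ε : ℝ} (hε : ε < 1 / 2) {h g : ℝ → ℝ} {A B D : ℝ}
    (hd : ∀ x ∈ Ioo (-1 : ℝ) 1, HasDerivAt h (g x) x) (hg : ContinuousOn g (Ioo (-1) 1))
    (hA : ∀ x ∈ Ioo (-1 : ℝ) 1, |wVal ε .south x * h x| ≤ A)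
    (hB : ∀ x ∈ Ioo (-1 : ℝ) 1, |wDer ε .south x * g x| ≤ B) (hD : C2B g D) :
    MemM₁ ε .south ((Ioo (-1) 1).indicator h) := by
  set H := (Ioo (-1 : ℝ) 1).indicator h with hH
  have hHh : ∀ x ∈ Ioo (-1 : ℝ) 1, H x = h x := fun x hx => indicator_of_mem hx h
  have hD1 : ∀ x ∈ Ioo (-1 : ℝ) 1, HasDerivAt H (g x) x := fun x hx =>
    (hd x hx).congr_of_eventuallyEq (indicator_eventuallyEq hx)
  have hD1' : ∀ x ∈ Ioo (-1 / 2 : ℝ) (1 / 2), HasDerivAt H (g x) x := fun x hx =>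
    hD1 x (inner_subset_outer hx)
  have h0 : ∀ x, x ∉ Ioo (-1 : ℝ) 1 → H x = 0 := fun x hx => indicator_of_notMem hx h
  have hb0 : BddOn (Ioo (-1) 1) fun x => wVal ε .south x * H x :=
    ⟨A, fun x hx => by simp only [hHh x hx]; exact hA x hx⟩
  have hc1 : ContDiffOn ℝ 1 H (Ioo (-1) 1) :=
    contDiffOn_succ_of_hasDerivAt (n := 0) hD1 (contDiffOn_zero.2 hg)
  refine ⟨h0, continuousOn_Icc_of_weight hε hc1.continuousOn h0 hb0, hc1,
    contDiffOn_succ_of_hasDerivAt (n := 2) hD1' hD.c2, hb0,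
    ⟨B, fun x hx => by simp only [(hD1 x hx).deriv]; exact hB x hx⟩, ⟨D, fun x hx => ?_⟩,
    ⟨D, fun x hx => ?_⟩⟩
  · rw [iteratedDeriv_succ_eqOn hD1' hx, iteratedDeriv_one]; exact hD.le1 x hx
  · rw [iteratedDeriv_succ_eqOn hD1' hx]; exact hD.le2 x hx

/-- Bootstrapping: each differentiation of `h' = ρ - θ h` expresses the next derivative of `h`
through those already bounded by `D`, `M0`, `M1`. -/
theorem exists_c2b_of_linear {ρ θ h : ℝ → ℝ} {A B D : ℝ} (hρ : C2B ρ A) (hθ : C2B θ B)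
    (hh : ∀ x ∈ Ioo (-1 / 2 : ℝ) (1 / 2), |h x| ≤ D)
    (hd : ∀ x ∈ Ioo (-1 / 2 : ℝ) (1 / 2), HasDerivAt h (ρ x - θ x * h x) x) :
    ∃ M, C2B (fun x => ρ x - θ x * h x) M := by
  have hA := hρ.nonneg
  have hB := hθ.nonneg
  have hD0 : 0 ≤ D := (abs_nonneg _).trans (hh 0 half_mem)
  have m : ∀ {a b P Q : ℝ}, |a| ≤ P → |b| ≤ Q → |a * b| ≤ P * Q := fun {a b P Q} ha hb => by
    rw [abs_mul]; exact mul_le_mul ha hb (abs_nonneg _) ((abs_nonneg _).trans ha)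
  set M0 := A + B * D with hM0
  set M1 := A + (B * D + B * M0) with hM1
  set M2 := A + ((B * D + B * M0) + (B * M0 + B * M1)) with hM2
  have b0 : ∀ x ∈ Ioo (-1 / 2 : ℝ) (1 / 2), |ρ x - θ x * h x| ≤ M0 := fun x hx =>
    (abs_sub _ _).trans (add_le_add (hρ.le0 x hx) (m (hθ.le0 x hx) (hh x hx)))
  have b1 : ∀ x ∈ Ioo (-1 / 2 : ℝ) (1 / 2),
      |deriv ρ x - (deriv θ x * h x + θ x * (ρ x - θ x * h x))| ≤ M1 := fun x hx =>
    (abs_sub _ _).trans (add_le_add (hρ.le1 x hx) ((abs_add_le _ _).trans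
      (add_le_add (m (hθ.le1 x hx) (hh x hx)) (m (hθ.le0 x hx) (b0 x hx)))))
  have hd1 : ∀ x ∈ Ioo (-1 / 2 : ℝ) (1 / 2), HasDerivAt (fun x => ρ x - θ x * h x)
      (deriv ρ x - (deriv θ x * h x + θ x * (ρ x - θ x * h x))) x := fun x hx =>
    (hρ.hasDerivAt hx).sub ((hθ.hasDerivAt hx).mul (hd x hx))
  have hch : ContinuousOn h (Ioo (-1 / 2) (1 / 2)) := fun x hx =>
    (hd x hx).continuousAt.continuousWithinAt
  have hM : 0 ≤ M0 ∧ 0 ≤ M1 ∧ 0 ≤ M2 := by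
    refine ⟨by positivity, by positivity, by positivity⟩
  have c0 := hρ.c2.continuousOn
  have c1 := (hρ.c2.deriv_Ioo (m := 1) (by norm_num)).continuousOn
  have t0 := hθ.c2.continuousOn
  have t1 := (hθ.c2.deriv_Ioo (m := 1) (by norm_num)).continuousOn
  have e0 := c0.sub (t0.mul hch)
  have e1 := c1.sub ((t1.mul hch).add (t0.mul e0))
  refine ⟨M0 + M1 + M2, C2B.of_hasDerivAt hd1 (f₂ := fun x => iteratedDeriv 2 ρ x
    - ((iteratedDeriv 2 θ x * h x + deriv θ x * (ρ x - θ x * h x))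
      + (deriv θ x * (ρ x - θ x * h x)
        + θ x * (deriv ρ x - (deriv θ x * h x + θ x * (ρ x - θ x * h x))))))
    (fun x hx => (hρ.hasDerivAt₂ hx).sub (((hθ.hasDerivAt₂ hx).mul (hd x hx)).add
      ((hθ.hasDerivAt hx).mul (hd1 x hx)))) ?_ ?_ ?_ ?_⟩
  · exact hρ.continuousOn₂.sub (((hθ.continuousOn₂.mul hch).add (t1.mul e0)).add
      ((t1.mul e0).add (t0.mul e1)))
  · exact fun x hx => (b0 x hx).trans (by linarith)
  · exact fun x hx => (b1 x hx).trans (by linarith)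
  · intro x hx
    refine ((abs_sub _ _).trans (add_le_add (hρ.le2 x hx) ((abs_add_le _ _).trans (add_le_add
      ((abs_add_le _ _).trans (add_le_add (m (hθ.le2 x hx) (hh x hx)) (m (hθ.le1 x hx) (b0 x hx))))
      ((abs_add_le _ _).trans (add_le_add (m (hθ.le1 x hx) (b0 x hx))
        (m (hθ.le0 x hx) (b1 x hx)))))))).trans ?_
    linarith

section Linearised

variable {ε s : ℝ} {v : M₁ ε .south} {E : ℝ → ℝ}

theorem continuousOn_rate {v : ℝ → ℝ} (s : ℝ) (hv : ContinuousOn v (Ioo (-1) 1)) :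
    ContinuousOn (rate s v) (Ioo (-1) 1) := by
  unfold rate
  refine ContinuousOn.add (ContinuousOn.neg (ContinuousOn.div (by fun_prop) (by fun_prop)
    fun x hx => ?_)) (hv.div (by fun_prop) fun x hx => (one_sub_sq_pos hx).ne')
  have := hx.2
  exact ne_of_gt (by linarith)

theorem exists_c2b_rate (h0 : 0 < ε) (h1 : ε < 1 / 2) (s : ℝ) (v : M₁ ε .south) :
    ∃ A, C2B (rate s v.fn) A := by
  obtain ⟨G, hG⟩ := exists_C2B (contDiffOn_inv_one_sub_sq 2) le_rfl
  obtain ⟨H, hH⟩ := exists_C2B (f := fun x : ℝ => -(s / (1 - x))) (n := 2) (by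
    refine ContDiffOn.neg (ContDiffOn.div (by fun_prop) (by fun_prop) fun x hx => ?_)
    have := hx.2
    exact ne_of_gt (by linarith)) le_rfl
  have hP := (v.c2b h0 h1).mul hG
  refine ⟨H + 4 * (36 * ‖v‖ * G), ?_⟩
  refine C2B.of_hasDerivAt (f₁ := fun x => deriv (fun x : ℝ => -(s / (1 - x))) x
      + deriv (fun x => v.fn x * (1 - x ^ 2)⁻¹) x)
    (f₂ := fun x => iteratedDeriv 2 (fun x : ℝ => -(s / (1 - x))) x
      + iteratedDeriv 2 (fun x => v.fn x * (1 - x ^ 2)⁻¹) x)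
    (fun x hx => (hH.hasDerivAt hx).add (hP.hasDerivAt hx))
    (fun x hx => (hH.hasDerivAt₂ hx).add (hP.hasDerivAt₂ hx))
    (hH.continuousOn₂.add hP.continuousOn₂)
    (fun x hx => (abs_add_le _ _).trans (add_le_add (hH.le0 x hx) (hP.le0 x hx)))
    (fun x hx => (abs_add_le _ _).trans (add_le_add (hH.le1 x hx) (hP.le1 x hx)))
    (fun x hx => (abs_add_le _ _).trans (add_le_add (hH.le2 x hx) (hP.le2 x hx)))

/-- Exhibits the operator as a first-order scalar one, for which `IsWeight` supplies the integrating
factor. -/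
theorem Operators.linθ_fn (o : Operators ε) (s : ℝ) (v h : M₁ ε .south) {x : ℝ}
    (hx : x ∈ Ioo (-1 : ℝ) 1) :
    (o.linθ s v h).fn x = deriv h.fn x + rate s v.fn x * h.fn x := by
  rw [Operators.linθ, Y₁.fn_add, Y₁.fn_sub, Y₁.fn_smul, Pi.add_apply, Pi.sub_apply, Pi.smul_apply,
    o.d_fn _ x hx, o.quot_fn _ x hx, o.prod_fn _ _ x hx, smul_eq_mul, rate]
  ring

theorem Operators.eqφ_fn (o : Operators ε) (s : ℝ) (v : M₁ ε .south) (χ : M₂ ε) {x : ℝ}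
    (hx : x ∈ Ioo (-1 : ℝ) 1) :
    (o.eqφ s v χ).fn x
      = iteratedDeriv 2 χ.fn x + (rate s v.fn x - 2 * x / (1 - x ^ 2)) * deriv χ.fn x := by
  rw [Operators.eqφ, Y₂.fn_add, Y₂.fn_sub, Y₂.fn_sub, Y₂.fn_smul, Pi.add_apply, Pi.sub_apply,
    Pi.sub_apply, Pi.smul_apply, o.d₂_fn _ x hx, o.drift_fn _ x hx, o.quot₂_fn _ x hx,
    o.transport_fn _ _ x hx, smul_eq_mul, rate]
  ring

theorem IsWeight.continuousOn {v : ℝ → ℝ} (hE : IsWeight s v E) : ContinuousOn E (Ioo (-1) 1) :=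
  fun x hx => (hE.der x hx).continuousAt.continuousWithinAt

/-- `E ρ` is integrable up to the pole `x = 1`, with the expected rate. -/
theorem IsWeight.integral_le {v : ℝ → ℝ} (hE : IsWeight s v E) (hs : 0 ≤ s)
    (h1 : ε < 1 / 2) : ∃ K, 0 ≤ K ∧ ∀ (ρ : ℝ → ℝ) (N : ℝ), ContinuousOn ρ (Ioo (-1) 1) →
      (∀ x ∈ Ioo (-1 : ℝ) 1, |wDer ε .south x * ρ x| ≤ N) → ∀ x ∈ Ioo (-1 : ℝ) 1,
      IntervalIntegrable (fun y => E y * ρ y) MeasureTheory.volume x 1 ∧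
      |∫ y in x..1, E y * ρ y| ≤ K * N * ((1 - x) ^ (s + (1 - 2 * ε)) * ell x) := by
  obtain ⟨C, hC0, hC⟩ := hE.upper
  set p := s + (1 - 2 * ε) with hp
  have hp0 : 0 < p := by rw [hp]; linarith
  -- The primitive used is `-(1-y)^p ell y`. After removal of `(1-y)^(p-1) / (1+y)` from the
  -- integrand and from its derivative, domination amounts to `c₁ ≤ p ell(y) (1+y) + (1-y)`: the
  -- first term gives `p/3` for `y ≥ 0`, the second gives `1` for `y ≤ 0`.
  set c₁ := min 1 (p / 3) with hc₁
  have hc0 : 0 < c₁ := lt_min one_pos (by positivity)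
  refine ⟨C / c₁, by positivity, fun ρ N hρc hρ x hx => ?_⟩
  have hN : 0 ≤ N := (abs_nonneg _).trans (hρ 0 zero_mem_outer)
  have hsub : ∀ {y}, y ∈ Ioo x 1 → y ∈ Ioo (-1 : ℝ) 1 := fun hy => ⟨hx.1.trans hy.1, hy.2⟩
  obtain ⟨hi, hb⟩ := intervalIntegrable_of_majorant (g := fun y => E y * ρ y) (a := x) (b := 1)
    hx.2.le (G := fun y => C / c₁ * N * (-((1 - y) ^ p * ell y)))
    (G' := fun y => C / c₁ * N * (p * (1 - y) ^ (p - 1) * ell y + (1 - y) ^ p * (1 + y)⁻¹))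
    (by
      refine continuousOn_const.mul (ContinuousOn.neg (ContinuousOn.mul
        (ContinuousOn.rpow_const (by fun_prop) fun _ _ => Or.inr hp0.le) fun y hy => ?_))
      exact (hasDerivAt_ell (hx.1.trans_le hy.1)).continuousAt.continuousWithinAt)
    (fun y hy => by
      have := (((hasDerivAt_one_sub_rpow p hy.2).mul (hasDerivAt_ell
        (hx.1.trans hy.1))).neg).const_mul (C / c₁ * N)
      exact this.congr_deriv (by ring))
    ((hE.continuousOn.mul hρc).mono fun y hy => hsub hy)
    (fun y hy => by
      have hy' := hsub hy
      have y1 : 0 < 1 - y := by linarith [hy'.2]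
      have y2 : 0 < 1 + y := by linarith [hy'.1]
      have hl := ell_pos hy'
      have hw : 0 < wDer ε .south y := wDer_pos ε .south hy'
      have hr : |ρ y| ≤ N / wDer ε .south y := by
        have := hρ y hy'
        rw [abs_mul, abs_of_pos hw] at this
        rw [le_div_iff₀ hw]; linarith
      have e1 : (1 - y) ^ s / (1 - y) ^ (2 * ε) = (1 - y) ^ (p - 1) := by
        rw [← Real.rpow_sub y1]; congr 1; rw [hp]; ring
      have e2 : (1 - y) ^ p = (1 - y) ^ (p - 1) * (1 - y) := by
        rw [← Real.rpow_add_one y1.ne']; congr 1; ring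
      have hq : 0 < (1 - y) ^ (p - 1) := by positivity
      have key : c₁ * (1 + y)⁻¹ ≤ p * ell y + (1 - y) * (1 + y)⁻¹ := by
        rw [← div_eq_mul_inv, ← div_eq_mul_inv, div_le_iff₀ y2, add_mul, div_mul_cancel₀ _ y2.ne']
        have k1 : c₁ ≤ 1 := min_le_left _ _
        have k2 : c₁ ≤ p / 3 := min_le_right _ _
        have hg := ell_ge hy'
        rcases le_total 0 y with h | h
        · have a : p / 3 ≤ p * ell y := by nlinarith
          have b : 0 ≤ p * ell y := by positivity
          nlinarith
        · have b : 0 ≤ p * ell y * (1 + y) := by positivity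
          linarith
      calc |E y * ρ y| = E y * |ρ y| := by rw [abs_mul, abs_of_pos (hE.pos y hy')]
        _ ≤ C * ((1 - y) ^ s * ell y ^ 2) * (N / wDer ε .south y) := by
          gcongr
          exact hC y hy'
        _ = C * N * ((1 - y) ^ (p - 1) * (1 + y)⁻¹) := by
          rw [wDer_south, ← e1]; field_simp
        _ = C / c₁ * N * ((1 - y) ^ (p - 1) * (c₁ * (1 + y)⁻¹)) := by field_simp
        _ ≤ C / c₁ * N * ((1 - y) ^ (p - 1) * (p * ell y + (1 - y) * (1 + y)⁻¹)) := by gcongr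
        _ = _ := by rw [e2]; ring)
  refine ⟨hi, hb.trans (le_of_eq ?_)⟩
  simp only [sub_self, Real.zero_rpow hp0.ne', zero_mul, neg_zero, mul_zero]
  ring

/-- Solvability of the linearised `θ`-equation, with the explicit solution. -/
theorem IsWeight.exists_linθ_eq (hE : IsWeight s v.fn E) (hs : 0 ≤ s) (h0 : 0 < ε) (h1 : ε < 1 / 2)
    (o : Operators ε) (ρ : Y₁ ε) : ∃ h : M₁ ε .south, o.linθ s v h = ρ ∧
      ∀ x ∈ Ioo (-1 : ℝ) 1, h.fn x = (E x)⁻¹ * ∫ y in (1 : ℝ)..x, E y * ρ.fn y := by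
  obtain ⟨K, hK0, hK⟩ := hE.integral_le (ε := ε) hs h1
  obtain ⟨c, hc0, hc⟩ := hE.lower
  have hKρ := hK ρ.fn ‖ρ‖ ρ.mem.cont fun x hx => ρ.val_le hx
  -- Integration has to start at `1`: a different constant would add a multiple of `1/E`, which does
  -- not vanish at that pole because `s ≥ 0`.
  set h : ℝ → ℝ := fun x => (E x)⁻¹ * ∫ y in (1 : ℝ)..x, E y * ρ.fn y with hh
  have hder : ∀ x ∈ Ioo (-1 : ℝ) 1, HasDerivAt h (ρ.fn x - rate s v.fn x * h x) x := by
    intro x hx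
    have hEx := (hE.pos x hx).ne'
    have a := (hE.der x hx).inv hEx
    have b := hasDerivAt_integral_Ioo (hE.continuousOn.mul ρ.mem.cont) (hKρ x hx).1.symm hx
    refine (a.mul b).congr_deriv ?_
    simp only [hh, Pi.mul_apply, Pi.inv_apply]
    field_simp
    ring
  have hcont : ContinuousOn h (Ioo (-1) 1) := fun x hx =>
    (hder x hx).continuousAt.continuousWithinAt
  have hval : ∀ x ∈ Ioo (-1 : ℝ) 1, |wVal ε .south x * h x| ≤ K * ‖ρ‖ / c := by
    intro x hx
    have x1 : 0 < 1 - x := by linarith [hx.2]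
    have hl := ell_pos hx
    have hb := (hKρ x hx).2
    have hEx := hE.pos x hx
    have e1 : (1 - x) ^ (s + (1 - 2 * ε)) * (1 - x) ^ (-1 + 2 * ε) = (1 - x) ^ s := by
      rw [← Real.rpow_add x1]; congr 1; ring
    have hps : 0 < (1 - x) ^ s := by positivity
    have hpe : 0 < (1 - x) ^ (-1 + 2 * ε) := by positivity
    rw [abs_mul, abs_wVal_south ε hx, hh]
    simp only
    rw [intervalIntegral.integral_symm, abs_mul, abs_neg, abs_inv, abs_of_pos hEx,
      le_div_iff₀ hc0]
    have hEi : (E x)⁻¹ ≤ (c * ((1 - x) ^ s * ell x ^ 2))⁻¹ :=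
      inv_anti₀ (by positivity) (hc x hx)
    calc ell x * (1 - x) ^ (-1 + 2 * ε) * ((E x)⁻¹ * |∫ y in x..1, E y * ρ.fn y|) * c
        ≤ ell x * (1 - x) ^ (-1 + 2 * ε) * ((c * ((1 - x) ^ s * ell x ^ 2))⁻¹ *
          (K * ‖ρ‖ * ((1 - x) ^ (s + (1 - 2 * ε)) * ell x))) * c := by
          gcongr
      _ = K * ‖ρ‖ := by
          rw [← e1]
          field_simp
  have hg : ContinuousOn (fun x => ρ.fn x - rate s v.fn x * h x) (Ioo (-1) 1) :=
    ρ.mem.cont.sub ((continuousOn_rate s v.mem.c1.continuousOn).mul hcont)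
  have hwd : ∀ x ∈ Ioo (-1 : ℝ) 1, |wDer ε .south x * (ρ.fn x - rate s v.fn x * h x)|
      ≤ ‖ρ‖ + (|s| * (3 * (K * ‖ρ‖ / c)) + 2 * (‖v‖ * (K * ‖ρ‖ / c))) := by
    intro x hx
    have e : wDer ε .south x * (ρ.fn x - rate s v.fn x * h x) = wDer ε .south x * ρ.fn x
        - (-(s * (wDer ε .south x * (h x / (1 - x))))
          + wDer ε .south x * (v.fn x * h x / (1 - x ^ 2))) := by
      rw [rate]; ring
    rw [e]
    refine (abs_sub _ _).trans (add_le_add (ρ.val_le hx) ((abs_add_le _ _).trans (add_le_add ?_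
      (wDer_mul_prod_le h0 h1 hx (v.val_le hx) (hval x hx)))))
    rw [abs_neg, abs_mul]
    exact mul_le_mul_of_nonneg_left (wDer_mul_quot_le hx (hval x hx)) (abs_nonneg _)
  obtain ⟨B, hB⟩ := exists_c2b_rate h0 h1 s v
  have hρ2 : C2B ρ.fn (36 * ‖ρ‖) := by
    refine ⟨ρ.mem.c2, fun x hx => ?_, fun x hx => (ρ.der_le hx).trans (by linarith [norm_nonneg ρ]),
      fun x hx => (ρ.der2_le hx).trans (by linarith [norm_nonneg ρ])⟩
    have := abs_le_of_weight (by norm_num) (wDer_inner_ge h0 h1 hx)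
      (ρ.val_le (inner_subset_outer hx))
    linarith
  obtain ⟨M, hM⟩ := exists_c2b_of_linear (h := h) hρ2 hB (D := 6 * (K * ‖ρ‖ / c)) (fun x hx => by
      have hx' := inner_subset_outer hx
      refine (abs_le_of_wVal hx' (hval x hx')).trans ?_
      have a := one_sub_rpow_le_two (r := 1 - 2 * ε) (by linarith) (by linarith) hx'
      have b := ell_ge hx'
      have : (1 - x) ^ (1 - 2 * ε) / ell x ≤ 6 := by
        rw [div_le_iff₀ (ell_pos hx')]; linarith
      rw [mul_comm 6]
      gcongr)
    (fun x hx => hder x (inner_subset_outer hx))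
  refine ⟨M₁.mk _ (memM₁_indicator h1 hder hg hval hwd hM), ?_, fun x hx => indicator_of_mem hx h⟩
  refine Y₁.ext_on fun x hx => ?_
  rw [o.linθ_fn s v _ hx, M₁.fn_mk, (indicator_eventuallyEq hx).deriv_eq, (hder x hx).deriv,
    indicator_of_mem hx]
  ring

/-- The bounds `(1-x)^s ell²` on `E` and `(1-x)^(1-2ε) / ell` on `h` multiply to something vanishing
at `x = 1`. This is the boundary condition that replaces an initial value in the uniqueness
arguments. -/
theorem IsWeight.tendsto_mul (hE : IsWeight s v.fn E) (hs : 0 ≤ s) (h1 : ε < 1 / 2)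
    (h : M₁ ε .south) : Tendsto (fun x => E x * h.fn x) (𝓝[<] 1) (𝓝 0) := by
  obtain ⟨C, hC0, hC⟩ := hE.upper
  have hp : 0 < s + (1 - 2 * ε) := by linarith
  refine squeeze_zero_norm' (a := fun x => 3 * C * ‖h‖ * (1 - x) ^ (s + (1 - 2 * ε))) ?_ ?_
  · have : Ioi (0 : ℝ) ∈ 𝓝[<] (1 : ℝ) := mem_nhdsWithin_of_mem_nhds (Ioi_mem_nhds (by norm_num))
    filter_upwards [self_mem_nhdsWithin, this] with x hx1 hx0
    have hx0' : (0 : ℝ) < x := hx0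
    have hx1' : x < 1 := hx1
    have hx : x ∈ Ioo (-1 : ℝ) 1 := ⟨by linarith, hx1⟩
    have x1 : 0 < 1 - x := by linarith
    have hl := ell_pos hx
    rw [Real.norm_eq_abs, abs_mul, abs_of_pos (hE.pos x hx)]
    calc E x * |h.fn x| ≤ C * ((1 - x) ^ s * ell x ^ 2) * (‖h‖ * ((1 - x) ^ (1 - 2 * ε) / ell x)) := by
          gcongr
          · exact hC x hx
          · exact abs_le_of_wVal hx (h.val_le hx)
      _ = C * ‖h‖ * (1 - x) ^ (s + (1 - 2 * ε)) * ell x := by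
          rw [Real.rpow_add x1]; field_simp
      _ ≤ C * ‖h‖ * (1 - x) ^ (s + (1 - 2 * ε)) * 3 := by
          gcongr
          exact ell_le_three hx0'.le hx1'
      _ = _ := by ring
  · have : ContinuousAt (fun x : ℝ => 3 * C * ‖h‖ * (1 - x) ^ (s + (1 - 2 * ε))) 1 :=
      continuousAt_const.mul (ContinuousAt.rpow_const (by fun_prop) (Or.inr hp.le))
    have h := this.tendsto
    simp only [sub_self, Real.zero_rpow hp.ne', mul_zero] at h
    exact h.mono_left nhdsWithin_le_nhds

theorem IsWeight.hasDerivAt_mul (hE : IsWeight s v.fn E) (o : Operators ε) (h : M₁ ε .south)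
    {x : ℝ} (hx : x ∈ Ioo (-1 : ℝ) 1) :
    HasDerivAt (fun x => E x * h.fn x) (E x * (o.linθ s v h).fn x) x := by
  refine ((hE.der x hx).mul (h.mem.c1.hasDerivAt_Ioo one_ne_zero hx)).congr_deriv ?_
  rw [o.linθ_fn s v h hx]; ring

/-- A function with constant-sign derivative `c·E`, `E > 0`, vanishing at `0` and at `1`, forces
`c = 0`. -/
theorem eq_zero_of_hasDerivAt_of_tendsto {f E : ℝ → ℝ} {c : ℝ}
    (hE : ∀ x ∈ Ioo (-1 : ℝ) 1, 0 < E x) (hf : ∀ x ∈ Ioo (-1 : ℝ) 1, HasDerivAt f (c * E x) x)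
    (h0 : f 0 = 0) (h1 : Tendsto f (𝓝[<] 1) (𝓝 0)) : c = 0 := by
  by_contra hc
  have hg : ∀ x ∈ Ioo (-1 : ℝ) 1, HasDerivAt (fun x => c * f x) (c * (c * E x)) x := fun x hx =>
    (hf x hx).const_mul c
  have hmono : StrictMonoOn (fun x => c * f x) (Ioo (-1) 1) := by
    refine strictMonoOn_of_deriv_pos (convex_Ioo _ _)
      (fun x hx => (hg x hx).continuousAt.continuousWithinAt) fun x hx => ?_
    rw [interior_Ioo] at hx
    rw [(hg x hx).deriv, ← mul_assoc]
    exact mul_pos (mul_self_pos.2 hc) (hE x hx)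
  have ht : Tendsto (fun x => c * f x) (𝓝[<] 1) (𝓝 (c * 0)) := h1.const_mul c
  have hle : c * f (1 / 2) ≤ c * 0 := by
    refine ge_of_tendsto ht ?_
    have : Ioi (1 / 2 : ℝ) ∈ 𝓝[<] (1 : ℝ) := mem_nhdsWithin_of_mem_nhds (Ioi_mem_nhds (by norm_num))
    filter_upwards [self_mem_nhdsWithin, this] with x hx1 hx0
    have hx0' : (1 / 2 : ℝ) < x := hx0
    exact (hmono ⟨by norm_num, by norm_num⟩ ⟨by linarith, hx1⟩ hx0').le
  have := hmono zero_mem_outer (⟨by norm_num, by norm_num⟩ : (1 / 2 : ℝ) ∈ Ioo (-1 : ℝ) 1)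
    (by norm_num)
  simp only [h0, mul_zero] at this hle
  linarith

/-- For a kernel element `E h` is constant, and its limit at `x = 1` is zero. -/
theorem IsWeight.linθ_injective (hE : IsWeight s v.fn E) (hs : 0 ≤ s) (h1 : ε < 1 / 2)
    (o : Operators ε) {h : M₁ ε .south} (hh : o.linθ s v h = 0) : h = 0 := by
  have hd : ∀ x ∈ Ioo (-1 : ℝ) 1, HasDerivAt (fun x => E x * h.fn x) 0 x := fun x hx => by
    have := hE.hasDerivAt_mul o h hx
    rwa [hh, Y₁.fn_zero, Pi.zero_apply, mul_zero] at this
  have hc : ∀ x ∈ Ioo (-1 : ℝ) 1, E x * h.fn x = E 0 * h.fn 0 := fun x hx =>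
    eq_of_hasDerivAt_zero hd hx zero_mem_outer
  have ht : Tendsto (fun x => E x * h.fn x) (𝓝[<] 1) (𝓝 (E 0 * h.fn 0)) := by
    refine tendsto_const_nhds.congr' ?_
    have : Ioi (-1 : ℝ) ∈ 𝓝[<] (1 : ℝ) := mem_nhdsWithin_of_mem_nhds (Ioi_mem_nhds (by norm_num))
    filter_upwards [self_mem_nhdsWithin, this] with x hx1 hx0
    exact (hc x ⟨hx0, hx1⟩).symm
  have hz := tendsto_nhds_unique ht (hE.tendsto_mul hs h1 h)
  refine M₁.ext_on fun x hx => ?_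
  have := hc x hx
  rw [hz] at this
  rw [M₁.fn_zero, Pi.zero_apply]
  exact (mul_eq_zero.1 this).resolve_left (hE.pos x hx).ne'

/-- Here `(E h)' = E > 0` while `E h` tends to `0` at `x = 1`, so it cannot vanish at `0` as well.
For the background this says `V^{2b}(0) ≠ 0`, so the value at `0` can serve as the coordinate along
`V^{2b}`. -/
theorem IsWeight.ev_ne_zero (hE : IsWeight s v.fn E) (hs : 0 ≤ s) (h1 : ε < 1 / 2)
    (o : Operators ε) {h : M₁ ε .south} (hh : o.linθ s v h = o.one) : o.ev h ≠ 0 := by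
  intro h0
  rw [o.ev_fn] at h0
  refine one_ne_zero (α := ℝ) (eq_zero_of_hasDerivAt_of_tendsto (f := fun x => E x * h.fn x) hE.pos
    (fun x hx => ?_) (by simp [h0]) (hE.tendsto_mul hs h1 h))
  have := hE.hasDerivAt_mul o h hx
  rw [hh, o.one_fn x hx] at this
  exact this.congr_deriv (by ring)

end Linearised

end HomNS

namespace HomNS

/-! ### The linearised `φ`-equation -/

theorem memM₂_indicator {ε : ℝ} {h q r : ℝ → ℝ} {A B D : ℝ}
    (hd : ∀ x ∈ Ioo (-1 : ℝ) 1, HasDerivAt h (q x) x)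
    (hq : ∀ x ∈ Ioo (-1 : ℝ) 1, HasDerivAt q (r x) x) (hr : ContinuousOn r (Ioo (-1) 1))
    (hA : ∀ x ∈ Ioo (-1 : ℝ) 1, |(1 - x ^ 2) ^ ε * h x| ≤ A)
    (hB : ∀ x ∈ Ioo (-1 : ℝ) 1, |(1 - x ^ 2) ^ (1 + ε) * q x| ≤ B)
    (hD : ∀ x ∈ Ioo (-1 : ℝ) 1, |(1 - x ^ 2) ^ (2 + ε) * r x| ≤ D) :
    MemM₂ ε ((Ioo (-1) 1).indicator h) := by
  have hHh : ∀ x ∈ Ioo (-1 : ℝ) 1, (Ioo (-1 : ℝ) 1).indicator h x = h x := fun x hx =>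
    indicator_of_mem hx h
  have hD1 : ∀ x ∈ Ioo (-1 : ℝ) 1, HasDerivAt ((Ioo (-1 : ℝ) 1).indicator h) (q x) x :=
    fun x hx => (hd x hx).congr_of_eventuallyEq (indicator_eventuallyEq hx)
  have hc : ContDiffOn ℝ ((0 : ℕ) + 1) q (Ioo (-1) 1) :=
    contDiffOn_succ_of_hasDerivAt hq (contDiffOn_zero.2 hr)
  refine ⟨fun x hx => indicator_of_notMem hx h,
    contDiffOn_succ_of_hasDerivAt (n := 1) hD1 (by simpa using hc),
    ⟨A, fun x hx => by simp only [hHh x hx]; exact hA x hx⟩,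
    ⟨B, fun x hx => by simp only [(hD1 x hx).deriv]; exact hB x hx⟩,
    ⟨D, fun x hx => by
      simp only [iteratedDeriv_two_eq hD1 hx (hq x hx)]
      exact hD x hx⟩⟩

theorem two_inv_le_rpow_neg {r y : ℝ} (h0 : 0 ≤ r) (h1 : r ≤ 1) (y0 : 0 < y) (y2 : y ≤ 2) :
    1 / 2 ≤ y ^ (-r) := by
  have : y ^ r ≤ 2 := by
    calc y ^ r ≤ 2 ^ r := Real.rpow_le_rpow y0.le y2 h0
      _ ≤ 2 ^ (1 : ℝ) := Real.rpow_le_rpow_of_exponent_le (by norm_num) h1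
      _ = 2 := by norm_num
  rw [Real.rpow_neg y0.le, one_div]
  exact inv_anti₀ (by positivity) this

section Azimuthal

variable {ε s : ℝ} {v : M₁ ε .south} {E : ℝ → ℝ}

/-- The growth rate of the primitive of the weighted right-hand side of the `φ`-equation. -/
noncomputable def growth (ε s x : ℝ) : ℝ := (1 - x) ^ (s - ε) * (1 + x) ^ (-ε) * ell x ^ 2

/-- The factor `18` comes from `(1+x)^(-ε) ≥ 1/2` and `ell² ≥ 1/9`. -/
theorem growth_ge_right (h0 : 0 < ε) (h1 : ε < 1 / 2) {x : ℝ} (hx0 : 0 ≤ x)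
    (hx1 : x < 1) : (1 - x) ^ (s - ε) ≤ 18 * growth ε s x := by
  have hx : x ∈ Ioo (-1 : ℝ) 1 := ⟨by linarith, hx1⟩
  have a := two_inv_le_rpow_neg (y := 1 + x) h0.le (by linarith) (by linarith) (by linarith)
  have b := ell_ge hx
  have x1 : 0 < 1 - x := by linarith
  have c : 0 < (1 - x) ^ (s - ε) := by positivity
  have d : 1 / 9 ≤ ell x ^ 2 := by nlinarith
  have e : 1 / 18 ≤ (1 + x) ^ (-ε) * ell x ^ 2 := by nlinarith
  rw [growth, mul_assoc]
  nlinarith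

theorem growth_ge_left (hs : 0 ≤ s) (hsε : s < ε) (h1 : ε < 1 / 2) {x : ℝ} (hx0 : x ≤ 0)
    (hx1 : -1 < x) : (1 + x) ^ (-ε) * ell x ^ 2 ≤ 2 * growth ε s x := by
  have a := two_inv_le_rpow_neg (r := ε - s) (y := 1 - x) (by linarith) (by linarith)
    (by linarith) (by linarith)
  rw [neg_sub] at a
  have x1 : 0 < 1 + x := by linarith
  have c : 0 ≤ (1 + x) ^ (-ε) * ell x ^ 2 := by positivity
  rw [growth, mul_assoc]
  nlinarith

theorem one_le_growth (hs : 0 ≤ s) (hsε : s < ε) (h1 : ε < 1 / 2) {x : ℝ}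
    (hx : x ∈ Ioo (-1 : ℝ) 1) : 1 ≤ 18 * growth ε s x := by
  have x1 : 0 < 1 - x := by linarith [hx.2]
  have x2 : 0 < 1 + x := by linarith [hx.1]
  rcases le_total 0 x with h | h
  · refine le_trans ?_ (growth_ge_right (hs.trans_lt hsε) h1 h hx.2)
    exact Real.one_le_rpow_of_pos_of_le_one_of_nonpos x1 (by linarith) (by linarith)
  · have a : 1 ≤ (1 + x) ^ (-ε) :=
      Real.one_le_rpow_of_pos_of_le_one_of_nonpos x2 (by linarith) (by linarith)
    have b := ell_ge hx
    have d : 1 / 9 ≤ ell x ^ 2 := by nlinarith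
    have := growth_ge_left hs hsε h1 h hx.1
    nlinarith

/-- On the right `ell` is at most `3` and the majorant `(1-y)^(s-ε-1)` integrates to `(1-x)^(s-ε)`,
a negative power since `s < ε`. On the left `(1+y)^(-1-ε) ell²` is below the derivative of
`-(1+y)^(-ε) ell² / ε`, the extra term from differentiating `ell²` having the good sign. The
constants are `162 = 9·18` and `4 = 2·2`. -/
theorem abs_integral_le_growth (hs : 0 ≤ s) (hsε : s < ε) (h1 : ε < 1 / 2) {g : ℝ → ℝ} {N : ℝ}
    (hg : ContinuousOn g (Ioo (-1) 1))
    (hN : ∀ x ∈ Ioo (-1 : ℝ) 1, |g x| ≤ N * ((1 - x ^ 2) ^ (-1 - ε) * ((1 - x) ^ s * ell x ^ 2)))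
    {x : ℝ} (hx : x ∈ Ioo (-1 : ℝ) 1) :
    |∫ y in (0 : ℝ)..x, g y| ≤ N * (162 / (ε - s) + 4 / ε) * growth ε s x := by
  have h0 : 0 < ε := hs.trans_lt hsε
  have hd : 0 < ε - s := by linarith
  have hN0 : 0 ≤ N := by
    have := (abs_nonneg _).trans (hN 0 zero_mem_outer)
    have hl := ell_pos zero_mem_outer
    refine nonneg_of_mul_nonneg_left this ?_
    simp only [ne_eq, OfNat.ofNat_ne_zero, not_false_eq_true, zero_pow, sub_zero, Real.one_rpow]
    positivity
  have hg0 : 0 ≤ growth ε s x := by linarith [one_le_growth hs hsε h1 hx]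
  rcases le_total 0 x with h | h
  · obtain ⟨-, hb⟩ := intervalIntegrable_of_majorant (g := g) (a := 0) (b := x) h
      (G := fun y => 9 * N / (ε - s) * (1 - y) ^ (s - ε))
      (G' := fun y => 9 * N / (ε - s) * -((s - ε) * (1 - y) ^ (s - ε - 1)))
      (fun y hy => ((hasDerivAt_one_sub_rpow (s - ε) (hy.2.trans_lt hx.2)).const_mul
        _).continuousAt.continuousWithinAt)
      (fun y hy => (hasDerivAt_one_sub_rpow (s - ε) (hy.2.trans hx.2)).const_mul _)
      (hg.mono fun y hy => ⟨by linarith [hy.1], hy.2.trans hx.2⟩)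
      (fun y hy => by
        have hy' : y ∈ Ioo (-1 : ℝ) 1 := ⟨by linarith [hy.1], hy.2.trans hx.2⟩
        have y1 : 0 < 1 - y := by linarith [hy'.2]
        have hl := ell_pos hy'
        calc |g y| ≤ N * ((1 - y ^ 2) ^ (-1 - ε) * ((1 - y) ^ s * ell y ^ 2)) := hN y hy'
          _ ≤ N * ((1 - y) ^ (-1 - ε) * ((1 - y) ^ s * 3 ^ 2)) := by
              have e1 := one_sub_sq_rpow_le_left (r := -1 - ε) (by linarith) hy.1.le hy'.2
              have e2 := ell_le_three hy.1.le hy'.2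
              exact mul_le_mul_of_nonneg_left (mul_le_mul e1 (by gcongr) (by positivity)
                (by positivity)) hN0
          _ = 9 * N * ((1 - y) ^ (-1 - ε) * (1 - y) ^ s) := by ring
          _ = 9 * N * (1 - y) ^ (s - ε - 1) := by
              rw [← Real.rpow_add y1]; congr 2; ring
          _ = _ := by field_simp; ring)
    refine hb.trans ?_
    have hr := growth_ge_right (s := s) h0 h1 h hx.2
    have x1 : 0 < 1 - x := by linarith [hx.2]
    simp only [sub_zero, Real.one_rpow, mul_one]
    calc 9 * N / (ε - s) * (1 - x) ^ (s - ε) - 9 * N / (ε - s)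
        ≤ 9 * N / (ε - s) * (1 - x) ^ (s - ε) := by
          have : 0 ≤ 9 * N / (ε - s) := by positivity
          linarith
      _ ≤ 9 * N / (ε - s) * (18 * growth ε s x) := by gcongr
      _ = N * (162 / (ε - s)) * growth ε s x := by ring
      _ ≤ _ := by
          gcongr
          have : 0 ≤ 4 / ε := by positivity
          linarith
  · obtain ⟨-, hb⟩ := intervalIntegrable_of_majorant (g := g) (a := x) (b := 0) h
      (G := fun y => 2 * N / ε * -((1 + y) ^ (-ε) * ell y ^ 2))
      (G' := fun y => 2 * N / ε * -(-ε * (1 + y) ^ (-ε - 1) * ell y ^ 2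
        + (1 + y) ^ (-ε) * (2 * ell y * -(1 + y)⁻¹)))
      (fun y hy => by
        have hy1 : -1 < y := hx.1.trans_le hy.1
        exact ((((hasDerivAt_one_add_rpow (-ε) hy1).continuousAt.mul
          ((hasDerivAt_ell hy1).continuousAt.pow 2)).neg).const_mul _).continuousWithinAt)
      (fun y hy => by
        have hy1 : -1 < y := hx.1.trans hy.1
        refine ((((hasDerivAt_one_add_rpow (-ε) hy1).mul
          ((hasDerivAt_ell hy1).pow 2)).neg).const_mul _).congr_deriv ?_
        simp)
      (hg.mono fun y hy => ⟨hx.1.trans hy.1, by linarith [hy.2]⟩)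
      (fun y hy => by
        have hy' : y ∈ Ioo (-1 : ℝ) 1 := ⟨hx.1.trans hy.1, by linarith [hy.2]⟩
        have y1 : 0 < 1 - y := by linarith [hy'.2]
        have y2 : 0 < 1 + y := by linarith [hy'.1]
        have hl := ell_pos hy'
        calc |g y| ≤ N * ((1 - y ^ 2) ^ (-1 - ε) * ((1 - y) ^ s * ell y ^ 2)) := hN y hy'
          _ ≤ N * ((1 + y) ^ (-1 - ε) * (2 * ell y ^ 2)) := by
              have e1 := one_sub_sq_rpow_le_right (r := -1 - ε) (by linarith) hy.2.le hy'.1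
              have e2 := one_sub_rpow_le_two hs (by linarith) hy'
              exact mul_le_mul_of_nonneg_left (mul_le_mul e1 (by gcongr) (by positivity)
                (by positivity)) hN0
          _ = 2 * N / ε * (ε * (1 + y) ^ (-1 - ε) * ell y ^ 2) := by field_simp
          _ ≤ 2 * N / ε * (ε * (1 + y) ^ (-1 - ε) * ell y ^ 2
              + (1 + y) ^ (-ε) * (2 * ell y * (1 + y)⁻¹)) := by
              gcongr
              have : 0 ≤ (1 + y) ^ (-ε) * (2 * ell y * (1 + y)⁻¹) := by positivity
              linarith
          _ = _ := by rw [show -ε - 1 = -1 - ε by ring]; ring)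
    rw [intervalIntegral.integral_symm, abs_neg]
    refine hb.trans ?_
    have hr := growth_ge_left hs hsε h1 h hx.1
    have hl := ell_pos zero_mem_outer
    simp only [add_zero, Real.one_rpow, one_mul]
    calc 2 * N / ε * -ell 0 ^ 2 - 2 * N / ε * -((1 + x) ^ (-ε) * ell x ^ 2)
        ≤ 2 * N / ε * ((1 + x) ^ (-ε) * ell x ^ 2) := by
          have : 0 ≤ 2 * N / ε * ell 0 ^ 2 := by positivity
          linarith
      _ ≤ 2 * N / ε * (2 * growth ε s x) := by gcongr
      _ = N * (4 / ε) * growth ε s x := by ring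
      _ ≤ _ := by
          gcongr
          have : 0 ≤ 162 / (ε - s) := by positivity
          linarith

/-- The integrating factor of the `φ`-equation. -/
theorem IsWeight.hasDerivAt_azimuthal (hE : IsWeight s v.fn E) {x : ℝ} (hx : x ∈ Ioo (-1 : ℝ) 1) :
    HasDerivAt (fun x => (1 - x ^ 2) * E x)
      ((rate s v.fn x - 2 * x / (1 - x ^ 2)) * ((1 - x ^ 2) * E x)) x := by
  have h := ((hasDerivAt_pow 2 x).const_sub 1).mul (hE.der x hx)
  refine h.congr_deriv ?_
  have := (one_sub_sq_pos hx).ne'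
  field_simp
  ring

/-- `(1-x²) E χ'` is constant, so the vanishing of `χ'(0)` kills `χ'` and that of `χ(0)` kills `χ`.
-/
theorem IsWeight.eqφ_injective (hE : IsWeight s v.fn E) (o : Operators ε) {χ : M₂ ε}
    (h : o.eqφ s v χ = 0) (h1 : o.evDer χ = 0) (h0 : o.ev₂ χ = 0) : χ = 0 := by
  rw [o.evDer_fn] at h1
  rw [o.ev₂_fn] at h0
  have hd : ∀ x ∈ Ioo (-1 : ℝ) 1, HasDerivAt (fun x => (1 - x ^ 2) * E x * deriv χ.fn x) 0 x := by
    intro x hx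
    have a := (χ.mem.c2.deriv_Ioo (m := 1) (by norm_num)).hasDerivAt_Ioo one_ne_zero hx
    refine ((hE.hasDerivAt_azimuthal hx).mul a).congr_deriv ?_
    have e := congrArg (fun η => η.fn x) h
    simp only [o.eqφ_fn s v χ hx, Y₂.fn_zero, Pi.zero_apply, iteratedDeriv_succ,
      iteratedDeriv_zero] at e
    linear_combination ((1 - x ^ 2) * E x) * e
  have hz : ∀ x ∈ Ioo (-1 : ℝ) 1, HasDerivAt χ.fn 0 x := by
    intro x hx
    have e := eq_of_hasDerivAt_zero hd hx zero_mem_outer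
    simp only [h1, mul_zero] at e
    have := (mul_eq_zero.1 e).resolve_left (mul_pos (one_sub_sq_pos hx) (hE.pos x hx)).ne'
    rw [← this]
    exact χ.mem.c2.hasDerivAt_Ioo two_ne_zero hx
  refine M₂.ext_on fun x hx => ?_
  rw [eq_of_hasDerivAt_zero hz hx zero_mem_outer, h0, M₂.fn_zero, Pi.zero_apply]

/-- With `F = (1-x²)E` the solution has `χ' = G/F`, where `G` is the primitive of `F η` with the
prescribed value at `0`. Dividing the growth rate of `G` by the lower bound of `F` leaves exactly
`(1-x²)^(-1-ε)`, and one more integration costs one power. The homogeneous part of `χ'` is of size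
`(1-x)^(-1-s)` at `x = 1`, which the space admits because `s < ε`. -/
theorem IsWeight.exists_eqφ_eq (hE : IsWeight s v.fn E) (hs : 0 ≤ s) (hsε : s < ε) (h1 : ε < 1 / 2)
    (o : Operators ε) (η : Y₂ ε) (a b : ℝ) : ∃ χ, o.eqφ s v χ = η ∧ o.evDer χ = a ∧ o.ev₂ χ = b := by
  have h0 : 0 < ε := hs.trans_lt hsε
  obtain ⟨C, hC0, hC⟩ := hE.upper
  obtain ⟨c, hc0, hc⟩ := hE.lower
  set F : ℝ → ℝ := fun x => (1 - x ^ 2) * E x with hF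
  have hFpos : ∀ x ∈ Ioo (-1 : ℝ) 1, 0 < F x := fun x hx =>
    mul_pos (one_sub_sq_pos hx) (hE.pos x hx)
  have hFd : ∀ x ∈ Ioo (-1 : ℝ) 1, HasDerivAt F
      ((rate s v.fn x - 2 * x / (1 - x ^ 2)) * F x) x := fun x hx => hE.hasDerivAt_azimuthal hx
  have hFc : ContinuousOn F (Ioo (-1) 1) := fun x hx => (hFd x hx).continuousAt.continuousWithinAt
  have hFη : ContinuousOn (fun y => F y * η.fn y) (Ioo (-1) 1) := hFc.mul η.mem.cont
  set G : ℝ → ℝ := fun x => F 0 * a + ∫ y in (0 : ℝ)..x, F y * η.fn y with hG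
  have hGd : ∀ x ∈ Ioo (-1 : ℝ) 1, HasDerivAt G (F x * η.fn x) x := fun x hx =>
    (hasDerivAt_primitive hFη hx).const_add _
  set q : ℝ → ℝ := fun x => G x / F x with hq
  set r : ℝ → ℝ := fun x => η.fn x - (rate s v.fn x - 2 * x / (1 - x ^ 2)) * q x with hr
  have hqd : ∀ x ∈ Ioo (-1 : ℝ) 1, HasDerivAt q (r x) x := by
    intro x hx
    refine ((hGd x hx).div (hFd x hx) (hFpos x hx).ne').congr_deriv ?_
    have := (hFpos x hx).ne'
    simp only [hr, hq]
    field_simp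
  have hqc : ContinuousOn q (Ioo (-1) 1) := fun x hx => (hqd x hx).continuousAt.continuousWithinAt
  have hrc : ContinuousOn r (Ioo (-1) 1) :=
    η.mem.cont.sub (((continuousOn_rate s v.mem.c1.continuousOn).sub
      (ContinuousOn.div (by fun_prop) (by fun_prop) fun x hx => (one_sub_sq_pos hx).ne')).mul hqc)
  have hη : ∀ x ∈ Ioo (-1 : ℝ) 1, |F x * η.fn x|
      ≤ ‖η‖ * C * ((1 - x ^ 2) ^ (-1 - ε) * ((1 - x) ^ s * ell x ^ 2)) := by
    intro x hx
    have x0 := one_sub_sq_pos hx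
    have x1 : 0 < 1 - x := by linarith [hx.2]
    have e := η.val_le hx
    have hp : 0 < (1 - x ^ 2) ^ (2 + ε) := one_sub_sq_rpow_pos _ hx
    rw [abs_mul, abs_of_pos hp] at e
    have e' : |η.fn x| ≤ ‖η‖ * (1 - x ^ 2) ^ (-(2 + ε)) := by
      rw [Real.rpow_neg x0.le, ← div_eq_mul_inv, le_div_iff₀ hp]; linarith
    have e2 : (1 - x ^ 2) * (1 - x ^ 2) ^ (-(2 + ε)) = (1 - x ^ 2) ^ (-1 - ε) := by
      rw [mul_comm, ← Real.rpow_add_one x0.ne']; congr 1; ring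
    rw [abs_mul, abs_of_pos (hFpos x hx)]
    calc F x * |η.fn x| ≤ (1 - x ^ 2) * (C * ((1 - x) ^ s * ell x ^ 2)) *
          (‖η‖ * (1 - x ^ 2) ^ (-(2 + ε))) := by
          simp only [hF]
          gcongr
          exact hC x hx
      _ = _ := by rw [← e2]; ring
  set K := 18 * (F 0 * |a|) + ‖η‖ * C * (162 / (ε - s) + 4 / ε) with hK
  have hGb : ∀ x ∈ Ioo (-1 : ℝ) 1, |G x| ≤ K * growth ε s x := by
    intro x hx
    have e1 := abs_integral_le_growth hs hsε h1 hFη hη hx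
    have e2 := one_le_growth hs hsε h1 hx
    have e3 : 0 ≤ F 0 * |a| := mul_nonneg (hFpos 0 zero_mem_outer).le (abs_nonneg _)
    calc |G x| ≤ |F 0 * a| + |∫ y in (0 : ℝ)..x, F y * η.fn y| := abs_add_le _ _
      _ ≤ F 0 * |a| * (18 * growth ε s x)
          + ‖η‖ * C * (162 / (ε - s) + 4 / ε) * growth ε s x := by
          rw [abs_mul, abs_of_pos (hFpos 0 zero_mem_outer)]
          refine add_le_add (le_mul_of_one_le_right e3 e2) e1
      _ = _ := by rw [hK]; ring
  have hK0 : 0 ≤ K := by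
    have : 0 < ε - s := by linarith
    have := (hFpos 0 zero_mem_outer).le
    positivity
  have hqb : ∀ x ∈ Ioo (-1 : ℝ) 1, |q x| ≤ K / c * (1 - x ^ 2) ^ (-1 - ε) := by
    intro x hx
    have x0 := one_sub_sq_pos hx
    have x1 : 0 < 1 - x := by linarith [hx.2]
    have x2 : 0 < 1 + x := by linarith [hx.1]
    have hl := ell_pos hx
    have hEx := hE.pos x hx
    rw [hq]
    simp only
    rw [abs_div, abs_of_pos (hFpos x hx), div_le_iff₀ (hFpos x hx)]
    refine (hGb x hx).trans ?_
    have e : growth ε s x = (1 - x ^ 2) ^ (-1 - ε) * ((1 - x ^ 2) * ((1 - x) ^ s * ell x ^ 2)) := by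
      rw [growth, ← mul_assoc, ← Real.rpow_add_one x0.ne', show -1 - ε + 1 = -ε by ring,
        one_sub_sq_rpow_eq _ hx, show s - ε = s + -ε by ring, Real.rpow_add x1]
      ring
    have hp : 0 < (1 - x ^ 2) ^ (-1 - ε) := one_sub_sq_rpow_pos _ hx
    calc K * growth ε s x = K / c * (1 - x ^ 2) ^ (-1 - ε) *
          ((1 - x ^ 2) * (c * ((1 - x) ^ s * ell x ^ 2))) := by rw [e]; field_simp
      _ ≤ _ := by
          simp only [hF]
          gcongr
          exact hc x hx
  set h : ℝ → ℝ := fun x => b + ∫ y in (0 : ℝ)..x, q y with hh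
  have hhd : ∀ x ∈ Ioo (-1 : ℝ) 1, HasDerivAt h (q x) x := fun x hx =>
    (hasDerivAt_primitive hqc hx).const_add _
  have hq1 : ∀ x ∈ Ioo (-1 : ℝ) 1, |(1 - x ^ 2) ^ (1 + ε) * q x| ≤ K / c := by
    intro x hx
    have hp : 0 < (1 - x ^ 2) ^ (1 + ε) := one_sub_sq_rpow_pos _ hx
    rw [abs_mul, abs_of_pos hp]
    refine (mul_le_mul_of_nonneg_left (hqb x hx) hp.le).trans (le_of_eq ?_)
    rw [mul_left_comm, ← Real.rpow_add (one_sub_sq_pos hx)]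
    simp
  have hle1 : ∀ x ∈ Ioo (-1 : ℝ) 1, (1 - x ^ 2) ^ ε ≤ 1 := fun x hx =>
    Real.rpow_le_one (one_sub_sq_pos hx).le (by nlinarith [sq_nonneg x]) h0.le
  refine ⟨M₂.mk _ (memM₂_indicator (A := |b| + K / c * (2 ^ ε / ε)) (B := K / c)
    (D := ‖η‖ + (2 * s + 6 * ‖v‖ + 2) * (K / c)) hhd hqd hrc ?_ hq1 ?_), ?_, ?_, ?_⟩
  · intro x hx
    have hp : 0 < (1 - x ^ 2) ^ ε := one_sub_sq_rpow_pos _ hx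
    have e1 := abs_primitive_le hqc h0 hqb hx
    have e2 : (1 - x ^ 2) ^ ε * (1 - x ^ 2) ^ (-ε) = 1 := by
      rw [← Real.rpow_add (one_sub_sq_pos hx)]; simp
    rw [abs_mul, abs_of_pos hp]
    calc (1 - x ^ 2) ^ ε * |h x| ≤ (1 - x ^ 2) ^ ε * (|b| + K / c * (2 ^ ε / ε) *
          (1 - x ^ 2) ^ (-ε)) := by
          gcongr
          exact (abs_add_le _ _).trans (add_le_add le_rfl e1)
      _ = (1 - x ^ 2) ^ ε * |b| + K / c * (2 ^ ε / ε) * ((1 - x ^ 2) ^ ε * (1 - x ^ 2) ^ (-ε)) := by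
          ring
      _ ≤ _ := by
          rw [e2, mul_one]
          gcongr
          exact mul_le_of_le_one_left (abs_nonneg _) (hle1 x hx)
  · intro x hx
    have x0 := one_sub_sq_pos hx
    have x1 : 0 < 1 - x := by linarith [hx.2]
    have e : (1 - x ^ 2) ^ (2 + ε) * r x = (1 - x ^ 2) ^ (2 + ε) * η.fn x
        - (-(s * (1 + x)) + v.fn x - 2 * x) * ((1 - x ^ 2) ^ (1 + ε) * q x) := by
      have e1 : (1 - x ^ 2) ^ (2 + ε) = (1 - x ^ 2) ^ (1 + ε) * (1 - x ^ 2) := by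
        rw [← Real.rpow_add_one x0.ne']; congr 1; ring
      have e2 : (1 - x ^ 2) * (rate s v.fn x - 2 * x / (1 - x ^ 2))
          = -(s * (1 + x)) + v.fn x - 2 * x := by
        rw [rate]
        have e3 : (1 - x ^ 2) = (1 - x) * (1 + x) := by ring
        have : 1 + x ≠ 0 := by linarith [hx.1]
        rw [e3]
        field_simp
      rw [hr, ← e2, e1]
      ring
    rw [e]
    refine (abs_sub _ _).trans (add_le_add (η.val_le hx) ?_)
    rw [abs_mul]
    refine mul_le_mul ?_ (hq1 x hx) (abs_nonneg _) (by positivity)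
    have hv := v.abs_le h0 h1 hx
    rw [abs_le] at hv ⊢
    have := hx.1
    have := hx.2
    constructor <;> nlinarith
  · refine Y₂.ext_on fun x hx => ?_
    have hD1 : ∀ x ∈ Ioo (-1 : ℝ) 1, HasDerivAt ((Ioo (-1 : ℝ) 1).indicator h) (q x) x :=
      fun x hx => (hhd x hx).congr_of_eventuallyEq (indicator_eventuallyEq hx)
    rw [o.eqφ_fn s v _ hx, M₂.fn_mk, iteratedDeriv_two_eq hD1 hx (hqd x hx), (hD1 x hx).deriv, hr]
    ring
  · rw [o.evDer_fn, M₂.fn_mk, (indicator_eventuallyEq zero_mem_outer).deriv_eq,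
      (hhd 0 zero_mem_outer).deriv]
    have := (hFpos 0 zero_mem_outer).ne'
    simp only [hq, hG, intervalIntegral.integral_same, add_zero]
    field_simp
  · rw [o.ev₂_fn, M₂.fn_mk, indicator_of_mem zero_mem_outer]
    simp [hh]

theorem IsWeight.solvable (hE : IsWeight s v.fn E) (hs : 0 ≤ s) (hsε : s < ε) (h1 : ε < 1 / 2)
    (o : Operators ε) : o.Solvable s v where
  surjθ := fun ρ => by
    obtain ⟨h, hh, -⟩ := hE.exists_linθ_eq hs (hs.trans_lt hsε) h1 o ρ
    exact ⟨h, hh⟩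
  injθ := fun _ => hE.linθ_injective hs h1 o
  ne := fun _ => hE.ev_ne_zero hs h1 o
  surjφ := hE.exists_eqφ_eq hs hsε h1 o
  injφ := fun _ => hE.eqφ_injective o

end Azimuthal

end HomNS

namespace HomNS

/-! ## The no-swirl profile as a power series at the regular pole -/

/-- Bounded coefficients give radius of convergence at least `1`; the differentiated series is
dominated on a smaller interval of radius `r` between `|t|` and `1`. -/
theorem hasSum_deriv_series {a : ℕ → ℝ} {C t : ℝ} (ha : ∀ n, |a n| ≤ C) (ht : |t| < 1) :
    Summable (fun n : ℕ => a n * t ^ n) ∧ Summable (fun n : ℕ => a n * (n * t ^ (n - 1))) ∧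
      HasDerivAt (fun t : ℝ => ∑' n : ℕ, a n * t ^ n) (∑' n : ℕ, a n * (n * t ^ (n - 1))) t := by
  obtain ⟨r, hr, hr1⟩ := exists_between ht
  have hr0 : 0 < r := (abs_nonneg t).trans_lt hr
  have hC : 0 ≤ C := (abs_nonneg _).trans (ha 0)
  have hu : Summable fun n : ℕ => C * (n * r ^ (n - 1)) := by
    have h := (summable_pow_mul_geometric_of_norm_lt_one 1 (r := r)
      (by rwa [Real.norm_eq_abs, abs_of_pos hr0])).mul_left (C * r⁻¹)
    refine h.congr fun n => ?_
    rcases n with _ | n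
    · simp
    · rw [Nat.add_sub_cancel, pow_one, pow_succ]; field_simp
  have hbd : ∀ (n : ℕ) (y : ℝ), y ∈ Ioo (-r) r → ‖a n * (n * y ^ (n - 1))‖ ≤ C * (n * r ^ (n - 1)) := by
    intro n y hy
    rw [Real.norm_eq_abs, abs_mul, abs_mul, abs_pow, Nat.abs_cast]
    have := abs_le.2 ⟨hy.1.le, hy.2.le⟩
    gcongr
    exact ha n
  have htr : t ∈ Ioo (-r) r := abs_lt.1 hr
  have h0 : Summable fun n : ℕ => a n * (0 : ℝ) ^ n :=
    summable_of_ne_finset_zero (s := {0}) fun n hn => by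
      simp only [Finset.mem_singleton] at hn
      simp [hn]
  have hg : ∀ (n : ℕ) (y : ℝ), y ∈ Ioo (-r) r →
      HasDerivAt (fun y : ℝ => a n * y ^ n) (a n * (n * y ^ (n - 1))) y := fun n y _ =>
    (hasDerivAt_pow n y).const_mul _
  have hr0' : (0 : ℝ) ∈ Ioo (-r) r := ⟨by linarith, hr0⟩
  exact ⟨summable_of_summable_hasDerivAt_of_isPreconnected (g := fun (n : ℕ) (y : ℝ) => a n * y ^ n)
      (g' := fun (n : ℕ) (y : ℝ) => a n * (n * y ^ (n - 1))) hu isOpen_Ioo isPreconnected_Ioo hg hbd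
      hr0' h0 htr,
    Summable.of_norm_bounded hu fun n => hbd n t htr,
    hasDerivAt_tsum_of_isPreconnected (g := fun (n : ℕ) (y : ℝ) => a n * y ^ n)
      (g' := fun (n : ℕ) (y : ℝ) => a n * (n * y ^ (n - 1))) hu isOpen_Ioo isPreconnected_Ioo hg hbd
      hr0' h0 htr⟩

/-- Taylor coefficients of the profile. -/
noncomputable def profileCoeff (κ s : ℝ) : ℕ → ℝ
  | 0 => 1
  | n + 1 => (n * profileCoeff κ s n + κ * profileCoeff κ s n / (n + 1 + s)) / (n + 1)

section Profile

variable {κ s : ℝ}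

/-- Multiplied by `n + 1 + s` this is the recurrence of the hypergeometric series with lower
parameter `1 + s` and upper parameters of sum `1 + s` and product `κ`: the logarithmic case. In
terms of `n z_n` it shows the monotone growth directly. -/
theorem profileCoeff_succ (n : ℕ) : (n + 1 : ℝ) * profileCoeff κ s (n + 1)
    = n * profileCoeff κ s n + κ * profileCoeff κ s n / (n + 1 + s) := by
  rw [profileCoeff]; field_simp

theorem profileCoeff_nonneg (hκ : 0 < κ) (hs : 0 ≤ s) (n : ℕ) : 0 ≤ profileCoeff κ s n := by
  induction n with
  | zero => simp [profileCoeff]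
  | succ n ih => rw [profileCoeff]; positivity

/-- By the recurrence `n z_n` is nondecreasing, and its value at `n = 1` is `κ / (1+s)`. -/
theorem profileCoeff_lower (hκ : 0 < κ) (hs : 0 ≤ s) (n : ℕ) :
    κ / (1 + s) ≤ (n + 1 : ℝ) * profileCoeff κ s (n + 1) := by
  induction n with
  | zero => rw [profileCoeff_succ]; simp [profileCoeff]
  | succ n ih =>
    rw [profileCoeff_succ]
    have := profileCoeff_nonneg hκ hs (n + 1)
    have h : 0 ≤ κ * profileCoeff κ s (n + 1) / ((n + 1 : ℕ) + 1 + s) := by positivity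
    push_cast at h ⊢
    linarith

/-- Each step multiplies `(n+1) z_{n+1}` by at most `1 + κ/((n+1)(n+2)) ≤ exp(κ/((n+1)(n+2)))`, and
these exponents telescope to `κ(1 - 1/(n+1))`. -/
theorem profileCoeff_upper (hκ : 0 < κ) (hs : 0 ≤ s) (n : ℕ) :
    (n + 1 : ℝ) * profileCoeff κ s (n + 1) ≤ κ / (1 + s) * Real.exp (κ * (1 - 1 / (n + 1))) := by
  induction n with
  | zero => rw [profileCoeff_succ]; simp [profileCoeff]
  | succ n ih =>
    rw [profileCoeff_succ]
    have h0 := profileCoeff_nonneg hκ hs (n + 1)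
    have h1 : 1 + κ / ((n + 1 : ℝ) * (n + 2)) ≤ Real.exp (κ / ((n + 1 : ℝ) * (n + 2))) := by
      linarith [Real.add_one_le_exp (κ / ((n + 1 : ℝ) * (n + 2)))]
    push_cast
    calc ((n : ℝ) + 1) * profileCoeff κ s (n + 1)
          + κ * profileCoeff κ s (n + 1) / ((n : ℝ) + 1 + 1 + s)
        ≤ ((n : ℝ) + 1) * profileCoeff κ s (n + 1)
          + κ * profileCoeff κ s (n + 1) / ((n : ℝ) + 2) := by
          have : (n : ℝ) + 2 ≤ n + 1 + 1 + s := by linarith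
          gcongr
      _ = ((n : ℝ) + 1) * profileCoeff κ s (n + 1) * (1 + κ / ((n + 1 : ℝ) * (n + 2))) := by
          field_simp
      _ ≤ κ / (1 + s) * Real.exp (κ * (1 - 1 / (n + 1))) * Real.exp (κ / ((n + 1 : ℝ) * (n + 2))) := by
          gcongr
      _ = _ := by
          rw [mul_assoc, ← Real.exp_add]
          congr 2
          field_simp
          ring

/-- Uniform bound of `n z_n`. -/
noncomputable def profileBound (κ s : ℝ) : ℝ := κ / (1 + s) * Real.exp κ

theorem profileCoeff_upper' (hκ : 0 < κ) (hs : 0 ≤ s) (n : ℕ) :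
    (n + 1 : ℝ) * profileCoeff κ s (n + 1) ≤ profileBound κ s := by
  refine (profileCoeff_upper hκ hs n).trans ?_
  rw [profileBound]
  gcongr
  have : (0 : ℝ) ≤ 1 / (n + 1) := by positivity
  nlinarith

/-- The profile `z` in the variable `t = (1 - x) / 2`. -/
noncomputable def profileZ (κ s t : ℝ) : ℝ := ∑' n : ℕ, profileCoeff κ s n * t ^ n

/-- `D = t z'`. -/
noncomputable def profileD (κ s t : ℝ) : ℝ := ∑' n : ℕ, (n * profileCoeff κ s n) * t ^ n

theorem abs_d_le (hκ : 0 < κ) (hs : 0 ≤ s) (n : ℕ) :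
    |n * profileCoeff κ s n| ≤ profileBound κ s := by
  have hz := profileCoeff_nonneg hκ hs n
  rw [abs_of_nonneg (by positivity)]
  rcases n with _ | n
  · simp only [Nat.cast_zero, zero_mul, profileBound]; positivity
  · simpa using profileCoeff_upper' hκ hs n

theorem abs_z_le (hκ : 0 < κ) (hs : 0 ≤ s) (n : ℕ) :
    |profileCoeff κ s n| ≤ 1 + profileBound κ s := by
  have hz := profileCoeff_nonneg hκ hs n
  have hB : 0 ≤ profileBound κ s := by rw [profileBound]; positivity
  rw [abs_of_nonneg hz]
  rcases n with _ | n
  · simp only [profileCoeff]; linarith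
  · have := profileCoeff_upper' hκ hs n
    have h : 0 ≤ (n : ℝ) * profileCoeff κ s (n + 1) := by positivity
    linarith

/-- The hypergeometric equation as a first-order system for `z` and `D = t z'`, obtained by
comparing coefficients. -/
theorem profile_ode (hκ : 0 < κ) (hs : 0 ≤ s) {t : ℝ} (ht0 : 0 < t) (ht : t < 1) :
    HasDerivAt (profileZ κ s) (profileD κ s t / t) t ∧
    ∃ D', HasDerivAt (profileD κ s) D' t ∧
      t * (1 - t) * D' + s * profileD κ s t - (1 + s) * t * profileD κ s t
        = κ * t * profileZ κ s t := by
  have ht' : |t| < 1 := by rwa [abs_of_pos ht0]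
  obtain ⟨z1, z2, z3⟩ := hasSum_deriv_series (abs_z_le hκ hs) ht'
  obtain ⟨d1, d2, d3⟩ := hasSum_deriv_series (abs_d_le hκ hs) ht'
  have hpow : ∀ n : ℕ, (n : ℝ) * t ^ (n - 1) * t = n * t ^ n := fun n => by
    rcases n with _ | n
    · simp
    · rw [Nat.add_sub_cancel, pow_succ]; ring
  refine ⟨z3.congr_deriv ?_, _, d3, ?_⟩
  · rw [eq_div_iff ht0.ne', profileD, ← tsum_mul_right]
    refine tsum_congr fun n => ?_
    rw [mul_assoc, hpow]; ring
  · set D' := ∑' n : ℕ, (n * profileCoeff κ s n) * ((n : ℝ) * t ^ (n - 1)) with hD'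
    have a1 : HasSum (fun n : ℕ => (n + s) * (n * profileCoeff κ s n) * t ^ n)
        (t * D' + s * profileD κ s t) := by
      refine ((d2.hasSum.mul_left t).add (d1.hasSum.mul_left s)).congr_fun ?_
      intro n
      have := hpow n
      linear_combination (-(n * profileCoeff κ s n)) * this
    have a2 : HasSum (fun n : ℕ => ((n + 1 : ℕ) + s) * ((n + 1 : ℕ) * profileCoeff κ s (n + 1)) * t ^ (n + 1))
        (t * D' + s * profileD κ s t) := by
      have := (hasSum_nat_add_iff' 1).2 a1
      simpa using this
    -- The same series is summed twice: `a2` shifts the index, using that the term `n = 0` vanishes,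
    -- and `a3` inserts the recurrence. Uniqueness of the sum is the differential equation.
    have a3 : HasSum (fun n : ℕ => ((n + 1 : ℕ) + s) * ((n + 1 : ℕ) * profileCoeff κ s (n + 1)) * t ^ (n + 1))
        (t * (t * D' + s * profileD κ s t) + t * profileD κ s t + κ * t * profileZ κ s t) := by
      refine (((a1.mul_left t).add (d1.hasSum.mul_left t)).add (z1.hasSum.mul_left (κ * t))).congr_fun ?_
      intro n
      have h := profileCoeff_succ (κ := κ) (s := s) n
      push_cast
      rw [h, pow_succ]
      have : (n : ℝ) + 1 + s ≠ 0 := by positivity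
      field_simp
      ring
    have := a2.unique a3
    linear_combination this

/-- Termwise comparison with `-log(1-t) = ∑ t^(n+1)/(n+1)`, by the two-sided bounds on `n z_n`. For
`D` below, the same is done with the geometric series. -/
theorem profileZ_bounds (hκ : 0 < κ) (hs : 0 ≤ s) {t : ℝ} (ht0 : 0 < t) (ht : t < 1) :
    1 + κ / (1 + s) * -Real.log (1 - t) ≤ profileZ κ s t ∧
      profileZ κ s t ≤ 1 + profileBound κ s * -Real.log (1 - t) := by
  have ht' : |t| < 1 := by rwa [abs_of_pos ht0]
  obtain ⟨z1, -, -⟩ := hasSum_deriv_series (abs_z_le hκ hs) ht'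
  have h1 : HasSum (fun n : ℕ => profileCoeff κ s (n + 1) * t ^ (n + 1)) (profileZ κ s t - 1) := by
    have := (hasSum_nat_add_iff' 1).2 z1.hasSum
    simpa [profileCoeff, profileZ] using this
  have hL := Real.hasSum_pow_div_log_of_abs_lt_one ht'
  constructor
  · have := hasSum_le (fun n => ?_) (hL.mul_left (κ / (1 + s))) h1
    · linarith
    · have h := profileCoeff_lower hκ hs n
      have : 0 < t ^ (n + 1) := by positivity
      rw [← mul_div_assoc, div_le_iff₀ (by positivity)]
      nlinarith
  · have := hasSum_le (fun n => ?_) h1 (hL.mul_left (profileBound κ s))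
    · linarith
    · have h := profileCoeff_upper' hκ hs n
      have : 0 < t ^ (n + 1) := by positivity
      rw [← mul_div_assoc, le_div_iff₀ (by positivity)]
      nlinarith

theorem profileD_bounds (hκ : 0 < κ) (hs : 0 ≤ s) {t : ℝ} (ht0 : 0 < t) (ht : t < 1) :
    0 ≤ profileD κ s t ∧ (1 - t) * profileD κ s t ≤ profileBound κ s * t := by
  have ht' : |t| < 1 := by rwa [abs_of_pos ht0]
  obtain ⟨d1, -, -⟩ := hasSum_deriv_series (abs_d_le hκ hs) ht'
  have hz := profileCoeff_nonneg hκ hs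
  refine ⟨tsum_nonneg fun n => by have := hz n; positivity, ?_⟩
  have h1 : HasSum (fun n : ℕ => ((n + 1 : ℕ) * profileCoeff κ s (n + 1)) * t ^ (n + 1))
      (profileD κ s t) := by
    have := (hasSum_nat_add_iff' 1).2 d1.hasSum
    simpa [profileD] using this
  have h2 : HasSum (fun n : ℕ => profileBound κ s * t * t ^ n) (profileBound κ s * t * (1 - t)⁻¹) :=
    (hasSum_geometric_of_lt_one ht0.le ht).mul_left _
  have := hasSum_le (fun n => ?_) h1 h2
  · have h3 : 0 < 1 - t := by linarith
    rw [← div_eq_mul_inv, le_div_iff₀ h3] at this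
    linarith
  · have h := profileCoeff_upper' hκ hs n
    have : 0 < t ^ (n + 1) := by positivity
    rw [mul_assoc (profileBound κ s), ← pow_succ']
    push_cast
    gcongr

end Profile

/-- The `θ`-equation of the no-swirl correction `v`, solved for `v'`. -/
def IsProfile (s k : ℝ) (v : ℝ → ℝ) : Prop :=
  ∀ x ∈ Ioo (-1 : ℝ) 1,
    HasDerivAt v (k + s * (v x / (1 - x)) - 1 / 2 * (v x * v x / (1 - x ^ 2))) x

/-- The Riccati equation is linearised by `v = 2(1-x²) z'/z` with `z` the series in `t = (1-x)/2`
and `κ = k/2`. The logarithmic derivative of `(1-x)^s z²` is then `rate s v`, so the bounds on `z`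
are bounds on the integrating factor. -/
theorem exists_profile {ε s k : ℝ} (h0 : 0 < ε) (h1 : ε < 1 / 2) (hs : 0 ≤ s) (hk : 0 < k) :
    ∃ (v : M₁ ε .south) (E : ℝ → ℝ), IsWeight s v.fn E ∧ E 0 = 1 ∧ IsProfile s k v.fn := by
  set κ := k / 2 with hκdef
  have hκ : 0 < κ := by positivity
  set z : ℝ → ℝ := fun x => profileZ κ s ((1 - x) / 2) with hz
  set D : ℝ → ℝ := fun x => profileD κ s ((1 - x) / 2) with hD
  have ht : ∀ {x : ℝ}, x ∈ Ioo (-1 : ℝ) 1 → 0 < (1 - x) / 2 ∧ (1 - x) / 2 < 1 := fun {x} hx =>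
    ⟨by linarith [hx.2], by linarith [hx.1]⟩
  have hL : ∀ {x : ℝ}, x ∈ Ioo (-1 : ℝ) 1 → ell x - 1 / 2 ≤ -Real.log (1 - (1 - x) / 2) ∧
      -Real.log (1 - (1 - x) / 2) ≤ ell x ∧ 0 ≤ -Real.log (1 - (1 - x) / 2) := by
    intro x hx
    have x2 : 0 < 1 + x := by linarith [hx.1]
    have e : ell x = -Real.log (1 - (1 - x) / 2) + Real.log (3 / 2) := by
      rw [ell, show (1 + x) / 3 = (1 - (1 - x) / 2) / (3 / 2) by ring,
        Real.log_div (by linarith) (by norm_num)]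
      ring
    have l1 : Real.log (3 / 2) ≤ 1 / 2 := by
      have := Real.log_le_sub_one_of_pos (show (0 : ℝ) < 3 / 2 by norm_num)
      linarith
    have l2 : 0 ≤ Real.log (3 / 2) := Real.log_nonneg (by norm_num)
    have l3 : Real.log (1 - (1 - x) / 2) ≤ 0 :=
      Real.log_nonpos (by linarith) (by linarith [hx.2])
    exact ⟨by linarith, by linarith, by linarith⟩
  set B := profileBound κ s with hB
  have hB0 : 0 < B := by rw [hB, profileBound]; positivity
  -- The requirement `b ≤ 1` lets the constant term `1` of `z` make up for the difference of at most
  -- `1/2` between `ell` and `-log(1-t)`.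
  set b := min 1 (κ / (1 + s)) with hb
  have hb0 : 0 < b := lt_min one_pos (by positivity)
  have hzl : ∀ x ∈ Ioo (-1 : ℝ) 1, b * ell x ≤ z x := by
    intro x hx
    obtain ⟨t0, t1⟩ := ht hx
    obtain ⟨l1, l2, l3⟩ := hL hx
    have := (profileZ_bounds hκ hs t0 t1).1
    have b1 : b ≤ 1 := min_le_left _ _
    have b2 : b ≤ κ / (1 + s) := min_le_right _ _
    have := mul_le_mul_of_nonneg_right b2 l3
    simp only [hz]
    nlinarith
  have hzu : ∀ x ∈ Ioo (-1 : ℝ) 1, z x ≤ (3 + B) * ell x := by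
    intro x hx
    obtain ⟨t0, t1⟩ := ht hx
    obtain ⟨l1, l2, l3⟩ := hL hx
    have := (profileZ_bounds hκ hs t0 t1).2
    have := ell_ge hx
    have := mul_le_mul_of_nonneg_left l2 hB0.le
    simp only [hz]
    nlinarith
  have hzpos : ∀ x ∈ Ioo (-1 : ℝ) 1, 0 < z x := fun x hx =>
    (mul_pos hb0 (ell_pos hx)).trans_le (hzl x hx)
  have hzd : ∀ x ∈ Ioo (-1 : ℝ) 1, HasDerivAt z (-(D x / (1 - x))) x := by
    intro x hx
    obtain ⟨t0, t1⟩ := ht hx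
    have h := ((profile_ode hκ hs t0 t1).1).comp x (((hasDerivAt_id x).const_sub 1).div_const 2)
    refine h.congr_deriv ?_
    have : 1 - x ≠ 0 := by linarith [hx.2]
    simp only [hD]
    field_simp
  -- This is `2(1-x²) z'/z`, because `z' = -D/(1-x)`.
  set w : ℝ → ℝ := fun x => -(2 * (1 + x)) * D x / z x with hw
  have hwd : IsProfile s k w := by
    intro x hx
    obtain ⟨t0, t1⟩ := ht hx
    obtain ⟨D', hD', hode⟩ := (profile_ode hκ hs t0 t1).2
    have hDx : HasDerivAt D (D' * (-1 / 2)) x :=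
      HasDerivAt.comp (h₂ := profileD κ s) (h := fun x : ℝ => (1 - x) / 2) x hD' (((hasDerivAt_id x).const_sub 1).div_const 2)
    have h := ((((hasDerivAt_id x).const_add 1).const_mul 2).neg.mul hDx).div (hzd x hx)
      (hzpos x hx).ne'
    refine h.congr_deriv ?_
    have z0 := (hzpos x hx).ne'
    have x1 : 1 - x ≠ 0 := by linarith [hx.2]
    have x2 : 1 + x ≠ 0 := by linarith [hx.1]
    have x3 : 1 - x ^ 2 ≠ 0 := (one_sub_sq_pos hx).ne'
    have hk : k = 2 * κ := by rw [hκdef]; ring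
    change (1 - x) / 2 * (1 - (1 - x) / 2) * D' + s * D x - (1 + s) * ((1 - x) / 2) * D x
      = κ * ((1 - x) / 2) * z x at hode
    have e3 : 1 - x ^ 2 = (1 - x) * (1 + x) := by ring
    simp only [hw, id, Pi.neg_apply, Pi.mul_apply]
    rw [e3, hk]
    field_simp
    linear_combination (4 * z x) * hode
  have hwb : ∀ x ∈ Ioo (-1 : ℝ) 1, |w x| ≤ 2 * B / b * ((1 - x) / ell x) := by
    intro x hx
    obtain ⟨t0, t1⟩ := ht hx
    obtain ⟨d0, d1⟩ := profileD_bounds hκ hs t0 t1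
    have x2 : 0 < 1 + x := by linarith [hx.1]
    have x1 : 0 < 1 - x := by linarith [hx.2]
    have hl := ell_pos hx
    have e : |w x| = 4 * ((1 - (1 - x) / 2) * D x) / z x := by
      rw [hw]
      simp only
      rw [abs_div, abs_mul, abs_neg, abs_of_pos (hzpos x hx), abs_of_pos (by positivity),
        abs_of_nonneg d0]
      ring
    rw [e]
    calc 4 * ((1 - (1 - x) / 2) * D x) / z x ≤ 4 * (B * ((1 - x) / 2)) / (b * ell x) := by
          gcongr
          exact hzl x hx
      _ = _ := by field_simp; ring
  have hwv : ∀ x ∈ Ioo (-1 : ℝ) 1, |wVal ε .south x * w x| ≤ 4 * B / b := by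
    intro x hx
    have x1 : 0 < 1 - x := by linarith [hx.2]
    have hl := ell_pos hx
    have e : (1 - x) ^ (-1 + 2 * ε) * (1 - x) = (1 - x) ^ (2 * ε) := by
      rw [← Real.rpow_add_one x1.ne']; congr 1; ring
    have e2 := one_sub_rpow_le_two (r := 2 * ε) (by linarith) (by linarith) hx
    rw [abs_mul, abs_wVal_south ε hx]
    calc ell x * (1 - x) ^ (-1 + 2 * ε) * |w x|
        ≤ ell x * (1 - x) ^ (-1 + 2 * ε) * (2 * B / b * ((1 - x) / ell x)) := by
          gcongr
          exact hwb x hx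
      _ = 2 * B / b * ((1 - x) ^ (-1 + 2 * ε) * (1 - x)) := by field_simp
      _ ≤ 2 * B / b * 2 := by rw [e]; gcongr
      _ = _ := by ring
  set g : ℝ → ℝ := fun x => k + s * (w x / (1 - x)) - 1 / 2 * (w x * w x / (1 - x ^ 2)) with hg
  -- Each application raises the regularity of `w` by one through its own equation, up to what the
  -- inner part of the `M₁` norm requires.
  have hgw : ∀ {n : ℕ}, ContDiffOn ℝ n w (Ioo (-1) 1) → ContDiffOn ℝ n g (Ioo (-1) 1) := by
    intro n hn
    simp only [hg, div_eq_mul_inv]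
    exact (contDiffOn_const.add (contDiffOn_const.mul (hn.mul (contDiffOn_inv_one_sub n)))).sub
      (contDiffOn_const.mul ((hn.mul hn).mul (contDiffOn_inv_one_sub_sq n)))
  have w0 : ContDiffOn ℝ (0 : ℕ) w (Ioo (-1) 1) := contDiffOn_zero.2 fun x hx =>
    (hwd x hx).continuousAt.continuousWithinAt
  have w1 : ContDiffOn ℝ (1 : ℕ) w (Ioo (-1) 1) := by
    simpa using contDiffOn_succ_of_hasDerivAt hwd (hgw w0)
  have w2 : ContDiffOn ℝ (2 : ℕ) w (Ioo (-1) 1) := by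
    have := contDiffOn_succ_of_hasDerivAt hwd (hgw w1)
    rwa [← Nat.cast_succ] at this
  obtain ⟨M, hM⟩ := exists_C2B (hgw w2) (by norm_num)
  have hgb : ∀ x ∈ Ioo (-1 : ℝ) 1, |wDer ε .south x * g x|
      ≤ 24 * k + s * (3 * (4 * B / b)) + 1 / 2 * (2 * ((4 * B / b) * (4 * B / b))) := by
    intro x hx
    have e : wDer ε .south x * g x = wDer ε .south x * k + s * (wDer ε .south x * (w x / (1 - x)))
        - 1 / 2 * (wDer ε .south x * (w x * w x / (1 - x ^ 2))) := by
      rw [hg]; ring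
    rw [e]
    refine (abs_sub _ _).trans (add_le_add ((abs_add_le _ _).trans (add_le_add ?_ ?_)) ?_)
    · have hp : 0 < wDer ε .south x := wDer_pos ε .south hx
      rw [abs_of_pos (by positivity)]
      exact mul_le_mul_of_nonneg_right (wDer_le h0 h1 hx) hk.le
    · rw [abs_mul, abs_of_nonneg hs]
      exact mul_le_mul_of_nonneg_left (wDer_mul_quot_le hx (hwv x hx)) hs
    · rw [abs_mul, abs_of_pos (by norm_num : (0 : ℝ) < 1 / 2)]
      exact mul_le_mul_of_nonneg_left (wDer_mul_prod_le h0 h1 hx (hwv x hx) (hwv x hx))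
        (by norm_num)
  have hmem := memM₁_indicator h1 hwd ((hgw w0).continuousOn) hwv hgb hM
  have hfn : ∀ x ∈ Ioo (-1 : ℝ) 1, (M₁.mk _ hmem : M₁ ε .south).fn x = w x := fun x hx => by
    rw [M₁.fn_mk, indicator_of_mem hx]
  have hz0 := hzpos 0 zero_mem_outer
  -- The normalisation `E 0 = 1` makes `E` equal to `exp a_{c,γ}` later on.
  refine ⟨M₁.mk _ hmem, fun x => (z 0 ^ 2)⁻¹ * ((1 - x) ^ s * z x ^ 2), ⟨?_, ?_, ?_, ?_⟩, ?_, ?_⟩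
  · intro x hx
    have x1 : 0 < 1 - x := by linarith [hx.2]
    have := hzpos x hx
    positivity
  · intro x hx
    have x1 : 0 < 1 - x := by linarith [hx.2]
    have hE := (((hasDerivAt_one_sub_rpow s hx.2).mul ((hzd x hx).pow 2))).const_mul (z 0 ^ 2)⁻¹
    refine hE.congr_deriv ?_
    rw [rate, hfn x hx]
    have z0 := (hzpos x hx).ne'
    have x2 : 1 + x ≠ 0 := by linarith [hx.1]
    have e1 : (1 - x) ^ s = (1 - x) ^ (s - 1) * (1 - x) := by
      rw [← Real.rpow_add_one x1.ne']; congr 1; ring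
    have e3 : 1 - x ^ 2 = (1 - x) * (1 + x) := by ring
    simp only [hw, Pi.pow_apply]
    rw [e3, e1]
    have := x1.ne'
    have := hz0.ne'
    field_simp
    ring
  · refine ⟨(z 0 ^ 2)⁻¹ * b ^ 2, by positivity, fun x hx => ?_⟩
    have x1 : 0 < 1 - x := by linarith [hx.2]
    have hl := ell_pos hx
    calc (z 0 ^ 2)⁻¹ * b ^ 2 * ((1 - x) ^ s * ell x ^ 2)
        = (z 0 ^ 2)⁻¹ * ((1 - x) ^ s * (b * ell x) ^ 2) := by ring
      _ ≤ _ := by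
          gcongr
          exact hzl x hx
  · refine ⟨(z 0 ^ 2)⁻¹ * (3 + B) ^ 2, by positivity, fun x hx => ?_⟩
    have x1 : 0 < 1 - x := by linarith [hx.2]
    have hzx := hzpos x hx
    calc (z 0 ^ 2)⁻¹ * ((1 - x) ^ s * z x ^ 2)
        ≤ (z 0 ^ 2)⁻¹ * ((1 - x) ^ s * ((3 + B) * ell x) ^ 2) := by
          gcongr
          exact hzu x hx
      _ = _ := by ring
  · simp only [sub_zero, Real.one_rpow, one_mul]
    field_simp
  · intro x hx
    rw [hfn x hx]
    exact (hwd x hx).congr_of_eventuallyEq (indicator_eventuallyEq hx)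

end HomNS

namespace HomNS

/-! ## Integrating factors -/

/-- The integrating factor `exp ∫₀ˣ θ`. -/
noncomputable def integratingFactor (θ : ℝ → ℝ) (x : ℝ) : ℝ := Real.exp (∫ y in (0 : ℝ)..x, θ y)

theorem integratingFactor_pos (θ : ℝ → ℝ) (x : ℝ) : 0 < integratingFactor θ x := Real.exp_pos _

theorem integratingFactor_zero (θ : ℝ → ℝ) : integratingFactor θ 0 = 1 := by
  simp [integratingFactor]

theorem hasDerivAt_integratingFactor {θ : ℝ → ℝ} (hθ : ContinuousOn θ (Ioo (-1) 1)) {x : ℝ}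
    (hx : x ∈ Ioo (-1 : ℝ) 1) :
    HasDerivAt (integratingFactor θ) (θ x * integratingFactor θ x) x :=
  ((hasDerivAt_primitive hθ hx).exp).congr_deriv (mul_comm _ _)

/-- Uniqueness for linear homogeneous first-order equations. -/
theorem eq_zero_of_linear {θ f : ℝ → ℝ} (hθ : ContinuousOn θ (Ioo (-1) 1))
    (hf : ∀ x ∈ Ioo (-1 : ℝ) 1, HasDerivAt f (-(θ x * f x)) x) (h0 : f 0 = 0) {x : ℝ}
    (hx : x ∈ Ioo (-1 : ℝ) 1) : f x = 0 := by
  have hd : ∀ y ∈ Ioo (-1 : ℝ) 1, HasDerivAt (fun y => integratingFactor θ y * f y) 0 y :=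
    fun y hy => ((hasDerivAt_integratingFactor hθ hy).mul (hf y hy)).congr_deriv (by ring)
  have := eq_of_hasDerivAt_zero hd hx zero_mem_outer
  simp only [h0, mul_zero] at this
  exact (mul_eq_zero.1 this).resolve_left (integratingFactor_pos θ x).ne'

theorem eq_integratingFactor {θ E : ℝ → ℝ} (hθ : ContinuousOn θ (Ioo (-1) 1))
    (hE : ∀ x ∈ Ioo (-1 : ℝ) 1, HasDerivAt E (θ x * E x) x) (h0 : E 0 = 1) {x : ℝ}
    (hx : x ∈ Ioo (-1 : ℝ) 1) : integratingFactor θ x = E x := by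
  have := eq_zero_of_linear (θ := fun x => -θ x) (f := fun x => integratingFactor θ x - E x) hθ.neg
    (fun y hy => ((hasDerivAt_integratingFactor hθ hy).sub (hE y hy)).congr_deriv (by ring))
    (by simp [h0, integratingFactor_zero]) hx
  linarith

/-! ## The no-swirl solutions with a logarithmic profile -/

/-- The part of the background flow that carries its boundary values. -/
def baseFlow (s x : ℝ) : ℝ := (1 - x) - (1 + s) * (1 + x)

theorem hasDerivAt_baseFlow (s x : ℝ) : HasDerivAt (baseFlow s) (-(2 + s)) x := by
  have := ((hasDerivAt_id x).const_sub 1).sub (((hasDerivAt_id x).const_add 1).const_mul (1 + s))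
  exact this.congr_deriv (by ring)

theorem contDiff_baseFlow (s : ℝ) {n : WithTop ℕ∞} : ContDiff ℝ n (baseFlow s) := by
  unfold baseFlow; fun_prop

/-- With `w = 0` this says that the base flow solves the swirl-free equation with constants `-1`,
`s² - 1` and `c̄₃ = -s(s+2)/2`. Hence a correction `w` sees only the excess of the third constant.
-/
theorem baseFlow_identity (s x w w' : ℝ) :
    (1 - x ^ 2) * (-(2 + s) + w') + 2 * x * (baseFlow s x + w) + 1 / 2 * (baseFlow s x + w) ^ 2
      = -1 * (1 - x) + (s ^ 2 - 1) * (1 + x) + -(s * (s + 2) / 2) * (1 - x ^ 2)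
        + ((1 - x ^ 2) * w' - s * (1 + x) * w + 1 / 2 * (w * w)) := by
  unfold baseFlow; ring

section Profile

variable {s k : ℝ} {v w E : ℝ → ℝ}

theorem IsProfile.continuousOn (h : IsProfile s k v) : ContinuousOn v (Ioo (-1) 1) :=
  fun x hx => (h x hx).continuousAt.continuousWithinAt

theorem IsProfile.contDiffOn (h : IsProfile s k v) : ContDiffOn ℝ 1 v (Ioo (-1) 1) := by
  have : ContDiffOn ℝ ((0 : ℕ) + 1) v (Ioo (-1) 1) := by
    refine contDiffOn_succ_of_hasDerivAt h (contDiffOn_zero.2 ?_)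
    have hv := h.continuousOn
    refine (continuousOn_const.add (continuousOn_const.mul (hv.div (by fun_prop) fun x hx => ?_))).sub
      (continuousOn_const.mul ((hv.mul hv).div (by fun_prop) fun x hx => (one_sub_sq_pos hx).ne'))
    exact ne_of_gt (by linarith [hx.2])
  simpa using this

/-- The difference of two solutions of a Riccati equation solves a Bernoulli equation, whose linear
part is the linearisation at `v`. -/
theorem IsProfile.sub_hasDerivAt (hv : IsProfile s k v) (hw : IsProfile s k w) {x : ℝ}
    (hx : x ∈ Ioo (-1 : ℝ) 1) : HasDerivAt (fun x => w x - v x)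
      (-(rate s v x * (w x - v x)) - 1 / 2 * ((w x - v x) ^ 2 / (1 - x ^ 2))) x := by
  refine ((hw x hx).sub (hv x hx)).congr_deriv ?_
  rw [rate]; ring

theorem IsProfile.unique (hv : IsProfile s k v) (hw : IsProfile s k w) (h0 : w 0 = v 0) {x : ℝ}
    (hx : x ∈ Ioo (-1 : ℝ) 1) : w x = v x := by
  have := eq_zero_of_linear (θ := fun x => rate s v x + 1 / 2 * ((w x - v x) / (1 - x ^ 2)))
    (f := fun x => w x - v x)
    ((continuousOn_rate s hv.continuousOn).add (continuousOn_const.mul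
      ((hw.continuousOn.sub hv.continuousOn).div (by fun_prop) fun x hx => (one_sub_sq_pos hx).ne')))
    (fun y hy => (hv.sub_hasDerivAt hw hy).congr_deriv (by ring)) (by simp [h0]) hx
  linarith

/-- The profile in `M₁` is the lowest one: a lower one blows up before reaching the pole `x = 1`. -/
theorem IsProfile.le_of_isWeight (hv : IsProfile s k v) (hE : IsWeight s v E) (hs : 0 ≤ s)
    (hw : IsProfile s k w) : v 0 ≤ w 0 := by
  by_contra! hlt
  obtain ⟨C, hC0, hC⟩ := hE.upper
  -- The integrating factor removes the linear part of the Bernoulli equation, so that `1/g` has the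
  -- derivative `1/(2E(1-x²))`.
  set g : ℝ → ℝ := fun x => E x * (w x - v x) with hg
  have hgd : ∀ x ∈ Ioo (-1 : ℝ) 1,
      HasDerivAt g (-(1 / 2 * (g x ^ 2 / (E x * (1 - x ^ 2))))) x := by
    intro x hx
    refine ((hE.der x hx).mul (hv.sub_hasDerivAt hw hx)).congr_deriv ?_
    have := (hE.pos x hx).ne'
    have := (one_sub_sq_pos hx).ne'
    simp only [hg]
    field_simp
    ring
  have hsub : Ico (0 : ℝ) 1 ⊆ Ioo (-1) 1 := fun x hx => ⟨by linarith [hx.1], hx.2⟩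
  have hcg : ContinuousOn g (Ico 0 1) := fun x hx =>
    (hgd x (hsub hx)).continuousAt.continuousWithinAt
  have hg0 : g 0 < 0 := by
    have := hE.pos 0 zero_mem_outer
    exact mul_neg_of_pos_of_neg this (by linarith)
  have hanti : AntitoneOn g (Ico 0 1) := by
    refine antitoneOn_of_deriv_nonpos (convex_Ico _ _) hcg (fun x hx => ?_) fun x hx => ?_
    · rw [interior_Ico] at hx
      exact (hgd x (hsub ⟨hx.1.le, hx.2⟩)).differentiableAt.differentiableWithinAt
    · rw [interior_Ico] at hx
      have hx' := hsub ⟨hx.1.le, hx.2⟩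
      rw [(hgd x hx').deriv]
      have := hE.pos x hx'
      have := one_sub_sq_pos hx'
      have : 0 ≤ 1 / 2 * (g x ^ 2 / (E x * (1 - x ^ 2))) := by positivity
      linarith
  have hneg : ∀ x ∈ Ico (0 : ℝ) 1, g x < 0 := fun x hx =>
    (hanti ⟨le_rfl, one_pos⟩ hx hx.1).trans_lt hg0
  -- On `[0,1)` one has `E ≤ 9C` and `1 - x² ≤ 2(1-x)`, hence `(1/g)' ≥ c/(1-x)`, which is not
  -- integrable up to `1`.
  set c := 1 / (36 * C) with hc
  have hc0 : 0 < c := by positivity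
  have hpd : ∀ x ∈ Ico (0 : ℝ) 1, HasDerivAt (fun x => (g x)⁻¹ + c * Real.log (1 - x))
      (1 / 2 * (E x * (1 - x ^ 2))⁻¹ - c * (1 - x)⁻¹) x := by
    intro x hx
    have x1 : 1 - x ≠ 0 := by linarith [hx.2]
    have h := ((hgd x (hsub hx)).inv (hneg x hx).ne).add
      ((((hasDerivAt_id x).const_sub 1).log x1).const_mul c)
    refine h.congr_deriv ?_
    have := (hneg x hx).ne
    have := (hE.pos x (hsub hx)).ne'
    have := (one_sub_sq_pos (hsub hx)).ne'
    simp only [id]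
    field_simp
    ring
  have hmono : MonotoneOn (fun x => (g x)⁻¹ + c * Real.log (1 - x)) (Ico 0 1) := by
    refine monotoneOn_of_deriv_nonneg (convex_Ico _ _)
      (fun x hx => (hpd x hx).continuousAt.continuousWithinAt) (fun x hx => ?_) fun x hx => ?_
    · rw [interior_Ico] at hx
      exact (hpd x ⟨hx.1.le, hx.2⟩).differentiableAt.differentiableWithinAt
    · rw [interior_Ico] at hx
      have hx' : x ∈ Ico (0 : ℝ) 1 := ⟨hx.1.le, hx.2⟩
      have hx'' := hsub hx'
      rw [(hpd x hx').deriv]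
      have x1 : 0 < 1 - x := by linarith [hx.2]
      have hEx := hE.pos x hx''
      have hle : E x ≤ C * 9 := by
        refine (hC x hx'').trans (mul_le_mul_of_nonneg_left ?_ hC0.le)
        have a : (1 - x) ^ s ≤ 1 := Real.rpow_le_one x1.le (by linarith [hx.1]) hs
        have b := ell_le_three hx.1.le hx.2
        have l := ell_pos hx''
        have d : ell x ^ 2 ≤ 9 := by nlinarith
        have : 0 ≤ ell x ^ 2 := by positivity
        nlinarith
      have h2 : E x * (1 - x ^ 2) ≤ C * 18 * (1 - x) := by
        have : 1 - x ^ 2 ≤ 2 * (1 - x) := by nlinarith [hx.1, hx.2]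
        calc E x * (1 - x ^ 2) ≤ (C * 9) * (2 * (1 - x)) :=
              mul_le_mul hle this (one_sub_sq_pos hx'').le (by positivity)
          _ = _ := by ring
      have h3 := inv_anti₀ (mul_pos hEx (one_sub_sq_pos hx'')) h2
      have h4 : c * (1 - x)⁻¹ = 1 / 2 * (C * 18 * (1 - x))⁻¹ := by
        rw [hc]; field_simp; norm_num
      rw [h4]
      linarith
  -- At this point the lower bound `1/g(0) - c log(1-x)` of `1/g` reaches zero, against `g < 0`.
  set y := 1 - Real.exp ((g 0)⁻¹ / c) with hy
  have he : Real.exp ((g 0)⁻¹ / c) ≤ 1 := by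
    rw [Real.exp_le_one_iff]
    exact (div_neg_of_neg_of_pos (inv_lt_zero.2 hg0) hc0).le
  have hyI : y ∈ Ico (0 : ℝ) 1 := ⟨by rw [hy]; linarith, by
    rw [hy]; linarith [Real.exp_pos ((g 0)⁻¹ / c)]⟩
  have h := hmono ⟨le_rfl, one_pos⟩ hyI hyI.1
  have e : Real.log (1 - y) = (g 0)⁻¹ / c := by rw [hy, sub_sub_cancel, Real.log_exp]
  simp only [e, sub_zero, Real.log_one, mul_zero, add_zero] at h
  rw [mul_div_cancel₀ _ hc0.ne'] at h
  have := inv_lt_zero.2 (hneg y hyI)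
  linarith

end Profile

/-- Parameters of a background flow with a logarithmic profile at the south pole. -/
structure IsLogParam (c : R3) (s k : ℝ) : Prop where
  hs : 0 ≤ s
  hk : 0 < k
  h0 : c 0 = -1
  h1 : c 1 = s ^ 2 - 1
  h2 : c 2 = -(s * (s + 2) / 2) + k

/-- Subtracting the base flow removes the boundary terms of `P_c`, so that division by `1 - x²`
leaves only the constant `k`. -/
theorem IsLogParam.isNoSwirl_iff {c : R3} {s k : ℝ} (h : IsLogParam c s k) {γ : ℝ} {u : ℝ → ℝ} :
    IsNoSwirl c γ u ↔ IsProfile s k (fun x => u x - baseFlow s x) ∧ u 0 = γ := by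
  have key : ∀ x ∈ Ioo (-1 : ℝ) 1, ∀ u' : ℝ,
      ((1 - x ^ 2) * u' + 2 * x * u x + 1 / 2 * u x ^ 2 = P c x) ↔
        u' + (2 + s) = k + s * ((u x - baseFlow s x) / (1 - x))
          - 1 / 2 * ((u x - baseFlow s x) * (u x - baseFlow s x) / (1 - x ^ 2)) := by
    intro x hx u'
    have x1 : 1 - x ≠ 0 := by linarith [hx.2]
    have x2 : 1 + x ≠ 0 := by linarith [hx.1]
    have e := baseFlow_identity s x (u x - baseFlow s x) (u' + (2 + s))
    have e1 : baseFlow s x + (u x - baseFlow s x) = u x := by ring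
    have e2 : -(2 + s) + (u' + (2 + s)) = u' := by ring
    have x3 : (1 - x ^ 2) ≠ 0 := (one_sub_sq_pos hx).ne'
    rw [e1, e2] at e
    rw [e, P, h.h0, h.h1, h.h2]
    set w := u x - baseFlow s x
    have e3 : k + s * (w / (1 - x)) - 1 / 2 * (w * w / (1 - x ^ 2))
        = ((1 - x ^ 2) * k + s * (1 + x) * w - 1 / 2 * (w * w)) / (1 - x ^ 2) := by
      have : 1 - x ^ 2 = (1 - x) * (1 + x) := by ring
      rw [this]
      field_simp
    rw [e3, eq_div_iff x3]
    constructor <;> intro h <;> linarith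
  constructor
  · rintro ⟨h1, h2, h3⟩
    refine ⟨fun x hx => ?_, h3⟩
    refine ((h1.hasDerivAt_Ioo one_ne_zero hx).sub (hasDerivAt_baseFlow s x)).congr_deriv ?_
    rw [← (key x hx _).1 (h2 x hx)]; ring
  · rintro ⟨h1, h3⟩
    have hd : ∀ x ∈ Ioo (-1 : ℝ) 1, HasDerivAt u _ x := fun x hx =>
      ((h1 x hx).add (hasDerivAt_baseFlow s x)).congr_of_eventuallyEq
        (Eventually.of_forall fun y => by simp)
    refine ⟨?_, fun x hx => ?_, h3⟩
    · have := h1.contDiffOn.add (contDiff_baseFlow s).contDiffOn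
      exact this.congr fun x _ => by simp
    · rw [key x hx, (hd x hx).deriv]; ring

/-- The lowest no-swirl solution. -/
theorem IsLogParam.ubar {c : R3} {s k : ℝ} (h : IsLogParam c s k) {v E : ℝ → ℝ}
    (hv : IsProfile s k v) (hE : IsWeight s v E) :
    γminus c = v 0 - s ∧
      ∀ x ∈ Ioo (-1 : ℝ) 1, Ubar c (γminus c) x = baseFlow s x + v x := by
  have hu : IsNoSwirl c (v 0 - s) fun x => baseFlow s x + v x := by
    rw [h.isNoSwirl_iff]
    refine ⟨?_, ?_⟩
    · simpa using hv
    · simp only [baseFlow]; ring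
  have hmin : IsLeast {γ | ∃ u, IsNoSwirl c γ u} (v 0 - s) := by
    refine ⟨⟨_, hu⟩, ?_⟩
    rintro γ ⟨u, hu⟩
    rw [h.isNoSwirl_iff] at hu
    have := hv.le_of_isWeight hE h.hs hu.1
    rw [hu.2] at this
    simp only [baseFlow] at this
    linarith
  have hγ : γminus c = v 0 - s := hmin.csInf_eq
  refine ⟨hγ, fun x hx => ?_⟩
  have hU : IsNoSwirl c (v 0 - s) (Ubar c (v 0 - s)) := Ubar_spec ⟨_, hu⟩
  rw [h.isNoSwirl_iff] at hU
  have := hv.unique hU.1 (by rw [hU.2]; simp only [baseFlow]; ring) hx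
  rw [hγ]
  linarith

/-! ## The system and the Navier-Stokes equations -/

section System

variable {ε : ℝ}

theorem Operators.eqθ_fn (o : Operators ε) (s k : ℝ) (w : M₁ ε .south) (φ : M₂ ε) {x : ℝ}
    (hx : x ∈ Ioo (-1 : ℝ) 1) : (o.eqθ s k w φ).fn x
      = deriv w.fn x - s * (w.fn x / (1 - x)) + 1 / 2 * (w.fn x * w.fn x / (1 - x ^ 2))
        + psiHat φ.fn φ.fn x / (1 - x ^ 2) - k := by
  simp only [Operators.eqθ, Y₁.fn_add, Y₁.fn_sub, Y₁.fn_smul, Pi.add_apply, Pi.sub_apply,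
    Pi.smul_apply, o.d_fn _ x hx, o.quot_fn _ x hx, o.prod_fn _ _ x hx, o.swirl_fn _ _ x hx,
    o.one_fn x hx, smul_eq_mul, mul_one]

/-- A function in `Y₁` has no poles at the end points. -/
theorem Y₁.eq_zero_of_poles {ρ : Y₁ ε} (h0 : 0 < ε) (h1 : ε < 1 / 2) {a b : ℝ}
    (h : ∀ x ∈ Ioo (-1 : ℝ) 1, ρ.fn x = a / (1 + x) + b / (1 - x)) : a = 0 ∧ b = 0 := by
  -- At `x = -1` the factor `ell²` tends to infinity and forces `a = 0`; at `x = 1` the right side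
  -- tends to zero while `ell² ≥ 1/9`, which forces `b = 0`.
  have hb : ∀ x ∈ Ioo (-1 : ℝ) 1,
      |a * (1 - x) + b * (1 + x)| * ell x ^ 2 ≤ ‖ρ‖ * (1 - x) ^ (1 - 2 * ε) := by
    intro x hx
    have x1 : 0 < 1 - x := by linarith [hx.2]
    have x2 : 0 < 1 + x := by linarith [hx.1]
    have e := ρ.val_le hx
    have e1 : wDer ε .south x * ρ.fn x * (1 - x) ^ (1 - 2 * ε)
        = (a * (1 - x) + b * (1 + x)) * ell x ^ 2 := by
      have : (1 - x) ^ (2 * ε) * (1 - x) ^ (1 - 2 * ε) = 1 - x := by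
        rw [← Real.rpow_add x1]; simp
      rw [wDer_south, h x hx]
      calc _ = (1 + x) * ell x ^ 2 * (a / (1 + x) + b / (1 - x))
            * ((1 - x) ^ (2 * ε) * (1 - x) ^ (1 - 2 * ε)) := by ring
        _ = _ := by rw [this]; field_simp
    have e2 : 0 ≤ ell x ^ 2 := by positivity
    have e3 : 0 < (1 - x) ^ (1 - 2 * ε) := by positivity
    rw [← abs_of_nonneg e2, ← abs_mul, ← e1, abs_mul, abs_of_pos e3]
    gcongr
  have hp : 0 < 1 - 2 * ε := by linarith
  have north : Ioi (-1 : ℝ) ∈ 𝓝[<] (1 : ℝ) := mem_nhdsWithin_of_mem_nhds (Ioi_mem_nhds (by norm_num))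
  have south : Iio (1 : ℝ) ∈ 𝓝[>] (-1 : ℝ) := mem_nhdsWithin_of_mem_nhds (Iio_mem_nhds (by norm_num))
  constructor
  · have t1 : Tendsto (fun x : ℝ => |a * (1 - x) + b * (1 + x)|) (𝓝[>] (-1)) (𝓝 |a * 2|) := by
      have : ContinuousAt (fun x : ℝ => |a * (1 - x) + b * (1 + x)|) (-1) := by fun_prop
      have h := this.tendsto.mono_left (nhdsWithin_le_nhds (s := Ioi (-1)))
      convert h using 2
      norm_num
    have t2 : Tendsto (fun x : ℝ => ‖ρ‖ * 2 / ell x ^ 2) (𝓝[>] (-1)) (𝓝 0) :=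
      ((tendsto_pow_atTop two_ne_zero).comp tendsto_ell).const_div_atTop _
    have := le_of_tendsto_of_tendsto t1 t2 (by
      filter_upwards [self_mem_nhdsWithin, south] with x hx1 hx0
      have hx : x ∈ Ioo (-1 : ℝ) 1 := ⟨hx1, hx0⟩
      have hl := ell_pos hx
      rw [le_div_iff₀ (by positivity)]
      exact (hb x hx).trans (mul_le_mul_of_nonneg_left
        (one_sub_rpow_le_two hp.le (by linarith) hx) (norm_nonneg _)))
    have := abs_eq_zero.1 (le_antisymm this (abs_nonneg _))
    linarith
  · have t1 : Tendsto (fun x : ℝ => |a * (1 - x) + b * (1 + x)|) (𝓝[<] 1) (𝓝 |b * 2|) := by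
      have : ContinuousAt (fun x : ℝ => |a * (1 - x) + b * (1 + x)|) 1 := by fun_prop
      have h := this.tendsto.mono_left (nhdsWithin_le_nhds (s := Iio 1))
      convert h using 2
      norm_num
    have t2 : Tendsto (fun x : ℝ => ‖ρ‖ * (1 - x) ^ (1 - 2 * ε) * 9) (𝓝[<] 1) (𝓝 0) := by
      have : ContinuousAt (fun x : ℝ => ‖ρ‖ * (1 - x) ^ (1 - 2 * ε) * 9) 1 :=
        (continuousAt_const.mul (ContinuousAt.rpow_const (by fun_prop) (Or.inr hp.le))).mul
          continuousAt_const
      have h := this.tendsto.mono_left (nhdsWithin_le_nhds (s := Iio 1))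
      simpa [hp.ne'] using h
    have := le_of_tendsto_of_tendsto t1 t2 (by
      filter_upwards [self_mem_nhdsWithin, north] with x hx1 hx0
      have hx : x ∈ Ioo (-1 : ℝ) 1 := ⟨hx0, hx1⟩
      have hl := ell_ge hx
      have := hb x hx
      have h0 := abs_nonneg (a * (1 - x) + b * (1 + x))
      have hsq : 1 / 9 ≤ ell x ^ 2 := by nlinarith
      nlinarith)
    have := abs_eq_zero.1 (le_antisymm this (abs_nonneg _))
    linarith

theorem psi_eq_psiHat (f : ℝ → ℝ) (x : ℝ) :
    psi f x = psiHat f f x + 1 / 2 * psi f (-1) * (1 - x) + 1 / 2 * psi f 1 * (1 + x) := by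
  change psi₂ f f x = psiHat f f x + 1 / 2 * psi₂ f f (-1) * (1 - x) + 1 / 2 * psi₂ f f 1 * (1 + x)
  rw [psiHat]; ring

/-- The reduced Navier-Stokes equations in terms of the system. -/
theorem Operators.solvesNSE_iff (o : Operators ε) (h0 : 0 < ε) (h1 : ε < 1 / 2) (s : ℝ)
    (w : M₁ ε .south) (φ : M₂ ε) (c : R3) :
    SolvesNSE c (fun x => baseFlow s x + w.fn x) φ.fn ↔
      c 0 = -1 + 1 / 2 * psi φ.fn (-1) ∧ c 1 = s ^ 2 - 1 + 1 / 2 * psi φ.fn 1 ∧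
      o.eqθ s (c 2 + s * (s + 2) / 2) w φ = 0 ∧ o.eqφ s w φ = 0 := by
  have hreg : ContDiffOn ℝ 1 (fun x => baseFlow s x + w.fn x) (Ioo (-1) 1) :=
    (contDiff_baseFlow s).contDiffOn.add w.mem.c1
  have hder : ∀ x ∈ Ioo (-1 : ℝ) 1, deriv (fun x => baseFlow s x + w.fn x) x
      = -(2 + s) + deriv w.fn x := fun x hx =>
    ((hasDerivAt_baseFlow s x).add (w.mem.c1.hasDerivAt_Ioo one_ne_zero hx)).deriv
  have hφ : (∀ x ∈ Ioo (-1 : ℝ) 1, (1 - x ^ 2) * iteratedDeriv 2 φ.fn x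
      + (baseFlow s x + w.fn x) * deriv φ.fn x = 0) ↔ o.eqφ s w φ = 0 := by
    have key : ∀ x ∈ Ioo (-1 : ℝ) 1, (1 - x ^ 2) * iteratedDeriv 2 φ.fn x
        + (baseFlow s x + w.fn x) * deriv φ.fn x = (1 - x ^ 2) * (o.eqφ s w φ).fn x := by
      intro x hx
      have x1 : 1 - x ≠ 0 := by linarith [hx.2]
      have x2 : 1 + x ≠ 0 := by linarith [hx.1]
      have e : 1 - x ^ 2 = (1 - x) * (1 + x) := by ring
      rw [o.eqφ_fn s w φ hx, rate, baseFlow, e]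
      field_simp
      ring
    constructor
    · intro h
      refine Y₂.ext_on fun x hx => ?_
      have := h x hx
      rw [key x hx] at this
      exact (mul_eq_zero.1 this).resolve_left (one_sub_sq_pos hx).ne'
    · intro h x hx
      rw [key x hx, h, Y₂.fn_zero, Pi.zero_apply, mul_zero]
  -- The full residual differs from `(1-x²)` times the system by an affine function. After division
  -- that function becomes a sum of simple poles, excluded in `Y₁`; this determines the first two
  -- constants.
  have key : ∀ x ∈ Ioo (-1 : ℝ) 1, (1 - x ^ 2) * deriv (fun x => baseFlow s x + w.fn x) x
      + 2 * x * (baseFlow s x + w.fn x) + 1 / 2 * (baseFlow s x + w.fn x) ^ 2 + psi φ.fn x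
      - P c x = (1 - x ^ 2) * (o.eqθ s (c 2 + s * (s + 2) / 2) w φ).fn x
        - (c 0 + 1 - 1 / 2 * psi φ.fn (-1)) * (1 - x)
        - (c 1 - (s ^ 2 - 1) - 1 / 2 * psi φ.fn 1) * (1 + x) := by
    intro x hx
    have x1 : 1 - x ≠ 0 := by linarith [hx.2]
    have x2 : 1 + x ≠ 0 := by linarith [hx.1]
    have e : 1 - x ^ 2 = (1 - x) * (1 + x) := by ring
    have e1 := baseFlow_identity s x (w.fn x) (deriv w.fn x)
    have e2 : (1 - x ^ 2) * (o.eqθ s (c 2 + s * (s + 2) / 2) w φ).fn x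
        = (1 - x ^ 2) * deriv w.fn x - s * (1 + x) * w.fn x + 1 / 2 * (w.fn x * w.fn x)
          + psiHat φ.fn φ.fn x - (1 - x ^ 2) * (c 2 + s * (s + 2) / 2) := by
      rw [o.eqθ_fn s _ w φ hx, e]
      field_simp
    rw [hder x hx, e1, e2, P, psi_eq_psiHat φ.fn x]
    ring
  constructor
  · rintro ⟨-, -, h⟩
    have hz : ∀ x ∈ Ioo (-1 : ℝ) 1, (o.eqθ s (c 2 + s * (s + 2) / 2) w φ).fn x
        = (c 0 + 1 - 1 / 2 * psi φ.fn (-1)) / (1 + x)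
          + (c 1 - (s ^ 2 - 1) - 1 / 2 * psi φ.fn 1) / (1 - x) := by
      intro x hx
      have x1 : 1 - x ≠ 0 := by linarith [hx.2]
      have x2 : 1 + x ≠ 0 := by linarith [hx.1]
      have e := key x hx
      rw [(h x hx).1, sub_self] at e
      have e3 : 1 - x ^ 2 = (1 - x) * (1 + x) := by ring
      rw [e3] at e
      rw [div_add_div _ _ x2 x1, eq_div_iff (mul_ne_zero x2 x1)]
      linarith
    obtain ⟨e1, e2⟩ := Y₁.eq_zero_of_poles h0 h1 hz
    refine ⟨by linarith, by linarith, Y₁.ext_on fun x hx => ?_, hφ.1 fun x hx => (h x hx).2⟩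
    rw [hz x hx, e1, e2]
    simp [Y₁.fn_zero]
  · rintro ⟨e1, e2, e3, e4⟩
    refine ⟨hreg, φ.mem.c2, fun x hx => ⟨?_, hφ.2 e4 x hx⟩⟩
    have e := key x hx
    rw [e3, e1, e2, Y₁.fn_zero, Pi.zero_apply] at e
    linarith

theorem M₁.tendsto_zero {w : M₁ ε .south} :
    Tendsto w.fn (𝓝[<] 1) (𝓝 0) := by
  have h := w.mem.cont 1 ⟨by norm_num, le_rfl⟩
  have h' := h.tendsto
  rw [w.mem.zero_off 1 (by simp)] at h'
  refine h'.mono_left ?_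
  rw [← nhdsWithin_Ioo_eq_nhdsLT (show (-1 : ℝ) < 1 by norm_num)]
  exact nhdsWithin_mono _ Ioo_subset_Icc_self

/-- The system determines the background flow. -/
theorem Operators.sys_injective (o : Operators ε) (h0 : 0 < ε) (h1 : ε < 1 / 2) {s k : ℝ}
    {v : M₁ ε .south} (hs : 0 ≤ s) (hv : IsProfile s k v.fn) {e : Unknowns ε}
    (he : o.sys e = o.sys (s, k, v, 0)) : e = (s, k, v, 0) := by
  obtain ⟨s', k', w, φ⟩ := e
  simp only [Operators.sys, Prod.mk.injEq, o.ev_fn, o.evDer_fn, o.ev₂_fn] at he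
  obtain ⟨rfl, hθ, hφ, hw0, hφ1, hφ0⟩ := he
  rw [M₂.fn_zero] at hφ1 hφ0
  have hφ1' : deriv φ.fn 0 = 0 := by rw [hφ1]; exact deriv_const 0 (0 : ℝ)
  have hc := (continuousOn_rate s' w.mem.c1.continuousOn).sub (ContinuousOn.div
    (f := fun x : ℝ => 2 * x) (g := fun x : ℝ => 1 - x ^ 2) (by fun_prop) (by fun_prop)
    fun x hx => (one_sub_sq_pos hx).ne')
  have hφz : ∀ x ∈ Ioo (-1 : ℝ) 1, deriv φ.fn x = 0 := fun x hx => by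
    refine eq_zero_of_linear hc (fun y hy => ?_) hφ1' hx
    have a := (φ.mem.c2.deriv_Ioo (m := 1) (by norm_num)).hasDerivAt_Ioo one_ne_zero hy
    refine a.congr_deriv ?_
    have e := congrArg (fun η => η.fn y) hφ
    have z : o.eqφ s' v 0 = 0 := by simp [Operators.eqφ]
    simp only [z, o.eqφ_fn s' w φ hy, Y₂.fn_zero, Pi.zero_apply, iteratedDeriv_succ,
      iteratedDeriv_zero] at e
    simp only [Pi.sub_apply, Pi.div_apply]
    linarith
  have hφ : φ = 0 := M₂.ext_on fun x hx => by
    have hz : ∀ x ∈ Ioo (-1 : ℝ) 1, HasDerivAt φ.fn 0 x := fun x hx => by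
      rw [← hφz x hx]; exact φ.mem.c2.hasDerivAt_Ioo two_ne_zero hx
    rw [eq_of_hasDerivAt_zero hz hx zero_mem_outer, hφ0]; rfl
  subst hφ
  -- Since `w² - v² = (w+v)(w-v)`, the difference `w - v` solves a linear equation with this
  -- coefficient and source `k' - k`.
  set θ : ℝ → ℝ := fun x => -(s' / (1 - x)) + 1 / 2 * ((w.fn x + v.fn x) / (1 - x ^ 2)) with hθd
  have hθc : ContinuousOn θ (Ioo (-1) 1) := by
    refine (ContinuousOn.neg (ContinuousOn.div (by fun_prop) (by fun_prop) fun x hx => ?_)).add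
      (continuousOn_const.mul ((w.mem.c1.continuousOn.add v.mem.c1.continuousOn).div (by fun_prop)
        fun x hx => (one_sub_sq_pos hx).ne'))
    exact ne_of_gt (by linarith [hx.2])
  have hf : ∀ x ∈ Ioo (-1 : ℝ) 1, HasDerivAt (fun x => w.fn x - v.fn x)
      (k' - k - θ x * (w.fn x - v.fn x)) x := by
    intro x hx
    refine ((w.mem.c1.hasDerivAt_Ioo one_ne_zero hx).sub
      (v.mem.c1.hasDerivAt_Ioo one_ne_zero hx)).congr_deriv ?_
    have e := congrArg (fun η => η.fn x) hθ
    simp only [o.eqθ_fn _ _ _ _ hx] at e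
    rw [hθd]
    linear_combination e
  have hMf : ∀ x ∈ Ioo (-1 : ℝ) 1,
      HasDerivAt (fun x => integratingFactor θ x * (w.fn x - v.fn x))
        ((k' - k) * integratingFactor θ x) x := fun x hx =>
    ((hasDerivAt_integratingFactor hθc hx).mul (hf x hx)).congr_deriv (by ring)
  -- Only an upper bound is required: the term `-s/(1-x)` is nonpositive and may be dropped, and the
  -- rest is at most a multiple of `(1-x)^(-2ε)`, integrable up to `1`.
  have hbd : ∃ B, ∀ x ∈ Ico (0 : ℝ) 1, integratingFactor θ x ≤ B := by
    have hp : 0 < 1 - 2 * ε := by linarith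
    set N := 3 / 2 * (‖w‖ + ‖v‖) with hN
    have hN0 : 0 ≤ N := by positivity
    refine ⟨Real.exp (N / (1 - 2 * ε)), fun x hx => Real.exp_le_exp.2 ?_⟩
    have hx' : x ∈ Ioo (-1 : ℝ) 1 := ⟨by linarith [hx.1], hx.2⟩
    have hmon : ∫ y in (0 : ℝ)..x, θ y ≤ ∫ y in (0 : ℝ)..x, N * (1 - y) ^ (-(2 * ε)) := by
      refine intervalIntegral.integral_mono_on hx.1 (intervalIntegrable_Ioo hθc zero_mem_outer hx')
        (intervalIntegrable_Ioo (continuousOn_const.mul (ContinuousOn.rpow_const (by fun_prop)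
          fun y hy => Or.inl ?_)) zero_mem_outer hx') fun y hy => ?_
      · exact ne_of_gt (by linarith [hy.2])
      · have hy' : y ∈ Ioo (-1 : ℝ) 1 := ⟨by linarith [hy.1], hy.2.trans_lt hx.2⟩
        have y1 : 0 < 1 - y := by linarith [hy'.2]
        have hl := ell_ge hy'
        have bound : ∀ u : M₁ ε .south, u.fn y ≤ 3 * ‖u‖ * (1 - y) ^ (1 - 2 * ε) := fun u => by
          refine (le_abs_self _).trans ((abs_le_of_wVal hy' (u.val_le hy')).trans ?_)
          rw [mul_comm 3, mul_assoc]
          refine mul_le_mul_of_nonneg_left ?_ (norm_nonneg _)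
          rw [div_le_iff₀ (ell_pos hy')]
          have : 0 < (1 - y) ^ (1 - 2 * ε) := by positivity
          nlinarith
        have e : (1 - y) ^ (1 - 2 * ε) = (1 - y) ^ (-(2 * ε)) * (1 - y) := by
          rw [← Real.rpow_add_one y1.ne']; congr 1; ring
        have hq : 0 < (1 - y) ^ (-(2 * ε)) := by positivity
        have s1 : 0 ≤ s' / (1 - y) := by positivity
        have hsum : w.fn y + v.fn y ≤ 2 * N * (1 - y) ^ (1 - 2 * ε) := by
          have := bound w
          have := bound v
          rw [hN]; linarith
        have : (w.fn y + v.fn y) / (1 - y ^ 2) ≤ 2 * N * (1 - y) ^ (-(2 * ε)) := by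
          rw [div_le_iff₀ (one_sub_sq_pos hy')]
          refine hsum.trans ?_
          rw [e]
          have : 1 - y ≤ 1 - y ^ 2 := by nlinarith [hy.1, hy'.2]
          calc 2 * N * ((1 - y) ^ (-(2 * ε)) * (1 - y)) ≤ 2 * N * ((1 - y) ^ (-(2 * ε)) * (1 - y ^ 2)) := by
                gcongr
            _ = _ := by ring
        simp only [hθd]
        linarith
    have hint : ∫ y in (0 : ℝ)..x, N * (1 - y) ^ (-(2 * ε))
        = N / (1 - 2 * ε) * (1 - (1 - x) ^ (1 - 2 * ε)) := by
      rw [intervalIntegral.integral_eq_sub_of_hasDerivAt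
        (f := fun y : ℝ => -(N / (1 - 2 * ε)) * (1 - y) ^ (1 - 2 * ε))]
      · simp only [sub_zero, Real.one_rpow]; ring
      · intro y hy
        rw [uIcc_of_le hx.1] at hy
        refine ((hasDerivAt_one_sub_rpow (1 - 2 * ε) (hy.2.trans_lt hx.2)).const_mul _).congr_deriv ?_
        rw [show 1 - 2 * ε - 1 = -(2 * ε) by ring]
        field_simp
      · exact intervalIntegrable_Ioo (continuousOn_const.mul (ContinuousOn.rpow_const (by fun_prop)
          fun y hy => Or.inl (ne_of_gt (by linarith [hy.2])))) zero_mem_outer hx'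
    refine hmon.trans ?_
    rw [hint]
    have x1 : 0 < 1 - x := by linarith [hx.2]
    have a : 0 ≤ (1 - x) ^ (1 - 2 * ε) := by positivity
    have b : 0 ≤ N / (1 - 2 * ε) := by positivity
    nlinarith
  obtain ⟨B, hB⟩ := hbd
  have ht : Tendsto (fun x => integratingFactor θ x * (w.fn x - v.fn x)) (𝓝[<] 1) (𝓝 0) := by
    have hz : Tendsto (fun x => B * |w.fn x - v.fn x|) (𝓝[<] 1) (𝓝 0) := by
      have := (((M₁.tendsto_zero (w := w)).sub (M₁.tendsto_zero (w := v))).abs).const_mul B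
      simpa using this
    refine squeeze_zero_norm' ?_ hz
    have : Ioi (0 : ℝ) ∈ 𝓝[<] (1 : ℝ) := mem_nhdsWithin_of_mem_nhds (Ioi_mem_nhds (by norm_num))
    filter_upwards [self_mem_nhdsWithin, this] with x hx1 hx0
    rw [Real.norm_eq_abs, abs_mul, abs_of_pos (integratingFactor_pos θ x)]
    exact mul_le_mul_of_nonneg_right (hB x ⟨le_of_lt hx0, hx1⟩) (abs_nonneg _)
  -- The weighted difference vanishes at `0` and in the limit at `1`, while its derivative has the
  -- constant sign of `k' - k`.
  have hkk := eq_zero_of_hasDerivAt_of_tendsto (fun x _ => integratingFactor_pos θ x) hMf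
    (by simp [hw0]) ht
  have hwv : w = v := M₁.ext_on fun x hx => by
    have := eq_zero_of_linear hθc (fun y hy => (hf y hy).congr_deriv (by rw [hkk]; ring))
      (by simp [hw0]) hx
    linarith
  rw [hwv, show k' = k by linarith]

end System

end HomNS

namespace HomNS

/-! ## The background flow and the kernel of its linearisation -/

/-- The background flow `q = (c, γ)` and the kernel functions of its linearisation, as elements of
the weighted spaces. -/
structure Background {ε : ℝ} (o : Operators ε) (q : R3 × ℝ) (s : ℝ) where
  k : ℝ
  v : M₁ ε .south
  h : M₁ ε .south
  χ₃ : M₂ ε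
  χ₄ : M₂ ε
  param : IsLogParam q.1 s k
  profile : IsProfile s k v.fn
  solvable : o.Solvable s v
  ubar : ∀ x ∈ Ioo (-1 : ℝ) 1, Ubar q.1 q.2 x = baseFlow s x + v.fn x
  v_zero : o.ev v = q.2 + s
  eqθ : o.eqθ s k v 0 = 0
  linθ : o.linθ s v h = o.one
  h_fn : ∀ x ∈ Ioo (-1 : ℝ) 1, h.fn x = V2b q.1 q.2 x
  eqφ₃ : o.eqφ s v χ₃ = 0
  der₃ : o.evDer χ₃ = 1
  val₃ : o.ev₂ χ₃ = 0
  χ₃_fn : ∀ x ∈ Ioo (-1 : ℝ) 1, χ₃.fn x = V3 q.1 q.2 x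
  eqφ₄ : o.eqφ s v χ₄ = 0
  der₄ : o.evDer χ₄ = 0
  val₄ : o.ev₂ χ₄ = 1
  χ₄_fn : ∀ x ∈ Ioo (-1 : ℝ) 1, χ₄.fn x = V4 q.1 q.2 x

theorem integral_congr_Ioo {f g : ℝ → ℝ} {a b : ℝ} (hab : a ≤ b) (h : EqOn f g (Ioo a b)) :
    ∫ x in a..b, f x = ∫ x in a..b, g x := by
  rw [intervalIntegral.integral_of_le hab, intervalIntegral.integral_of_le hab,
    MeasureTheory.integral_Ioc_eq_integral_Ioo, MeasureTheory.integral_Ioc_eq_integral_Ioo]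
  exact MeasureTheory.setIntegral_congr_fun measurableSet_Ioo h

theorem integratingFactor_congr {θ θ' : ℝ → ℝ} (h : EqOn θ θ' (Ioo (-1) 1)) {x : ℝ}
    (hx : x ∈ Ioo (-1 : ℝ) 1) : integratingFactor θ x = integratingFactor θ' x := by
  unfold integratingFactor
  rw [intervalIntegral.integral_congr fun y hy => h (uIcc_zero_subset hx hy)]

section Existence

variable {ε s k : ℝ} {c : R3} {γ : ℝ} {v E : ℝ → ℝ}

/-- The point is that `2x` plus the base flow equals `-s(1+x)`, so the integrand of `a` is `rate s
v`. -/
theorem exp_aFun (hE : IsWeight s v E) (hE0 : E 0 = 1) (hv : ContinuousOn v (Ioo (-1) 1))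
    (hu : ∀ x ∈ Ioo (-1 : ℝ) 1, Ubar c γ x = baseFlow s x + v x) {x : ℝ}
    (hx : x ∈ Ioo (-1 : ℝ) 1) : Real.exp (aFun c γ x) = E x := by
  rw [← eq_integratingFactor (continuousOn_rate s hv) hE.der hE0 hx]
  refine integratingFactor_congr (fun y hy => ?_) hx
  simp only [hu y hy, rate, baseFlow]
  have y1 : 1 - y ≠ 0 := by linarith [hy.2]
  have y2 : 1 + y ≠ 0 := by linarith [hy.1]
  have e : 1 - y ^ 2 = (1 - y) * (1 + y) := by ring
  rw [e]
  field_simp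
  ring

theorem exp_bFun (hE : IsWeight s v E) (hE0 : E 0 = 1) (hv : ContinuousOn v (Ioo (-1) 1))
    (hu : ∀ x ∈ Ioo (-1 : ℝ) 1, Ubar c γ x = baseFlow s x + v x) {x : ℝ}
    (hx : x ∈ Ioo (-1 : ℝ) 1) : Real.exp (bFun c γ x) = (1 - x ^ 2) * E x := by
  have hc : ContinuousOn (fun x => rate s v x - 2 * x / (1 - x ^ 2)) (Ioo (-1) 1) :=
    (continuousOn_rate s hv).sub (ContinuousOn.div (by fun_prop) (by fun_prop)
      fun x hx => (one_sub_sq_pos hx).ne')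
  rw [← eq_integratingFactor (E := fun x => (1 - x ^ 2) * E x) hc ?_ (by simp [hE0]) hx]
  · refine integratingFactor_congr (fun y hy => ?_) hx
    simp only [hu y hy, rate, baseFlow]
    have y1 : 1 - y ≠ 0 := by linarith [hy.2]
    have y2 : 1 + y ≠ 0 := by linarith [hy.1]
    have e : 1 - y ^ 2 = (1 - y) * (1 + y) := by ring
    rw [e]
    field_simp
    ring
  · intro y hy
    have h := ((hasDerivAt_pow 2 y).const_sub 1).mul (hE.der y hy)
    refine h.congr_deriv ?_
    have := (one_sub_sq_pos hy).ne'
    field_simp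
    ring

/-- The kernel functions are first produced inside the weighted spaces by solvability and only then
identified with `V^{2b}`, `V³`, `V⁴`. Their membership in the spaces thus needs no separate
estimate. -/
theorem IsLogParam.nonempty_background {q : R3 × ℝ} (h : IsLogParam q.1 s k)
    (hγ : q.2 = γminus q.1) (hsε : s < ε) (h1 : ε < 1 / 2) (o : Operators ε) :
    Nonempty (Background o q s) := by
  have h0 : 0 < ε := h.hs.trans_lt hsε
  obtain ⟨v, E, hE, hE0, hv⟩ := exists_profile h0 h1 h.hs h.hk
  obtain ⟨hγ', hu⟩ := h.ubar hv hE
  rw [← hγ] at hγ' hu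
  have hvc := v.mem.c1.continuousOn
  have hsol := hE.solvable h.hs hsε h1 o
  obtain ⟨g, hg, hgE⟩ := hE.exists_linθ_eq h.hs h0 h1 o o.one
  obtain ⟨χ₃, e3, d3, v3⟩ := hsol.surjφ 0 1 0
  obtain ⟨χ₄, e4, d4, v4⟩ := hsol.surjφ 0 0 1
  have hE1 : ∀ x ∈ Ioo (-1 : ℝ) 1, Real.exp (-aFun q.1 q.2 x) = (E x)⁻¹ := fun x hx => by
    rw [Real.exp_neg, exp_aFun hE hE0 hvc hu hx]
  have hF : ∀ (χ : M₂ ε), o.eqφ s v χ = 0 → ∀ x ∈ Ioo (-1 : ℝ) 1,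
      deriv χ.fn x = Real.exp (-bFun q.1 q.2 x) * o.evDer χ := by
    intro χ hχ x hx
    have hd : ∀ y ∈ Ioo (-1 : ℝ) 1,
        HasDerivAt (fun y => (1 - y ^ 2) * E y * deriv χ.fn y) 0 y := by
      intro y hy
      have a := (χ.mem.c2.deriv_Ioo (m := 1) (by norm_num)).hasDerivAt_Ioo one_ne_zero hy
      refine ((hE.hasDerivAt_azimuthal hy).mul a).congr_deriv ?_
      have e := congrArg (fun η => η.fn y) hχ
      simp only [o.eqφ_fn s v χ hy, Y₂.fn_zero, Pi.zero_apply, iteratedDeriv_succ,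
        iteratedDeriv_zero] at e
      linear_combination ((1 - y ^ 2) * E y) * e
    have e := eq_of_hasDerivAt_zero hd hx zero_mem_outer
    rw [Real.exp_neg, exp_bFun hE hE0 hvc hu hx, o.evDer_fn]
    have := hE.pos x hx
    have := one_sub_sq_pos hx
    simp only [ne_eq, OfNat.ofNat_ne_zero, not_false_eq_true, zero_pow, sub_zero, hE0,
      mul_one, one_mul] at e
    rw [← e]
    field_simp
  have hχ : ∀ (χ : M₂ ε), o.eqφ s v χ = 0 → ∀ x ∈ Ioo (-1 : ℝ) 1,
      χ.fn x = V3 q.1 q.2 x * o.evDer χ + o.ev₂ χ := by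
    intro χ hχ x hx
    have hc : ContinuousOn (deriv χ.fn) (Ioo (-1) 1) := χ.continuousOn_deriv
    have : ∫ y in (0 : ℝ)..x, deriv χ.fn y = χ.fn x - χ.fn 0 :=
      intervalIntegral.integral_eq_sub_of_hasDerivAt
        (fun y hy => χ.mem.c2.hasDerivAt_Ioo two_ne_zero (uIcc_zero_subset hx hy))
        (intervalIntegrable_Ioo hc zero_mem_outer hx)
    rw [intervalIntegral.integral_congr fun y hy => hF χ hχ y (uIcc_zero_subset hx hy),
      intervalIntegral.integral_mul_const] at this
    rw [V3, this, o.ev₂_fn]; ring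
  refine ⟨⟨k, v, g, χ₃, χ₄, h, hv, hsol, hu, ?_, ?_, hg, ?_, e3, d3, v3, ?_, e4, d4, v4, ?_⟩⟩
  · rw [o.ev_fn, hγ']; ring
  · refine Y₁.ext_on fun x hx => ?_
    have hz : psiHat (0 : M₂ ε).fn (0 : M₂ ε).fn x = 0 := by
      have hz : ∀ y, psi₂ (0 : M₂ ε).fn (0 : M₂ ε).fn y = 0 := fun y => by
        simp [psi₂, M₂.fn_zero]
      simp only [psiHat, hz]; ring
    rw [o.eqθ_fn s k v 0 hx, (hv x hx).deriv, hz, Y₁.fn_zero, Pi.zero_apply]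
    ring
  · intro x hx
    rw [hgE x hx, V2b, hE1 x hx]
    congr 1
    rw [intervalIntegral.integral_symm, intervalIntegral.integral_symm x 1]
    congr 1
    refine integral_congr_Ioo hx.2.le fun y hy => ?_
    have hy' : y ∈ Ioo (-1 : ℝ) 1 := ⟨hx.1.trans hy.1, hy.2⟩
    simp only [o.one_fn y hy', mul_one, exp_aFun hE hE0 hvc hu hy']
  · intro x hx
    rw [hχ χ₃ e3 x hx, d3, v3]; ring
  · intro x hx
    rw [hχ χ₄ e4 x hx, d4, v4, V4]; ring

end Existence

/-! ## Invariance under changes off `(-1,1)` and the shifted constants -/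

theorem SolvesNSE.congr {c : R3} {u f u' f' : ℝ → ℝ} (h : SolvesNSE c u f)
    (hu : EqOn u' u (Ioo (-1) 1)) (hf : EqOn f' f (Ioo (-1) 1)) : SolvesNSE c u' f' := by
  have hd : EqOn (deriv f') (deriv f) (Ioo (-1) 1) := hf.deriv isOpen_Ioo
  have hd2 : EqOn (iteratedDeriv 2 f') (iteratedDeriv 2 f) (Ioo (-1) 1) := by
    simpa only [iteratedDeriv_succ, iteratedDeriv_zero] using hd.deriv isOpen_Ioo
  refine ⟨h.1.congr hu, h.2.1.congr hf, fun x hx => ?_⟩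
  have hp : psi f' x = psi f x := psi₂_congr hf hd (Ioo_subset_Icc_self hx)
  rw [hu.deriv isOpen_Ioo hx, hu hx, hd hx, hd2 hx, hp]
  exact h.2.2 x hx

theorem psi_congr {f f' : ℝ → ℝ} (hf : EqOn f' f (Ioo (-1) 1)) {x : ℝ} (hx : x ∈ Icc (-1 : ℝ) 1) :
    psi f' x = psi f x := psi₂_congr hf (hf.deriv isOpen_Ioo) hx

/-- The third constant is read off from the second derivative of `φ_{c,γ}[Ũ_θ]` at `0`. -/
theorem SolvesNSE.third_constant {c c' : R3} {γ : ℝ} {p f : ℝ → ℝ}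
    (hU : IsNoSwirl c γ (Ubar c γ)) (hp : ContDiffOn ℝ 1 p (Ioo (-1) 1))
    (h : SolvesNSE c' (fun x => Ubar c γ x + p x) f) :
    c 2 - 1 / 2 * iteratedDeriv 2 (varphi c γ p) 0 = c' 2 := by
  -- The two equations subtract to this. It makes the left side twice differentiable although `p` is
  -- only `C¹`, and `ψ''(0) = 0` leaves the difference of the third constants.
  have e : EqOn (varphi c γ p) (fun x => P c' x - P c x - psi f x) (Ioo (-1) 1) := by
    intro x hx
    have e1 := (h.2.2 x hx).1
    have e2 := hU.2.1 x hx
    have e3 : deriv (fun x => Ubar c γ x + p x) x = deriv (Ubar c γ) x + deriv p x :=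
      deriv_add_Ioo one_ne_zero hU.1 hp hx
    rw [e3] at e1
    simp only [varphi]
    linear_combination e1 - e2
  have hf0 : ContinuousOn f (Ioo (-1) 1) := h.2.1.continuousOn
  have hf1 : ContinuousOn (deriv f) (Ioo (-1) 1) :=
    (h.2.1.deriv_Ioo (m := 1) (by norm_num)).continuousOn
  have hP : ∀ (d : R3) (x : ℝ), HasDerivAt (P d) (-d 0 + d 1 - 2 * d 2 * x) x := fun d x => by
    have a := ((((hasDerivAt_id x).const_sub 1).const_mul (d 0)).add
      (((hasDerivAt_id x).const_add 1).const_mul (d 1))).add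
      (((hasDerivAt_pow 2 x).const_sub 1).const_mul (d 2))
    refine a.congr_deriv ?_
    simp only [Nat.cast_ofNat, Nat.add_one_sub_one, pow_one]
    ring
  have hd1 : ∀ x ∈ Ioo (-1 : ℝ) 1, HasDerivAt (varphi c γ p)
      ((-c' 0 + c' 1 - 2 * c' 2 * x) - (-c 0 + c 1 - 2 * c 2 * x) - psiDer₁ f f x) x := by
    intro x hx
    have := ((hP c' x).sub (hP c x)).sub (psi₂_hasDerivAt hf0 hf1 hx).1
    exact this.congr_of_eventuallyEq (e.eventuallyEq_of_mem (isOpen_Ioo.mem_nhds hx))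
  have hd2 : HasDerivAt (fun x => (-c' 0 + c' 1 - 2 * c' 2 * x) - (-c 0 + c 1 - 2 * c 2 * x)
      - psiDer₁ f f x) (-(2 * c' 2) + 2 * c 2 - psiDer₂ f f 0) 0 := by
    have a := ((((hasDerivAt_id (0 : ℝ)).const_mul (2 * c' 2)).const_sub (-c' 0 + c' 1)).sub
      (((hasDerivAt_id (0 : ℝ)).const_mul (2 * c 2)).const_sub (-c 0 + c 1))).sub
      (psi₂_hasDerivAt hf0 hf1 zero_mem_outer).2
    exact a.congr_deriv (by ring)
  rw [iteratedDeriv_two_eq hd1 zero_mem_outer hd2]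
  have : psiDer₂ f f 0 = 0 := by simp [psiDer₂]
  rw [this]; ring

theorem SolvesNSE.chat_eq {c c' : R3} {γ : ℝ} {p f : ℝ → ℝ}
    (hU : IsNoSwirl c γ (Ubar c γ)) (hp : ContDiffOn ℝ 1 p (Ioo (-1) 1))
    (h : SolvesNSE c' (fun x => Ubar c γ x + p x) f) (h0 : c' 0 = c 0 + 1 / 2 * psi f (-1))
    (h1 : c' 1 = c 1 + 1 / 2 * psi f 1) : chat c γ p f = c' := by
  ext i
  fin_cases i
  · exact h0.symm
  · exact h1.symm
  · exact h.third_constant hU hp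

end HomNS

namespace HomNS

/-! ## The bifurcating branch for a profile at the south pole -/

/-- The perturbation part of the unknowns, as an element of `X`. -/
noncomputable def toX (ε : ℝ) : Unknowns ε →L[ℝ] X ε .south :=
  ((WithLp.prodContinuousLinearEquiv 1 ℝ (M₁ ε .south) (M₂ ε)).symm :
    M₁ ε .south × M₂ ε →L[ℝ] X ε .south).comp
  ((ContinuousLinearMap.snd ℝ ℝ (M₁ ε .south × M₂ ε)).comp
    (ContinuousLinearMap.snd ℝ ℝ (ℝ × M₁ ε .south × M₂ ε)))

theorem thetaPart_toX {ε : ℝ} (e : Unknowns ε) : thetaPart (toX ε e) = e.2.2.1.fn := rfl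
theorem phiPart_toX {ε : ℝ} (e : Unknowns ε) : phiPart (toX ε e) = e.2.2.2.fn := rfl

section Branch

variable {ε : ℝ}

/-- A closed subspace of finite codimension is complemented. The projection is there to keep `V`
inside `X_{2b}` at parameters off `K`, where the normalisations of the remainder need not vanish; on
`K` it acts as the identity. -/
theorem Operators.exists_proj (o : Operators ε) :
    ∃ π : X ε .south →L[ℝ] X₂b ε, ∀ Z : X ε .south, o.ev Z.fst = 0 → o.evDer Z.snd = 0 →
      o.ev₂ Z.snd = 0 → (π Z : X ε .south) = Z := by
  set p := (WithLp.prodContinuousLinearEquiv 1 ℝ (M₁ ε .south) (M₂ ε) :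
    X ε .south →L[ℝ] M₁ ε .south × M₂ ε)
  set L : X ε .south →L[ℝ] ℝ × ℝ × ℝ := (o.ev.comp ((ContinuousLinearMap.fst ℝ _ _).comp p)).prod
    ((o.evDer.comp ((ContinuousLinearMap.snd ℝ _ _).comp p)).prod
      (o.ev₂.comp ((ContinuousLinearMap.snd ℝ _ _).comp p))) with hL
  have hLZ : ∀ Z, L Z = (o.ev Z.fst, o.evDer Z.snd, o.ev₂ Z.snd) := fun Z => rfl
  have hker : (L : X ε .south →ₗ[ℝ] ℝ × ℝ × ℝ).ker = X₂b ε := by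
    ext Z
    rw [LinearMap.mem_ker]
    change L Z = 0 ↔ _
    rw [hLZ, Prod.mk_eq_zero, Prod.mk_eq_zero, o.ev_fn, o.evDer_fn, o.ev₂_fn]
    simp only [X₂b, X₂, Submodule.mem_inf, LinearMap.mem_ker, and_assoc]
    rfl
  obtain ⟨π, hπ⟩ := hker ▸ L.ker_closedComplemented_of_finiteDimensional_range
  refine ⟨π, fun Z h1 h2 h3 => ?_⟩
  have hZ : Z ∈ X₂b ε := by
    rw [← hker, LinearMap.mem_ker]
    change L Z = 0
    rw [hLZ, h1, h2, h3]; rfl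
  exact congrArg Subtype.val (hπ ⟨Z, hZ⟩)

/-- Evaluation at `0`. -/
theorem Y₁.exists_eval (h0 : 0 < ε) (h1 : ε < 1 / 2) : ∃ ev : Y₁ ε →L[ℝ] ℝ, ∀ ρ, ev ρ = ρ.fn 0 :=
  ⟨LinearMap.mkContinuous
    { toFun := fun ρ : Y₁ ε => ρ.fn 0, map_add' := fun _ _ => rfl, map_smul' := fun _ _ => rfl }
    36 fun ρ => by
      have := abs_le_of_weight (by norm_num) (wDer_inner_ge h0 h1 half_mem) (ρ.val_le zero_mem_outer)
      change |ρ.fn 0| ≤ 36 * ‖ρ‖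
      linarith, fun _ => rfl⟩

theorem Operators.continuous_eqθ (o : Operators ε) :
    Continuous fun e : Unknowns ε => o.eqθ e.1 e.2.1 e.2.2.1 e.2.2.2 :=
  continuous_fst.comp (continuous_snd.comp o.contDiff_sys.continuous)

theorem Operators.eqθ_eq_sub (o : Operators ε) (s k : ℝ) (w : M₁ ε .south) (φ : M₂ ε) :
    o.eqθ s k w φ = o.eqθ s 0 w φ - k • o.one := by
  simp [Operators.eqθ]

variable {o : Operators ε}

/-- The background flow as an element of the space of unknowns. -/
def Background.unknowns {q : R3 × ℝ} {s : ℝ} (b : Background o q s) : Unknowns ε :=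
  (s, b.k, b.v, 0)

/-- Neither `k` nor `v` occurs in the image, so the data are a smooth function of `q` as soon as `s`
is. -/
theorem Background.sys_unknowns {q : R3 × ℝ} {s : ℝ} (b : Background o q s) :
    o.sys b.unknowns = (s, 0, 0, q.2 + s, 0, 0) := by
  have h1 : o.eqφ s b.v 0 = 0 := by simp [Operators.eqφ]
  simp only [Operators.sys, Background.unknowns, b.eqθ, h1, b.v_zero, map_zero]

theorem Background.eq_of_sys_eq {q : R3 × ℝ} {s : ℝ} (b : Background o q s) (h0 : 0 < ε)
    (h1 : ε < 1 / 2) {e : Unknowns ε} (he : o.sys e = o.sys b.unknowns) : e = b.unknowns :=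
  o.sys_injective h0 h1 b.param.hs b.profile he

/-- The backgrounds are chosen independently for each `q`. Near `q₀` the local inverse applied to
the continuous data produces unknowns with the same image, and uniqueness identifies them with the
chosen ones. -/
theorem Background.continuous_unknowns (h0 : 0 < ε) (h1 : ε < 1 / 2) {K : Set (R3 × ℝ)}
    {σ : R3 × ℝ → ℝ} (hσ : ContinuousOn σ K) (b : ∀ q : K, Background o q (σ q)) :
    Continuous fun q => (b q).unknowns := by
  have := M₁.completeSpace h1 .south
  rw [continuous_iff_continuousAt]
  intro q₀
  obtain ⟨U, S, -, hU, hN, hS, hSΨ⟩ := exists_smooth_inverse_near_compact o.contDiff_sys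
    (isCompact_singleton (x := (b q₀).unknowns)) (injOn_singleton _ _) (by
      rintro e rfl
      exact (b q₀).solvable.exists_equiv h1 _)
  have hy : Continuous fun q : K => o.sys (b q).unknowns := by
    simp only [Background.sys_unknowns]
    have hσ' : Continuous fun q : K => σ q := hσ.domRestrict
    have h2 : Continuous fun q : K => (q : R3 × ℝ).2 := continuous_snd.comp continuous_subtype_val
    exact hσ'.prodMk (continuous_const.prodMk (continuous_const.prodMk
      ((h2.add hσ').prodMk (continuous_const.prodMk continuous_const))))
  have hmem : o.sys (b q₀).unknowns ∈ o.sys '' U := mem_image_of_mem _ (hU rfl)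
  have hev : ∀ᶠ q in 𝓝 q₀, o.sys (b q).unknowns ∈ o.sys '' U :=
    hy.continuousAt.eventually (hN.mem_nhds hmem)
  have hSc : ContinuousAt (fun q : K => S (o.sys (b q).unknowns)) q₀ :=
    ContinuousAt.comp (f := fun q : K => o.sys (b q).unknowns)
      (hS.continuousOn.continuousAt (hN.mem_nhds hmem)) hy.continuousAt
  refine hSc.congr ?_
  filter_upwards [hev] with q ⟨e, he, heq⟩
  rw [← heq, hSΨ e he]
  exact (b q).eq_of_sys_eq h0 h1 heq

/-- The tangent direction of the branch. -/
def Background.tangent {q : R3 × ℝ} {s : ℝ} (b : Background o q s) (β : R3) : Unknowns ε :=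
  (0, β 0, β 0 • b.h, β 1 • b.χ₃ + β 2 • b.χ₄)

/-- The kernel functions are preimages of the coordinate directions of the three normalisations, up
to the factor `h(0)` in the first. The increment `β₂` of `k` cancels the residual of `β₂ h`. -/
theorem Background.fderiv_tangent {q : R3 × ℝ} {s : ℝ} (b : Background o q s) (β : R3) :
    fderiv ℝ o.sys b.unknowns (b.tangent β) = (0, 0, 0, β 0 * o.ev b.h, β 1, β 2) := by
  have e1 : o.eqφ s b.v (β 1 • b.χ₃ + β 2 • b.χ₄)
      = β 1 • o.eqφ s b.v b.χ₃ + β 2 • o.eqφ s b.v b.χ₄ := by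
    simp only [Operators.eqφ, map_add, map_smul]; module
  rw [Background.unknowns, Background.tangent, o.fderiv_sys, e1, b.eqφ₃, b.eqφ₄, o.linθ_smul,
    b.linθ]
  simp [b.der₃, b.der₄, b.val₃, b.val₄]

/-- The normalisations of a perturbation, with the first one rescaled. -/
noncomputable def Operators.coordinates (o : Operators ε) (p : ℝ × X ε .south) : R3 :=
  WithLp.toLp 2 ![p.1 * o.ev p.2.fst, o.evDer p.2.snd, o.ev₂ p.2.snd]

theorem X.continuous_fst : Continuous fun Z : X ε .south => Z.fst :=
  _root_.continuous_fst.comp (WithLp.prod_continuous_ofLp 1 _ _)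

theorem X.continuous_snd : Continuous fun Z : X ε .south => Z.snd :=
  _root_.continuous_snd.comp (WithLp.prod_continuous_ofLp 1 _ _)

theorem Operators.exists_radius_coordinates (o : Operators ε) {Θ : Set ℝ} (hΘ : IsCompact Θ) {δ : ℝ}
    (hδ : 0 < δ) : ∃ δ' : ℝ, 0 < δ' ∧ ∀ t ∈ Θ, ∀ Z : X ε .south, ‖Z‖ < δ' →
      o.coordinates (t, Z) ∈ Metric.ball (0 : R3) δ := by
  have hRc : Continuous o.coordinates := by
    refine (PiLp.continuous_toLp 2 _).comp (continuous_pi fun i => ?_)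
    have hf := X.continuous_fst.comp (continuous_snd (X := ℝ) (Y := X ε .south))
    have hs := X.continuous_snd.comp (continuous_snd (X := ℝ) (Y := X ε .south))
    fin_cases i
    · exact continuous_fst.mul (o.ev.continuous.comp hf)
    · exact o.evDer.continuous.comp hs
    · exact o.ev₂.continuous.comp hs
  obtain ⟨A, D, -, hDo, hA, hD0, hAD⟩ := generalized_tube_lemma hΘ
    (isCompact_singleton (x := (0 : X ε .south))) (Metric.isOpen_ball.preimage hRc) (by
      rintro ⟨t, Z⟩ ⟨-, rfl⟩
      change o.coordinates (t, 0) ∈ Metric.ball 0 δ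
      have : o.coordinates (t, 0) = 0 := by
        have z1 : (0 : X ε .south).fst = 0 := rfl
        have z2 : (0 : X ε .south).snd = 0 := rfl
        ext i
        fin_cases i <;> simp [Operators.coordinates, z1, z2]
      rw [this]; exact Metric.mem_ball_self hδ)
  obtain ⟨δ₁, hδ₁, hδD⟩ := Metric.isOpen_iff.1 hDo 0 (hD0 rfl)
  exact ⟨δ₁, hδ₁, fun t ht Z hZ => hAD ⟨hA ht, hδD (by rwa [mem_ball_zero_iff])⟩⟩

/-- Replaces the second unknown `k` by the value that the `θ`-equation at `x = 0` prescribes. -/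
noncomputable def Operators.correct (o : Operators ε) (ev : Y₁ ε →L[ℝ] ℝ) (e : Unknowns ε) :
    Unknowns ε :=
  (e.1, ev (o.eqθ e.1 e.2.1 e.2.2.1 e.2.2.2) + e.2.1, e.2.2)

theorem Operators.continuous_correct (o : Operators ε) (ev : Y₁ ε →L[ℝ] ℝ) :
    Continuous (o.correct ev) :=
  continuous_fst.prodMk (((ev.continuous.comp o.continuous_eqθ).add
    (continuous_fst.comp continuous_snd)).prodMk (continuous_snd.comp continuous_snd))

/-- `k` enters the `θ`-equation only through `-k` times the constant function, so evaluation at `0`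
recovers it from the other unknowns. -/
theorem Operators.correct_eq (o : Operators ε) {ev : Y₁ ε →L[ℝ] ℝ} (hev : ∀ ρ, ev ρ = ρ.fn 0)
    {s k k' : ℝ} {w : M₁ ε .south} {φ : M₂ ε} (h : o.eqθ s k' w φ = 0) :
    o.correct ev (s, k, w, φ) = (s, k', w, φ) := by
  have e : o.eqθ s k w φ = (k' - k) • o.one := by
    rw [o.eqθ_eq_sub, sub_eq_zero] at h
    rw [o.eqθ_eq_sub, h, sub_smul]
  simp only [Operators.correct, e, hev, Y₁.fn_smul, Pi.smul_apply, o.one_fn 0 zero_mem_outer,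
    smul_eq_mul, mul_one, sub_add_cancel]

/-- An element of `X` as an increment of the unknowns. -/
def increment (Z : X ε .south) : Unknowns ε := (0, 0, Z.fst, Z.snd)

theorem continuous_increment : Continuous (increment : X ε .south → Unknowns ε) :=
  continuous_const.prodMk (continuous_const.prodMk (X.continuous_fst.prodMk X.continuous_snd))

/-- In the uniqueness statement only the flow is assumed close to the background, not its constants.
Since `k` is a continuous function of the rest, the complete unknowns still lie in `U`; the tube
lemma makes the radius uniform over the compact set. -/
theorem Background.exists_radius (h0 : 0 < ε) (h1 : ε < 1 / 2) {K : Set (R3 × ℝ)}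
    {σ : R3 × ℝ → ℝ} (b : ∀ q : K, Background o q (σ q))
    (hΓ : IsCompact (range fun q => (b q).unknowns)) {U : Set (Unknowns ε)} (hUo : IsOpen U)
    (hU : ∀ q, (b q).unknowns ∈ U) : ∃ δ' : ℝ, 0 < δ' ∧ ∀ q : K, ∀ Z : X ε .south, ‖Z‖ < δ' → ∀ k,
      o.eqθ (σ q) k ((b q).v + Z.fst) Z.snd = 0 → (σ q, k, (b q).v + Z.fst, Z.snd) ∈ U := by
  obtain ⟨ev, hev⟩ := Y₁.exists_eval h0 h1
  have hTc : Continuous fun p : Unknowns ε × X ε .south => o.correct ev (p.1 + increment p.2) :=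
    (o.continuous_correct ev).comp (continuous_fst.add (continuous_increment.comp continuous_snd))
  have hadd : ∀ (q : K) (Z : X ε .south), (b q).unknowns + increment Z
      = (σ q, (b q).k, (b q).v + Z.fst, Z.snd) := fun q Z => by
    simp only [Background.unknowns, increment, Prod.mk_add_mk, add_zero, zero_add]
  obtain ⟨A, D, -, hDo, hA, hD0, hAD⟩ := generalized_tube_lemma hΓ
    (isCompact_singleton (x := (0 : X ε .south))) (hUo.preimage hTc) (by
      rintro ⟨_, Z⟩ ⟨⟨q, rfl⟩, rfl⟩
      have e : increment (0 : X ε .south) = 0 := rfl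
      simp only [mem_preimage, e, add_zero]
      rw [Background.unknowns, o.correct_eq hev (b q).eqθ]
      exact hU q)
  obtain ⟨δ₁, hδ₁, hδD⟩ := Metric.isOpen_iff.1 hDo 0 (hD0 rfl)
  refine ⟨δ₁, hδ₁, fun q Z hZ k hθ => ?_⟩
  have hTU : o.correct ev ((b q).unknowns + increment Z) ∈ U :=
    hAD (⟨hA ⟨q, rfl⟩, hδD (by rwa [mem_ball_zero_iff])⟩ : ((b q).unknowns, Z) ∈ A ×ˢ D)
  rwa [hadd, o.correct_eq hev hθ] at hTU

/-- `V` is the second-order Taylor remainder in `β` of the inverse of the system, taken along data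
with zero residuals and with normalisations shifted by `β`. -/
theorem exists_branch (h0 : 0 < ε) (h1 : ε < 1 / 2) {K : Set (R3 × ℝ)} (hK : IsCompact K)
    {σ : R3 × ℝ → ℝ} {O₀ : Set (R3 × ℝ)} (hO₀ : IsOpen O₀) (hKO : K ⊆ O₀)
    (hσ : ContDiffOn ℝ ∞ σ O₀) (b : ∀ q : K, Background o q (σ q)) :
    ∃ δ : ℝ, 0 < δ ∧ ∃ V : (R3 × ℝ) × R3 → X₂b ε,
      (∃ O : Set (R3 × ℝ), IsOpen O ∧ K ⊆ O ∧
        ContDiffOn ℝ ∞ V (O ×ˢ Metric.ball (0 : R3) δ)) ∧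
      (∀ q ∈ K, V (q, 0) = 0 ∧ HasFDerivAt (fun β : R3 => V (q, β)) (0 : R3 →L[ℝ] X₂b ε) 0) ∧
      (∀ q : K, ∀ β ∈ Metric.ball (0 : R3) δ, ∃ k w φ, o.eqθ (σ q) k w φ = 0 ∧
        o.eqφ (σ q) w φ = 0 ∧ (V (q, β) : X ε .south)
          = toX ε (0, 0, w - (b q).v - β 0 • (b q).h, φ - (β 1 • (b q).χ₃ + β 2 • (b q).χ₄))) ∧
      ∃ δ' : ℝ, 0 < δ' ∧ ∀ q : K, ∀ W : X ε .south, ‖W‖ < δ' → ∀ k,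
        o.eqθ (σ q) k ((b q).v + W.fst) W.snd = 0 → o.eqφ (σ q) ((b q).v + W.fst) W.snd = 0 →
        ∃ β ∈ Metric.ball (0 : R3) δ, (V (q, β) : X ε .south)
          = toX ε (0, 0, W.fst - β 0 • (b q).h, W.snd - (β 1 • (b q).χ₃ + β 2 • (b q).χ₄)) := by
  have := M₁.completeSpace h1 .south
  have htop : (∞ : WithTop ℕ∞) ≠ 0 := by simp
  have hKc : CompactSpace K := isCompact_iff_compactSpace.1 hK
  have hΓ : IsCompact (range fun q => (b q).unknowns) :=
    isCompact_range (Background.continuous_unknowns h0 h1 (hσ.continuousOn.mono hKO) b)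
  obtain ⟨U, S, hUo, hU, hN, hS, hSΨ⟩ := exists_smooth_inverse_near_compact o.contDiff_sys hΓ (by
      rintro _ ⟨q, rfl⟩ _ ⟨q', rfl⟩ h
      exact (b q').eq_of_sys_eq h0 h1 h) (by
      rintro _ ⟨q, rfl⟩
      exact (b q).solvable.exists_equiv h1 _)
  set N := o.sys '' U with hNdef
  obtain ⟨π, hπ⟩ := o.exists_proj
  set y₀ : R3 × ℝ → Data ε := fun q => (σ q, 0, 0, q.2 + σ q, 0, 0) with hy₀
  have hsys : ∀ q : K, o.sys (b q).unknowns = y₀ q := fun q => (b q).sys_unknowns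
  have hbU : ∀ q : K, (b q).unknowns ∈ U := fun q => hU ⟨q, rfl⟩
  have hy₀N : ∀ q : K, y₀ q ∈ N := fun q => by rw [← hsys]; exact mem_image_of_mem _ (hbU q)
  have hSd : ∀ q : K, ∀ ξ, fderiv ℝ S (y₀ q) (fderiv ℝ o.sys (b q).unknowns ξ) = ξ := by
    intro q ξ
    have a : HasFDerivAt S (fderiv ℝ S (o.sys (b q).unknowns)) (o.sys (b q).unknowns) :=
      ((hS.contDiffAt (hN.mem_nhds (mem_image_of_mem _ (hbU q)))).differentiableAt htop).hasFDerivAt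
    have d : HasFDerivAt o.sys (fderiv ℝ o.sys (b q).unknowns) (b q).unknowns :=
      (o.contDiff_sys.differentiable htop _).hasFDerivAt
    have e : HasFDerivAt (S ∘ o.sys) (ContinuousLinearMap.id ℝ _) (b q).unknowns :=
      (hasFDerivAt_id _).congr_of_eventuallyEq (by
        filter_upwards [hUo.mem_nhds (hbU q)] with e he using hSΨ e he)
    rw [← hsys]
    exact congrArg (fun A => A ξ) ((a.comp _ d).unique e)
  have hy₀c : ContDiffOn ℝ ∞ y₀ O₀ := by
    have h2 : ContDiffOn ℝ ∞ (fun q : R3 × ℝ => q.2 + σ q) O₀ := contDiff_snd.contDiffOn.add hσ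
    exact hσ.prodMk (contDiffOn_const.prodMk (contDiffOn_const.prodMk
      (h2.prodMk (contDiffOn_const.prodMk contDiffOn_const))))
  set Q := O₀ ∩ y₀ ⁻¹' N with hQ
  have hQo : IsOpen Q := hy₀c.continuousOn.isOpen_inter_preimage hO₀ hN
  -- On `K` this is `1/h(0)`: the unit vector in the slot of `w(0)` has the preimage `h/h(0)`, with
  -- `k`-component `1/h(0)`. Unlike `h`, the expression is defined and smooth on a neighbourhood of
  -- `K`.
  set g : R3 × ℝ → ℝ := fun q => (fderiv ℝ S (y₀ q) (0, 0, 0, 1, 0, 0)).2.1 with hg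
  have hgc : ContDiffOn ℝ ∞ g Q := by
    have a : ContDiffOn ℝ ∞ (fderiv ℝ S) N := hS.fderiv_of_isOpen hN (by simp)
    have c : ContDiffOn ℝ ∞ (fun q => fderiv ℝ S (y₀ q) (0, 0, 0, 1, 0, 0)) Q :=
      (a.comp (hy₀c.mono inter_subset_left) fun q hq => hq.2).clm_apply contDiffOn_const
    exact contDiff_fst.comp_contDiffOn (contDiff_snd.comp_contDiffOn c)
  have hne : ∀ q : K, o.ev (b q).h ≠ 0 := fun q => (b q).solvable.ne _ (b q).linθ
  have hgK : ∀ q : K, g q = (o.ev (b q).h)⁻¹ := by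
    intro q
    have := (b q).fderiv_tangent (WithLp.toLp 2 ![(o.ev (b q).h)⁻¹, 0, 0])
    simp only [Matrix.cons_val_zero, Matrix.cons_val_one, Matrix.cons_val,
      inv_mul_cancel₀ (hne q)] at this
    simp only [hg]
    rw [← this, hSd]
    rfl
  set Q₁ := Q ∩ g ⁻¹' {0}ᶜ with hQ₁
  have hQ₁o : IsOpen Q₁ := hgc.continuousOn.isOpen_inter_preimage hQo isOpen_compl_singleton
  have hKQ : ∀ q : K, (q : R3 × ℝ) ∈ Q₁ := fun q => ⟨⟨hKO q.2, hy₀N q⟩, by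
    change g q ≠ 0
    rw [hgK]; exact inv_ne_zero (hne q)⟩
  -- The rescaling by `g⁻¹ = h(0)` turns the first-order change of the `θ`-component into `β₂
  -- V^{2b}` exactly.
  set Y : (R3 × ℝ) × R3 → Data ε := fun p =>
    (σ p.1, 0, 0, p.1.2 + σ p.1 + (g p.1)⁻¹ * p.2 0, p.2 1, p.2 2) with hY
  have hY0 : ∀ q, Y (q, 0) = y₀ q := fun q => by simp [hY, hy₀]
  have hYc : ContDiffOn ℝ ∞ Y (Q₁ ×ˢ univ) := by
    have s1 : ContDiffOn ℝ ∞ (fun p : (R3 × ℝ) × R3 => σ p.1) (Q₁ ×ˢ univ) :=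
      hσ.comp contDiffOn_fst fun p hp => hp.1.1.1
    have s2 : ContDiffOn ℝ ∞ (fun p : (R3 × ℝ) × R3 => (g p.1)⁻¹) (Q₁ ×ˢ univ) :=
      (hgc.comp contDiffOn_fst fun p hp => hp.1.1).inv fun p hp => hp.1.2
    have s3 : ∀ i, ContDiffOn ℝ ∞ (fun p : (R3 × ℝ) × R3 => p.2 i) (Q₁ ×ˢ univ) := fun i => by
      have : ContDiff ℝ ∞ (fun p : (R3 × ℝ) × R3 => p.2 i) := by fun_prop
      exact this.contDiffOn
    have s4 : ContDiffOn ℝ ∞ (fun p : (R3 × ℝ) × R3 => p.1.2) (Q₁ ×ˢ univ) := by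
      have : ContDiff ℝ ∞ (fun p : (R3 × ℝ) × R3 => p.1.2) := by fun_prop
      exact this.contDiffOn
    exact s1.prodMk (contDiffOn_const.prodMk (contDiffOn_const.prodMk
      (((s4.add s1).add (s2.mul (s3 0))).prodMk ((s3 1).prodMk (s3 2)))))
  set G := (Q₁ ×ˢ (univ : Set R3)) ∩ Y ⁻¹' N with hG
  have hGo : IsOpen G := hYc.continuousOn.isOpen_inter_preimage (hQ₁o.prod isOpen_univ) hN
  set W : (R3 × ℝ) × R3 → X ε .south := fun p => toX ε (S (Y p)) with hW
  have hWc : ContDiffOn ℝ ∞ W G :=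
    (toX ε).contDiff.comp_contDiffOn (hS.comp (hYc.mono inter_subset_left) fun p hp => hp.2)
  have hG0 : ∀ q ∈ Q₁, (q, (0 : R3)) ∈ G := fun q hq => ⟨⟨hq, mem_univ _⟩, by
    change Y (q, 0) ∈ N
    rw [hY0]; exact hq.1.2⟩
  -- Subtracting the value and the linear part makes `V` and its `β`-derivative vanish at `β = 0`
  -- wherever `W` is differentiable.
  set V : (R3 × ℝ) × R3 → X₂b ε := fun p =>
    π (W p - W (p.1, 0) - fderiv ℝ W (p.1, 0) (0, p.2)) with hV
  have hVc : ContDiffOn ℝ ∞ V G := by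
    have a0 : ContDiffOn ℝ ∞ (fun p : (R3 × ℝ) × R3 => (p.1, (0 : R3))) G :=
      (contDiff_fst.prodMk contDiff_const).contDiffOn
    have a1 : ContDiffOn ℝ ∞ (fun p : (R3 × ℝ) × R3 => ((0 : R3 × ℝ), p.2)) G :=
      (contDiff_const.prodMk contDiff_snd).contDiffOn
    have a2 : ContDiffOn ℝ ∞ (fun p : (R3 × ℝ) × R3 => W (p.1, 0)) G :=
      hWc.comp a0 fun p hp => hG0 _ hp.1.1
    have a3 : ContDiffOn ℝ ∞ (fun p : (R3 × ℝ) × R3 => fderiv ℝ W (p.1, 0)) G :=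
      (hWc.fderiv_of_isOpen hGo (m := ∞) (by simp)).comp a0 fun p hp => hG0 _ hp.1.1
    exact π.contDiff.comp_contDiffOn ((hWc.sub a2).sub (a3.clm_apply a1))
  have hWK : ∀ q : K, W (q, 0) = toX ε (b q).unknowns := fun q => by
    simp only [hW, hY0, ← hsys, hSΨ _ (hbU q)]
  have hWd : ∀ q ∈ Q₁, HasFDerivAt W (fderiv ℝ W (q, 0)) (q, 0) := fun q hq =>
    ((hWc.contDiffAt (hGo.mem_nhds (hG0 q hq))).differentiableAt htop).hasFDerivAt
  have hWt : ∀ (q : K) (β : R3), fderiv ℝ W (q, 0) (0, β) = toX ε ((b q).tangent β) := by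
    intro q β
    have l1 : HasDerivAt (fun t : ℝ => W ((q : R3 × ℝ), t • β)) (fderiv ℝ W (q, 0) (0, β)) 0 := by
      have hline : HasDerivAt (fun t : ℝ => ((q : R3 × ℝ), t • β)) ((0 : R3 × ℝ), β) 0 := by
        have := (hasDerivAt_const (0 : ℝ) (q : R3 × ℝ)).prodMk ((hasDerivAt_id (0 : ℝ)).smul_const β)
        simpa using this
      exact HasFDerivAt.comp_hasDerivAt (l := W) (f := fun t : ℝ => ((q : R3 × ℝ), t • β)) (0 : ℝ)
        (by simpa using hWd q (hKQ q)) hline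
    have l2 : HasDerivAt (fun t : ℝ => W ((q : R3 × ℝ), t • β)) (toX ε ((b q).tangent β)) 0 := by
      have hline : HasDerivAt (fun t : ℝ => y₀ q + t • fderiv ℝ o.sys (b q).unknowns ((b q).tangent β))
          (fderiv ℝ o.sys (b q).unknowns ((b q).tangent β)) 0 := by
        have := ((hasDerivAt_id (0 : ℝ)).smul_const
          (fderiv ℝ o.sys (b q).unknowns ((b q).tangent β))).const_add (y₀ q)
        simpa using this
      have hS' : HasFDerivAt S (fderiv ℝ S (y₀ q)) (y₀ q) :=
        ((hS.contDiffAt (hN.mem_nhds (hy₀N q))).differentiableAt htop).hasFDerivAt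
      have hc := HasFDerivAt.comp_hasDerivAt (l := S)
        (f := fun t : ℝ => y₀ q + t • fderiv ℝ o.sys (b q).unknowns ((b q).tangent β)) (0 : ℝ)
        (by simpa using hS') hline
      rw [hSd] at hc
      have := (toX ε).hasFDerivAt.comp_hasDerivAt (0 : ℝ) hc
      refine this.congr_of_eventuallyEq (Eventually.of_forall fun t => ?_)
      simp only [hW, Function.comp]
      congr 2
      rw [(b q).fderiv_tangent]
      simp only [hY, hy₀, hgK q, inv_inv, PiLp.smul_apply, smul_eq_mul, Prod.smul_mk,
        Prod.mk_add_mk, smul_zero, add_zero, zero_add, mul_zero, Prod.mk.injEq, true_and, and_true]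
      ring
    exact l1.unique l2
  have hVeq : ∀ (q : K) (β : R3) (e : Unknowns ε), e ∈ U → o.sys e = Y (q, β) →
      (V (q, β) : X ε .south) = toX ε (0, 0, e.2.2.1 - (b q).v - β 0 • (b q).h,
        e.2.2.2 - (β 1 • (b q).χ₃ + β 2 • (b q).χ₄)) := by
    intro q β e he hes
    have e1 : W (q, β) - W (q, 0) - fderiv ℝ W (q, 0) (0, β)
        = toX ε (0, 0, e.2.2.1 - (b q).v - β 0 • (b q).h,
          e.2.2.2 - (β 1 • (b q).χ₃ + β 2 • (b q).χ₄)) := by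
      have e2 : W (q, β) = toX ε e := by simp only [hW, ← hes, hSΨ e he]
      rw [hWK, hWt, e2, ← map_sub, ← map_sub]
      simp only [Background.unknowns, Background.tangent]
      have e3 : e.2.2.2 - (0 : M₂ ε) - (β 1 • (b q).χ₃ + β 2 • (b q).χ₄)
          = e.2.2.2 - (β 1 • (b q).χ₃ + β 2 • (b q).χ₄) := by rw [sub_zero]
      rw [← e3]
      rfl
    simp only [hV, e1]
    simp only [Operators.sys, hY, Prod.mk.injEq] at hes
    obtain ⟨-, -, -, f1, f2, f3⟩ := hes
    refine hπ _ ?_ ?_ ?_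
    · change o.ev (e.2.2.1 - (b q).v - β 0 • (b q).h) = 0
      rw [map_sub, map_sub, map_smul, f1, (b q).v_zero, hgK, inv_inv, smul_eq_mul]
      ring
    · change o.evDer (e.2.2.2 - (β 1 • (b q).χ₃ + β 2 • (b q).χ₄)) = 0
      rw [map_sub, map_add, map_smul, map_smul, f2, (b q).der₃, (b q).der₄]
      simp
    · change o.ev₂ (e.2.2.2 - (β 1 • (b q).χ₃ + β 2 • (b q).χ₄)) = 0
      rw [map_sub, map_add, map_smul, map_smul, f3, (b q).val₃, (b q).val₄]
      simp
  obtain ⟨O, B, hOo, hBo, hKO', hB0, hOB⟩ := generalized_tube_lemma hK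
    (isCompact_singleton (x := (0 : R3))) hGo (by
      rintro ⟨q, β⟩ ⟨hq, rfl⟩
      exact hG0 q (hKQ ⟨q, hq⟩))
  obtain ⟨δ, hδ, hδB⟩ := Metric.isOpen_iff.1 hBo 0 (hB0 rfl)
  have hsub : O ×ˢ Metric.ball (0 : R3) δ ⊆ G := fun p hp => hOB ⟨hp.1, hδB hp.2⟩
  refine ⟨δ, hδ, V, ⟨O, hOo, hKO', hVc.mono hsub⟩, fun q hq => ⟨?_, ?_⟩, fun q β hβ => ?_, ?_⟩
  · have : ((0 : R3 × ℝ), (0 : R3)) = 0 := rfl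
    simp only [hV, sub_self, this, map_zero]
  · have a := (hWd q (hKQ ⟨q, hq⟩)).comp (0 : R3)
      (hasFDerivAt_prodMk_right q (0 : R3))
    have c := ((fderiv ℝ W (q, 0)).comp (ContinuousLinearMap.inr ℝ (R3 × ℝ) R3)).hasFDerivAt
      (x := (0 : R3))
    have d := π.hasFDerivAt.comp (0 : R3) ((a.sub_const (W (q, 0))).sub c)
    refine d.congr_fderiv ?_
    simp
  · have hp : (↑q, β) ∈ G := hsub ⟨hKO' q.2, hβ⟩
    obtain ⟨e, he, hes⟩ := hp.2
    have hes' := hes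
    simp only [Operators.sys, hY, Prod.mk.injEq] at hes'
    obtain ⟨f0, f1, f2, -, -, -⟩ := hes'
    refine ⟨e.2.1, e.2.2.1, e.2.2.2, ?_, ?_, hVeq q β e he hes⟩
    · rw [← f0]; exact f1
    · rw [← f0]; exact f2
  · obtain ⟨δ₁, hδ₁, hR₁⟩ := Background.exists_radius h0 h1 b hΓ hUo hbU
    obtain ⟨δ₂, hδ₂, hR₂⟩ := o.exists_radius_coordinates (hK.image_of_continuousOn
      (hgc.continuousOn.mono fun q hq => (hKQ ⟨q, hq⟩).1)) hδ
    refine ⟨min δ₁ δ₂, lt_min hδ₁ hδ₂, fun q Z hZ k hθ hφ => ?_⟩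
    -- `β` is read off from the normalisations of the perturbation. With it the system takes the
    -- value `Y (q, β)` at the given solution, which lies in the domain `U` where `S` inverts it.
    refine ⟨o.coordinates (g q, Z), hR₂ _ ⟨q, q.2, rfl⟩ Z (hZ.trans_le (min_le_right _ _)), ?_⟩
    have := hVeq q (o.coordinates (g q, Z)) _ (hR₁ q Z (hZ.trans_le (min_le_left _ _)) k hθ) (by
      have hgne : g q ≠ 0 := (hKQ q).2
      simp only [Operators.sys, hY, hθ, hφ, map_add, (b q).v_zero, Operators.coordinates]
      simp only [Matrix.cons_val_zero, Matrix.cons_val_one, Matrix.cons_val,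
        inv_mul_cancel_left₀ hgne])
    rw [this, add_sub_cancel_left]

end Branch

end HomNS

namespace HomNS

/-! ## The theorem for a profile at the south pole -/

theorem thetaPart_pert {ε : ℝ} {o : Operators ε} {q : R3 × ℝ} {s : ℝ} (b : Background o q s)
    {β : R3} {Z : X ε .south} {w : M₁ ε .south} {φ : M₂ ε}
    (hZ : Z = toX ε (0, 0, w - β 0 • b.h, φ - (β 1 • b.χ₃ + β 2 • b.χ₄))) {x : ℝ}
    (hx : x ∈ Ioo (-1 : ℝ) 1) :
    pertθb q.1 q.2 β Z x = w.fn x ∧ pertφ q.1 q.2 β Z x = φ.fn x := by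
  subst hZ
  constructor
  · rw [pertθb, thetaPart_toX, ← b.h_fn x hx]
    simp only [M₁.fn_sub, M₁.fn_smul, Pi.sub_apply, Pi.smul_apply, smul_eq_mul]
    ring
  · rw [pertφ, phiPart_toX, ← b.χ₃_fn x hx, ← b.χ₄_fn x hx]
    simp only [M₂.fn_sub, M₂.fn_add, M₂.fn_smul, Pi.sub_apply, Pi.add_apply, Pi.smul_apply,
      smul_eq_mul]
    ring

theorem Background.isNoSwirl {ε : ℝ} {o : Operators ε} {q : R3 × ℝ} {s : ℝ}
    (b : Background o q s) : IsNoSwirl q.1 q.2 (Ubar q.1 q.2) := by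
  refine Ubar_spec ⟨fun x => baseFlow s x + b.v.fn x, b.param.isNoSwirl_iff.2 ⟨?_, ?_⟩⟩
  · simpa using b.profile
  · have := b.v_zero
    rw [o.ev_fn] at this
    simp only [baseFlow, this]
    ring

theorem main_south {ε : ℝ} (h0 : 0 < ε) (h1 : ε < 1 / 2) {K : Set (R3 × ℝ)} (hK : IsCompact K)
    {σ : R3 × ℝ → ℝ} {O₀ : Set (R3 × ℝ)} (hO₀ : IsOpen O₀) (hKO : K ⊆ O₀)
    (hσ : ContDiffOn ℝ ∞ σ O₀)
    (hpar : ∀ q ∈ K, ∃ k, IsLogParam q.1 (σ q) k ∧ σ q < ε ∧ q.2 = γminus q.1) :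
    ∃ δ : ℝ, 0 < δ ∧ ∃ V : (R3 × ℝ) × R3 → X₂b ε,
      (∃ O : Set (R3 × ℝ), IsOpen O ∧ K ⊆ O ∧
        ContDiffOn ℝ ∞ V (O ×ˢ Metric.ball (0 : R3) δ)) ∧
      (∀ q ∈ K, V (q, 0) = 0 ∧ HasFDerivAt (fun β : R3 => V (q, β)) (0 : R3 →L[ℝ] X₂b ε) 0) ∧
      (∀ q ∈ K, ∀ β ∈ Metric.ball (0 : R3) δ,
        SolvesNSE
          (chat q.1 q.2 (pertθb q.1 q.2 β (V (q, β) : X ε .south))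
            (pertφ q.1 q.2 β (V (q, β) : X ε .south)))
          (fun x => Ubar q.1 q.2 x + pertθb q.1 q.2 β (V (q, β) : X ε .south) x)
          (pertφ q.1 q.2 β (V (q, β) : X ε .south))) ∧
      ∃ δ' : ℝ, 0 < δ' ∧ ∀ q ∈ K, ∀ W : X ε .south, ‖W‖ < δ' →
        (∃ c' : R3, SolvesNSE c' (fun x => Ubar q.1 q.2 x + thetaPart W x) (phiPart W)) →
        ∃ β ∈ Metric.ball (0 : R3) δ, ∀ x ∈ Ioo (-1 : ℝ) 1,
          thetaPart W x = pertθb q.1 q.2 β (V (q, β) : X ε .south) x ∧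
          phiPart W x = pertφ q.1 q.2 β (V (q, β) : X ε .south) x := by
  obtain ⟨o⟩ := exists_operators h0 h1
  have hb : ∀ q : K, Nonempty (Background o q (σ q)) := fun q => by
    obtain ⟨k, h2, h3, h4⟩ := hpar q q.2
    exact h2.nonempty_background h4 h3 h1 o
  have b : ∀ q : K, Background o q (σ q) := fun q => (hb q).some
  obtain ⟨δ, hδ, V, hVs, hV0, hVe, δ', hδ', hVu⟩ := exists_branch h0 h1 hK hO₀ hKO hσ b
  refine ⟨δ, hδ, V, hVs, hV0, fun q hq β hβ => ?_, δ', hδ', fun q hq W hW hc => ?_⟩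
  · obtain ⟨k, w, φ, e1, e2, e3⟩ := hVe ⟨q, hq⟩ β hβ
    set bq := b ⟨q, hq⟩ with hbq
    have hpert := fun x hx => thetaPart_pert bq e3 (x := x) hx
    set c' : R3 := WithLp.toLp 2 ![-1 + 1 / 2 * psi φ.fn (-1),
      σ q ^ 2 - 1 + 1 / 2 * psi φ.fn 1, k - σ q * (σ q + 2) / 2] with hc'
    have hs : SolvesNSE c' (fun x => baseFlow (σ q) x + w.fn x) φ.fn := by
      rw [o.solvesNSE_iff h0 h1]
      refine ⟨rfl, rfl, ?_, e2⟩
      have : c' 2 + σ q * (σ q + 2) / 2 = k := by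
        have : c' 2 = k - σ q * (σ q + 2) / 2 := rfl
        rw [this]; ring
      rw [this]; exact e1
    have hθ : EqOn (pertθb q.1 q.2 β (V (q, β) : X ε .south)) (w - bq.v).fn (Ioo (-1) 1) :=
      fun x hx => (hpert x hx).1
    have hφ : EqOn (pertφ q.1 q.2 β (V (q, β) : X ε .south)) φ.fn (Ioo (-1) 1) :=
      fun x hx => (hpert x hx).2
    have hs' : SolvesNSE c' (fun x => Ubar q.1 q.2 x + pertθb q.1 q.2 β (V (q, β) : X ε .south) x)
        (pertφ q.1 q.2 β (V (q, β) : X ε .south)) :=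
      hs.congr (fun x hx => by
        simp only [hθ hx, bq.ubar x hx, M₁.fn_sub, Pi.sub_apply]; ring) hφ
    have hchat := hs'.chat_eq bq.isNoSwirl ((w - bq.v).mem.c1.congr hθ)
      (by rw [psi_congr hφ (by simp), bq.param.h0]; rfl)
      (by rw [psi_congr hφ (by simp), bq.param.h1]; rfl)
    rw [hchat]
    exact hs'
  · obtain ⟨c', hc'⟩ := hc
    set bq := b ⟨q, hq⟩ with hbq
    have hs : SolvesNSE c' (fun x => baseFlow (σ q) x + (bq.v + W.fst).fn x) W.snd.fn :=
      hc'.congr (fun x hx => by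
        simp only [bq.ubar x hx, M₁.fn_add, Pi.add_apply, thetaPart]; ring) fun x _ => rfl
    rw [o.solvesNSE_iff h0 h1] at hs
    obtain ⟨β, hβ, e⟩ := hVu ⟨q, hq⟩ W hW _ hs.2.2.1 hs.2.2.2
    refine ⟨β, hβ, fun x hx => ?_⟩
    obtain ⟨p1, p2⟩ := thetaPart_pert bq e hx
    exact ⟨p1.symm, p2.symm⟩

/-! ## The parameter sets -/

/-- For `c₁ = -1` the threshold is `c̄₃ = -s(s+2)/2` with `s = √(1+c₂)`, so `k` is the excess of
`c₃` over it. -/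
theorem isLogParam_of_mem {c : R3} (h0 : c 0 = -1) (h1 : -1 ≤ c 1)
    (h2 : c₃bar (c 0) (c 1) < c 2) :
    IsLogParam c (√(1 + c 1)) (c 2 - c₃bar (c 0) (c 1)) := by
  have hs : √(1 + c 1) ^ 2 = 1 + c 1 := Real.sq_sqrt (by linarith)
  refine ⟨Real.sqrt_nonneg _, by linarith, h0, by rw [hs]; ring, ?_⟩
  have : c₃bar (c 0) (c 1) = -(√(1 + c 1) * (√(1 + c 1) + 2) / 2) := by
    rw [c₃bar, h0]
    simp only [add_neg_cancel, Real.sqrt_zero, zero_add]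
    ring
  rw [this]; ring

/-- The boundary value of the lowest no-swirl solution at the regular pole. -/
theorem IsLogParam.tendsto_ubar {c : R3} {s k : ℝ} (h : IsLogParam c s k) :
    Tendsto (Ubar c (γminus c)) (𝓝[<] 1) (𝓝 (-2 - 2 * s)) := by
  -- The exponent `1/4` is auxiliary; any value in `(0, 1/2)` would do, as the boundary value does
  -- not depend on it.
  obtain ⟨v, E, hE, -, hv⟩ := exists_profile (ε := 1 / 4) (by norm_num) (by norm_num) h.hs h.hk
  obtain ⟨-, hu⟩ := h.ubar hv hE
  have hb : Tendsto (baseFlow s) (𝓝[<] 1) (𝓝 (-2 - 2 * s)) := by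
    have := ((contDiff_baseFlow s (n := 0)).continuous.tendsto 1).mono_left
      (nhdsWithin_le_nhds (s := Iio 1))
    convert this using 2
    simp only [baseFlow]; ring
  have := hb.add (M₁.tendsto_zero (w := v))
  rw [add_zero] at this
  refine this.congr' ?_
  have hm : Ioi (-1 : ℝ) ∈ 𝓝[<] (1 : ℝ) := mem_nhdsWithin_of_mem_nhds (Ioi_mem_nhds (by norm_num))
  filter_upwards [self_mem_nhdsWithin, hm] with x hx1 hx0
  exact (hu x ⟨hx0, hx1⟩).symm

/-- The boundary value `-2-2s` turns the hypothesis on `ε` into `s < ε`. The two parameter sets are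
treated apart because `√(1+c₂)` is not differentiable at `c₂ = -1`; there the constant `0` is a
smooth choice of `σ`. -/
theorem exists_south_data {K : Set (R3 × ℝ)} (hK : K ⊆ I₂₃ ∨ K ⊆ I₄₃) {ε : ℝ}
    (hε : ∀ q ∈ K, ∀ L : ℝ, Tendsto (Ubar q.1 q.2) (𝓝[<] 1) (𝓝 L) → -L / 2 - 1 < ε) :
    ∃ (σ : R3 × ℝ → ℝ) (O₀ : Set (R3 × ℝ)), IsOpen O₀ ∧ K ⊆ O₀ ∧ ContDiffOn ℝ ∞ σ O₀ ∧
      ∀ q ∈ K, ∃ k, IsLogParam q.1 (σ q) k ∧ σ q < ε ∧ q.2 = γminus q.1 := by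
  have key : ∀ q ∈ K, ∀ k, IsLogParam q.1 (√(1 + q.1 1)) k → q.2 = γminus q.1 →
      √(1 + q.1 1) < ε := by
    intro q hq k h hγ
    have := hε q hq _ (hγ ▸ h.tendsto_ubar)
    linarith
  rcases hK with hK | hK
  · refine ⟨fun q => √(1 + q.1 1), {q | -1 < q.1 1}, ?_, fun q hq => (hK hq).2.1.2.2.1, ?_,
      fun q hq => ?_⟩
    · exact isOpen_lt continuous_const (by fun_prop)
    · refine ContDiffOn.sqrt (ContDiff.contDiffOn (by fun_prop)) fun q hq => ?_
      have : -1 < q.1 1 := hq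
      exact ne_of_gt (by linarith)
    · obtain ⟨-, ⟨-, a0, a1, a2⟩, -, hγ⟩ := hK hq
      have h := isLogParam_of_mem a0 a1.le a2
      exact ⟨_, h, key q hq _ h hγ, hγ⟩
  · refine ⟨fun _ => 0, univ, isOpen_univ, subset_univ _, contDiffOn_const, fun q hq => ?_⟩
    obtain ⟨-, ⟨-, a0, a1, a2⟩, -, hγ⟩ := hK hq
    have h := isLogParam_of_mem a0 a1.ge a2
    have e := key q hq _ h hγ
    have hz : √(1 + q.1 1) = 0 := by rw [a1]; simp
    rw [hz] at h e
    exact ⟨_, h, e, hγ⟩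

end HomNS

namespace HomNS

/-! ## Reflection in the equator -/

/-- The reflection `f ↦ -f(-·)` of a velocity component. -/
def refl (f : ℝ → ℝ) (x : ℝ) : ℝ := -f (-x)

theorem refl_refl (f : ℝ → ℝ) : refl (refl f) = f := by
  funext x
  simp [refl]

theorem neg_mem_Ioo {a x : ℝ} (hx : x ∈ Ioo (-a) a) : -x ∈ Ioo (-a) a :=
  ⟨neg_lt_neg hx.2, neg_lt.1 hx.1⟩

theorem deriv_refl (f : ℝ → ℝ) (x : ℝ) : deriv (refl f) x = deriv f (-x) := by
  have : refl f = fun x => -(fun y => f (-y)) x := rfl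
  rw [this, deriv.fun_neg, deriv_comp_neg, neg_neg]

theorem iteratedDeriv_refl (n : ℕ) (f : ℝ → ℝ) (x : ℝ) :
    iteratedDeriv n (refl f) x = -((-1) ^ n * iteratedDeriv n f (-x)) := by
  have : refl f = fun x => -(fun y => f (-y)) x := rfl
  rw [this, iteratedDeriv_fun_neg, iteratedDeriv_comp_neg, smul_eq_mul]

theorem contDiffOn_refl {n : WithTop ℕ∞} {f : ℝ → ℝ} {a : ℝ} (hf : ContDiffOn ℝ n f (Ioo (-a) a)) :
    ContDiffOn ℝ n (refl f) (Ioo (-a) a) :=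
  (hf.comp contDiff_neg.contDiffOn fun _ hx => neg_mem_Ioo hx).neg

/-- The integrand changes sign once under reflection, because `f` does and `f'` does not, and each
of the three integrations contributes another sign. -/
theorem psi_refl (f : ℝ → ℝ) (x : ℝ) : psi (refl f) x = psi f (-x) := by
  unfold psi
  have e1 : ∀ t : ℝ, (∫ s in (0 : ℝ)..t, 2 * refl f s * deriv (refl f) s / (1 - s ^ 2))
      = ∫ s in (0 : ℝ)..-t, 2 * f s * deriv f s / (1 - s ^ 2) := by
    intro t
    have := intervalIntegral.integral_comp_neg (a := 0) (b := t)
      fun s => 2 * f s * deriv f s / (1 - s ^ 2)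
    rw [intervalIntegral.integral_symm (-t), neg_zero] at *
    rw [← this, ← intervalIntegral.integral_neg]
    refine intervalIntegral.integral_congr fun s _ => ?_
    simp only [deriv_refl, refl, neg_sq]
    ring
  simp only [e1]
  have e2 : ∀ l : ℝ,
      (∫ t in (0 : ℝ)..l, ∫ s in (0 : ℝ)..-t, 2 * f s * deriv f s / (1 - s ^ 2))
      = -∫ t in (0 : ℝ)..-l, ∫ s in (0 : ℝ)..t, 2 * f s * deriv f s / (1 - s ^ 2) := by
    intro l
    rw [intervalIntegral.integral_comp_neg (a := 0) (b := l)
      fun t => ∫ s in (0 : ℝ)..t, 2 * f s * deriv f s / (1 - s ^ 2),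
      intervalIntegral.integral_symm, neg_zero]
  simp only [e2]
  rw [intervalIntegral.integral_neg, intervalIntegral.integral_comp_neg (a := 0) (b := x)
      fun l => ∫ t in (0 : ℝ)..l, ∫ s in (0 : ℝ)..t, 2 * f s * deriv f s / (1 - s ^ 2),
      intervalIntegral.integral_symm, neg_zero, neg_neg]

/-- The constants of the reflected flow. -/
noncomputable def swap (c : R3) : R3 := !₂[c 1, c 0, c 2]

theorem swap_swap (c : R3) : swap (swap c) = c := by
  ext i
  fin_cases i <;> rfl

theorem P_swap (c : R3) (x : ℝ) : P (swap c) x = P c (-x) := by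
  change c 1 * (1 - x) + c 0 * (1 + x) + c 2 * (1 - x ^ 2) = _
  rw [P]; ring

theorem SolvesNSE.refl {c : R3} {u f : ℝ → ℝ} (h : SolvesNSE c u f) :
    SolvesNSE (swap c) (refl u) (refl f) := by
  refine ⟨contDiffOn_refl h.1, contDiffOn_refl h.2.1, fun x hx => ?_⟩
  obtain ⟨h1, h2⟩ := h.2.2 (-x) (neg_mem_Ioo hx)
  rw [psi_refl, P_swap, iteratedDeriv_refl, deriv_refl, deriv_refl, HomNS.refl, ← h1]
  exact ⟨by ring, by linear_combination -h2⟩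

theorem IsNoSwirl.refl {c : R3} {γ : ℝ} {u : ℝ → ℝ} (h : IsNoSwirl c γ u) :
    IsNoSwirl (swap c) (-γ) (refl u) := by
  refine ⟨contDiffOn_refl h.1, fun x hx => ?_, by rw [HomNS.refl, neg_zero, h.2.2]⟩
  rw [P_swap, ← h.2.1 (-x) (neg_mem_Ioo hx), deriv_refl, HomNS.refl]
  ring

/-- The difference of two solutions solves a linear homogeneous equation with coefficient built from
their sum. It identifies the chosen `Ubar` with the reflection of another chosen one. -/
theorem IsNoSwirl.unique {c : R3} {γ : ℝ} {u v : ℝ → ℝ} (hu : IsNoSwirl c γ u)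
    (hv : IsNoSwirl c γ v) : EqOn u v (Ioo (-1) 1) := by
  intro x hx
  refine sub_eq_zero.1 (eq_zero_of_linear (f := fun x => u x - v x)
    (θ := fun x => (2 * x + (u x + v x) / 2) / (1 - x ^ 2)) ?_ (fun y hy => ?_) ?_ hx)
  · have := hu.1.continuousOn
    have := hv.1.continuousOn
    exact ContinuousOn.div (by fun_prop) (by fun_prop) fun y hy => (one_sub_sq_pos hy).ne'
  · refine ((hu.1.hasDerivAt_Ioo one_ne_zero hy).sub
      (hv.1.hasDerivAt_Ioo one_ne_zero hy)).congr_deriv ?_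
    have hy' := (one_sub_sq_pos hy).ne'
    field_simp
    linear_combination 2 * hu.2.1 y hy - 2 * hv.2.1 y hy
  · simp only [hu.2.2, hv.2.2, sub_self]

theorem isNoSwirl_swap_iff {c : R3} {γ : ℝ} :
    (∃ u, IsNoSwirl (swap c) γ u) ↔ ∃ u, IsNoSwirl c (-γ) u := by
  constructor
  · rintro ⟨u, hu⟩
    exact ⟨_, swap_swap c ▸ hu.refl⟩
  · rintro ⟨u, hu⟩
    exact ⟨_, neg_neg γ ▸ hu.refl⟩

theorem γminus_swap (c : R3) : γminus (swap c) = -γplus c := by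
  -- The real infimum is by definition minus the supremum of the negated set, so no boundedness is
  -- required.
  rw [γminus, γplus, Real.sInf_def]
  congr 2
  ext γ
  exact isNoSwirl_swap_iff.trans (by rw [neg_neg]; rfl)

theorem γplus_swap (c : R3) : γplus (swap c) = -γminus c := by
  rw [← neg_neg (γplus (swap c)), ← γminus_swap, swap_swap]

theorem swap_mem_J {c : R3} (h : c ∈ J) : swap c ∈ J := by
  refine ⟨h.2.1, h.1, ?_⟩
  change c₃bar (c 1) (c 0) ≤ c 2
  rw [c₃bar, add_comm (√(1 + c 1))]
  exact h.2.2

/-- The reflection of the parameters. -/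
noncomputable def reflPar (q : R3 × ℝ) : R3 × ℝ := (swap q.1, -q.2)

theorem reflPar_reflPar (q : R3 × ℝ) : reflPar (reflPar q) = q := by
  simp [reflPar, swap_swap]

theorem reflPar_mem_I {q : R3 × ℝ} (h : q ∈ I) : reflPar q ∈ I := by
  refine ⟨swap_mem_J h.1, ?_, ?_⟩
  · simpa [reflPar, γminus_swap] using h.2.2
  · simpa [reflPar, γplus_swap] using h.2.1

theorem reflPar_mem_I₂₃ {q : R3 × ℝ} (h : q ∈ I₃₂) : reflPar q ∈ I₂₃ := by
  obtain ⟨h1, ⟨a0, a1, a2, a3⟩, h3, h4⟩ := h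
  refine ⟨reflPar_mem_I h1, ⟨swap_mem_J a0, a2, a1, ?_⟩, h3, ?_⟩
  · change c₃bar (q.1 1) (q.1 0) < q.1 2
    rw [c₃bar, add_comm (√(1 + q.1 1))]
    exact a3
  · simp [reflPar, γminus_swap, h4]

theorem reflPar_mem_I₄₃ {q : R3 × ℝ} (h : q ∈ I₄₂) : reflPar q ∈ I₄₃ := by
  obtain ⟨h1, ⟨a0, a1, a2, a3⟩, h3, h4⟩ := h
  refine ⟨reflPar_mem_I h1, ⟨swap_mem_J a0, a2, a1, ?_⟩, h3, ?_⟩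
  · change c₃bar (q.1 1) (q.1 0) < q.1 2
    rw [c₃bar, add_comm (√(1 + q.1 1))]
    exact a3
  · simp [reflPar, γminus_swap, h4]

theorem contDiff_reflPar : ContDiff ℝ ∞ reflPar := by
  refine ContDiff.prodMk ?_ contDiff_snd.neg
  rw [contDiff_euclidean]
  intro i
  fin_cases i
  · exact (by fun_prop : ContDiff ℝ ∞ fun q : R3 × ℝ => q.1 1)
  · exact (by fun_prop : ContDiff ℝ ∞ fun q : R3 × ℝ => q.1 0)
  · exact (by fun_prop : ContDiff ℝ ∞ fun q : R3 × ℝ => q.1 2)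

theorem IsLogParam.isNoSwirl {c : R3} {s k : ℝ} (h : IsLogParam c s k) :
    ∃ u, IsNoSwirl c (γminus c) u := by
  obtain ⟨v, E, hE, -, hv⟩ := exists_profile (ε := 1 / 4) (by norm_num) (by norm_num) h.hs h.hk
  refine ⟨fun x => baseFlow s x + v.fn x, h.isNoSwirl_iff.2 ⟨by simpa using hv, ?_⟩⟩
  rw [(h.ubar hv hE).1]
  simp only [baseFlow]; ring

/-! ### The reflected background -/

section Background

variable {q : R3 × ℝ}

theorem ubar_reflPar (h : ∃ u, IsNoSwirl q.1 q.2 u) :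
    EqOn (Ubar q.1 q.2) (refl (Ubar (reflPar q).1 (reflPar q).2)) (Ioo (-1) 1) := by
  obtain ⟨u, hu⟩ := h
  have h1 := (Ubar_spec ⟨_, hu.refl⟩).refl
  rw [swap_swap, neg_neg] at h1
  exact (Ubar_spec ⟨u, hu⟩).unique h1

theorem aFun_reflPar (h : ∃ u, IsNoSwirl q.1 q.2 u) {x : ℝ} (hx : x ∈ Ioo (-1 : ℝ) 1) :
    aFun q.1 q.2 x = aFun (reflPar q).1 (reflPar q).2 (-x) := by
  have := intervalIntegral.integral_comp_neg (a := 0) (b := x)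
    fun s => (2 * s + Ubar (reflPar q).1 (reflPar q).2 s) / (1 - s ^ 2)
  rw [neg_zero] at this
  rw [aFun, aFun, intervalIntegral.integral_symm (-x), ← this, ← intervalIntegral.integral_neg]
  refine intervalIntegral.integral_congr fun s hs => ?_
  simp only [ubar_reflPar h (uIcc_zero_subset hx hs), refl, neg_sq]
  ring

theorem bFun_reflPar (h : ∃ u, IsNoSwirl q.1 q.2 u) {x : ℝ} (hx : x ∈ Ioo (-1 : ℝ) 1) :
    bFun q.1 q.2 x = bFun (reflPar q).1 (reflPar q).2 (-x) := by
  have := intervalIntegral.integral_comp_neg (a := 0) (b := x)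
    fun s => Ubar (reflPar q).1 (reflPar q).2 s / (1 - s ^ 2)
  rw [neg_zero] at this
  rw [bFun, bFun, intervalIntegral.integral_symm (-x), ← this, ← intervalIntegral.integral_neg]
  refine intervalIntegral.integral_congr fun s hs => ?_
  simp only [ubar_reflPar h (uIcc_zero_subset hx hs), refl, neg_sq]
  ring

theorem V2a_reflPar (h : ∃ u, IsNoSwirl q.1 q.2 u) :
    EqOn (V2a q.1 q.2) (refl (V2b (reflPar q).1 (reflPar q).2)) (Ioo (-1) 1) := by
  intro x hx
  have e : (∫ s in (-1 : ℝ)..x, Real.exp (aFun q.1 q.2 s))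
      = ∫ s in (-1 : ℝ)..x, Real.exp (aFun (reflPar q).1 (reflPar q).2 (-s)) :=
    integral_congr_Ioo hx.1.le fun s hs => by
      simp only [aFun_reflPar h ⟨hs.1, hs.2.trans hx.2⟩]
  rw [intervalIntegral.integral_comp_neg
    fun s => Real.exp (aFun (reflPar q).1 (reflPar q).2 s), neg_neg] at e
  rw [V2a, refl, V2b, e, aFun_reflPar h hx, intervalIntegral.integral_symm]
  ring

theorem V3_reflPar (h : ∃ u, IsNoSwirl q.1 q.2 u) :
    EqOn (V3 q.1 q.2) (refl (V3 (reflPar q).1 (reflPar q).2)) (Ioo (-1) 1) := by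
  intro x hx
  have e : V3 q.1 q.2 x = ∫ t in (0 : ℝ)..x, Real.exp (-bFun (reflPar q).1 (reflPar q).2 (-t)) :=
    intervalIntegral.integral_congr fun t ht => by
      simp only [bFun_reflPar h (uIcc_zero_subset hx ht)]
  rw [e, intervalIntegral.integral_comp_neg
    fun t => Real.exp (-bFun (reflPar q).1 (reflPar q).2 t), refl, V3,
    intervalIntegral.integral_symm, neg_zero]

end Background

end HomNS

namespace HomNS

/-! ### The reflected spaces -/

/-- The opposite pole. -/
def Pole.opp : Pole → Pole
  | .south => .north
  | .north => .south

theorem Pole.opp_coord (p : Pole) (x : ℝ) : p.opp.coord x = p.coord (-x) := by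
  cases p
  · rfl
  · exact (neg_neg x).symm

theorem wVal_opp (ε : ℝ) (p : Pole) (x : ℝ) : wVal ε p.opp x = wVal ε p (-x) := by
  rw [wVal, wVal, p.opp_coord]

theorem wDer_opp (ε : ℝ) (p : Pole) (x : ℝ) : wDer ε p.opp x = wDer ε p (-x) := by
  rw [wDer, wDer, p.opp_coord]

theorem BddOn.refl {a : ℝ} {g h : ℝ → ℝ} (hg : BddOn (Ioo (-a) a) g)
    (e : ∀ x, |h x| = |g (-x)|) : BddOn (Ioo (-a) a) h := by
  obtain ⟨C, hC⟩ := hg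
  exact ⟨C, fun x hx => (e x).trans_le (hC _ (neg_mem_Ioo hx))⟩

theorem supOn_refl {a : ℝ} {g h : ℝ → ℝ} (hg : BddOn (Ioo (-a) a) g)
    (e : ∀ x, |h x| = |g (-x)|) : supOn (Ioo (-a) a) h = supOn (Ioo (-a) a) g := by
  refine le_antisymm (supOn_le (supOn_nonneg _ _) fun x hx => ?_)
    (supOn_le (supOn_nonneg _ _) fun x hx => ?_)
  · rw [e]
    exact le_supOn hg (neg_mem_Ioo hx)
  · have := le_supOn (hg.refl e) (neg_mem_Ioo hx)
    rwa [e, neg_neg] at this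

variable {ε : ℝ} {p : Pole}

theorem abs_iteratedDeriv_refl (n : ℕ) (f : ℝ → ℝ) (x : ℝ) :
    |iteratedDeriv n (refl f) x| = |iteratedDeriv n f (-x)| := by
  rw [iteratedDeriv_refl, abs_neg, abs_mul, abs_pow, abs_neg, abs_one, one_pow, one_mul]

theorem abs_wVal_refl (f : ℝ → ℝ) (x : ℝ) :
    |wVal ε p.opp x * refl f x| = |wVal ε p (-x) * f (-x)| := by
  rw [wVal_opp, refl, mul_neg, abs_neg]

theorem abs_wDer_refl (f : ℝ → ℝ) (x : ℝ) :
    |wDer ε p.opp x * deriv (refl f) x| = |wDer ε p (-x) * deriv f (-x)| := by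
  rw [wDer_opp, deriv_refl]

theorem abs_swirl_refl (f : ℝ → ℝ) (x : ℝ) :
    |(1 - x ^ 2) ^ ε * refl f x| = |(1 - (-x) ^ 2) ^ ε * f (-x)| := by
  rw [neg_sq, refl, mul_neg, abs_neg]

theorem abs_swirl_deriv_refl (f : ℝ → ℝ) (x : ℝ) :
    |(1 - x ^ 2) ^ (1 + ε) * deriv (refl f) x| = |(1 - (-x) ^ 2) ^ (1 + ε) * deriv f (-x)| := by
  rw [neg_sq, deriv_refl]

theorem abs_swirl_deriv2_refl (f : ℝ → ℝ) (x : ℝ) :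
    |(1 - x ^ 2) ^ (2 + ε) * iteratedDeriv 2 (refl f) x|
      = |(1 - (-x) ^ 2) ^ (2 + ε) * iteratedDeriv 2 f (-x)| := by
  rw [neg_sq, abs_mul, abs_iteratedDeriv_refl, abs_mul]

theorem neg_half : (-1 / 2 : ℝ) = -(1 / 2) := by norm_num

theorem refl_zero_off {f : ℝ → ℝ} (h : ∀ x, x ∉ Ioo (-1 : ℝ) 1 → f x = 0) (x : ℝ)
    (hx : x ∉ Ioo (-1 : ℝ) 1) : refl f x = 0 := by
  rw [refl, h _ fun h' => hx (neg_neg x ▸ neg_mem_Ioo h'), neg_zero]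

theorem MemM₁.refl {f : ℝ → ℝ} (h : MemM₁ ε p f) : MemM₁ ε p.opp (refl f) where
  zero_off := refl_zero_off h.zero_off
  cont := (h.cont.comp continuous_neg.continuousOn
    fun x hx => ⟨neg_le_neg hx.2, neg_le.1 hx.1⟩).neg
  c1 := contDiffOn_refl h.c1
  c3 := by
    have := h.c3
    rw [neg_half] at *
    exact contDiffOn_refl this
  bdd0 := h.bdd0.refl (abs_wVal_refl f)
  bdd1 := h.bdd1.refl (abs_wDer_refl f)
  bdd2 := by
    have := h.bdd2
    rw [neg_half] at *
    exact this.refl (abs_iteratedDeriv_refl 2 f)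
  bdd3 := by
    have := h.bdd3
    rw [neg_half] at *
    exact this.refl (abs_iteratedDeriv_refl 3 f)

theorem MemM₂.refl {f : ℝ → ℝ} (h : MemM₂ ε f) : MemM₂ ε (refl f) where
  zero_off := refl_zero_off h.zero_off
  c2 := contDiffOn_refl h.c2
  bdd0 := h.bdd0.refl (abs_swirl_refl f)
  bdd1 := h.bdd1.refl (abs_swirl_deriv_refl f)
  bdd2 := h.bdd2.refl (abs_swirl_deriv2_refl f)

theorem refl_add (f g : ℝ → ℝ) : refl (f + g) = refl f + refl g :=
  funext fun _ => neg_add _ _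

theorem refl_smul (a : ℝ) (f : ℝ → ℝ) : refl (a • f) = a • refl f :=
  funext fun _ => (mul_neg _ _).symm

/-- Reflection as an isometry of the `θ`-spaces. -/
noncomputable def reflM₁ : M₁ ε p →ₗᵢ[ℝ] M₁ ε p.opp where
  toFun f := (⟨refl f.fn, f.mem.refl⟩ : M₁sub ε p.opp)
  map_add' f g := M₁.ext_fn (refl_add f.fn g.fn)
  map_smul' a f := M₁.ext_fn (refl_smul a f.fn)
  norm_map' f := by
    rw [M₁.norm_def, M₁.norm_def]
    have h2 := f.mem.bdd2
    have h3 := f.mem.bdd3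
    rw [neg_half] at *
    congr 1
    · congr 1
      · congr 1
        · exact supOn_refl f.mem.bdd0 (abs_wVal_refl f.fn)
        · exact supOn_refl f.mem.bdd1 (abs_wDer_refl f.fn)
      · exact supOn_refl h2 (abs_iteratedDeriv_refl 2 f.fn)
    · exact supOn_refl h3 (abs_iteratedDeriv_refl 3 f.fn)

/-- Reflection as an isometry of the `φ`-space. -/
noncomputable def reflM₂ : M₂ ε →ₗᵢ[ℝ] M₂ ε where
  toFun f := (⟨refl f.fn, f.mem.refl⟩ : M₂sub ε)
  map_add' f g := M₂.ext_fn (refl_add f.fn g.fn)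
  map_smul' a f := M₂.ext_fn (refl_smul a f.fn)
  norm_map' f := by
    rw [M₂.norm_def, M₂.norm_def]
    congr 1
    · congr 1
      · exact supOn_refl f.mem.bdd0 (abs_swirl_refl f.fn)
      · exact supOn_refl f.mem.bdd1 (abs_swirl_deriv_refl f.fn)
    · exact supOn_refl f.mem.bdd2 (abs_swirl_deriv2_refl f.fn)

/-- Reflection as an isometry of the spaces of pairs. -/
noncomputable def reflX : X ε p →ₗᵢ[ℝ] X ε p.opp where
  toFun V := WithLp.toLp 1 (reflM₁ V.fst, reflM₂ V.snd)
  map_add' V W := by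
    simp only [WithLp.add_fst, WithLp.add_snd, map_add]; rfl
  map_smul' a V := by
    simp only [WithLp.smul_fst, WithLp.smul_snd, map_smul]; rfl
  norm_map' V := by
    rw [WithLp.prod_norm_eq_of_L1, WithLp.prod_norm_eq_of_L1]
    exact congr_arg₂ _ (reflM₁.norm_map _) (reflM₂.norm_map _)

theorem reflX_mem {V : X ε p} (h : V ∈ X₂ ε p) : reflX V ∈ X₂ ε p.opp := by
  obtain ⟨⟨h1, h2⟩, h3⟩ := h
  have h1' : thetaPart V 0 = 0 := h1
  have h2' : deriv (phiPart V) 0 = 0 := h2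
  have h3' : phiPart V 0 = 0 := h3
  refine ⟨⟨?_, ?_⟩, ?_⟩
  · change refl (thetaPart V) 0 = 0
    rw [refl, neg_zero, h1', neg_zero]
  · change deriv (refl (phiPart V)) 0 = 0
    rw [deriv_refl, neg_zero, h2']
  · change refl (phiPart V) 0 = 0
    rw [refl, neg_zero, h3', neg_zero]

/-- Reflection as an isometry of the complements of the kernel. -/
noncomputable def reflX₂ : X₂ ε p →ₗᵢ[ℝ] X₂ ε p.opp where
  toFun V := ⟨reflX (V : X ε p), reflX_mem V.2⟩
  map_add' V W := Subtype.ext (reflX.map_add (V : X ε p) W)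
  map_smul' a V := Subtype.ext (reflX.map_smul a (V : X ε p))
  norm_map' V := reflX.norm_map (V : X ε p)

/-! ### The theorem for a profile at the north pole -/

/-- The parameters of the reflected perturbation. -/
noncomputable def reflβ (β : R3) : R3 := !₂[β 0, β 1, -β 2]

theorem reflβ_reflβ (β : R3) : reflβ (reflβ β) = β := by
  ext i
  fin_cases i
  · rfl
  · rfl
  · exact neg_neg _

theorem contDiff_reflβ : ContDiff ℝ ∞ reflβ := by
  rw [contDiff_euclidean]
  intro i
  fin_cases i
  · exact (by fun_prop : ContDiff ℝ ∞ fun β : R3 => β 0)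
  · exact (by fun_prop : ContDiff ℝ ∞ fun β : R3 => β 1)
  · exact (by fun_prop : ContDiff ℝ ∞ fun β : R3 => -β 2)

theorem reflβ_mem_ball {β : R3} {δ : ℝ} (h : β ∈ Metric.ball (0 : R3) δ) :
    reflβ β ∈ Metric.ball (0 : R3) δ := by
  rw [mem_ball_zero_iff] at *
  refine lt_of_eq_of_lt ?_ h
  simp [EuclideanSpace.norm_eq, Fin.sum_univ_three, reflβ]

theorem reflβ_zero : reflβ 0 = 0 := by
  ext i
  fin_cases i <;> simp [reflβ]

theorem pertθa_reflX {q : R3 × ℝ} (h : ∃ u, IsNoSwirl q.1 q.2 u) (β : R3) (V : X ε .south) :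
    EqOn (pertθa q.1 q.2 β (reflX V : X ε .north))
      (refl (pertθb (reflPar q).1 (reflPar q).2 (reflβ β) V)) (Ioo (-1) 1) := by
  intro x hx
  change β 0 * V2a q.1 q.2 x + -thetaPart V (-x)
    = -(β 0 * V2b (reflPar q).1 (reflPar q).2 (-x) + thetaPart V (-x))
  rw [V2a_reflPar h hx, refl]
  ring

/-- `V³` is carried to `V³`, but the constant `V⁴ = 1` is carried to `-1`; this is why `reflβ`
changes the sign of `β₄` alone. -/
theorem pertφ_reflX {q : R3 × ℝ} (h : ∃ u, IsNoSwirl q.1 q.2 u) (β : R3) (V : X ε .south) :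
    EqOn (pertφ q.1 q.2 β (reflX V : X ε .north))
      (refl (pertφ (reflPar q).1 (reflPar q).2 (reflβ β) V)) (Ioo (-1) 1) := by
  intro x hx
  change β 1 * V3 q.1 q.2 x + β 2 * 1 + -phiPart V (-x)
    = -(β 1 * V3 (reflPar q).1 (reflPar q).2 (-x) + -β 2 * 1 + phiPart V (-x))
  rw [V3_reflPar h hx, refl]
  ring

theorem exists_isNoSwirl {q : R3 × ℝ} (h : q ∈ I₂₃ ∨ q ∈ I₄₃) : ∃ u, IsNoSwirl q.1 q.2 u := by
  rcases h with ⟨-, ⟨-, a0, a1, a2⟩, -, hγ⟩ | ⟨-, ⟨-, a0, a1, a2⟩, -, hγ⟩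
  · exact hγ ▸ (isLogParam_of_mem a0 a1.le a2).isNoSwirl
  · exact hγ ▸ (isLogParam_of_mem a0 a1.ge a2).isNoSwirl

theorem exists_isNoSwirl_of_reflPar {q : R3 × ℝ} (h : reflPar q ∈ I₂₃ ∨ reflPar q ∈ I₄₃) :
    ∃ u, IsNoSwirl q.1 q.2 u := by
  simpa [reflPar] using isNoSwirl_swap_iff.1 (exists_isNoSwirl h)

theorem tendsto_ubar_reflPar {q : R3 × ℝ} (h : ∃ u, IsNoSwirl q.1 q.2 u) {L : ℝ}
    (hL : Tendsto (Ubar (reflPar q).1 (reflPar q).2) (𝓝[<] 1) (𝓝 L)) :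
    Tendsto (Ubar q.1 q.2) (𝓝[>] (-1)) (𝓝 (-L)) := by
  have h1 : Tendsto (fun x : ℝ => -x) (𝓝[>] (-1)) (𝓝[<] 1) := by
    simpa using tendsto_neg_nhdsGT (a := (-1 : ℝ))
  refine ((hL.comp h1).neg).congr' ?_
  have hm : Iio (1 : ℝ) ∈ 𝓝[>] (-1 : ℝ) := mem_nhdsWithin_of_mem_nhds (Iio_mem_nhds (by norm_num))
  filter_upwards [self_mem_nhdsWithin, hm] with x hx0 hx1
  exact (ubar_reflPar h ⟨hx0, hx1⟩).symm

/-- The reflection of a solution near a background flow. -/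
theorem SolvesNSE.refl_pert {q : R3 × ℝ} (h : ∃ u, IsNoSwirl q.1 q.2 u) {c' : R3}
    {g f g' f' : ℝ → ℝ} (hg : EqOn g' (HomNS.refl g) (Ioo (-1) 1))
    (hf : EqOn f' (HomNS.refl f) (Ioo (-1) 1))
    (hs : SolvesNSE c' (fun x => Ubar (reflPar q).1 (reflPar q).2 x + g x) f) :
    SolvesNSE (swap c') (fun x => Ubar q.1 q.2 x + g' x) f' :=
  hs.refl.congr (fun x hx => by
    simp only [ubar_reflPar h hx, hg hx, HomNS.refl]; ring) hf

/-- Reflection exchanges `c₁` with `c₂` and `γ⁺` with `-γ⁻`, hence moves `K` to the southern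
parameter sets. It is isometric on the function spaces and on the `β`-ball, so the same radii serve.
-/
theorem main_north (h0 : 0 < ε) (h1 : ε < 1 / 2) {K : Set (R3 × ℝ)} (hK : IsCompact K)
    (hKI : K ⊆ I₃₂ ∨ K ⊆ I₄₂)
    (hε : ∀ q ∈ K, ∀ L : ℝ, Tendsto (Ubar q.1 q.2) (𝓝[>] (-1)) (𝓝 L) → L / 2 - 1 < ε) :
    ∃ δ : ℝ, 0 < δ ∧ ∃ V : (R3 × ℝ) × R3 → X₂a ε,
      (∃ O : Set (R3 × ℝ), IsOpen O ∧ K ⊆ O ∧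
        ContDiffOn ℝ ∞ V (O ×ˢ Metric.ball (0 : R3) δ)) ∧
      (∀ q ∈ K, V (q, 0) = 0 ∧ HasFDerivAt (fun β : R3 => V (q, β)) (0 : R3 →L[ℝ] X₂a ε) 0) ∧
      (∀ q ∈ K, ∀ β ∈ Metric.ball (0 : R3) δ,
        SolvesNSE
          (chat q.1 q.2 (pertθa q.1 q.2 β (V (q, β) : X ε .north))
            (pertφ q.1 q.2 β (V (q, β) : X ε .north)))
          (fun x => Ubar q.1 q.2 x + pertθa q.1 q.2 β (V (q, β) : X ε .north) x)
          (pertφ q.1 q.2 β (V (q, β) : X ε .north))) ∧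
      ∃ δ' : ℝ, 0 < δ' ∧ ∀ q ∈ K, ∀ W : X ε .north, ‖W‖ < δ' →
        (∃ c' : R3, SolvesNSE c' (fun x => Ubar q.1 q.2 x + thetaPart W x) (phiPart W)) →
        ∃ β ∈ Metric.ball (0 : R3) δ, ∀ x ∈ Ioo (-1 : ℝ) 1,
          thetaPart W x = pertθa q.1 q.2 β (V (q, β) : X ε .north) x ∧
          phiPart W x = pertφ q.1 q.2 β (V (q, β) : X ε .north) x := by
  have hrK : reflPar '' K ⊆ I₂₃ ∨ reflPar '' K ⊆ I₄₃ := by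
    rcases hKI with hK | hK
    · exact .inl (image_subset_iff.2 fun q hq => reflPar_mem_I₂₃ (hK hq))
    · exact .inr (image_subset_iff.2 fun q hq => reflPar_mem_I₄₃ (hK hq))
  have hex : ∀ q ∈ K, ∃ u, IsNoSwirl q.1 q.2 u := fun q hq =>
    exists_isNoSwirl_of_reflPar
      (hrK.imp (fun h => h (mem_image_of_mem _ hq)) fun h => h (mem_image_of_mem _ hq))
  have hrε : ∀ q ∈ reflPar '' K, ∀ L : ℝ, Tendsto (Ubar q.1 q.2) (𝓝[<] 1) (𝓝 L) →
      -L / 2 - 1 < ε := by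
    rintro _ ⟨q, hq, rfl⟩ L hL
    exact hε q hq _ (tendsto_ubar_reflPar (hex q hq) hL)
  obtain ⟨σ, O₀, hO₀, hKO, hσ, hpar⟩ := exists_south_data hrK hrε
  obtain ⟨δ, hδ, V, ⟨O, hO, hKO, hVs⟩, hV0, hVe, δ', hδ', hVu⟩ :=
    main_south h0 h1 (hK.image contDiff_reflPar.continuous) hO₀ hKO hσ hpar
  let ι : X₂b ε →ₗᵢ[ℝ] X₂a ε := reflX₂
  have hθ : ∀ q ∈ K, ∀ β, EqOn
      (pertθa q.1 q.2 β (ι (V (reflPar q, reflβ β)) : X ε .north))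
      (refl (pertθb (reflPar q).1 (reflPar q).2 (reflβ β) (V (reflPar q, reflβ β) : X ε .south)))
      (Ioo (-1) 1) := fun q hq β => pertθa_reflX (hex q hq) β _
  have hφ : ∀ q ∈ K, ∀ β, EqOn
      (pertφ q.1 q.2 β (ι (V (reflPar q, reflβ β)) : X ε .north))
      (refl (pertφ (reflPar q).1 (reflPar q).2 (reflβ β) (V (reflPar q, reflβ β) : X ε .south)))
      (Ioo (-1) 1) := fun q hq β => pertφ_reflX (hex q hq) β _
  -- The northern branch is the southern one conjugated by the reflections of parameters, of `β` and
  -- of functions; smoothness and vanishing to first order are inherited by composition.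
  refine ⟨δ, hδ, fun z => ι (V (reflPar z.1, reflβ z.2)),
    ⟨reflPar ⁻¹' O, hO.preimage contDiff_reflPar.continuous, image_subset_iff.1 hKO, ?_⟩,
    fun q hq => ⟨?_, ?_⟩, fun q hq β hβ => ?_, δ', hδ', fun q hq W hW hc => ?_⟩
  · refine ι.toContinuousLinearMap.contDiff.comp_contDiffOn (hVs.comp ?_ fun z hz => ?_)
    · exact ((contDiff_reflPar.comp contDiff_fst).prodMk
        (contDiff_reflβ.comp contDiff_snd)).contDiffOn
    · exact ⟨hz.1, reflβ_mem_ball hz.2⟩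
  · simp only [reflβ_zero, (hV0 _ (mem_image_of_mem _ hq)).1, map_zero]
  · have hd := (hV0 _ (mem_image_of_mem _ hq)).2
    rw [← reflβ_zero] at hd
    have hr : HasFDerivAt reflβ (fderiv ℝ reflβ 0) 0 :=
      (contDiff_reflβ.differentiable (by simp) 0).hasFDerivAt
    exact (ι.toContinuousLinearMap.hasFDerivAt.comp (0 : R3) (hd.comp (0 : R3) hr)).congr_fderiv
      (by simp)
  · have hs := (hVe _ (mem_image_of_mem _ hq) _ (reflβ_mem_ball hβ)).refl_pert (hex q hq)
      (hθ q hq β) (hφ q hq β)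
    have hz := hφ q hq β
    have hψ : ∀ x ∈ Icc (-1 : ℝ) 1, _ := fun x hx => (psi_congr hz hx).trans (psi_refl _ x)
    have hc1 : ContDiffOn ℝ 1 (pertθa q.1 q.2 β (ι (V (reflPar q, reflβ β)) : X ε .north))
        (Ioo (-1) 1) :=
      (hs.1.sub (Ubar_spec (hex q hq)).1).congr fun x _ => by simp
    have hchat := hs.chat_eq (Ubar_spec (hex q hq)) hc1
      (by rw [hψ _ (by simp), neg_neg]; rfl) (by rw [hψ _ (by simp)]; rfl)
    simp only [hchat]
    exact hs
  · obtain ⟨c', hc'⟩ := hc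
    have hex' : ∃ u, IsNoSwirl (reflPar q).1 (reflPar q).2 u :=
      isNoSwirl_swap_iff.2 (by simpa [reflPar] using hex q hq)
    rw [← reflPar_reflPar q] at hc'
    let W' : X ε .south := reflX W
    have hs : SolvesNSE (swap c')
        (fun x => Ubar (reflPar q).1 (reflPar q).2 x + thetaPart W' x) (phiPart W') :=
      hc'.refl_pert hex' (fun _ _ => rfl) fun _ _ => rfl
    obtain ⟨β, hβ, e⟩ := hVu _ (mem_image_of_mem _ hq) W'
      ((reflX.norm_map W).trans_lt hW) ⟨_, hs⟩
    refine ⟨reflβ β, reflβ_mem_ball hβ, fun x hx =>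
      ⟨Eq.trans ?_ (hθ q hq (reflβ β) hx).symm, Eq.trans ?_ (hφ q hq (reflβ β) hx).symm⟩⟩
    · rw [reflβ_reflβ, refl, ← (e _ (neg_mem_Ioo hx)).1]
      exact (congr_fun (refl_refl (thetaPart W)) x).symm
    · rw [reflβ_reflβ, refl, ← (e _ (neg_mem_Ioo hx)).2]
      exact (congr_fun (refl_refl (phiPart W)) x).symm

end HomNS

theorem theorem4p2 :
    -- `K ⊆ I_{2,3}` or `K ⊆ I_{4,3}`
    (∀ K : Set (R3 × ℝ), IsCompact K → (K ⊆ I₂₃ ∨ K ⊆ I₄₃) →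
      ∀ ε : ℝ, 0 < ε → ε < 1 / 2 →
      -- `ε > - Ū_θ(1) / 2 - 1`, where `Ū_θ(1)` is the boundary value of `Ū_θ`
      (∀ q ∈ K, ∀ L : ℝ, Tendsto (Ubar q.1 q.2) (𝓝[<] 1) (𝓝 L) → -L / 2 - 1 < ε) →
      ∃ δ : ℝ, 0 < δ ∧ ∃ V : (R3 × ℝ) × R3 → X₂b ε,
        (∃ O : Set (R3 × ℝ), IsOpen O ∧ K ⊆ O ∧
          ContDiffOn ℝ ∞ V (O ×ˢ Metric.ball (0 : R3) δ)) ∧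
        (∀ q ∈ K, V (q, 0) = 0 ∧
          HasFDerivAt (fun β : R3 => V (q, β)) (0 : R3 →L[ℝ] X₂b ε) 0) ∧
        (∀ q ∈ K, ∀ β ∈ Metric.ball (0 : R3) δ,
          SolvesNSE
            (chat q.1 q.2 (pertθb q.1 q.2 β (V (q, β) : X ε .south))
              (pertφ q.1 q.2 β (V (q, β) : X ε .south)))
            (fun x => Ubar q.1 q.2 x + pertθb q.1 q.2 β (V (q, β) : X ε .south) x)
            (pertφ q.1 q.2 β (V (q, β) : X ε .south))) ∧
        ∃ δ' : ℝ, 0 < δ' ∧ ∀ q ∈ K, ∀ W : X ε .south, ‖W‖ < δ' →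
          (∃ c' : R3, SolvesNSE c' (fun x => Ubar q.1 q.2 x + thetaPart W x) (phiPart W)) →
          ∃ β ∈ Metric.ball (0 : R3) δ, ∀ x ∈ Ioo (-1 : ℝ) 1,
            thetaPart W x = pertθb q.1 q.2 β (V (q, β) : X ε .south) x ∧
            phiPart W x = pertφ q.1 q.2 β (V (q, β) : X ε .south) x) ∧
    -- `K ⊆ I_{3,2}` or `K ⊆ I_{4,2}`
    (∀ K : Set (R3 × ℝ), IsCompact K → (K ⊆ I₃₂ ∨ K ⊆ I₄₂) →
      ∀ ε : ℝ, 0 < ε → ε < 1 / 2 →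
      -- `ε > Ū_θ(-1) / 2 - 1`, where `Ū_θ(-1)` is the boundary value of `Ū_θ`
      (∀ q ∈ K, ∀ L : ℝ, Tendsto (Ubar q.1 q.2) (𝓝[>] (-1)) (𝓝 L) → L / 2 - 1 < ε) →
      ∃ δ : ℝ, 0 < δ ∧ ∃ V : (R3 × ℝ) × R3 → X₂a ε,
        (∃ O : Set (R3 × ℝ), IsOpen O ∧ K ⊆ O ∧
          ContDiffOn ℝ ∞ V (O ×ˢ Metric.ball (0 : R3) δ)) ∧
        (∀ q ∈ K, V (q, 0) = 0 ∧
          HasFDerivAt (fun β : R3 => V (q, β)) (0 : R3 →L[ℝ] X₂a ε) 0) ∧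
        (∀ q ∈ K, ∀ β ∈ Metric.ball (0 : R3) δ,
          SolvesNSE
            (chat q.1 q.2 (pertθa q.1 q.2 β (V (q, β) : X ε .north))
              (pertφ q.1 q.2 β (V (q, β) : X ε .north)))
            (fun x => Ubar q.1 q.2 x + pertθa q.1 q.2 β (V (q, β) : X ε .north) x)
            (pertφ q.1 q.2 β (V (q, β) : X ε .north))) ∧
        ∃ δ' : ℝ, 0 < δ' ∧ ∀ q ∈ K, ∀ W : X ε .north, ‖W‖ < δ' →
          (∃ c' : R3, SolvesNSE c' (fun x => Ubar q.1 q.2 x + thetaPart W x) (phiPart W)) →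
          ∃ β ∈ Metric.ball (0 : R3) δ, ∀ x ∈ Ioo (-1 : ℝ) 1,
            thetaPart W x = pertθa q.1 q.2 β (V (q, β) : X ε .north) x ∧
            phiPart W x = pertφ q.1 q.2 β (V (q, β) : X ε .north) x) := by
  refine ⟨fun K hK hKI ε h0 h1 hε => ?_, fun K hK hKI ε h0 h1 hε => main_north h0 h1 hK hKI hε⟩
  obtain ⟨σ, O₀, hO₀, hKO, hσ, hpar⟩ := exists_south_data hKI hε
  exact main_south h0 h1 hK hO₀ hKO hσ hpar
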